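/- Let $\Gamma\subset\mathrm{SL}_2(\mathbb{C})$ be a finite subgroup and $X=\mathbb{C}^2/\Gamma=\operatorname{Spec}\mathbb{C}[X]$ with $\mathbb{C}[X]=\mathbb{C}[u,v]^\Gamma$, graded by degree in $u,v$ and with the Poisson bracket $\{f,h\}=\partial_uf\,\partial_vh-\partial_vf\,\partial_uh$. An anti-Poisson involution is a graded $\mathbb{C}$-algebra automorphism $\theta$ of $\mathbb{C}[X]$ with $\theta^2=\mathrm{id}$ and $\theta\{f,h\}=-\{\theta f,\theta h\}$. Its scheme-theoretic fixed locus is $X^\theta=\operatorname{Spec}\mathbb{C}[X]/J$, where $J=(\theta(f)-f\mid f\in\mathbb{C}[X])$. A cusp is a curve isomorphic to $\operatorname{Spec}\mathbb{C}[s,t]/(s^p-t^q)$ with $p,q\ge 2$ coprime. Let $0\in X$ be the image of the origin. **General statement.** For every finite $\Gamma\subset\mathrm{SL}_2(\mathbb{C})$ and every anti-Poisson involution $\theta$ of $X$, the scheme $X^\theta$ is reduced; and unless $X^\theta$ is a single point, each irreducible component of $X^\theta$ (with its reduced structure) is isomorphic to $\mathbb{A}^1$ or to a cusp. **Explicit description.**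 Put $\epsilon_m=e^{2\pi i/m}$. For each group $\Gamma$ below, the listed $x,y,z$ lie in $\mathbb{C}[X]$ and generate it; every formula listed for $\theta$ defines an anti-Poisson involution; every anti-Poisson involution of $X$ is conjugate, by a graded Poisson automorphism of $\mathbb{C}[X]$, to a listed one; and $J$ and $X^\theta$ are as stated. All listed $X^\theta$ are reduced; "a union of" means that the listed curves are exactly the irreducible components, and that any two of them meet exactly at the point $0$. * $A_n$: $\Gamma=\{\mathrm{diag}(\epsilon,\epsilon^{-1}):\epsilon^{n+1}=1\}$; $x=u^{n+1}$, $y=v^{n+1}$, $z=uv$. * $n\ge1$ odd: * (I) $\theta(x,y,z)=(y,x,z)$: $J=(x-y)$, $X^\theta=\operatorname{Spec}\mathbb{C}[x,z]/(x^2-z^{n+1})$, a union of two $\mathbb{A}^1$'s. * (II) $\theta(x,y,z)=(x,y,-z)$: $J=(z)$, $X^\theta=\operatorname{Spec}\mathbb{C}[x,y]/(xy)$, a union of two $\mathbb{A}^1$'s. * (III) $\theta(x,y,z)=(-x,-y,-z)$: $J=(x,y,z)$, $X^\theta=\operatorname{Spec}\mathbb{C}$. * $n\ge2$ even: * (I)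 $\theta(x,y,z)=(y,x,z)$: $J=(x-y)$, $X^\theta=\operatorname{Spec}\mathbb{C}[x,z]/(x^2-z^{n+1})$, a cusp. * (II) $\theta(x,y,z)=(-x,y,-z)$: $J=(x,z)$, $X^\theta=\operatorname{Spec}\mathbb{C}[y]\simeq\mathbb{A}^1$. * $D_n$: $\Gamma=\left\{\begin{pmatrix}\epsilon&0\\0&\epsilon^{-1}\end{pmatrix},\begin{pmatrix}0&i\epsilon\\ i\epsilon^{-1}&0\end{pmatrix}:\epsilon^{2(n-2)}=1\right\}$. * $n\ge4$ even: $x=u^2v^2$, $y=-\tfrac14(u^{2n-4}-2u^{n-2}v^{n-2}+v^{2n-4})$, $z=\tfrac14uv(u^{2n-4}-v^{2n-4})$. * (I) $\theta(x,y,z)=(x,y,-z)$: $J=(z)$, $X^\theta=\operatorname{Spec}\mathbb{C}[x,y]/(xy(y-x^{\frac{n-2}2}))$, a union of three $\mathbb{A}^1$'s. * (II) $\theta(x,y,z)=(x,x^{\frac{n-2}2}-y,z)$: $J=(2y-x^{\frac{n-2}2})$, $X^\theta=\operatorname{Spec}\mathbb{C}[x,z]/(x^{n-1}+4z^2)$,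 a cusp. * $n\ge5$ odd: $x=u^2v^2$, $y=\tfrac14(u^{2n-4}-v^{2n-4})$, $z=-\tfrac14uv(u^{2n-4}-2u^{n-2}v^{n-2}+v^{2n-4})$. * (I) $\theta(x,y,z)=(x,-y,z)$: $J=(y)$, $X^\theta=\operatorname{Spec}\mathbb{C}[x,z]/(z(z-x^{\frac{n-1}2}))$, a union of two $\mathbb{A}^1$'s. * (II) $\theta(x,y,z)=(x,y,x^{\frac{n-1}2}-z)$: $J=(2z-x^{\frac{n-1}2})$, $X^\theta=\operatorname{Spec}\mathbb{C}[x,y]/(x(4y^2+x^{n-2}))$, a union of an $\mathbb{A}^1$ and a cusp. * $E_6$: $\Gamma$ generated by $\begin{pmatrix}i&0\\0&-i\end{pmatrix},\begin{pmatrix}0&i\\i&0\end{pmatrix},\frac1{1-i}\begin{pmatrix}1&i\\1&-i\end{pmatrix}$; $x=2uv(u^4-v^4)$, $y=\tfrac13(u^8+14u^4v^4+v^8)$, $z=\tfrac{i\sqrt3}{9}(u^{12}-33u^8v^4-33u^4v^8+v^{12})-2u^2v^2(u^4-v^4)^2$. * (I) $\theta(x,y,z)=(-x,y,z)$: $J=(x)$,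 $X^\theta=\operatorname{Spec}\mathbb{C}[y,z]/(z^2+y^3)$, a cusp. * (II) $\theta(x,y,z)=(x,y,-z-x^2)$: $J=(2z+x^2)$, $X^\theta=\operatorname{Spec}\mathbb{C}[x,y]/(x^4-4y^3)$, a cusp. * $E_7$: $\Gamma$ generated by $\begin{pmatrix}\epsilon_8&0\\0&\epsilon_8^{-1}\end{pmatrix},\begin{pmatrix}0&i\\i&0\end{pmatrix},\frac1{1-i}\begin{pmatrix}1&i\\1&-i\end{pmatrix}$; $x=-\tfrac1{108}(u^8+14u^4v^4+v^8)$, $y=\tfrac1{108}(u^5v-uv^5)^2$, $z=\tfrac1{108^2}uv(u^8-v^8)(u^8-34u^4v^4+v^8)$. * $\theta(x,y,z)=(x,y,-z)$: $J=(z)$, $X^\theta=\operatorname{Spec}\mathbb{C}[x,y]/(y(x^3+y^2))$, a union of an $\mathbb{A}^1$ and a cusp. * $E_8$: $\Gamma$ generated by $\begin{pmatrix}\epsilon_{10}&0\\0&\epsilon_{10}^{-1}\end{pmatrix},\begin{pmatrix}0&1\\-1&0\end{pmatrix},\frac1{\sqrt5}\begin{pmatrix}-\epsilon_5+\epsilon_5^4&\epsilon_5^2-\epsilon_5^3\\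 \epsilon_5^2-\epsilon_5^3&\epsilon_5-\epsilon_5^4\end{pmatrix}$; $x=-\tfrac1{1728}uv(u^{10}+11u^5v^5-v^{10})$, $y=-\tfrac1{1728^2}(u^{20}+v^{20}-228(u^{15}v^5-u^5v^{15})+494u^{10}v^{10})$, $z=\tfrac1{1728^3}(u^{30}+v^{30}+522(u^{25}v^5-u^5v^{25})-10005(u^{20}v^{10}+u^{10}v^{20}))$. * $\theta(x,y,z)=(x,y,-z)$: $J=(z)$, $X^\theta=\operatorname{Spec}\mathbb{C}[x,y]/(x^5+y^3)$, a cusp. -/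

import Mathlib

noncomputable section

namespace Kleinian

open MvPolynomial

/-- The polynomial ring `ℂ[u, v]`. -/
abbrev Poly : Type := MvPolynomial (Fin 2) ℂ

/-- The coordinate `u` of `ℂ²`. -/
def u : Poly := X 0

/-- The coordinate `v` of `ℂ²`. -/
def v : Poly := X 1

/-- The linear substitution `f ↦ f (g • (u, v))`. -/
def linSubst (g : Matrix (Fin 2) (Fin 2) ℂ) : Poly →ₐ[ℂ] Poly :=
  aeval fun i => ∑ j, C (g i j) * X j

/-- The standard Poisson bracket on `ℂ[u, v]`, of degree `-2`. -/
def polyBracket (f g : Poly) : Poly :=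
  pderiv 0 f * pderiv 1 g - pderiv 1 f * pderiv 0 g

/-- The coordinate ring `ℂ[X] = ℂ[u, v]^Γ` of the quotient `X = ℂ² / Γ`. -/
def invariants (Γ : Subgroup (Matrix.SpecialLinearGroup (Fin 2) ℂ)) : Subalgebra ℂ Poly where
  carrier := {f | ∀ g ∈ Γ, linSubst (g : Matrix (Fin 2) (Fin 2) ℂ) f = f}
  mul_mem' := fun ha hb g hg => by rw [map_mul, ha g hg, hb g hg]
  add_mem' := fun ha hb g hg => by rw [map_add, ha g hg, hb g hg]
  algebraMap_mem' := fun r g _ => by rw [AlgHom.commutes]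

theorem pderiv_linSubst (g : Matrix (Fin 2) (Fin 2) ℂ) (k : Fin 2) (f : Poly) :
    pderiv k (linSubst g f) = ∑ i, C (g i k) * linSubst g (pderiv i f) := by
  induction f using MvPolynomial.induction_on with
  | C a => simp [linSubst]
  | add p q hp hq => simp only [map_add, hp, hq, mul_add, Finset.sum_add_distrib]
  | mul_X p j hp =>
    have hX : pderiv k (linSubst g (X j)) = C (g j k) := by
      fin_cases k <;> simp [linSubst, Fin.sum_univ_two, pderiv_X]
    rw [map_mul, Derivation.leibniz, hp, hX]
    fin_cases j <;> simp [Fin.sum_univ_two, pderiv_X, Derivation.leibniz] <;> ring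

theorem polyBracket_mem {Γ : Subgroup (Matrix.SpecialLinearGroup (Fin 2) ℂ)} {f h : Poly}
    (hf : f ∈ invariants Γ) (hh : h ∈ invariants Γ) : polyBracket f h ∈ invariants Γ := by
  intro g hg
  have hdet : (C (g.1 0 0) * C (g.1 1 1) - C (g.1 0 1) * C (g.1 1 0) : Poly) = 1 := by
    have := g.2
    rw [Matrix.det_fin_two] at this
    rw [← map_mul, ← map_mul, ← map_sub, this, map_one]
  have e : ∀ k (p : Poly), p ∈ invariants Γ →
      pderiv k p = ∑ i, C (g.1 i k) * linSubst g.1 (pderiv i p) := by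
    intro k p hp
    rw [← pderiv_linSubst, hp g hg]
  unfold polyBracket
  rw [e 0 f hf, e 1 f hf, e 0 h hh, e 1 h hh]
  rw [← e 0 f hf, ← e 1 f hf, ← e 0 h hh, ← e 1 h hh]
  rw [map_sub, map_mul, map_mul]
  conv_rhs => rw [e 0 f hf, e 1 f hf, e 0 h hh, e 1 h hh]
  simp only [Fin.sum_univ_two]
  linear_combination (-(linSubst g.1 (pderiv 0 f) * linSubst g.1 (pderiv 1 h)
    - linSubst g.1 (pderiv 1 f) * linSubst g.1 (pderiv 0 h))) * hdet

section

variable {Γ : Subgroup (Matrix.SpecialLinearGroup (Fin 2) ℂ)}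

/-- The Poisson bracket of `ℂ[X]`, restricted from `ℂ[u, v]`. -/
def bracket (f h : invariants Γ) : invariants Γ :=
  ⟨polyBracket f h, polyBracket_mem f.2 h.2⟩

/-- An algebra automorphism of `ℂ[X]` is graded if it preserves the degree in `u, v`. -/
def IsGraded (θ : invariants Γ ≃ₐ[ℂ] invariants Γ) : Prop :=
  ∀ (d : ℕ) (f : invariants Γ),
    (f : Poly).IsHomogeneous d → (θ f : Poly).IsHomogeneous d

/-- Anti-Poisson involutions of `X`. -/
structure IsAntiPoissonInvolution (θ : invariants Γ ≃ₐ[ℂ] invariants Γ) : Prop where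
  graded : IsGraded θ
  involutive : ∀ f, θ (θ f) = f
  antiPoisson : ∀ f h, θ (bracket f h) = -bracket (θ f) (θ h)

/-- Graded Poisson automorphisms of `X`. -/
structure IsGradedPoisson (σ : invariants Γ ≃ₐ[ℂ] invariants Γ) : Prop where
  graded : IsGraded σ
  poisson : ∀ f h, σ (bracket f h) = bracket (σ f) (σ h)

/-- `θ` and `η` are conjugate by a graded Poisson automorphism `σ`, i.e. `σ θ σ⁻¹ = η`. -/
def AreConjugate (θ η : invariants Γ ≃ₐ[ℂ] invariants Γ) : Prop :=
  ∃ σ : invariants Γ ≃ₐ[ℂ] invariants Γ, IsGradedPoisson σ ∧ ∀ f, σ (θ f) = η (σ f)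

/-- The ideal `J = (θ(f) - f | f ∈ ℂ[X])`. -/
def fixedIdeal (θ : invariants Γ ≃ₐ[ℂ] invariants Γ) : Ideal (invariants Γ) :=
  Ideal.span (Set.range fun f => θ f - f)

/-- The coordinate ring `ℂ[X] / J` of the fixed point locus. -/
abbrev FixedRing (θ : invariants Γ ≃ₐ[ℂ] invariants Γ) : Type :=
  invariants Γ ⧸ fixedIdeal θ

instance (θ : invariants Γ ≃ₐ[ℂ] invariants Γ) : CommRing (FixedRing θ) :=
  Ideal.Quotient.commRing (fixedIdeal θ)

instance (θ : invariants Γ ≃ₐ[ℂ] invariants Γ) : Algebra ℂ (FixedRing θ) :=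
  Ideal.Quotient.algebra ℂ

/-- The restriction of a function on `X` to the fixed point locus. -/
def restrict (θ : invariants Γ ≃ₐ[ℂ] invariants Γ) : invariants Γ →ₐ[ℂ] FixedRing θ :=
  Ideal.Quotient.mkₐ ℂ (fixedIdeal θ)

/-- The scheme-theoretic fixed point locus `X^θ = Spec ℂ[X] / J`. -/
def fixedLocus (θ : invariants Γ ≃ₐ[ℂ] invariants Γ) : AlgebraicGeometry.Scheme :=
  AlgebraicGeometry.Spec (CommRingCat.of (FixedRing θ))

/-- The prime ideal of `ℂ[X] / J` at a point of `X^θ`. -/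
def primeAt (θ : invariants Γ ≃ₐ[ℂ] invariants Γ) (p : fixedLocus θ) : Ideal (FixedRing θ) :=
  PrimeSpectrum.asIdeal (R := FixedRing θ) p

/-- The ideal of functions on `X^θ` vanishing on a set of points. -/
def idealOf (θ : invariants Γ ≃ₐ[ℂ] invariants Γ) (Z : Set (fixedLocus θ)) :
    Ideal (FixedRing θ) :=
  ⨅ p ∈ Z, primeAt θ p

/-- The coordinate ring of a closed subset of `X^θ` with its reduced structure. -/
abbrev ClosedRing (θ : invariants Γ ≃ₐ[ℂ] invariants Γ) (Z : Set (fixedLocus θ)) : Type :=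
  FixedRing θ ⧸ idealOf θ Z

instance (θ : invariants Γ ≃ₐ[ℂ] invariants Γ) (Z : Set (fixedLocus θ)) :
    CommRing (ClosedRing θ Z) :=
  Ideal.Quotient.commRing (idealOf θ Z)

instance (θ : invariants Γ ≃ₐ[ℂ] invariants Γ) (Z : Set (fixedLocus θ)) :
    Algebra ℂ (ClosedRing θ Z) :=
  Ideal.Quotient.algebra ℂ

/-- The maximal ideal of `ℂ[X]` at the point `0` of `X`, the image of the origin of `ℂ²`. -/
def originIdeal (Γ : Subgroup (Matrix.SpecialLinearGroup (Fin 2) ℂ)) : Ideal (invariants Γ) :=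
  RingHom.ker ((aeval fun _ => (0 : ℂ)).comp (invariants Γ).val : invariants Γ →ₐ[ℂ] ℂ)

end

/-- `A` is, as a `ℂ`-algebra, the coordinate ring of the affine line. -/
def IsAffineLine (A : Type) [CommRing A] [Algebra ℂ A] : Prop :=
  Nonempty (A ≃ₐ[ℂ] Polynomial ℂ)

/-- `A` is, as a `ℂ`-algebra, the coordinate ring of a cusp `s ^ p = t ^ q`
with coprime exponents `p, q ≥ 2`. -/
def IsCuspCurve (A : Type) [CommRing A] [Algebra ℂ A] : Prop :=
  ∃ p q : ℕ, 2 ≤ p ∧ 2 ≤ q ∧ p.Coprime q ∧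
    Nonempty (A ≃ₐ[ℂ] Poly ⧸ Ideal.span {(X 0 ^ p - X 1 ^ q : Poly)})

section

variable {Γ : Subgroup (Matrix.SpecialLinearGroup (Fin 2) ℂ)}

/-- `X^θ` consists of one point only. -/
def IsSinglePoint (θ : invariants Γ ≃ₐ[ℂ] invariants Γ) : Prop :=
  ∃ p : fixedLocus θ, ∀ q : fixedLocus θ, q = p

/-- `X^θ = Spec ℂ[a, b] / (F(a, b))` for the functions `a, b` on `X`. -/
def IsPlaneCurve (θ : invariants Γ ≃ₐ[ℂ] invariants Γ) (a b : invariants Γ)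
    (F : Poly → Poly → Poly) : Prop :=
  ∃ e : (Poly ⧸ Ideal.span {F (X 0) (X 1)}) ≃ₐ[ℂ] FixedRing θ,
    e (Ideal.Quotient.mk _ (X 0)) = restrict θ a ∧
    e (Ideal.Quotient.mk _ (X 1)) = restrict θ b

/-- `X^θ = Spec ℂ[a]` is an affine line with coordinate `a`. -/
def IsLineWithCoordinate (θ : invariants Γ ≃ₐ[ℂ] invariants Γ) (a : invariants Γ) : Prop :=
  ∃ e : Polynomial ℂ ≃ₐ[ℂ] FixedRing θ, e Polynomial.X = restrict θ a

/-- `X^θ = Spec ℂ`. -/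
def IsReducedPoint (θ : invariants Γ ≃ₐ[ℂ] invariants Γ) : Prop :=
  Nonempty (FixedRing θ ≃ₐ[ℂ] ℂ)

/-- `X^θ` is reduced, it has exactly `k + l` irreducible components, of which `k` are affine lines
and `l` are cusps, and any two of them intersect exactly at the point `0` of `X`. -/
structure IsReducedUnion (θ : invariants Γ ≃ₐ[ℂ] invariants Γ) (k l : ℕ) : Prop where
  reduced : AlgebraicGeometry.IsReduced (fixedLocus θ)
  card : (irreducibleComponents (fixedLocus θ)).encard = k + l
  lines : {Z ∈ irreducibleComponents (fixedLocus θ) | IsAffineLine (ClosedRing θ Z)}.encard = k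
  cusps : {Z ∈ irreducibleComponents (fixedLocus θ) | IsCuspCurve (ClosedRing θ Z)}.encard = l
  inter : ∀ Z ∈ irreducibleComponents (fixedLocus θ),
    ∀ W ∈ irreducibleComponents (fixedLocus θ), Z ≠ W →
      ∀ p : fixedLocus θ, p ∈ Z ∩ W ↔ (primeAt θ p).comap (restrict θ) = originIdeal Γ

end

/-- The subgroup of `SL₂(ℂ)` generated by a set of matrices of determinant `1`. -/
def generatedBy (S : Set (Matrix (Fin 2) (Fin 2) ℂ)) :
    Subgroup (Matrix.SpecialLinearGroup (Fin 2) ℂ) :=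
  Subgroup.closure {g | (g : Matrix (Fin 2) (Fin 2) ℂ) ∈ S}

/-- The primitive `n`-th root of unity `exp(2πi/n)`. -/
def rootOfUnity (n : ℕ) : ℂ := Complex.exp (2 * Real.pi * Complex.I / n)

/-- The cyclic group of order `n + 1`. -/
def groupA (n : ℕ) : Subgroup (Matrix.SpecialLinearGroup (Fin 2) ℂ) :=
  generatedBy {M | ∃ ε : ℂ, ε ^ (n + 1) = 1 ∧ M = !![ε, 0; 0, ε⁻¹]}

/-- The binary dihedral group of order `4 (n - 2)`. -/
def groupD (n : ℕ) : Subgroup (Matrix.SpecialLinearGroup (Fin 2) ℂ) :=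
  generatedBy {M | ∃ ε : ℂ, ε ^ (2 * (n - 2)) = 1 ∧
    (M = !![ε, 0; 0, ε⁻¹] ∨ M = !![0, Complex.I * ε; Complex.I * ε⁻¹, 0])}

/-- The matrix that, with the quaternion group, generates the binary
tetrahedral group. -/
def tetrahedralMatrix : Matrix (Fin 2) (Fin 2) ℂ :=
  (1 / (1 - Complex.I)) • !![1, Complex.I; 1, -Complex.I]

/-- The binary tetrahedral group of order `24`. -/
def groupE6 : Subgroup (Matrix.SpecialLinearGroup (Fin 2) ℂ) :=
  generatedBy {!![Complex.I, 0; 0, -Complex.I], !![0, Complex.I; Complex.I, 0], tetrahedralMatrix}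

/-- The binary octahedral group of order `48`. -/
def groupE7 : Subgroup (Matrix.SpecialLinearGroup (Fin 2) ℂ) :=
  generatedBy {!![rootOfUnity 8, 0; 0, (rootOfUnity 8)⁻¹], !![0, Complex.I; Complex.I, 0],
    tetrahedralMatrix}

/-- The matrix that, with `diag(ε₁₀, ε₁₀⁻¹)`, generates the binary icosahedral group. -/
def icosahedralMatrix : Matrix (Fin 2) (Fin 2) ℂ :=
  ((Real.sqrt 5 : ℝ) : ℂ)⁻¹ •
    !![-rootOfUnity 5 + rootOfUnity 5 ^ 4, rootOfUnity 5 ^ 2 - rootOfUnity 5 ^ 3;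
       rootOfUnity 5 ^ 2 - rootOfUnity 5 ^ 3, rootOfUnity 5 - rootOfUnity 5 ^ 4]

/-- The binary icosahedral group of order `120`. -/
def groupE8 : Subgroup (Matrix.SpecialLinearGroup (Fin 2) ℂ) :=
  generatedBy {!![rootOfUnity 10, 0; 0, (rootOfUnity 10)⁻¹], !![0, 1; -1, 0], icosahedralMatrix}

/-- `x, y, z` generate `ℂ[X]` as a `ℂ`-algebra. -/
def Generate {Γ : Subgroup (Matrix.SpecialLinearGroup (Fin 2) ℂ)} (x y z : invariants Γ) : Prop :=
  Algebra.adjoin ℂ {x, y, z} = ⊤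

end Kleinian

end

open Kleinian

open MvPolynomial
open Algebra (adjoin subset_adjoin smul_def)
open Complex (I I_sq)
open IsAlgClosed (exists_pow_nat_eq)
open MulAction (stabilizer)
open Matrix (cons_val_zero cons_val_one cons_val_fin_one cons_val' det_fin_two det_fin_two_of mulVec
  mul_fin_two of_apply one_mulVec one_fin_two)
open Matrix.SpecialLinearGroup renaming coe_mul → sl_mul, coe_one → sl_one

namespace Kleinian

/-- The special linear group of rank two. -/
abbrev SL2 : Type := Matrix.SpecialLinearGroup (Fin 2) ℂ

/-- The `2 × 2` matrices. -/
abbrev Mat : Type := Matrix (Fin 2) (Fin 2) ℂ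

/-- The automorphisms of the ring of invariants. -/
abbrev Aut (Γ : Subgroup SL2) : Type := invariants Γ ≃ₐ[ℂ] invariants Γ

variable {Γ : Subgroup SL2} {x y z f h : invariants Γ} {θ η : Aut Γ} {m n : ℕ}

theorem eval_linSubst (g : Mat) (f : Poly) (w : Fin 2 → ℂ) :
    eval w (linSubst g f) = eval (g.mulVec w) f := by
  rw [linSubst, ← coe_aeval_eq_eval, ← coe_aeval_eq_eval, RingHom.coe_coe, RingHom.coe_coe,
    ← AlgHom.comp_apply]
  congr 1
  ext i
  fin_cases i <;> simp

theorem linSubst_linSubst (g h : Mat) (f : Poly) :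
    linSubst h (linSubst g f) = linSubst (g * h) f := by
  apply MvPolynomial.funext
  intro w
  simp only [eval_linSubst, Matrix.mulVec_mulVec]

theorem linSubst_one (f : Poly) : linSubst 1 f = f := by
  apply MvPolynomial.funext
  intro w
  simp only [eval_linSubst, one_mulVec]

theorem linSubst_u (g : Mat) : linSubst g u = C (g 0 0) * u + C (g 0 1) * v := by
  simp [linSubst, u, v, Fin.sum_univ_two]

theorem linSubst_v (g : Mat) : linSubst g v = C (g 1 0) * u + C (g 1 1) * v := by
  simp [linSubst, u, v, Fin.sum_univ_two]

theorem linSubst_isHomogeneous (g : Mat) {f : Poly} {d : ℕ} (hf : f.IsHomogeneous d) :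
    (linSubst g f).IsHomogeneous d := by
  have h1 : ∀ i : Fin 2, (∑ j, C (g i j) * X j : Poly).IsHomogeneous 1 := fun i =>
    IsHomogeneous.sum _ _ _ fun j _ => isHomogeneous_C_mul_X _ _
  have h2 := hf.aeval _ h1
  rwa [one_mul] at h2

theorem polyBracket_linSubst (g : Mat) (f h : Poly) :
    polyBracket (linSubst g f) (linSubst g h) = C g.det * linSubst g (polyBracket f h) := by
  simp only [polyBracket, pderiv_linSubst, Fin.sum_univ_two, map_sub, map_mul, det_fin_two]
  ring

theorem polyBracket_isHomogeneous {f h : Poly} {d e : ℕ} (hf : f.IsHomogeneous d)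
    (hh : h.IsHomogeneous e) : (polyBracket f h).IsHomogeneous (d - 1 + (e - 1)) :=
  ((hf.pderiv).mul hh.pderiv).sub (hf.pderiv.mul hh.pderiv)

theorem pderiv_aeval (x : Fin 2 → Poly) (p : Poly) (i : Fin 2) : pderiv i (aeval x p) = ∑ j,
    aeval x (pderiv j p) * pderiv i (x j) := by
  induction p using MvPolynomial.induction_on with
  | C a => simp
  | add p q hp hq => simp only [map_add, hp, hq, add_mul, Finset.sum_add_distrib]
  | mul_X p j hp =>
    rw [map_mul, Derivation.leibniz, hp]
    fin_cases j <;> simp [Fin.sum_univ_two, pderiv_X, Derivation.leibniz] <;> ring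

theorem eq_C_of_pderiv_eq_zero {p : Poly} (h : ∀ i, pderiv i p = 0) : p = C (coeff 0 p) := by
  ext m
  rw [coeff_C]
  split_ifs with hm
  · rw [hm]
  · obtain ⟨i, hi⟩ : ∃ i, m i ≠ 0 := by
      by_contra! hc
      exact hm (Finsupp.ext fun i => (hc i).symm)
    have h1 := coeff_pderiv (i := i) p (m - Finsupp.single i 1)
    have h2 : m - Finsupp.single i 1 + Finsupp.single i 1 = m := by
      apply tsub_add_cancel_of_le
      rw [Finsupp.single_le_iff]
      omega
    rw [h i, coeff_zero, h2] at h1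
    have h3 : ((m - Finsupp.single i 1 : Fin 2 →₀ ℕ) i + 1 : ℂ) ≠ 0 := by
      exact Nat.cast_add_one_ne_zero _
    rcases mul_eq_zero.mp h1.symm with h4 | h4
    · exact h4
    · exact absurd h4 h3

theorem totalDegree_pderiv_lt {p : Poly} (i : Fin 2) (h : pderiv i p ≠ 0) :
    (pderiv i p).totalDegree < p.totalDegree := by
  obtain ⟨m, hm, hmax⟩ := Finset.exists_mem_eq_sup (pderiv i p).support
    (support_nonempty.mpr h) (fun s => s.sum fun _ e => e)
  have h1 : coeff (m + Finsupp.single i 1) p ≠ 0 := fun h0 => by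
    rw [mem_support_iff, coeff_pderiv, h0, zero_mul] at hm
    exact hm rfl
  have h2 := le_totalDegree (mem_support_iff.mpr h1)
  rw [totalDegree, hmax]
  rw [Finsupp.sum_add_index' (by simp) (by simp), Finsupp.sum_single_index rfl] at h2
  omega

/-- Polynomials with nonzero Poisson bracket are algebraically independent. -/
theorem aeval_eq_zero_of_polyBracket_ne_zero {x y : Poly} (hxy : polyBracket x y ≠ 0) (p : Poly)
    (hp : aeval ![x, y] p = 0) : p = 0 := by
  induction hn : p.totalDegree using Nat.strong_induction_on generalizing p with
  | _ n ih =>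
    have hu := pderiv_aeval ![x, y] p 0
    have hv := pderiv_aeval ![x, y] p 1
    rw [hp, map_zero] at hu hv
    simp only [Fin.sum_univ_two, cons_val_zero, cons_val_one] at hu hv
    have h0 : aeval ![x, y] (pderiv 0 p) = 0 := by
      have : aeval ![x, y] (pderiv 0 p) * polyBracket x y = 0 := by
        unfold polyBracket
        linear_combination (-pderiv 1 y) * hu + pderiv 0 y * hv
      exact (mul_eq_zero.mp this).resolve_right hxy
    have h1 : aeval ![x, y] (pderiv 1 p) = 0 := by
      have : aeval ![x, y] (pderiv 1 p) * polyBracket x y = 0 := by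
        unfold polyBracket
        linear_combination (pderiv 1 x) * hu - pderiv 0 x * hv
      exact (mul_eq_zero.mp this).resolve_right hxy
    have key : ∀ i, pderiv i p = 0 := fun i => by
      by_contra hne
      have hlt := totalDegree_pderiv_lt i hne
      rw [hn] at hlt
      refine hne (ih _ hlt _ ?_ rfl)
      fin_cases i
      · exact h0
      · exact h1
    have hC := eq_C_of_pderiv_eq_zero key
    rw [hC, aeval_C] at hp
    rw [hC]
    have : coeff 0 p = 0 := by simpa using hp
    rw [this, C_0]

theorem mem_invariants_generatedBy {S : Set (Mat)} {f : Poly} (h : ∀ M ∈ S, linSubst M f = f) :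
    f ∈ invariants (generatedBy S) := fun g hg => by
  unfold generatedBy at hg
  induction hg using Subgroup.closure_induction with
  | mem g hg => exact h _ hg
  | one => simpa using linSubst_one f
  | mul a b _ _ ha hb =>
    rw [sl_mul, ← linSubst_linSubst, ha, hb]
  | inv a _ ha =>
    conv_lhs => rw [← ha]
    rw [linSubst_linSubst, ← sl_mul, mul_inv_cancel, sl_one, linSubst_one]

theorem linSubst_eq_of_mem_generatedBy {S : Set (Mat)} {f : Poly}
    (hf : f ∈ invariants (generatedBy S)) {M : Mat} (hM : M ∈ S) (hdet : M.det = 1) :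
    linSubst M f = f :=
  hf ⟨M, hdet⟩ (Subgroup.subset_closure hM)

theorem Generate.algHom_ext {A : Type*} [Semiring A] [Algebra ℂ A] (h : Generate x y z)
    {φ ψ : invariants Γ →ₐ[ℂ] A} (hx : φ x = ψ x) (hy : φ y = ψ y) (hz : φ z = ψ z) : φ = ψ := by
  refine AlgHom.ext_of_adjoin_eq_top h ?_
  rintro a (rfl | rfl | rfl) <;> assumption

theorem Generate.algEquiv_ext (h : Generate x y z) {φ ψ : Aut Γ} (hx : φ x = ψ x) (hy : φ y = ψ y)
    (hz : φ z = ψ z) : φ = ψ := by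
  have := h.algHom_ext (φ := (φ : invariants Γ →ₐ[ℂ] invariants Γ))
    (ψ := (ψ : invariants Γ →ₐ[ℂ] invariants Γ)) hx hy hz
  ext1 f
  exact DFunLike.congr_fun this f

theorem Generate.induction (h : Generate x y z) (S : Subalgebra ℂ (invariants Γ)) (hx : x ∈ S)
    (hy : y ∈ S) (hz : z ∈ S) (f) : f ∈ S := by
  have : adjoin ℂ {x, y, z} ≤ S := Algebra.adjoin_le (by rintro a (rfl | rfl | rfl) <;> assumption)
  exact this (h ▸ Algebra.mem_top)

theorem Generate.linSubst_mem (h : Generate x y z) {g : Mat} (hx : linSubst g x ∈ invariants Γ)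
    (hy : linSubst g y ∈ invariants Γ) (hz : linSubst g z ∈ invariants Γ) (f : invariants Γ) :
    linSubst g f ∈ invariants Γ :=
  h.induction (((invariants Γ).comap (linSubst g)).comap (invariants Γ).val) hx hy hz f

/-- The endomorphism of the ring of invariants induced by a linear substitution. -/
noncomputable def restrictSubst (g : Mat) (h : ∀ f : invariants Γ, linSubst g f ∈ invariants Γ) :
    invariants Γ →ₐ[ℂ] invariants Γ :=
  ((linSubst g).comp (invariants Γ).val).codRestrict _ h

/-- The automorphism of the ring of invariants induced by an invertible linear substitution. -/
noncomputable def substEquiv (g g' : Mat) (h : ∀ f : invariants Γ, linSubst g f ∈ invariants Γ)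
    (h' : ∀ f : invariants Γ, linSubst g' f ∈ invariants Γ)
    (h1 : ∀ f : invariants Γ, linSubst g (linSubst g' f) = f)
    (h2 : ∀ f : invariants Γ, linSubst g' (linSubst g f) = f) : Aut Γ :=
  AlgEquiv.ofAlgHom (restrictSubst g h) (restrictSubst g' h')
    (AlgHom.ext fun f => Subtype.ext (h1 f)) (AlgHom.ext fun f => Subtype.ext (h2 f))

theorem Generate.exists_antiPoisson (hg : Generate x y z) (g : Mat) (hdet : g.det = -1)
    (x' y' z' : invariants Γ) (hx : linSubst g x = x') (hy : linSubst g y = y')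
    (hz : linSubst g z = z') (hx' : linSubst g x' = x) (hy' : linSubst g y' = y)
    (hz' : linSubst g z' = z) : ∃ θ : Aut Γ, IsAntiPoissonInvolution θ ∧ θ x = x' ∧ θ y = y' ∧
    θ z = z' := by
  have hmem := hg.linSubst_mem (hx ▸ x'.2) (hy ▸ y'.2) (hz ▸ z'.2)
  have hinv : ∀ f : invariants Γ, linSubst g (linSubst g f) = f := fun f => by
    have := hg.algHom_ext (φ := (restrictSubst g hmem).comp (restrictSubst g hmem))
      (ψ := AlgHom.id ℂ _) (Subtype.ext (show linSubst g (linSubst g x) = x by rw [hx, hx']))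
      (Subtype.ext (show linSubst g (linSubst g y) = y by rw [hy, hy']))
      (Subtype.ext (show linSubst g (linSubst g z) = z by rw [hz, hz']))
    exact congrArg Subtype.val (DFunLike.congr_fun this f)
  refine ⟨substEquiv g g hmem hmem hinv hinv, ⟨?_, ?_, ?_⟩, Subtype.ext hx, Subtype.ext hy,
    Subtype.ext hz⟩
  · intro d f hf
    exact linSubst_isHomogeneous g hf
  · intro f
    exact Subtype.ext (hinv f)
  · intro f h
    apply Subtype.ext
    change linSubst g (polyBracket f h) = -polyBracket (linSubst g f) (linSubst g h)
    rw [polyBracket_linSubst, hdet]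
    simp

theorem Generate.exists_gradedPoisson (hg : Generate x y z) (g g' : Mat) (hgg : g * g' = 1)
    (hdet : g.det = 1) (hx : linSubst g x ∈ invariants Γ) (hy : linSubst g y ∈ invariants Γ)
    (hz : linSubst g z ∈ invariants Γ) (hx' : linSubst g' x ∈ invariants Γ)
    (hy' : linSubst g' y ∈ invariants Γ) (hz' : linSubst g' z ∈ invariants Γ) : ∃ σ : Aut Γ,
    IsGradedPoisson σ ∧ ∀ f, (σ f : Poly) = linSubst g f := by
  refine ⟨substEquiv g g' (hg.linSubst_mem hx hy hz) (hg.linSubst_mem hx' hy' hz') ?_ ?_,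
    ⟨?_, ?_⟩, fun f => rfl⟩
  · intro f
    rw [linSubst_linSubst, mul_eq_one_comm.mp hgg, linSubst_one]
  · intro f
    rw [linSubst_linSubst, hgg, linSubst_one]
  · intro d f hf
    exact linSubst_isHomogeneous g hf
  · intro f h
    apply Subtype.ext
    change linSubst g (polyBracket f h) = polyBracket (linSubst g f) (linSubst g h)
    rw [polyBracket_linSubst, hdet]
    simp

theorem Generate.areConjugate (hg : Generate x y z) {σ : Aut Γ} (hσ : IsGradedPoisson σ)
    (hx : σ (θ x) = η (σ x)) (hy : σ (θ y) = η (σ y)) (hz : σ (θ z) = η (σ z)) :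
    AreConjugate θ η := by
  refine ⟨σ, hσ, fun f => ?_⟩
  have := hg.algEquiv_ext (φ := θ.trans σ) (ψ := σ.trans η) hx hy hz
  exact DFunLike.congr_fun this f

theorem areConjugate_refl (θ : Aut Γ) : AreConjugate θ θ :=
  ⟨AlgEquiv.refl, ⟨fun _ _ h => h, fun _ _ => rfl⟩, fun _ => rfl⟩

theorem Generate.areConjugate_of_eq (hg : Generate x y z) (hx : θ x = η x) (hy : θ y = η y)
    (hz : θ z = η z) : AreConjugate θ η := by
  rw [hg.algEquiv_ext hx hy hz]
  exact areConjugate_refl η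

/-- The functions fixed by `θ` modulo an ideal form a subalgebra. -/
noncomputable def fixedModulo (θ : Aut Γ) (I : Ideal (invariants Γ)) :
    Subalgebra ℂ (invariants Γ) :=
  AlgHom.equalizer ((Ideal.Quotient.mkₐ ℂ I).comp (θ : invariants Γ →ₐ[ℂ] invariants Γ))
    (Ideal.Quotient.mkₐ ℂ I)

theorem mem_fixedModulo {I : Ideal (invariants Γ)} : f ∈ fixedModulo θ I ↔ θ f - f ∈ I := by
  rw [← Ideal.Quotient.mk_eq_mk_iff_sub_mem]
  rfl

theorem Generate.fixedIdeal_eq (hg : Generate x y z) (θ : Aut Γ) :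
    fixedIdeal θ = Ideal.span {θ x - x, θ y - y, θ z - z} := by
  apply le_antisymm
  · rw [fixedIdeal, Ideal.span_le]
    rintro _ ⟨f, rfl⟩
    refine mem_fixedModulo.mp (hg.induction (fixedModulo θ _) ?_ ?_ ?_ f) <;>
    refine mem_fixedModulo.mpr (Ideal.subset_span ?_) <;> simp
  · rw [Ideal.span_le]
    rintro _ (rfl | rfl | rfl) <;> exact Ideal.subset_span ⟨_, rfl⟩

theorem coe_bracket (f h : invariants Γ) : (bracket f h : Poly) = polyBracket f h := rfl

theorem IsAffineLine.congr {A B : Type} [CommRing A] [Algebra ℂ A] [CommRing B] [Algebra ℂ B]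
    (e : A ≃ₐ[ℂ] B) (h : IsAffineLine A) : IsAffineLine B :=
  h.map fun f => e.symm.trans f

theorem IsCuspCurve.congr {A B : Type} [CommRing A] [Algebra ℂ A] [CommRing B] [Algebra ℂ B]
    (e : A ≃ₐ[ℂ] B) (h : IsCuspCurve A) : IsCuspCurve B := by
  obtain ⟨p, q, hp, hq, hpq, ⟨f⟩⟩ := h
  exact ⟨p, q, hp, hq, hpq, ⟨e.symm.trans f⟩⟩

theorem not_isPrincipalIdealRing_cusp {p q : ℕ} (hp : 2 ≤ p) (hq : 2 ≤ q) :
    ¬ IsPrincipalIdealRing (Poly ⧸ Ideal.span {(X 0 ^ p - X 1 ^ q : Poly)}) := fun hP => by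
  set G : Poly := X 0 ^ p - X 1 ^ q with hG
  let π := Ideal.Quotient.mk (Ideal.span {G})
  obtain ⟨p, rfl⟩ := Nat.exists_eq_add_of_le' hp
  obtain ⟨q, rfl⟩ := Nat.exists_eq_add_of_le' hq
  have hG0 : constantCoeff G = 0 := by simp [hG]
  have hGi : ∀ i, constantCoeff (pderiv i G) = 0 := fun i => by
    simp [hG]
  obtain ⟨⟨f', hf⟩⟩ := hP.principal (Ideal.span {π (X 0), π (X 1)})
  obtain ⟨f, rfl⟩ := Ideal.Quotient.mk_surjective f'
  have hX : ∀ i : Fin 2, π (X i) ∈ Ideal.span {π (X 0), π (X 1)} := fun i => by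
    apply Ideal.subset_span
    fin_cases i <;> simp
  have hdiv : ∀ i : Fin 2, ∃ a b : Poly, X i = f * a + G * b := fun i => by
    have h1 := hX i
    rw [hf] at h1
    obtain ⟨a', ha⟩ := Ideal.mem_span_singleton'.mp h1
    obtain ⟨a, rfl⟩ := Ideal.Quotient.mk_surjective a'
    have h2 : π (X i - a * f) = 0 := by
      rw [map_sub, map_mul, sub_eq_zero]
      exact ha.symm
    obtain ⟨b, hb⟩ := Ideal.mem_span_singleton.mp (Ideal.Quotient.eq_zero_iff_mem.mp h2)
    exact ⟨a, b, by linear_combination hb⟩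
  have hf0 : constantCoeff f = 0 := by
    have h1 : π f ∈ Ideal.span {π (X 0), π (X 1)} := by
      rw [hf]
      exact Ideal.mem_span_singleton_self _
    obtain ⟨a', b', hab⟩ := Ideal.mem_span_pair.mp h1
    obtain ⟨a, rfl⟩ := Ideal.Quotient.mk_surjective a'
    obtain ⟨b, rfl⟩ := Ideal.Quotient.mk_surjective b'
    have h2 : π (f - (a * X 0 + b * X 1)) = 0 := by
      rw [map_sub, map_add, map_mul, map_mul, sub_eq_zero]
      exact hab.symm
    obtain ⟨c, hc⟩ := Ideal.mem_span_singleton.mp (Ideal.Quotient.eq_zero_iff_mem.mp h2)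
    have h3 : f = a * X 0 + b * X 1 + G * c := by linear_combination hc
    rw [h3]
    simp [hG0]
  have hder : ∀ (a b : Poly) (j : Fin 2),
      constantCoeff (pderiv j (f * a + G * b)) = constantCoeff (pderiv j f) * constantCoeff a := by
    intro a b j
    simp [Derivation.leibniz, hf0, hG0, hGi]
    ring
  obtain ⟨a, b, hab⟩ := hdiv 0
  obtain ⟨c, d, hcd⟩ := hdiv 1
  have h00 := hder a b 0
  have h01 := hder a b 1
  have h10 := hder c d 0
  have h11 := hder c d 1
  rw [← hab] at h00 h01
  rw [← hcd] at h10 h11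
  simp [pderiv_X] at h00 h01 h10 h11
  rcases h01 with h | h
  · simp [h] at h11
  · simp [h] at h00

theorem IsAffineLine.not_isCuspCurve {A : Type} [CommRing A] [Algebra ℂ A] (h : IsAffineLine A) :
    ¬ IsCuspCurve A := by
  rintro ⟨p, q, hp, hq, -, ⟨f⟩⟩
  obtain ⟨e⟩ := h
  refine not_isPrincipalIdealRing_cusp hp hq ?_
  have g : Polynomial ℂ ≃ₐ[ℂ] _ := e.symm.trans f
  exact IsPrincipalIdealRing.of_surjective g.toRingEquiv.toRingHom g.surjective

theorem ker_eq_span_of_section (G : Poly) (φ : Poly →ₐ[ℂ] Polynomial ℂ)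
    (ι : Polynomial ℂ →ₐ[ℂ] Poly) (hG : φ G = 0) (h : ∀ i, X i - ι (φ (X i)) ∈ Ideal.span {G}) :
    RingHom.ker φ = Ideal.span {G} := by
  apply le_antisymm
  · intro f hf
    have key : Ideal.Quotient.mkₐ ℂ (Ideal.span {G})
        = ((Ideal.Quotient.mkₐ ℂ (Ideal.span {G})).comp ι).comp φ := by
      apply algHom_ext
      intro i
      exact (Ideal.Quotient.mk_eq_mk_iff_sub_mem _ _).mpr (h i)
    have h1 := DFunLike.congr_fun key f
    rw [AlgHom.comp_apply, (hf : φ f = 0), map_zero] at h1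
    exact Ideal.Quotient.eq_zero_iff_mem.mp h1
  · rw [Ideal.span_singleton_le_iff_mem]
    exact hG

theorem prime_and_isAffineLine (G : Poly) (hG0 : G ≠ 0) (φ : Poly →ₐ[ℂ] Polynomial ℂ)
    (ι : Polynomial ℂ →ₐ[ℂ] Poly) (hφι : φ (ι Polynomial.X) = Polynomial.X) (hG : φ G = 0)
    (h : ∀ i, X i - ι (φ (X i)) ∈ Ideal.span {G}) : Prime G ∧
    IsAffineLine (Poly ⧸ Ideal.span {G}) := by
  have hker := ker_eq_span_of_section G φ ι hG h
  have hsurj : Function.Surjective φ := fun p => by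
    have : φ.comp ι = AlgHom.id ℂ _ := Polynomial.algHom_ext hφι
    exact ⟨ι p, DFunLike.congr_fun this p⟩
  constructor
  · rw [← Ideal.span_singleton_prime hG0, ← hker]
    exact RingHom.ker_isPrime _
  · rw [← hker]
    exact ⟨Ideal.quotientKerAlgEquivOfSurjective hsurj⟩

theorem graph_ne_zero {i j : Fin 2} (hij : i ≠ j) (c : ℂ) : (X i - C c * X j ^ m : Poly) ≠ 0 := by
  intro h
  have h1 := congrArg (pderiv i) h
  simp [pderiv_X_of_ne hij.symm] at h1

theorem graph_isLine {i j : Fin 2} (hij : i ≠ j) (c : ℂ) (m : ℕ) :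
    Prime (X i - C c * X j ^ m : Poly) ∧
    IsAffineLine (Poly ⧸ Ideal.span {(X i - C c * X j ^ m : Poly)}) := by
  refine prime_and_isAffineLine _ (graph_ne_zero hij c)
    (aeval fun k => if k = i then Polynomial.C c * Polynomial.X ^ m else Polynomial.X)
    (Polynomial.aeval (X j)) ?_ ?_ ?_
  · simp [hij.symm]
  · simp [hij.symm, Polynomial.algebraMap_eq]
  · intro k
    by_cases hk : k = i
    · subst hk
      simp [algebraMap_eq]
    · have : k = j := by omega
      subst this
      simp [hk]

/-- The parametrization of the cusp `s ^ p = t ^ q`. -/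
noncomputable def cuspParam (p q : ℕ) : Poly →ₐ[ℂ] Polynomial ℂ :=
  aeval ![Polynomial.X ^ q, Polynomial.X ^ p]

theorem exists_cusp_normalForm (p q : ℕ) (hp : 0 < p) (P : Poly) : ∃ f : Fin p → Polynomial ℂ,
    P - ∑ i : Fin p,
    X 0 ^ (i : ℕ) * Polynomial.aeval (X 1) (f i) ∈ Ideal.span {(X 0 ^ p - X 1 ^ q : Poly)} := by
  induction P using MvPolynomial.induction_on'' with
  | C a =>
    refine ⟨Pi.single ⟨0, hp⟩ (Polynomial.C a), ?_⟩
    rw [Finset.sum_eq_single ⟨0, hp⟩]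
    · simp [algebraMap_eq]
    · intro i _ hi
      simp [Pi.single_eq_of_ne hi]
    · simp
  | monomial_add m a f _ _ ih₁ ih₂ =>
    obtain ⟨f₁, h₁⟩ := ih₁
    obtain ⟨f₂, h₂⟩ := ih₂
    refine ⟨f₁ + f₂, ?_⟩
    have := Ideal.add_mem _ h₁ h₂
    convert this using 1
    simp only [Pi.add_apply, map_add, mul_add, Finset.sum_add_distrib]
    ring
  | mul_X P j ih =>
    obtain ⟨f, hf⟩ := ih
    fin_cases j
    · obtain ⟨n, rfl⟩ := Nat.exists_eq_succ_of_ne_zero hp.ne'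
      refine ⟨Fin.cons (Polynomial.X ^ q * f (Fin.last n)) (fun i => f i.castSucc), ?_⟩
      have h1 := Ideal.mul_mem_right (X 0) _ hf
      have h2 : (X 0 ^ (n + 1) - X 1 ^ q : Poly) * Polynomial.aeval (X 1) (f (Fin.last n)) ∈
          Ideal.span {(X 0 ^ (n + 1) - X 1 ^ q : Poly)} :=
        Ideal.mul_mem_right _ _ (Ideal.mem_span_singleton_self _)
      have h3 := Ideal.add_mem _ h1 h2
      convert h3 using 1
      rw [Fin.sum_univ_succ, Fin.sum_univ_castSucc]
      simp only [Fin.cons_zero, Fin.cons_succ, Fin.val_zero, Fin.val_succ, Fin.val_castSucc,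
        Fin.val_last, map_mul, map_pow, Polynomial.aeval_X, pow_succ, sub_mul, add_mul,
        Finset.sum_mul, Fin.zero_eta]
      have h4 : ∑ i : Fin n, X 0 ^ (i : ℕ) * X 0 * Polynomial.aeval (X 1 : Poly) (f i.castSucc)
          = ∑ i : Fin n, X 0 ^ (i : ℕ) * Polynomial.aeval (X 1 : Poly) (f i.castSucc) * X 0 :=
        Finset.sum_congr rfl fun i _ => by ring
      rw [h4]
      ring
    · refine ⟨fun i => f i * Polynomial.X, ?_⟩
      have h1 := Ideal.mul_mem_right (X 1) _ hf
      convert h1 using 1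
      simp only [map_mul, Polynomial.aeval_X, sub_mul, Finset.sum_mul, Fin.mk_one, mul_assoc]

theorem ker_cuspParam {p q : ℕ} (hp : 0 < p) (hpq : p.Coprime q) :
    RingHom.ker (cuspParam p q) = Ideal.span {(X 0 ^ p - X 1 ^ q : Poly)} := by
  have hG : cuspParam p q (X 0 ^ p - X 1 ^ q) = 0 := by
    simp only [cuspParam, map_sub, map_pow, aeval_X, cons_val_zero, cons_val_one]
    ring
  apply le_antisymm
  · intro P hP
    obtain ⟨f, hf⟩ := exists_cusp_normalForm p q hp P
    obtain ⟨b, hb⟩ := Ideal.mem_span_singleton.mp hf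
    have h1 : ∑ i : Fin p, Polynomial.X ^ (q * (i : ℕ)) * Polynomial.expand ℂ p (f i) = 0 := by
      have h2 := congrArg (cuspParam p q) hb
      rw [map_mul, hG, zero_mul, map_sub, (hP : cuspParam p q P = 0), zero_sub, neg_eq_zero,
        map_sum] at h2
      rw [← h2]
      refine Finset.sum_congr rfl fun i _ => ?_
      have h3 : (cuspParam p q).comp (Polynomial.aeval (X 1)) = Polynomial.expand ℂ p := by
        apply Polynomial.algHom_ext
        simp [cuspParam]
      rw [map_mul, map_pow, ← h3]
      simp [cuspParam, pow_mul]
    have h4 : ∀ i, f i = 0 := fun i => by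
      ext j
      have h5 := congrArg (fun P => Polynomial.coeff P (q * (i : ℕ) + p * j)) h1
      simp only [Polynomial.finsetSum_coeff, Polynomial.coeff_zero] at h5
      rw [Finset.sum_eq_single i] at h5
      · rw [Polynomial.coeff_X_pow_mul', if_pos (by omega), Nat.add_sub_cancel_left,
          Polynomial.coeff_expand hp, if_pos (Dvd.intro _ rfl), Nat.mul_div_cancel_left _ hp] at h5
        simpa using h5
      · intro i' _ hi'
        rw [Polynomial.coeff_X_pow_mul']
        split_ifs with hle
        · rw [Polynomial.coeff_expand hp, if_neg]
          intro hdvd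
          have h6 : (p : ℤ) ∣ (q : ℤ) * ((i : ℕ) - (i' : ℕ) : ℤ) := by
            have h7 : (p : ℤ) ∣ ((q * (i : ℕ) + p * j - q * (i' : ℕ) : ℕ) : ℤ) := by
              exact_mod_cast hdvd
            rw [Nat.cast_sub hle] at h7
            have h8 := dvd_sub h7 (Dvd.intro (j : ℤ) rfl : (p : ℤ) ∣ p * j)
            have h10 : ((q * (i : ℕ) + p * j : ℕ) : ℤ) - ((q * (i' : ℕ) : ℕ) : ℤ) - p * j
                = (q : ℤ) * ((i : ℕ) - (i' : ℕ) : ℤ) := by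
              rw [Nat.cast_add, Nat.cast_mul, Nat.cast_mul, Nat.cast_mul]
              ring
            rwa [h10] at h8
          have h9 : (p : ℤ) ∣ ((i : ℕ) - (i' : ℕ) : ℤ) :=
            (Nat.isCoprime_iff_coprime.mpr hpq).dvd_of_dvd_mul_left h6
          have h10 := Int.eq_zero_of_abs_lt_dvd h9 (by
            have := i.2
            have := i'.2
            rw [abs_lt]
            constructor <;> omega)
          exact hi' (Fin.ext (by omega))
        · rfl
      · simp
    have h11 : P = (X 0 ^ p - X 1 ^ q) * b := by
      rw [← hb]
      simp [h4]
    rw [h11]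
    exact Ideal.mul_mem_right _ _ (Ideal.mem_span_singleton_self _)
  · rw [Ideal.span_singleton_le_iff_mem]
    exact hG

theorem exists_root (n : ℕ) {a : ℂ} (ha : a ≠ 0) (hn : n ≠ 0 := by omega) :
    ∃ r : ℂ, r ≠ 0 ∧ r ^ n = a := by
  obtain ⟨r, rfl⟩ := IsAlgClosed.exists_pow_nat_eq a (Nat.pos_of_ne_zero hn)
  exact ⟨r, fun h => ha (by rw [h, zero_pow hn]), rfl⟩

theorem cusp_isCusp {p q : ℕ} (hp : 2 ≤ p) (hq : 2 ≤ q) (hpq : p.Coprime q) {α β : ℂ} (hα : α ≠ 0)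
    (hβ : β ≠ 0) : Prime (C α * X 0 ^ p + C β * X 1 ^ q : Poly) ∧
    IsCuspCurve (Poly ⧸ Ideal.span {(C α * X 0 ^ p + C β * X 1 ^ q : Poly)}) := by
  obtain ⟨r, hr0, hr⟩ := exists_root p (inv_ne_zero hα)
  obtain ⟨s, hs0, hs⟩ := exists_root q (neg_ne_zero.mpr (inv_ne_zero hβ))
  let ρ : Poly ≃ₐ[ℂ] Poly := AlgEquiv.ofAlgHom (aeval ![C r * X 0, C s * X 1])
    (aeval ![C r⁻¹ * X 0, C s⁻¹ * X 1])
    (by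
      apply algHom_ext
      intro i
      fin_cases i <;> simp [← mul_assoc, ← C_mul, hr0, hs0, algebraMap_eq])
    (by
      apply algHom_ext
      intro i
      fin_cases i <;> simp [← mul_assoc, ← C_mul, hr0, hs0, algebraMap_eq])
  have hρ : ρ (C α * X 0 ^ p + C β * X 1 ^ q) = X 0 ^ p - X 1 ^ q := by
    change aeval ![C r * X 0, C s * X 1] (C α * X 0 ^ p + C β * X 1 ^ q : Poly) = _
    have h1 : (C α * C r ^ p : Poly) = 1 := by rw [← C_pow, hr, ← C_mul, mul_inv_cancel₀ hα, C_1]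
    have h2 : (C β * C s ^ q : Poly) = -1 := by
      rw [← C_pow, hs, ← C_mul, mul_neg, mul_inv_cancel₀ hβ, C_neg, C_1]
    simp only [map_add, map_mul, map_pow, aeval_X, cons_val_zero, cons_val_one,
      mul_pow, algHom_C, algebraMap_eq]
    linear_combination (X 0 ^ p) * h1 + X 1 ^ q * h2
  have hprime : Prime (X 0 ^ p - X 1 ^ q : Poly) := by
    rw [← Ideal.span_singleton_prime, ← ker_cuspParam (by omega) hpq]
    · exact RingHom.ker_isPrime _
    · intro h
      have := congrArg (eval ![1, 0]) h
      simp [show q ≠ 0 by omega] at this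
  constructor
  · rw [← MulEquiv.prime_iff (ρ : Poly ≃* Poly)]
    exact hρ ▸ hprime
  · refine ⟨p, q, hp, hq, hpq, ⟨Ideal.quotientEquivAlg _ _ ρ ?_⟩⟩
    rw [Ideal.map_span, Set.image_singleton]
    congr 2
    exact hρ.symm

/-- A reduced algebra whose spectrum is a point, or has lines and cusps as components. -/
def HasGoodComponents (A : Type) [CommRing A] [Algebra ℂ A] : Prop :=
  _root_.IsReduced A ∧ ((∃ p : PrimeSpectrum A, ∀ q, q = p) ∨
    ∀ P ∈ minimalPrimes A, IsAffineLine (A ⧸ P) ∨ IsCuspCurve (A ⧸ P))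

theorem HasGoodComponents.congr {A B : Type} [CommRing A] [Algebra ℂ A] [CommRing B] [Algebra ℂ B]
    (e : A ≃ₐ[ℂ] B) (h : HasGoodComponents A) : HasGoodComponents B := by
  obtain ⟨hred, h⟩ := h
  refine ⟨isReduced_of_injective e.symm.toRingEquiv.toRingHom e.symm.injective, ?_⟩
  rcases h with ⟨p, hp⟩ | h
  · left
    have hcomm : ∀ q : PrimeSpectrum B, PrimeSpectrum.comap e.symm.toRingEquiv.toRingHom
        (PrimeSpectrum.comap e.toRingEquiv.toRingHom q) = q := fun q => by
      ext x
      simp [PrimeSpectrum.comap]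
    refine ⟨PrimeSpectrum.comap e.symm.toRingEquiv.toRingHom p, fun q => ?_⟩
    rw [← hcomm q, hp (PrimeSpectrum.comap e.toRingEquiv.toRingHom q)]
  · right
    intro P hP
    have hP' : P.comap (e : A →+* B) ∈ minimalPrimes A := by
      rw [minimalPrimes_eq_minimals] at hP ⊢
      have := hP.1
      refine ⟨Ideal.comap_isPrime _ _, fun Q hQ hle => ?_⟩
      have hQ' : (Q.comap (e.symm : B →+* A)).IsPrime := Ideal.comap_isPrime _ _
      have h1 : Q.comap (e.symm : B →+* A) ≤ P := fun x hx => by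
        have := hle (Ideal.mem_comap.mp hx)
        simpa using this
      have h2 := hP.2 hQ' h1
      intro x hx
      have := h2 (Ideal.mem_comap.mp hx)
      simpa using this
    have e' : (A ⧸ P.comap (e : A →+* B)) ≃ₐ[ℂ] (B ⧸ P) := Ideal.quotientEquivAlg _ _ e
      (Ideal.map_comap_of_surjective _ e.surjective P).symm
    exact (h _ hP').imp (IsAffineLine.congr e') (IsCuspCurve.congr e')

theorem HasGoodComponents.of_equiv_complex {A : Type} [CommRing A] [Algebra ℂ A] (e : A ≃ₐ[ℂ] ℂ) :
    HasGoodComponents A := by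
  refine HasGoodComponents.congr e.symm ⟨inferInstance, Or.inl ⟨⊥, fun q => ?_⟩⟩
  exact Subsingleton.elim _ _

/-- A finite family of incomparable primes with zero intersection, the first `k` of which
define affine lines and the other `l` of which define cusps. -/
structure IsCurveDecomp {A : Type} [CommRing A] [Algebra ℂ A] {k l : ℕ} (P : Fin k ⊕ Fin l → Ideal A) : Prop where
  prime : ∀ i, (P i).IsPrime
  incomparable : ∀ i j, P i ≤ P j → i = j
  iInf_eq : ⨅ i, P i = ⊥
  line : ∀ i, IsAffineLine (A ⧸ P (.inl i))
  cusp : ∀ j, IsCuspCurve (A ⧸ P (.inr j))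

namespace IsCurveDecomp

variable {A : Type} [CommRing A] [Algebra ℂ A] {k l : ℕ} {P : Fin k ⊕ Fin l → Ideal A}

theorem isReduced (h : IsCurveDecomp P) : _root_.IsReduced A := by
  rw [← nilradical_eq_bot_iff, eq_bot_iff, ← h.iInf_eq]
  refine le_iInf fun i => ?_
  have := h.prime i
  exact nilradical_le_prime _

theorem minimalPrimes_eq (h : IsCurveDecomp P) : minimalPrimes A = Set.range P := by
  have hex : ∀ Q : Ideal A, Q.IsPrime → ∃ i, P i ≤ Q := fun Q hQ => by
    have h1 : Finset.univ.inf P ≤ Q := by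
      rw [Finset.inf_univ_eq_iInf, h.iInf_eq]
      exact bot_le
    obtain ⟨i, -, hi⟩ := (hQ.inf_le' (f := P)).mp h1
    exact ⟨i, hi⟩
  rw [minimalPrimes_eq_minimals]
  ext Q
  constructor
  · intro hQ
    obtain ⟨i, hi⟩ := hex Q hQ.1
    exact ⟨i, le_antisymm hi (hQ.2 (h.prime i) hi)⟩
  · rintro ⟨i, rfl⟩
    refine ⟨h.prime i, fun Q hQ hle => ?_⟩
    obtain ⟨j, hj⟩ := hex Q hQ
    rwa [← h.incomparable j i (hj.trans hle)]

theorem hasGoodComponents (h : IsCurveDecomp P) : HasGoodComponents A := by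
  refine ⟨h.isReduced, Or.inr ?_⟩
  rw [h.minimalPrimes_eq]
  rintro _ ⟨i | j, rfl⟩
  · exact Or.inl (h.line i)
  · exact Or.inr (h.cusp j)

theorem irreducibleComponents_eq (h : IsCurveDecomp P) : irreducibleComponents (PrimeSpectrum A) =
    Set.range fun i => PrimeSpectrum.zeroLocus (P i : Set A) := by
  rw [← PrimeSpectrum.zeroLocus_minimalPrimes, h.minimalPrimes_eq, ← Set.range_comp]
  rfl

theorem vanishingIdeal_eq (h : IsCurveDecomp P) (i : Fin k ⊕ Fin l) :
    PrimeSpectrum.vanishingIdeal (PrimeSpectrum.zeroLocus (P i : Set A)) = P i := by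
  rw [PrimeSpectrum.vanishingIdeal_zeroLocus_eq_radical]
  exact (h.prime i).radical

theorem zeroLocus_injective (h : IsCurveDecomp P) :
    Function.Injective fun i => PrimeSpectrum.zeroLocus (P i : Set A) := fun i j hij => by
  have : P i = P j := by
    rw [← h.vanishingIdeal_eq i, ← h.vanishingIdeal_eq j]
    exact congrArg _ hij
  exact h.incomparable i j this.le

end IsCurveDecomp

theorem HasGoodComponents.components (h : HasGoodComponents (FixedRing θ)) :
    AlgebraicGeometry.IsReduced (fixedLocus θ) ∧ (¬ IsSinglePoint θ → ∀ Z ∈ irreducibleComponents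
    (fixedLocus θ), IsAffineLine (ClosedRing θ Z) ∨ IsCuspCurve (ClosedRing θ Z)) := by
  obtain ⟨hred, h⟩ := h
  constructor
  · have : _root_.IsReduced (CommRingCat.of (FixedRing θ)) := hred
    exact inferInstanceAs (AlgebraicGeometry.IsReduced
      (AlgebraicGeometry.Spec (CommRingCat.of (FixedRing θ))))
  · intro hne Z hZ
    rcases h with h | h
    · exact absurd h hne
    · refine h (idealOf θ Z) ?_
      have : (PrimeSpectrum.vanishingIdeal (R := FixedRing θ) Z) ∈ minimalPrimes (FixedRing θ) := by
        rw [← PrimeSpectrum.vanishingIdeal_irreducibleComponents]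
        exact Set.mem_image_of_mem _ hZ
      exact this

theorem IsCurveDecomp.isReducedUnion {k l : ℕ} {P : Fin k ⊕ Fin l → Ideal (FixedRing θ)} (h :
    IsCurveDecomp P) (hmeet : ∀ i j, i ≠ j → ∀ Q : Ideal (FixedRing θ), Q.IsPrime → (P i ≤ Q ∧ P j ≤
    Q ↔ Q.comap (restrict θ) = originIdeal Γ)) : IsReducedUnion θ k l := by
  have hirr : irreducibleComponents (fixedLocus θ) =
      Set.range fun i => PrimeSpectrum.zeroLocus (P i : Set (FixedRing θ)) :=
    h.irreducibleComponents_eq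
  have hid : ∀ i, idealOf θ (PrimeSpectrum.zeroLocus (P i : Set (FixedRing θ))) = P i :=
    h.vanishingIdeal_eq
  have hline : ∀ i, IsAffineLine
      (ClosedRing θ (PrimeSpectrum.zeroLocus (P (.inl i) : Set (FixedRing θ)))) := fun i => by
    have := h.line i
    rwa [← hid (.inl i)] at this
  have hcusp : ∀ i, IsCuspCurve
      (ClosedRing θ (PrimeSpectrum.zeroLocus (P (.inr i) : Set (FixedRing θ)))) := fun i => by
    have := h.cusp i
    rwa [← hid (.inr i)] at this
  have hencard : ∀ {ι : Type} [Fintype ι] (f : ι → Fin k ⊕ Fin l), Function.Injective f →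
      (Set.range fun i => PrimeSpectrum.zeroLocus (P (f i) : Set (FixedRing θ))).encard =
        Fintype.card ι := by
    intro ι _ f hf
    have := (h.zeroLocus_injective.comp hf).encard_image Set.univ
    rwa [Set.image_univ, Set.encard_univ, ENat.card_eq_coe_fintype_card] at this
  refine ⟨(h.hasGoodComponents.components).1, ?_, ?_, ?_, ?_⟩
  · exact (congrArg Set.encard hirr).trans ((hencard id Function.injective_id).trans (by simp))
  · rw [← Fintype.card_fin k, ← hencard (Sum.inl : Fin k → Fin k ⊕ Fin l) Sum.inl_injective]
    congr 1
    ext Z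
    rw [hirr]
    constructor
    · rintro ⟨⟨i | j, rfl⟩, hZ⟩
      · exact ⟨i, rfl⟩
      · exact absurd (hcusp j) hZ.not_isCuspCurve
    · rintro ⟨i, rfl⟩
      exact ⟨⟨.inl i, rfl⟩, hline i⟩
  · rw [← Fintype.card_fin l, ← hencard (Sum.inr : Fin l → Fin k ⊕ Fin l) Sum.inr_injective]
    congr 1
    ext Z
    rw [hirr]
    constructor
    · rintro ⟨⟨i | j, rfl⟩, hZ⟩
      · exact absurd hZ (hline i).not_isCuspCurve
      · exact ⟨j, rfl⟩
    · rintro ⟨i, rfl⟩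
      exact ⟨⟨.inr i, rfl⟩, hcusp i⟩
  · rw [hirr]
    rintro _ ⟨i, rfl⟩ _ ⟨j, rfl⟩ hne p
    have hij : i ≠ j := fun hij => hne (by rw [hij])
    exact hmeet i j hij (primeAt θ p) (PrimeSpectrum.isPrime (R := FixedRing θ) p)

theorem isReducedUnion_of_isLineWithCoordinate {a : invariants Γ} (h : IsLineWithCoordinate θ a) :
    IsReducedUnion θ 1 0 ∧ HasGoodComponents (FixedRing θ) := by
  obtain ⟨e, -⟩ := h
  have hdom : IsDomain (FixedRing θ) := e.symm.toRingEquiv.toMulEquiv.isDomain _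
  have : Nontrivial (FixedRing θ) := hdom.toNontrivial
  have hsub : Subsingleton (Fin 1 ⊕ Fin 0) := (Equiv.sumEmpty (Fin 1) (Fin 0)).subsingleton
  have : IsCurveDecomp (fun _ => ⊥ : Fin 1 ⊕ Fin 0 → Ideal (FixedRing θ)) :=
    ⟨fun _ => Ideal.isPrime_bot, fun i j _ => hsub.elim _ _, iInf_const,
      fun _ => ⟨(AlgEquiv.quotientBot ℂ (FixedRing θ)).trans e.symm⟩, fun j => j.elim0⟩
  exact ⟨this.isReducedUnion fun i j hij => absurd (hsub.elim i j) hij,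
    this.hasGoodComponents⟩

theorem homogeneousComponent_linSubst (g : Mat) (d : ℕ) (f : Poly) :
    homogeneousComponent d (linSubst g f) = linSubst g (homogeneousComponent d f) := by
  conv_lhs => rw [← sum_homogeneousComponent f, map_sum, map_sum]
  have h1 : ∀ i, homogeneousComponent d (linSubst g (homogeneousComponent i f)) =
      if i = d then linSubst g (homogeneousComponent d f) else 0 := fun i => by
    have h2 := homogeneousComponent_of_mem (m := d)
      (linSubst_isHomogeneous g (homogeneousComponent_isHomogeneous i f))
    rw [h2]
    by_cases h : i = d
    · subst h; simp
    · simp [h, Ne.symm h]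
  rw [Finset.sum_congr rfl fun i _ => h1 i, Finset.sum_ite_eq']
  split_ifs with h
  · rfl
  · rw [homogeneousComponent_eq_zero _ _ (by simpa using h), map_zero]

theorem homogeneousComponent_mem_invariants {f : Poly} (hf : f ∈ invariants Γ) (d : ℕ) :
    homogeneousComponent d f ∈ invariants Γ := fun g hg => by
  rw [← homogeneousComponent_linSubst, hf g hg]

theorem invariants_homogeneous_induction {p : invariants Γ → Prop}
    (hom : ∀ (d : ℕ) (f : invariants Γ), (f : Poly).IsHomogeneous d → p f)
    (add : ∀ f g, p f → p g → p (f + g)) (f : invariants Γ) : p f := by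
  have hsum : ∀ n, p (∑ i ∈ Finset.range n,
      (⟨homogeneousComponent i f, homogeneousComponent_mem_invariants f.2 i⟩ : invariants Γ)) := by
    intro n
    induction n with
    | zero => exact hom 0 0 (isHomogeneous_zero _ _ _)
    | succ n ih =>
      rw [Finset.sum_range_succ]
      exact add _ _ ih (hom n _ (homogeneousComponent_isHomogeneous _ _))
  have := hsum ((f : Poly).totalDegree + 1)
  have heq : f = ∑ i ∈ Finset.range ((f : Poly).totalDegree + 1),
      (⟨homogeneousComponent i f, homogeneousComponent_mem_invariants f.2 i⟩ : invariants Γ) := by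
    apply Subtype.ext
    conv_lhs => rw [← sum_homogeneousComponent (f : Poly)]
    simp
  rw [heq]
  exact this

theorem mem_originIdeal : f ∈ originIdeal Γ ↔ constantCoeff (f : Poly) = 0 := by
  rw [originIdeal, RingHom.mem_ker]
  have : (aeval (fun _ => (0 : ℂ)) : Poly →ₐ[ℂ] ℂ) f = constantCoeff (f : Poly) :=
    aeval_zero' _
  rw [← this]
  rfl

theorem mem_originIdeal_of {d : ℕ} (hf : (f : Poly).IsHomogeneous d) (hd : d ≠ 0 := by omega) :
    f ∈ originIdeal Γ := by
  rw [mem_originIdeal, constantCoeff_eq]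
  exact hf.coeff_eq_zero (by simpa using hd.symm)

theorem IsGraded.sub_mem_originIdeal (h : IsGraded θ) (f : invariants Γ) :
    θ f - f ∈ originIdeal Γ := by
  induction f using invariants_homogeneous_induction with
  | hom d f hf =>
    rcases eq_or_ne d 0 with rfl | hd
    · have h1 : f = algebraMap ℂ _ (coeff 0 (f : Poly)) := by
        apply Subtype.ext
        exact (totalDegree_eq_zero_iff_eq_C.mp (Nat.le_zero.mp hf.totalDegree_le))
      rw [h1, AlgEquiv.commutes, sub_self]
      exact Ideal.zero_mem _
    · exact Ideal.sub_mem _ (mem_originIdeal_of (h d f hf) hd)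
        (mem_originIdeal_of hf hd)
  | add f g hf hg =>
    rw [map_add, add_sub_add_comm]
    exact Ideal.add_mem _ hf hg

theorem IsGraded.fixedIdeal_le (h : IsGraded θ) : fixedIdeal θ ≤ originIdeal Γ := by
  rw [fixedIdeal, Ideal.span_le]
  rintro _ ⟨f, rfl⟩
  exact h.sub_mem_originIdeal f

theorem sub_C_constantCoeff_mem {I : Ideal Poly} (h0 : X 0 ∈ I) (h1 : X 1 ∈ I) (p : Poly) :
    p - C (constantCoeff p) ∈ I := by
  induction p using MvPolynomial.induction_on with
  | C c => simp
  | add p q hp hq =>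
    rw [map_add, map_add, add_sub_add_comm]
    exact I.add_mem hp hq
  | mul_X p j _ =>
    have : X j ∈ I := by
      fin_cases j
      · exact h0
      · exact h1
    simpa using I.mul_mem_left p this

theorem comap_restrict_eq_originIdeal (hθ : IsGraded θ) {a b : invariants Γ}
    (ha : a ∈ originIdeal Γ) (hb : b ∈ originIdeal Γ) (ψ : Poly →ₐ[ℂ] FixedRing θ)
    (hψ : Function.Surjective ψ) (hψa : ψ (X 0) = restrict θ a) (hψb : ψ (X 1) = restrict θ b)
    {Q : Ideal (FixedRing θ)} (hQ : Q.IsPrime) : ψ (X 0) ∈ Q ∧ ψ (X 1) ∈ Q ↔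
    Q.comap (restrict θ) = originIdeal Γ := by
  have hker : ∀ f ∈ fixedIdeal θ,
      ((aeval fun _ => (0 : ℂ)).comp (invariants Γ).val : invariants Γ →ₐ[ℂ] ℂ) f = 0 :=
    fun f hf => hθ.fixedIdeal_le hf
  let aug : FixedRing θ →ₐ[ℂ] ℂ := Ideal.Quotient.liftₐ _ _ hker
  have haug : ∀ f, aug (restrict θ f) = 0 ↔ f ∈ originIdeal Γ := fun f => Iff.rfl
  have hcomp : ∀ p : Poly, aug (ψ p) = constantCoeff p := fun p => by
    have h1 : aug.comp ψ = aeval (fun _ => (0 : ℂ)) := by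
      apply algHom_ext
      intro i
      rw [aeval_X, AlgHom.comp_apply]
      fin_cases i
      · exact hψa ▸ (haug a).mpr ha
      · exact hψb ▸ (haug b).mpr hb
    rw [← AlgHom.comp_apply, h1]
    exact aeval_zero' _
  constructor
  · rintro ⟨h0, h1⟩
    have hmem : ∀ p : Poly, ψ p - algebraMap ℂ _ (constantCoeff p) ∈ Q := fun p => by
      have := sub_C_constantCoeff_mem (I := Q.comap ψ) h0 h1 p
      rwa [Ideal.mem_comap, map_sub, algHom_C] at this
    ext r
    obtain ⟨p, hp⟩ := hψ (restrict θ r)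
    rw [Ideal.mem_comap, ← haug, ← hp, hcomp]
    constructor
    · intro h
      by_contra hne
      have h2 := Q.sub_mem h (hmem p)
      rw [sub_sub_cancel] at h2
      exact hQ.ne_top (Q.eq_top_of_isUnit_mem h2 ((IsUnit.mk0 _ hne).map _))
    · intro h
      have := hmem p
      rwa [h, map_zero, sub_zero] at this
  · intro h
    rw [hψa, hψb, ← Ideal.mem_comap, ← Ideal.mem_comap (x := b), h]
    exact ⟨ha, hb⟩

theorem IsPlaneCurve.isReducedUnion (hθ : IsGraded θ) {a b : invariants Γ} (ha : a ∈ originIdeal Γ)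
    (hb : b ∈ originIdeal Γ) {F : Poly → Poly → Poly} (h : IsPlaneCurve θ a b F) {k l : ℕ}
    (G : Fin k ⊕ Fin l → Poly) (hF : F (X 0) (X 1) = ∏ i, G i) (hG0 : ∀ i, constantCoeff (G i) = 0)
    (hline : ∀ i, Prime (G (.inl i)) ∧ IsAffineLine (Poly ⧸ Ideal.span {G (.inl i)}))
    (hcusp : ∀ i, Prime (G (.inr i)) ∧ IsCuspCurve (Poly ⧸ Ideal.span {G (.inr i)}))
    (hmeet : ∀ i j, i ≠ j → ∀ Q : Ideal Poly, Q.IsPrime → G i ∈ Q → G j ∈ Q → X 0 ∈ Q ∧ X 1 ∈ Q) :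
    IsReducedUnion θ k l ∧ HasGoodComponents (FixedRing θ) := by
  obtain ⟨e, hea, heb⟩ := h
  have hprime : ∀ i, Prime (G i) := by
    rintro (i | j)
    · exact (hline i).1
    · exact (hcusp j).1
  let ψ : Poly →ₐ[ℂ] FixedRing θ :=
    e.toAlgHom.comp (Ideal.Quotient.mkₐ ℂ (Ideal.span {F (X 0) (X 1)}))
  have hψ : Function.Surjective ψ := e.surjective.comp Ideal.Quotient.mk_surjective
  have hψ0 : ∀ p, ψ p = 0 ↔ F (X 0) (X 1) ∣ p := fun p => by
    rw [← Ideal.mem_span_singleton, ← Ideal.Quotient.eq_zero_iff_mem]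
    exact map_eq_zero_iff e e.injective
  have hle : ∀ i, Ideal.span {F (X 0) (X 1)} ≤ Ideal.span {G i} := fun i => by
    rw [Ideal.span_singleton_le_span_singleton, hF]
    exact Finset.dvd_prod_of_mem _ (Finset.mem_univ i)
  let φ : ∀ i, FixedRing θ →ₐ[ℂ] Poly ⧸ Ideal.span {G i} := fun i =>
    (Ideal.Quotient.factorₐ ℂ (hle i)).comp e.symm.toAlgHom
  have hφψ : ∀ i p, φ i (ψ p) = Ideal.Quotient.mk _ p := fun i p => by
    change (Ideal.Quotient.factorₐ ℂ (hle i)) (e.symm (e (Ideal.Quotient.mk _ p))) = _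
    rw [AlgEquiv.symm_apply_apply]
    rfl
  have hφs : ∀ i, Function.Surjective (φ i) := fun i x => by
    obtain ⟨p, rfl⟩ := Ideal.Quotient.mk_surjective x
    exact ⟨ψ p, hφψ i p⟩
  let P : Fin k ⊕ Fin l → Ideal (FixedRing θ) := fun i => RingHom.ker (φ i)
  have hP : ∀ i p, ψ p ∈ P i ↔ G i ∣ p := fun i p => by
    rw [← Ideal.mem_span_singleton, ← Ideal.Quotient.eq_zero_iff_mem (I := Ideal.span {G i}), ← hφψ]
    rfl
  have hcop : ∀ i j, G i ∣ G j → i = j := fun i j hij => by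
    by_contra hne
    have h1 := hmeet i j hne (Ideal.span {G i})
      ((Ideal.span_singleton_prime (hprime i).ne_zero).mpr (hprime i))
      (Ideal.mem_span_singleton_self _) (Ideal.mem_span_singleton.mpr hij)
    rw [Ideal.mem_span_singleton, Ideal.mem_span_singleton] at h1
    have hX : ∀ n : Fin 2, Irreducible (X n : Poly) := fun n => by
      obtain ⟨m, hm⟩ : ∃ m, n ≠ m := exists_ne n |>.imp fun _ h => h.symm
      simpa using (graph_isLine hm 0 0).1.irreducible
    have h2 : (X 0 : Poly) ∣ X 1 :=
      ((hprime i).irreducible.dvd_irreducible_iff_associated (hX 0)).mp h1.1 |>.symm.dvd.trans h1.2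
    rw [X_dvd_X] at h2
    simp at h2
  have hdec : IsCurveDecomp P := by
    refine ⟨?_, ?_, ?_, ?_, ?_⟩
    · intro i
      have : IsDomain (Poly ⧸ Ideal.span {G i}) := by
        rw [Ideal.Quotient.isDomain_iff_prime, Ideal.span_singleton_prime (hprime i).ne_zero]
        exact hprime i
      exact RingHom.ker_isPrime _
    · intro i j hij
      refine (hcop j i ?_).symm
      rw [← hP]
      exact hij ((hP i _).mpr dvd_rfl)
    · rw [eq_bot_iff]
      intro x hx
      obtain ⟨p, rfl⟩ := hψ x
      rw [Ideal.mem_iInf] at hx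
      rw [Ideal.mem_bot, hψ0, hF]
      refine Finset.prod_dvd_of_isRelPrime ?_ fun i _ => (hP i p).mp (hx i)
      intro i _ j _ hij
      exact ((hprime i).irreducible.isRelPrime_iff_not_dvd).mpr fun hd => hij (hcop i j hd)
    · exact fun i => (hline i).2.congr (Ideal.quotientKerAlgEquivOfSurjective (hφs _)).symm
    · exact fun i => (hcusp i).2.congr (Ideal.quotientKerAlgEquivOfSurjective (hφs _)).symm
  refine ⟨hdec.isReducedUnion ?_, hdec.hasGoodComponents⟩
  intro i j hij Q hQ
  rw [← comap_restrict_eq_originIdeal hθ ha hb ψ hψ hea heb hQ]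
  constructor
  · rintro ⟨hi, hj⟩
    exact hmeet i j hij (Q.comap ψ) (Ideal.comap_isPrime _ _)
      (hi ((hP i _).mpr dvd_rfl)) (hj ((hP j _).mpr dvd_rfl))
  · rintro ⟨h0, h1⟩
    have hmem : ∀ p : Poly, constantCoeff p = 0 → ψ p ∈ Q := fun p hp => by
      have : p ∈ Q.comap ψ := by
        have h2 := sub_C_constantCoeff_mem (I := Q.comap ψ) h0 h1 p
        rwa [hp, C_0, sub_zero] at h2
      exact this
    have hPQ : ∀ i, P i ≤ Q := fun i x hx => by
      obtain ⟨p, rfl⟩ := hψ x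
      obtain ⟨c, rfl⟩ := (hP i p).mp hx
      exact hmem _ (by rw [map_mul, hG0, zero_mul])
    exact ⟨hPQ i, hPQ j⟩

theorem nonempty_fixedRing_equiv {Γ' : Subgroup SL2} {θ : Aut Γ}
    {θ' : invariants Γ' ≃ₐ[ℂ] invariants Γ'} (e : invariants Γ ≃ₐ[ℂ] invariants Γ')
    (h : ∀ f, e (θ f) = θ' (e f)) : Nonempty (FixedRing θ ≃ₐ[ℂ] FixedRing θ') := by
  refine ⟨Ideal.quotientEquivAlg _ _ e ?_⟩
  rw [fixedIdeal, fixedIdeal, Ideal.map_span, ← Set.range_comp]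
  congr 1
  ext f
  constructor
  · rintro ⟨f, rfl⟩
    exact ⟨e.symm f, by simp [h]⟩
  · rintro ⟨f, rfl⟩
    exact ⟨e f, by simp [h]⟩

theorem AreConjugate.hasGoodComponents (h : AreConjugate θ η) (hη : HasGoodComponents (FixedRing η))
    : HasGoodComponents (FixedRing θ) := by
  obtain ⟨σ, -, hσ⟩ := h
  obtain ⟨e⟩ := nonempty_fixedRing_equiv σ hσ
  exact hη.congr e.symm

theorem coe_aeval (x y : invariants Γ) (p : Poly) :
    (aeval ![x, y] p : Poly) = aeval ![(x : Poly), (y : Poly)] p := by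
  have : (invariants Γ).val.comp (aeval ![x, y]) = aeval ![(x : Poly), (y : Poly)] := by
    apply algHom_ext
    intro i
    fin_cases i <;> simp
  exact DFunLike.congr_fun this p

theorem isPlaneCurve_of {a b : invariants Γ} {F : Poly → Poly → Poly}
    (hsurj : ∀ f, ∃ p : Poly, f - aeval ![a, b] p ∈ fixedIdeal θ)
    (hker : ∀ p : Poly, aeval ![a, b] p ∈ fixedIdeal θ ↔ F (X 0) (X 1) ∣ p) :
    IsPlaneCurve θ a b F := by
  let ψ : Poly →ₐ[ℂ] FixedRing θ := (restrict θ).comp (aeval ![a, b])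
  have hψ : Function.Surjective ψ := fun f => by
    obtain ⟨f, rfl⟩ := Ideal.Quotient.mk_surjective f
    obtain ⟨p, hp⟩ := hsurj f
    exact ⟨p, ((Ideal.Quotient.mk_eq_mk_iff_sub_mem _ _).mpr hp).symm⟩
  have hk : Ideal.span {F (X 0) (X 1)} = RingHom.ker ψ := by
    ext p
    rw [Ideal.mem_span_singleton, ← hker, ← Ideal.Quotient.eq_zero_iff_mem]
    rfl
  refine ⟨(Ideal.quotientEquivAlgOfEq ℂ hk).trans (Ideal.quotientKerAlgEquivOfSurjective hψ),
    ?_, ?_⟩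
  · change (restrict θ) (aeval ![a, b] (X 0)) = _
    simp
  · change (restrict θ) (aeval ![a, b] (X 1)) = _
    simp

theorem span_smul_eq {c : ℂ} (hc : c ≠ 0) (f : invariants Γ) :
    Ideal.span {c • f} = Ideal.span {f} := by
  rw [smul_def]
  exact Ideal.span_singleton_mul_left_unit ((IsUnit.mk0 c hc).map (algebraMap ℂ _)) f

theorem span_neg_sub_self (f : invariants Γ) : Ideal.span {-f - f} = Ideal.span {f} := by
  rw [show -f - f = (-2 : ℂ) • f by module, span_smul_eq (by norm_num)]

theorem IsPlaneCurve.change {a b b' : invariants Γ} {F F' : Poly → Poly → Poly}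
    (h : IsPlaneCurve θ a b F) {α : ℂ} (hα : α ≠ 0) (q : Polynomial ℂ)
    (hb : b' - (α • b + Polynomial.aeval a q) ∈ fixedIdeal θ) {c : ℂ} (hc : c ≠ 0)
    (hF : aeval ![X 0, C α * X 1 + Polynomial.aeval (X 0) q] (F' (X 0) (X 1)) =
      C c * F (X 0) (X 1)) : IsPlaneCurve θ a b' F' := by
  obtain ⟨e, hea, heb⟩ := h
  have hq : ∀ f : Poly →ₐ[ℂ] Poly, f (X 0) = X 0 →
      f (Polynomial.aeval (X 0) q) = Polynomial.aeval (X 0) q := fun f hf => by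
    rw [← Polynomial.aeval_algHom_apply, hf]
  let ρ : Poly ≃ₐ[ℂ] Poly := AlgEquiv.ofAlgHom
    (aeval ![X 0, C α * X 1 + Polynomial.aeval (X 0) q])
    (aeval ![X 0, C α⁻¹ * (X 1 - Polynomial.aeval (X 0) q)])
    (by
      apply algHom_ext
      intro i
      fin_cases i
      · simp
      · simp only [AlgHom.comp_apply, Fin.mk_one, aeval_X, cons_val_one, cons_val_zero,
          map_mul, map_sub,
          algHom_C, algebraMap_eq, AlgHom.id_apply]
        rw [hq _ (by simp), add_sub_cancel_right, ← mul_assoc, ← C_mul, inv_mul_cancel₀ hα]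
        simp)
    (by
      apply algHom_ext
      intro i
      fin_cases i
      · simp
      · simp only [AlgHom.comp_apply, Fin.mk_one, aeval_X, cons_val_one, cons_val_zero,
          map_mul, map_add,
          algHom_C, algebraMap_eq, AlgHom.id_apply]
        rw [hq _ (by simp), ← mul_assoc, ← C_mul, mul_inv_cancel₀ hα]
        simp)
  have hmap : Ideal.span {F (X 0) (X 1)} =
      (Ideal.span {F' (X 0) (X 1)}).map (ρ : Poly →+* Poly) := by
    rw [Ideal.map_span, Set.image_singleton]
    have : (ρ : Poly →+* Poly) (F' (X 0) (X 1)) = C c * F (X 0) (X 1) := hF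
    rw [this]
    exact (Ideal.span_singleton_mul_left_unit ((IsUnit.mk0 c hc).map C) _).symm
  refine ⟨(Ideal.quotientEquivAlg _ _ ρ hmap).trans e, ?_, ?_⟩
  · rw [← hea]
    change e (Ideal.Quotient.mk _ (aeval ![X 0, C α * X 1 + Polynomial.aeval (X 0) q] (X 0))) = _
    simp
  · have h1 : restrict θ b' = α • restrict θ b + Polynomial.aeval (restrict θ a) q := by
      have h2 : restrict θ b' = restrict θ (α • b + Polynomial.aeval a q) :=
        (Ideal.Quotient.mk_eq_mk_iff_sub_mem _ _).mpr hb
      rw [h2, map_add, map_smul, Polynomial.aeval_algHom_apply]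
    rw [h1, ← hea, ← heb]
    change e (Ideal.Quotient.mk _ (aeval ![X 0, C α * X 1 + Polynomial.aeval (X 0) q] (X 1))) = _
    rw [aeval_X, cons_val_one, cons_val_zero, map_add, map_add, map_mul, map_mul, smul_def]
    congr 1
    · congr 1
      exact e.commutes α
    · have h3 := Polynomial.aeval_algHom_apply
        (e.toAlgHom.comp (Ideal.Quotient.mkₐ ℂ (Ideal.span {F (X 0) (X 1)}))) (X 0) q
      exact h3.symm

theorem IsPlaneCurve.rescale {a b : invariants Γ} {F F' : Poly → Poly → Poly}
    (h : IsPlaneCurve θ a b F) {α : ℂ} (hα : α ≠ 0) {c : ℂ} (hc : c ≠ 0)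
    (hF : aeval ![X 0, C α * X 1] (F' (X 0) (X 1)) = C c * F (X 0) (X 1)) :
    IsPlaneCurve θ a (α • b) F' :=
  h.change hα 0 (by simp) hc (by simpa using hF)

/-- `ℂ[X]` is the double cover `w ^ 2 = Δ(x, y)` of the `(x, y)`-plane. -/
structure IsDoubleCover (x y w : invariants Γ) (Δ : Poly) : Prop where
  gen : Generate x y w
  sq : w ^ 2 = aeval ![x, y] Δ
  indep : ∀ p q : Poly, aeval ![x, y] p + w * aeval ![x, y] q = 0 → p = 0 ∧ q = 0

theorem aeval_injective_of_bracket_ne_zero (h : bracket x y ≠ 0) (p : Poly)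
    (hp : aeval ![x, y] p = 0) : p = 0 := by
  refine aeval_eq_zero_of_polyBracket_ne_zero (x := x) (y := y) (fun h0 => h (Subtype.ext h0)) p ?_
  rw [← coe_aeval, hp]
  rfl

theorem isDoubleCover_of_flip {w : invariants Γ} {Δ : Poly} (gen : Generate x y w)
    (sq : w ^ 2 = aeval ![x, y] Δ) (hxy : bracket x y ≠ 0) (hw : w ≠ 0) (η : Aut Γ) (hx : η x = x)
    (hy : η y = y) (hηw : η w = -w) : IsDoubleCover x y w Δ := by
  refine ⟨gen, sq, fun p q h => ?_⟩
  have hη : ∀ p : Poly, η (aeval ![x, y] p) = aeval ![x, y] p := fun p => by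
    have : (η : invariants Γ →ₐ[ℂ] invariants Γ).comp (aeval ![x, y]) = aeval ![x, y] := by
      apply algHom_ext
      intro i
      fin_cases i <;> simp [hx, hy]
    exact DFunLike.congr_fun this p
  have h1 := congrArg η h
  rw [map_add, map_mul, hη, hη, hηw, map_zero] at h1
  have h2 : aeval ![x, y] p = 0 := by
    have : (2 : ℂ) • aeval ![x, y] p = 0 := by
      rw [two_smul]
      linear_combination h + h1
    exact (smul_eq_zero.mp this).resolve_left two_ne_zero
  rw [h2, zero_add] at h
  exact ⟨aeval_injective_of_bracket_ne_zero hxy p h2,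
    aeval_injective_of_bracket_ne_zero hxy q ((mul_eq_zero.mp h).resolve_left hw)⟩

theorem isDoubleCover_of_odd {w : invariants Γ} {Δ : Poly} (gen : Generate x y w)
    (sq : w ^ 2 = aeval ![x, y] Δ) (hxy : bracket x y ≠ 0) (hΔ : Odd (degreeOf 1 Δ)) :
    IsDoubleCover x y w Δ := by
  refine ⟨gen, sq, fun p q h => ?_⟩
  have h1 : p * p - Δ * (q * q) = 0 := by
    apply aeval_injective_of_bracket_ne_zero hxy
    rw [map_sub, map_mul, map_mul, map_mul, ← sq]
    linear_combination (aeval ![x, y] p - w * aeval ![x, y] q) * h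
  have hΔ0 : Δ ≠ 0 := by
    rintro rfl
    simp at hΔ
  have hq : q = 0 := by
    by_contra hq
    have hp : p ≠ 0 := by
      rintro rfl
      simp [hΔ0, hq] at h1
    have h2 := congrArg (degreeOf 1) (sub_eq_zero.mp h1)
    rw [degreeOf_mul_eq hp hp, degreeOf_mul_eq hΔ0 (mul_ne_zero hq hq), degreeOf_mul_eq hq hq] at h2
    obtain ⟨m, hm⟩ := hΔ
    omega
  subst hq
  simpa using h1

namespace IsDoubleCover

variable {w : invariants Γ} {Δ : Poly}

theorem exists_rep (h : IsDoubleCover x y w Δ) (f : invariants Γ) : ∃ p q : Poly,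
    f = aeval ![x, y] p + w * aeval ![x, y] q := by
  let S : Subalgebra ℂ (invariants Γ) :=
    { carrier := {f | ∃ p q : Poly, f = aeval ![x, y] p + w * aeval ![x, y] q}
      mul_mem' := by
        rintro _ _ ⟨p, q, rfl⟩ ⟨r, s, rfl⟩
        refine ⟨p * r + Δ * (q * s), p * s + q * r, ?_⟩
        simp only [map_add, map_mul, ← h.sq]
        ring
      add_mem' := by
        rintro _ _ ⟨p, q, rfl⟩ ⟨r, s, rfl⟩
        refine ⟨p + r, q + s, ?_⟩
        simp only [map_add]
        ring
      algebraMap_mem' := fun r => ⟨C r, 0, by simp⟩ }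
  exact h.gen.induction S ⟨X 0, 0, by simp⟩ ⟨X 1, 0, by simp⟩ ⟨0, 1, by simp⟩ f

theorem isPlaneCurve_branch (h : IsDoubleCover x y w Δ) (hx : θ x = x) (hy : θ y = y)
    (hw : θ w = -w) {F : Poly → Poly → Poly} {c : ℂ} (hc : c ≠ 0) (hF : F (X 0) (X 1) = C c * Δ) :
    fixedIdeal θ = Ideal.span {w} ∧ IsPlaneCurve θ x y F := by
  have hJ : fixedIdeal θ = Ideal.span {w} := by
    rw [h.gen.fixedIdeal_eq, hx, hy, hw, sub_self, sub_self, Ideal.span_insert_zero, Ideal.span_insert_zero,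
      span_neg_sub_self]
  refine ⟨hJ, isPlaneCurve_of ?_ ?_⟩
  · intro f
    obtain ⟨p, q, rfl⟩ := h.exists_rep f
    refine ⟨p, ?_⟩
    rw [hJ, add_sub_cancel_left]
    exact Ideal.mul_mem_right _ _ (Ideal.mem_span_singleton_self w)
  · intro p
    have hunit : IsUnit (C c : Poly) := (IsUnit.mk0 c hc).map C
    rw [hJ, hF, hunit.mul_left_dvd, Ideal.mem_span_singleton]
    constructor
    · rintro ⟨f, hf⟩
      obtain ⟨r, s, rfl⟩ := h.exists_rep f
      have h1 : aeval ![x, y] (p - Δ * s) + w * aeval ![x, y] (-r) = 0 := by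
        rw [map_sub, map_mul, map_neg, ← h.sq, hf]
        ring
      exact ⟨s, sub_eq_zero.mp (h.indep _ _ h1).1⟩
    · rintro ⟨s, rfl⟩
      rw [map_mul, ← h.sq]
      exact ⟨w * aeval ![x, y] s, by ring⟩

theorem exists_quadratic_normalForm (D p : Poly)
    (hD : ∃ d : Polynomial ℂ, D = Polynomial.aeval (X 0) d) : ∃ p₀ p₁ : Polynomial ℂ,
    X 1 ^ 2 - D ∣ p - (Polynomial.aeval (X 0) p₀ + X 1 * Polynomial.aeval (X 0) p₁) := by
  obtain ⟨d, rfl⟩ := hD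
  induction p using MvPolynomial.induction_on with
  | C a => exact ⟨Polynomial.C a, 0, by simp [algebraMap_eq]⟩
  | add p q hp hq =>
    obtain ⟨p₀, p₁, hp⟩ := hp
    obtain ⟨q₀, q₁, hq⟩ := hq
    refine ⟨p₀ + q₀, p₁ + q₁, ?_⟩
    convert dvd_add hp hq using 1
    simp only [map_add]
    ring
  | mul_X p j hp =>
    obtain ⟨p₀, p₁, b, hb⟩ := hp
    fin_cases j
    · refine ⟨p₀ * Polynomial.X, p₁ * Polynomial.X, b * X 0, ?_⟩
      simp only [map_mul, Polynomial.aeval_X, Fin.zero_eta]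
      linear_combination X 0 * hb
    · refine ⟨d * p₁, p₀, b * X 1 + Polynomial.aeval (X 0) p₁, ?_⟩
      simp only [map_mul, Fin.mk_one]
      linear_combination X 1 * hb

theorem isPlaneCurve_flip (h : IsDoubleCover x y w Δ) (hx : θ x = x) (hy : θ y = -y) (hw : θ w = w)
    {d : Polynomial ℂ} (hd : aeval ![X 0, 0] Δ = Polynomial.aeval (X 0 : Poly) d)
    {F : Poly → Poly → Poly} {c : ℂ} (hc : c ≠ 0)
    (hF : F (X 0) (X 1) = C c * (X 1 ^ 2 - Polynomial.aeval (X 0 : Poly) d)) :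
    fixedIdeal θ = Ideal.span {y} ∧ IsPlaneCurve θ x w F := by
  have hJ : fixedIdeal θ = Ideal.span {y} := by
    rw [h.gen.fixedIdeal_eq, hx, hy, hw, sub_self, sub_self, Ideal.span_insert_zero, Set.pair_comm, Ideal.span_insert_zero,
      span_neg_sub_self]
  have hmod : ∀ p : Poly, ∃ r : Poly, p = aeval ![X 0, 0] p + X 1 * r := fun p => by
    induction p using MvPolynomial.induction_on with
    | C a => exact ⟨0, by simp [algebraMap_eq]⟩
    | add p q hp hq =>
      obtain ⟨r, hr⟩ := hp
      obtain ⟨s, hs⟩ := hq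
      refine ⟨r + s, ?_⟩
      rw [map_add]
      linear_combination hr + hs
    | mul_X p j hp =>
      obtain ⟨r, hr⟩ := hp
      fin_cases j
      · refine ⟨r * X 0, ?_⟩
        simp only [Fin.zero_eta, map_mul, aeval_X, cons_val_zero]
        linear_combination X 0 * hr
      · refine ⟨p, ?_⟩
        simp only [Fin.mk_one, map_mul, aeval_X, cons_val_one, cons_val_zero]
        ring
  have hx0 : ∀ p : Polynomial ℂ, ∀ a b : invariants Γ,
      aeval ![a, b] (Polynomial.aeval (X 0 : Poly) p) = Polynomial.aeval a p := fun p a b => by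
    rw [← Polynomial.aeval_algHom_apply]
    simp
  have hsq : ∃ g, w ^ 2 - Polynomial.aeval x d = y * g := by
    obtain ⟨r, hr⟩ := hmod Δ
    refine ⟨aeval ![x, y] r, ?_⟩
    rw [h.sq]
    conv_lhs => rw [hr, hd]
    rw [map_add, map_mul, hx0]
    simp
  refine ⟨hJ, isPlaneCurve_of ?_ ?_⟩
  · intro f
    obtain ⟨p, q, rfl⟩ := h.exists_rep f
    have hp : ∀ p : Poly, ∃ g, aeval ![x, y] p =
        aeval ![x, w] (aeval ![(X 0 : Poly), 0] p) + y * g := fun p => by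
      obtain ⟨r, hr⟩ := hmod p
      refine ⟨aeval ![x, y] r, ?_⟩
      conv_lhs => rw [hr]
      rw [map_add, map_mul, aeval_X, cons_val_one, cons_val_zero]
      congr 1
      have : (aeval ![x, y]).comp (aeval ![(X 0 : Poly), 0]) =
          (aeval ![x, w]).comp (aeval ![(X 0 : Poly), 0]) := by
        apply algHom_ext
        intro i
        fin_cases i <;> simp
      exact DFunLike.congr_fun this p
    obtain ⟨g, hg⟩ := hp p
    obtain ⟨g', hg'⟩ := hp q
    refine ⟨aeval ![(X 0 : Poly), 0] p + X 1 * aeval ![X 0, 0] q, ?_⟩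
    rw [hJ, Ideal.mem_span_singleton]
    refine ⟨g + w * g', ?_⟩
    rw [hg, hg', map_add, map_mul, aeval_X, cons_val_one, cons_val_zero]
    ring
  · intro p
    have hunit : IsUnit (C c : Poly) := (IsUnit.mk0 c hc).map C
    rw [hJ, hF, hunit.mul_left_dvd, Ideal.mem_span_singleton]
    obtain ⟨g, hg⟩ := hsq
    have hE : ∀ b : Poly, y ∣ aeval ![x, w] ((X 1 ^ 2 - Polynomial.aeval (X 0 : Poly) d) * b) := by
      intro b
      rw [map_mul, map_sub, hx0]
      simp only [map_pow, aeval_X, cons_val_one, cons_val_zero]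
      rw [hg, mul_assoc]
      exact Dvd.intro _ rfl
    constructor
    · intro hp
      obtain ⟨p₀, p₁, b, hb⟩ := exists_quadratic_normalForm _ p ⟨d, rfl⟩
      have hp' : p = Polynomial.aeval (X 0) p₀ + X 1 * Polynomial.aeval (X 0) p₁ +
        (X 1 ^ 2 - Polynomial.aeval (X 0) d) * b := by linear_combination hb
      have h1 : y ∣ Polynomial.aeval x p₀ + w * Polynomial.aeval x p₁ := by
        have h2 := (dvd_sub hp (hE b))
        rw [hp', map_add, add_sub_cancel_right, map_add, map_mul, hx0, hx0] at h2
        simpa using h2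
      obtain ⟨f, hf⟩ := h1
      obtain ⟨r, s, rfl⟩ := h.exists_rep f
      have h3 := h.indep (Polynomial.aeval (X 0) p₀ - X 1 * r)
        (Polynomial.aeval (X 0) p₁ - X 1 * s) (by
          rw [map_sub, map_sub, hx0, hx0, map_mul, map_mul]
          simp only [aeval_X, cons_val_one, cons_val_zero]
          linear_combination hf)
      have h4 : ∀ (q : Polynomial ℂ) (r : Poly), Polynomial.aeval (X 0 : Poly) q - X 1 * r = 0 →
          Polynomial.aeval (X 0 : Poly) q = 0 := fun q r hqr => by
        have h5 := congrArg (aeval ![(X 0 : Poly), 0]) hqr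
        rw [map_sub, map_mul, ← Polynomial.aeval_algHom_apply] at h5
        simpa using h5
      rw [hp', h4 _ _ h3.1, h4 _ _ h3.2]
      exact ⟨b, by ring⟩
    · rintro ⟨b, rfl⟩
      exact hE b

end IsDoubleCover

theorem IsPlaneCurve.cusp (hθ : IsGraded θ) {a b : invariants Γ} (ha : a ∈ originIdeal Γ)
    (hb : b ∈ originIdeal Γ) {F : Poly → Poly → Poly} (h : IsPlaneCurve θ a b F) {p q : ℕ} {α β : ℂ}
    (hF : F (X 0) (X 1) = C α * X 0 ^ p + C β * X 1 ^ q) (hp : 2 ≤ p) (hq : 2 ≤ q)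
    (hpq : p.Coprime q) (hα : α ≠ 0) (hβ : β ≠ 0) : IsReducedUnion θ 0 1 ∧
    HasGoodComponents (FixedRing θ) := by
  have hsub : Subsingleton (Fin 0 ⊕ Fin 1) := (Equiv.emptySum (Fin 0) (Fin 1)).subsingleton
  refine h.isReducedUnion hθ ha hb (k := 0) (l := 1) (fun _ => C α * X 0 ^ p + C β * X 1 ^ q)
    ?_ ?_ (fun i => i.elim0) (fun _ => cusp_isCusp hp hq hpq hα hβ)
    fun i j hij => absurd (hsub.elim i j) hij
  · rw [hF]
    simp
  · intro _
    simp [show p ≠ 0 by omega, show q ≠ 0 by omega]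

theorem IsPlaneCurve.lines (hθ : IsGraded θ) {a b : invariants Γ} (ha : a ∈ originIdeal Γ)
    (hb : b ∈ originIdeal Γ) {F : Poly → Poly → Poly} (h : IsPlaneCurve θ a b F) {k : ℕ}
    (G : Fin k → Poly) (hF : F (X 0) (X 1) = ∏ i, G i) (hG0 : ∀ i, constantCoeff (G i) = 0)
    (hline : ∀ i, Prime (G i) ∧ IsAffineLine (Poly ⧸ Ideal.span {G i}))
    (hmeet : ∀ i j, i < j → ∀ Q : Ideal Poly, Q.IsPrime → G i ∈ Q → G j ∈ Q → X 0 ∈ Q ∧ X 1 ∈ Q) :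
    IsReducedUnion θ k 0 ∧ HasGoodComponents (FixedRing θ) := by
  refine h.isReducedUnion hθ ha hb (k := k) (l := 0) (Sum.elim G fun j => j.elim0) ?_ ?_ hline
    (fun j => j.elim0) ?_
  · rw [hF]
    simp
  · rintro (i | j)
    · exact hG0 i
    · exact j.elim0
  · rintro (i | i) (j | j) hij Q hQ hi hj
    · rcases lt_or_gt_of_ne (fun hne => hij (congrArg Sum.inl hne) : i ≠ j) with hlt | hlt
      · exact hmeet i j hlt Q hQ hi hj
      · exact hmeet j i hlt Q hQ hj hi
    · exact j.elim0
    · exact i.elim0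
    · exact i.elim0

theorem X_isLine (i : Fin 2) : Prime (X i : Poly) ∧
    IsAffineLine (Poly ⧸ Ideal.span {(X i : Poly)}) := by
  obtain ⟨m, hm⟩ : ∃ m, i ≠ m := exists_ne i |>.imp fun _ h => h.symm
  have h := graph_isLine hm 0 0
  rwa [C_0, zero_mul, sub_zero] at h

theorem IsPlaneCurve.line_cusp (hθ : IsGraded θ) {a b : invariants Γ} (ha : a ∈ originIdeal Γ)
    (hb : b ∈ originIdeal Γ) {F : Poly → Poly → Poly} (h : IsPlaneCurve θ a b F) (i : Fin 2)
    {p q : ℕ} {α β : ℂ} (hF : F (X 0) (X 1) = X i * (C α * X 0 ^ p + C β * X 1 ^ q)) (hp : 2 ≤ p)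
    (hq : 2 ≤ q) (hpq : p.Coprime q) (hα : α ≠ 0) (hβ : β ≠ 0) : IsReducedUnion θ 1 1 ∧
    HasGoodComponents (FixedRing θ) := by
  have key : ∀ Q : Ideal Poly, Q.IsPrime → X i ∈ Q → C α * X 0 ^ p + C β * X 1 ^ q ∈ Q →
      X 0 ∈ Q ∧ X 1 ∈ Q := fun Q hQ hi hj => by
    have hu : ∀ (γ : ℂ) (f : Poly), γ ≠ 0 → C γ * f ∈ Q → f ∈ Q := fun γ f hγ hf =>
      (Ideal.unit_mul_mem_iff_mem Q ((IsUnit.mk0 γ hγ).map C)).mp hf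
    fin_cases i
    · refine ⟨hi, hQ.mem_of_pow_mem q (hu β _ hβ ?_)⟩
      exact (Ideal.add_mem_iff_right Q
        (Q.mul_mem_left _ (Q.pow_mem_of_mem hi p (by omega)))).mp hj
    · refine ⟨hQ.mem_of_pow_mem p (hu α _ hα ?_), hi⟩
      exact (Ideal.add_mem_iff_left Q
        (Q.mul_mem_left _ (Q.pow_mem_of_mem hi q (by omega)))).mp hj
  refine h.isReducedUnion hθ ha hb (k := 1) (l := 1)
    (Sum.elim (fun _ => X i) fun _ => C α * X 0 ^ p + C β * X 1 ^ q) ?_ ?_ (fun _ => X_isLine i)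
    (fun _ => cusp_isCusp hp hq hpq hα hβ) ?_
  · rw [hF]
    simp
  · rintro (i | j)
    · simp
    · simp [show p ≠ 0 by omega, show q ≠ 0 by omega]
  · rintro (m | m) (n | n) hij Q hQ hi hj
    · exact absurd (congrArg Sum.inl (Subsingleton.elim m n)) hij
    · exact key Q hQ hi hj
    · exact key Q hQ hj hi
    · exact absurd (congrArg Sum.inr (Subsingleton.elim m n)) hij

theorem Generate.mem_of_isHomogeneous (hg : Generate x y z) {a b c : ℕ}
    (hx : (x : Poly).IsHomogeneous a) (hy : (y : Poly).IsHomogeneous b)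
    (hz : (z : Poly).IsHomogeneous c) {d : ℕ} (hf : (f : Poly).IsHomogeneous d)
    (T : Submodule ℂ (invariants Γ))
    (hT : ∀ i j k, a * i + b * j + c * k = d → x ^ i * y ^ j * z ^ k ∈ T) : f ∈ T := by
  let π : invariants Γ →ₗ[ℂ] invariants Γ :=
    LinearMap.restrict (p := Subalgebra.toSubmodule (invariants Γ))
      (q := Subalgebra.toSubmodule (invariants Γ)) (homogeneousComponent d)
      fun f hf => homogeneousComponent_mem_invariants hf d
  have hπ : ∀ f : invariants Γ, (π f : Poly) = homogeneousComponent d (f : Poly) := fun _ => rfl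
  have hmon : ∀ m ∈ Submonoid.closure {x, y, z}, ∃ i j k, m = x ^ i * y ^ j * z ^ k := by
    intro m hm
    induction hm using Submonoid.closure_induction with
    | mem m hm =>
      rcases hm with rfl | rfl | rfl
      · exact ⟨1, 0, 0, by simp⟩
      · exact ⟨0, 1, 0, by simp⟩
      · exact ⟨0, 0, 1, by simp⟩
    | one => exact ⟨0, 0, 0, by simp⟩
    | mul m n _ _ hm hn =>
      obtain ⟨i, j, k, rfl⟩ := hm
      obtain ⟨i', j', k', rfl⟩ := hn
      exact ⟨i + i', j + j', k + k', by ring⟩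
  have hall : ∀ g : invariants Γ, π g ∈ T := fun g => by
    have h1 : g ∈ Subalgebra.toSubmodule (adjoin ℂ {x, y, z}) := by
      rw [hg]
      trivial
    rw [Algebra.adjoin_eq_span] at h1
    induction h1 using Submodule.span_induction with
    | mem m hm =>
      obtain ⟨i, j, k, rfl⟩ := hmon m hm
      have h2 : ((x ^ i * y ^ j * z ^ k : invariants Γ) : Poly).IsHomogeneous
          (a * i + b * j + c * k) := ((hx.pow i).mul (hy.pow j)).mul (hz.pow k)
      have h3 := homogeneousComponent_of_mem (m := d) h2
      split_ifs at h3 with hd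
      · have : π (x ^ i * y ^ j * z ^ k) = x ^ i * y ^ j * z ^ k := Subtype.ext h3
        rw [this]
        exact hT i j k hd.symm
      · have : π (x ^ i * y ^ j * z ^ k) = 0 := Subtype.ext h3
        rw [this]
        exact T.zero_mem
    | zero => rw [map_zero]; exact T.zero_mem
    | add p q _ _ hp hq => rw [map_add]; exact T.add_mem hp hq
    | smul r p _ hp => rw [map_smul]; exact T.smul_mem r hp
  have : π f = f := Subtype.ext (homogeneousComponent_eq_self hf)
  rw [← this]
  exact hall f

theorem Generate.eq_smul_of_isHomogeneous (hg : Generate x y z) {a b c : ℕ}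
    (hx : (x : Poly).IsHomogeneous a) (hy : (y : Poly).IsHomogeneous b)
    (hz : (z : Poly).IsHomogeneous c) {m : invariants Γ} {d : ℕ} (hf : (f : Poly).IsHomogeneous d)
    (hm : ∀ i j k, a * i + b * j + c * k = d → x ^ i * y ^ j * z ^ k = m) : ∃ r : ℂ, f = r • m := by
  have := hg.mem_of_isHomogeneous hx hy hz hf (Submodule.span ℂ {m}) fun i j k h => by
    rw [hm i j k h]
    exact Submodule.mem_span_singleton_self m
  obtain ⟨r, hr⟩ := Submodule.mem_span_singleton.mp this
  exact ⟨r, hr.symm⟩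

theorem euler_identity {f : Poly} {d : ℕ} (hf : f.IsHomogeneous d) :
    X 0 * pderiv 0 f + X 1 * pderiv 1 f = C (d : ℂ) * f := by
  have h := hf.sum_X_mul_pderiv
  rw [Fin.sum_univ_two] at h
  rw [h, nsmul_eq_mul, map_natCast]

theorem pderiv_eq_zero_of_dvd {f : Poly} (i : Fin 2) (h : f ∣ pderiv i f) : pderiv i f = 0 := by
  by_contra hne
  obtain ⟨g, hg⟩ := h
  have hf : f ≠ 0 := by
    rintro rfl
    simp at hne
  have hg0 : g ≠ 0 := by
    rintro rfl
    exact hne (by rw [hg, mul_zero])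
  have h1 := totalDegree_pderiv_lt i hne
  rw [hg, totalDegree_mul_of_isDomain hf hg0] at h1
  omega

theorem not_dvd_polyBracket {f h : Poly} {d e : ℕ} (hf : f.IsHomogeneous d) (hh : h.IsHomogeneous e)
    (hd : d ≠ 0) (he : e ≠ 0) (hfh : IsRelPrime f h) : ¬ f ∣ polyBracket f h := fun hdvd => by
  have hf' := euler_identity hf
  have hh' := euler_identity hh
  have hunit : IsUnit (C (e : ℂ) : Poly) := (IsUnit.mk0 _ (Nat.cast_ne_zero.mpr he)).map C
  have h1 : C (e : ℂ) * (h * pderiv 0 f) = X 1 * polyBracket f h + f * (C (d : ℂ) * pderiv 0 h) := by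
    unfold polyBracket
    linear_combination (-pderiv 0 f) * hh' + pderiv 0 h * hf'
  have h2 : C (e : ℂ) * (h * pderiv 1 f) =
      -(X 0 * polyBracket f h) + f * (C (d : ℂ) * pderiv 1 h) := by
    unfold polyBracket
    linear_combination (-pderiv 1 f) * hh' + pderiv 1 h * hf'
  have hzero : ∀ i, pderiv i f = 0 := fun i => by
    apply pderiv_eq_zero_of_dvd
    apply hfh.dvd_of_dvd_mul_left
    rw [← hunit.dvd_mul_left (a := f)]
    fin_cases i
    · exact h1 ▸ dvd_add (hdvd.mul_left _) (Dvd.intro _ rfl)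
    · exact h2 ▸ dvd_add ((hdvd.mul_left _).neg_right) (Dvd.intro _ rfl)
  rw [hzero, hzero, mul_zero, mul_zero, add_zero] at hf'
  have hf0 : f = 0 := by
    rcases mul_eq_zero.mp hf'.symm with h3 | h3
    · exact absurd h3 (by simpa using hd)
    · exact h3
  rw [hf0, isRelPrime_zero_left] at hfh
  obtain ⟨r, -, hr⟩ := isUnit_iff_eq_C_of_isReduced.mp hfh
  have h4 := hh.inj_right (hr ▸ isHomogeneous_C (Fin 2) r) hfh.ne_zero
  exact he h4

theorem bracket_ne_zero_of_isRelPrime {d e : ℕ} (hx : (x : Poly).IsHomogeneous d)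
    (hy : (y : Poly).IsHomogeneous e) (hd : d ≠ 0) (he : e ≠ 0)
    (hxy : IsRelPrime (x : Poly) (y : Poly)) : bracket x y ≠ 0 := fun h => by
  apply not_dvd_polyBracket hx hy hd he hxy
  rw [← coe_bracket, h]
  exact dvd_zero _

theorem ne_zero_of_bracket_ne_zero (h : bracket x y ≠ 0) : x ≠ 0 ∧ y ≠ 0 := by
  constructor
  · rintro rfl
    exact h (Subtype.ext (by simp [coe_bracket, polyBracket]))
  · rintro rfl
    exact h (Subtype.ext (by simp [coe_bracket, polyBracket]))

theorem IsAntiPoissonInvolution.sq_eq_one (hθ : IsAntiPoissonInvolution θ) (hx : x ≠ 0) {a : ℂ}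
    (h : θ x = a • x) : a ^ 2 = 1 := by
  have h1 := hθ.involutive x
  rw [h, map_smul, h, smul_smul] at h1
  have h2 : (a * a - 1) • x = 0 := by rw [sub_smul, h1, one_smul, sub_self]
  have h3 := (smul_eq_zero.mp h2).resolve_right hx
  linear_combination h3

theorem Generate.not_identity (hg : Generate x y z) (hθ : IsAntiPoissonInvolution θ)
    (hb : bracket x y ≠ 0) (hx : θ x = x) (hy : θ y = y) : θ z ≠ z := fun hz => by
  have h1 : θ = AlgEquiv.refl := hg.algEquiv_ext hx hy hz
  have h2 := hθ.antiPoisson x y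
  rw [h1] at h2
  have h3 : bracket x y + bracket x y = 0 := by
    nth_rewrite 1 [show bracket x y = -bracket x y from h2]
    exact neg_add_cancel _
  rw [← two_smul ℂ] at h3
  exact hb ((smul_eq_zero.mp h3).resolve_left two_ne_zero)

/-- Homogeneous coprime functions `x, y` that generate `ℂ[X]` together with `z`. -/
structure IsGradedTriple (a b c : ℕ) (x y z : invariants Γ) : Prop where
  hx : (x : Poly).IsHomogeneous a
  hy : (y : Poly).IsHomogeneous b
  hz : (z : Poly).IsHomogeneous c
  gen : Generate x y z
  coprime : IsRelPrime (x : Poly) (y : Poly)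

/-- Generators of type `E 6`. -/
structure IsE6 (x y z : invariants Γ) : Prop extends IsGradedTriple 6 8 12 x y z where
  rel : z ^ 2 + z * x ^ 2 + y ^ 3 = 0

/-- Generators of type `E 7`. -/
structure IsE7 (x y z : invariants Γ) : Prop extends IsGradedTriple 8 12 18 x y z where
  rel : z ^ 2 + y * (x ^ 3 + y ^ 2) = 0

/-- Generators of type `E 8`. -/
structure IsE8 (x y z : invariants Γ) : Prop extends IsGradedTriple 12 20 30 x y z where
  rel : z ^ 2 + y ^ 3 + x ^ 5 = 0

theorem coeff_C_mul_X_pow (i j : Fin 2) (a : ℂ) (m n : ℕ) : coeff (Finsupp.single i m)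
    (C a * X j ^ n : Poly) = if Finsupp.single j n = Finsupp.single i m then a else 0 := by
  rw [coeff_C_mul, coeff_X_pow]
  simp

/-- A function of the form `α x ^ m + β y ^ n` vanishes only if `α = β = 0`. -/
theorem coeffs_eq_zero (h : bracket x y ≠ 0) {α β : ℂ} (hm : m ≠ 0) (hn : n ≠ 0)
    (h0 : α • x ^ m + β • y ^ n = 0) : α = 0 ∧ β = 0 := by
  have h1 := aeval_injective_of_bracket_ne_zero h (C α * X 0 ^ m + C β * X 1 ^ n) (by
    simpa [algebraMap_eq, smul_def] using h0)
  constructor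
  · have h2 := congrArg (coeff (Finsupp.single 0 m)) h1
    rw [coeff_add, coeff_C_mul_X_pow, coeff_C_mul_X_pow, if_pos rfl, if_neg] at h2
    · simpa using h2
    · intro h3
      have := DFunLike.congr_fun h3 0
      simp [hm.symm] at this
  · have h2 := congrArg (coeff (Finsupp.single 1 n)) h1
    rw [coeff_add, coeff_C_mul_X_pow, coeff_C_mul_X_pow, if_pos rfl, if_neg] at h2
    · simpa using h2
    · intro h3
      have := DFunLike.congr_fun h3 1
      simp [hn.symm] at this

theorem sq_eq_one_cases {a : ℂ} (h : a ^ 2 = 1) : a = 1 ∨ a = -1 := by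
  have : (a - 1) * (a + 1) = 0 := by linear_combination h
  exact (mul_eq_zero.mp this).imp sub_eq_zero.mp eq_neg_of_add_eq_zero_left

theorem four_mul_C : (4 * C (1 / 4) : Poly) = 1 := by
  rw [← map_ofNat C 4, ← map_mul, ← map_one C]
  norm_num

theorem C_half_sq : (C (1 / 2) ^ 2 : Poly) = C (1 / 4) := by rw [← map_pow]; norm_num

theorem C_ofNat_four : (C 4 : Poly) = 4 := map_ofNat C 4

theorem eq_one_of_pow {a : ℂ} (h2 : a ^ 2 = 1) (hm : Odd m) (h : a ^ m = 1) : a = 1 := by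
  obtain ⟨k, rfl⟩ := hm
  rwa [pow_add, pow_mul, h2, one_pow, one_mul, pow_one] at h

namespace IsGradedTriple

variable {a b c d : ℕ}

theorem bracket_ne_zero (h : IsGradedTriple a b c x y z) (ha : a ≠ 0 := by norm_num)
    (hb : b ≠ 0 := by norm_num) : bracket x y ≠ 0 :=
  bracket_ne_zero_of_isRelPrime h.hx h.hy ha hb h.coprime

theorem exists_smul (h : IsGradedTriple a b c x y z) (hf : (f : Poly).IsHomogeneous d)
    (i j k : ℕ) (hd : ∀ i' j' k', a * i' + b * j' + c * k' = d → i' = i ∧ j' = j ∧ k' = k) :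
    ∃ r : ℂ, f = r • (x ^ i * y ^ j * z ^ k) :=
  h.gen.eq_smul_of_isHomogeneous h.hx h.hy h.hz hf fun i' j' k' hijk => by
    obtain ⟨rfl, rfl, rfl⟩ := hd i' j' k' hijk
    rfl

theorem exists_smul_x (h : IsGradedTriple a b c x y z) (hf : (f : Poly).IsHomogeneous a)
    (hd : ∀ i j k, a * i + b * j + c * k = a → i = 1 ∧ j = 0 ∧ k = 0 := by omega) : ∃ r : ℂ, f = r • x := by
  simpa using h.exists_smul hf 1 0 0 hd

theorem exists_smul_y (h : IsGradedTriple a b c x y z) (hf : (f : Poly).IsHomogeneous b)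
    (hd : ∀ i j k, a * i + b * j + c * k = b → i = 0 ∧ j = 1 ∧ k = 0 := by omega) : ∃ r : ℂ, f = r • y := by
  simpa using h.exists_smul hf 0 1 0 hd

theorem exists_smul_z (h : IsGradedTriple a b c x y z) (hf : (f : Poly).IsHomogeneous c)
    (hd : ∀ i j k, a * i + b * j + c * k = c → i = 0 ∧ j = 0 ∧ k = 1 := by omega) : ∃ r : ℂ, f = r • z := by
  simpa using h.exists_smul hf 0 0 1 hd

theorem eq_zero_of_isHomogeneous (h : IsGradedTriple a b c x y z) (hf : (f : Poly).IsHomogeneous d)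
    (hd : ∀ i j k, a * i + b * j + c * k ≠ d) : f = 0 :=
  h.gen.mem_of_isHomogeneous h.hx h.hy h.hz hf ⊥ fun i j k hijk => absurd hijk (hd i j k)

theorem apply_eq_neg (h : IsGradedTriple a b c x y z)
    (hb : bracket x y ≠ 0) (hθ : IsAntiPoissonInvolution θ) (hz0 : z ≠ 0)
    (hz : ∃ r : ℂ, θ z = r • z) (hx : θ x = x) (hy : θ y = y) : θ z = -z := by
  obtain ⟨r, hr⟩ := hz
  rcases sq_eq_one_cases (hθ.sq_eq_one hz0 hr) with rfl | rfl
  · rw [one_smul] at hr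
    exact absurd hr (h.gen.not_identity hθ hb hx hy)
  · rw [hr, neg_one_smul]

end IsGradedTriple

namespace IsE8

theorem z_ne_zero (h : IsE8 x y z) : z ≠ 0 := by
  rintro rfl
  have h1 : (1 : ℂ) • x ^ 5 + (1 : ℂ) • y ^ 3 = 0 := by
    rw [one_smul, one_smul]
    linear_combination h.rel
  exact one_ne_zero (coeffs_eq_zero h.bracket_ne_zero (by norm_num) (by norm_num) h1).1

theorem apply_eq (h : IsE8 x y z) (hθ : IsAntiPoissonInvolution θ) : θ x = x ∧ θ y = y ∧
    θ z = -z := by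
  have hb := h.bracket_ne_zero
  obtain ⟨hx0, hy0⟩ := ne_zero_of_bracket_ne_zero hb
  obtain ⟨a, ha⟩ := h.exists_smul_x (hθ.graded _ _ h.hx)
  obtain ⟨b, hb'⟩ := h.exists_smul_y (hθ.graded _ _ h.hy)
  obtain ⟨c, hc⟩ := h.exists_smul_z (hθ.graded _ _ h.hz)
  have ha2 := hθ.sq_eq_one hx0 ha
  have hb2 := hθ.sq_eq_one hy0 hb'
  have hc2 := hθ.sq_eq_one h.z_ne_zero hc
  have hrel := congrArg θ h.rel
  simp only [map_add, map_pow, ha, hb', hc, map_zero, smul_pow, hc2] at hrel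
  have h1 : (a ^ 5 - 1) • x ^ 5 + (b ^ 3 - 1) • y ^ 3 = 0 := by
    rw [sub_smul, sub_smul, one_smul, one_smul]
    rw [one_smul] at hrel
    linear_combination hrel - h.rel
  obtain ⟨h2, h3⟩ := coeffs_eq_zero hb (by norm_num) (by norm_num) h1
  have ha1 := eq_one_of_pow ha2 (m := 5) (by decide) (sub_eq_zero.mp h2)
  have hb1 := eq_one_of_pow hb2 (m := 3) (by decide) (sub_eq_zero.mp h3)
  rw [ha1, one_smul] at ha
  rw [hb1, one_smul] at hb'
  exact ⟨ha, hb', h.apply_eq_neg hb hθ h.z_ne_zero ⟨c, hc⟩ ha hb'⟩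

theorem fixed (h : IsE8 x y z) (hθ : IsAntiPoissonInvolution θ) : fixedIdeal θ = Ideal.span {z} ∧
    IsPlaneCurve θ x y (fun s t => s ^ 5 + t ^ 3) ∧ IsReducedUnion θ 0 1 ∧
    HasGoodComponents (FixedRing θ) := by
  obtain ⟨hx, hy, hz⟩ := h.apply_eq hθ
  have hcov : IsDoubleCover x y z (-(X 0 ^ 5 + X 1 ^ 3)) :=
    isDoubleCover_of_flip h.gen (by
      simp
      linear_combination h.rel) h.bracket_ne_zero h.z_ne_zero θ hx hy hz
  obtain ⟨h1, h2⟩ := hcov.isPlaneCurve_branch (F := fun s t => s ^ 5 + t ^ 3) hx hy hz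
    (c := -1) (by norm_num) (by simp)
  refine ⟨h1, h2, ?_⟩
  exact h2.cusp hθ.graded (mem_originIdeal_of h.hx)
    (mem_originIdeal_of h.hy) (p := 5) (q := 3) (α := 1) (β := 1)
    (by simp) (by norm_num) (by norm_num) (by norm_num) one_ne_zero one_ne_zero

end IsE8

namespace IsE7

theorem z_ne_zero (h : IsE7 x y z) : z ≠ 0 := by
  rintro rfl
  have h0 := (ne_zero_of_bracket_ne_zero h.bracket_ne_zero).2
  have h1 : (1 : ℂ) • x ^ 3 + (1 : ℂ) • y ^ 2 = 0 := by
    have h2 : y * (x ^ 3 + y ^ 2) = 0 := by linear_combination h.rel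
    rw [one_smul, one_smul]
    exact (mul_eq_zero.mp h2).resolve_left h0
  exact one_ne_zero (coeffs_eq_zero h.bracket_ne_zero (by norm_num) (by norm_num) h1).1

theorem apply_eq (h : IsE7 x y z) (hθ : IsAntiPoissonInvolution θ) : θ x = x ∧ θ y = y ∧
    θ z = -z := by
  have hb := h.bracket_ne_zero
  obtain ⟨hx0, hy0⟩ := ne_zero_of_bracket_ne_zero hb
  obtain ⟨a, ha⟩ := h.exists_smul_x (hθ.graded _ _ h.hx)
  obtain ⟨b, hb'⟩ := h.exists_smul_y (hθ.graded _ _ h.hy)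
  obtain ⟨c, hc⟩ := h.exists_smul_z (hθ.graded _ _ h.hz)
  have ha2 := hθ.sq_eq_one hx0 ha
  have hb2 := hθ.sq_eq_one hy0 hb'
  have hc2 := hθ.sq_eq_one h.z_ne_zero hc
  have hrel := congrArg θ h.rel
  simp only [map_add, map_mul, map_pow, ha, hb', hc, map_zero, smul_pow, hc2, hb2, one_smul] at hrel
  have h1 : (b * a ^ 3 - 1) • x ^ 3 + (b - 1) • y ^ 2 = 0 := by
    have h2 : y * ((b * a ^ 3 - 1) • x ^ 3 + (b - 1) • y ^ 2) = 0 := by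
      simp only [smul_def, map_sub, map_mul, map_pow, map_one] at hrel ⊢
      linear_combination hrel - h.rel
    exact (mul_eq_zero.mp h2).resolve_left hy0
  obtain ⟨h2, h3⟩ := coeffs_eq_zero hb (by norm_num) (by norm_num) h1
  have hb1 : b = 1 := sub_eq_zero.mp h3
  rw [hb1, one_mul] at h2
  have ha1 := eq_one_of_pow ha2 (m := 3) (by decide) (sub_eq_zero.mp h2)
  rw [ha1, one_smul] at ha
  rw [hb1, one_smul] at hb'
  exact ⟨ha, hb', h.apply_eq_neg hb hθ h.z_ne_zero ⟨c, hc⟩ ha hb'⟩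

theorem fixed (h : IsE7 x y z) (hθ : IsAntiPoissonInvolution θ) : fixedIdeal θ = Ideal.span {z} ∧
    IsPlaneCurve θ x y (fun s t => t * (s ^ 3 + t ^ 2)) ∧ IsReducedUnion θ 1 1 ∧
    HasGoodComponents (FixedRing θ) := by
  obtain ⟨hx, hy, hz⟩ := h.apply_eq hθ
  have hcov : IsDoubleCover x y z (-(X 1 * (X 0 ^ 3 + X 1 ^ 2))) :=
    isDoubleCover_of_flip h.gen (by
      simp
      linear_combination h.rel) h.bracket_ne_zero h.z_ne_zero θ hx hy hz
  obtain ⟨h1, h2⟩ := hcov.isPlaneCurve_branch (F := fun s t => t * (s ^ 3 + t ^ 2)) hx hy hz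
    (c := -1) (by norm_num) (by simp)
  refine ⟨h1, h2, ?_⟩
  exact h2.line_cusp hθ.graded (mem_originIdeal_of h.hx)
    (mem_originIdeal_of h.hy) 1 (p := 3) (q := 2) (α := 1) (β := 1)
    (by simp) (by norm_num) (by norm_num) (by norm_num) one_ne_zero one_ne_zero

end IsE7

theorem IsDoubleCover.swap {w : invariants Γ} {Δ : Poly} (h : IsDoubleCover x y w Δ) :
    IsDoubleCover y x w (aeval ![X 1, X 0] Δ) := by
  have hs : ∀ p : Poly, aeval ![x, y] (aeval ![(X 1 : Poly), X 0] p) = aeval ![y, x] p := by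
    intro p
    have : (aeval ![x, y]).comp (aeval ![(X 1 : Poly), X 0]) = aeval ![y, x] := by
      apply algHom_ext
      intro i
      fin_cases i <;> simp
    exact DFunLike.congr_fun this p
  have hss : ∀ p : Poly, aeval ![(X 1 : Poly), X 0] (aeval ![(X 1 : Poly), X 0] p) = p := by
    intro p
    have : (aeval ![(X 1 : Poly), X 0]).comp (aeval ![(X 1 : Poly), X 0]) = AlgHom.id ℂ _ := by
      apply algHom_ext
      intro i
      fin_cases i <;> simp
    exact DFunLike.congr_fun this p
  refine ⟨?_, ?_, fun p q hpq => ?_⟩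
  · have := h.gen
    unfold Generate at this ⊢
    rwa [Set.insert_comm]
  · rw [← hs, hss, h.sq]
  · rw [← hs, ← hs] at hpq
    obtain ⟨h1, h2⟩ := h.indep _ _ hpq
    have h3 := congrArg (aeval ![(X 1 : Poly), X 0]) h1
    have h4 := congrArg (aeval ![(X 1 : Poly), X 0]) h2
    rw [hss, map_zero] at h3 h4
    exact ⟨h3, h4⟩

theorem Generate.congr {w : invariants Γ} (h : Generate x y z) (hz : z ∈ adjoin ℂ {x, y, w}) :
    Generate x y w := by
  rw [Generate, eq_top_iff]
  intro f _
  refine h.induction (adjoin ℂ {x, y, w}) ?_ ?_ hz f <;>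
  exact subset_adjoin (by simp)

theorem Generate.rescale {w : invariants Γ} (h : Generate x y z) {α : ℂ} (hf : f ∈ adjoin ℂ {x, y})
    (hz : z = α • w + f) : Generate x y w := by
  refine h.congr ?_
  rw [hz]
  refine add_mem (Subalgebra.smul_mem _ (subset_adjoin (by simp)) α) ?_
  refine Algebra.adjoin_mono ?_ hf
  intro g hg
  rcases hg with rfl | rfl <;> simp

namespace IsE6

theorem exists_smul_z (h : IsE6 x y z) (hf : (f : Poly).IsHomogeneous 12) : ∃ r s : ℂ,
    f = r • z + s • x ^ 2 := by
  have := h.gen.mem_of_isHomogeneous h.hx h.hy h.hz hf (Submodule.span ℂ {z, x ^ 2})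
    fun i j k hijk => by
      obtain ⟨rfl, rfl, rfl⟩ | ⟨rfl, rfl, rfl⟩ :
        (i = 0 ∧ j = 0 ∧ k = 1) ∨ (i = 2 ∧ j = 0 ∧ k = 0) := by omega
      all_goals exact Submodule.subset_span (by simp)
  obtain ⟨r, s, hrs⟩ := Submodule.mem_span_pair.mp this
  exact ⟨r, s, hrs.symm⟩

theorem two_mul_add_sq : 2 * z + x ^ 2 = (2 : ℂ) • z + (1 : ℂ) • x ^ 2 := by
  rw [one_smul, smul_def, map_ofNat]

theorem generate_branch (h : IsE6 x y z) : Generate x y (2 * z + x ^ 2) := by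
  refine h.gen.rescale (α := 1 / 2) (f := (-1 / 2 : ℂ) • x ^ 2) ?_ ?_
  · exact Subalgebra.smul_mem _ (pow_mem (subset_adjoin (by simp)) 2) _
  · rw [two_mul_add_sq, smul_add, smul_smul, smul_smul, add_assoc, ← add_smul]
    norm_num

theorem isDoubleCover (h : IsE6 x y z) :
    IsDoubleCover x y (2 * z + x ^ 2) (X 0 ^ 4 - C 4 * X 1 ^ 3) := by
  refine isDoubleCover_of_odd h.generate_branch ?_ h.bracket_ne_zero ?_
  · simp [C_ofNat_four]
    linear_combination 4 * h.rel
  · have h1 : degreeOf 1 (X 0 ^ 4 - C 4 * X 1 ^ 3 : Poly) = 3 := by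
      apply le_antisymm
      · refine (degreeOf_sub_le _ _ _).trans (max_le ?_ ?_)
        · refine (degreeOf_pow_le _ _ _).trans ?_
          simp [degreeOf_X]
        · refine (degreeOf_C_mul_le _ _ _).trans ((degreeOf_pow_le _ _ _).trans ?_)
          simp
      · have h2 : Finsupp.single 1 3 ∈ (X 0 ^ 4 - C 4 * X 1 ^ 3 : Poly).support := by
          rw [mem_support_iff, coeff_sub, coeff_C_mul_X_pow, if_pos rfl, coeff_X_pow, if_neg]
          · norm_num
          · intro h3
            have := DFunLike.congr_fun h3 1
            simp at this
        simpa using monomial_le_degreeOf 1 h2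
    rw [h1]
    decide

theorem bracket_not_mem_span (h : IsE6 x y z) (β : ℂ) : bracket x y ≠ β • x ^ 2 := fun hb => by
  refine not_dvd_polyBracket h.hx h.hy (by norm_num) (by norm_num) h.coprime ?_
  rw [← coe_bracket, hb]
  exact ⟨β • (x : Poly), by
    rw [mul_smul_comm]
    simp [sq]⟩

theorem apply_eq (h : IsE6 x y z) (hθ : IsAntiPoissonInvolution θ) :
    (θ x = -x ∧ θ y = y ∧ θ z = z) ∨ (θ x = x ∧ θ y = y ∧ θ z = -z - x ^ 2) := by
  have hb := h.bracket_ne_zero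
  have hcov := h.isDoubleCover
  obtain ⟨hx0, hy0⟩ := ne_zero_of_bracket_ne_zero hb
  obtain ⟨a, ha⟩ := h.exists_smul_x (hθ.graded _ _ h.hx)
  obtain ⟨b, hb'⟩ := h.exists_smul_y (hθ.graded _ _ h.hy)
  have ha2 := hθ.sq_eq_one hx0 ha
  have hb2 := hθ.sq_eq_one hy0 hb'
  set w := 2 * z + x ^ 2 with hw
  have hwh : ∀ f : invariants Γ, (f : Poly).IsHomogeneous 12 → ∃ r s : ℂ, f = r • w + s • x ^ 2 := by
    intro f hf
    obtain ⟨r, s, rfl⟩ := h.exists_smul_z hf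
    refine ⟨r / 2, s - r / 2, ?_⟩
    have h2 : (2 * z : invariants Γ) = (2 : ℂ) • z := by rw [smul_def, map_ofNat]
    rw [hw, h2, smul_add, smul_smul, sub_smul]
    have : r / 2 * 2 = r := by ring
    rw [this]
    abel
  have hθw : (w : Poly).IsHomogeneous 12 := by
    change (2 * (z : Poly) + (x : Poly) ^ 2).IsHomogeneous 12
    rw [← map_ofNat C 2]
    exact (h.hz.C_mul _).add (h.hx.pow 2)
  obtain ⟨c, d, hc⟩ := hwh (θ w) (hθ.graded _ _ hθw)
  have hsq : w ^ 2 = x ^ 4 - 4 * y ^ 3 := by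
    rw [hw]
    linear_combination 4 * h.rel
  have hy3 : b ^ 3 = b := by rw [pow_succ, hb2, one_mul]
  have hx4 : a ^ 4 = 1 := by rw [show a ^ 4 = (a ^ 2) ^ 2 by ring, ha2, one_pow]
  have hrel := congrArg θ hsq
  simp only [map_sub, map_mul, map_pow, ha, hb', hc, smul_pow, hx4, hy3, map_ofNat, one_smul] at hrel
  obtain ⟨h1, h2⟩ := hcov.indep
    (C (c ^ 2) * (X 0 ^ 4 - C 4 * X 1 ^ 3) + C (d ^ 2) * X 0 ^ 4 - X 0 ^ 4 + C (4 * b) * X 1 ^ 3)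
    (C (2 * c * d) * X 0 ^ 2) (by
      simp only [map_sub, map_add, map_mul, map_pow, aeval_X, cons_val_zero,
        cons_val_one, algHom_C, map_ofNat]
      simp only [smul_def] at hrel
      linear_combination hrel - (algebraMap ℂ (invariants Γ) c) ^ 2 * hsq)
  have hc0 : c ≠ 0 := by
    rintro rfl
    have h3 := congrArg θ hc
    rw [hθ.involutive, zero_smul, zero_add, map_smul, map_pow, ha, smul_pow, ha2, one_smul] at h3
    obtain ⟨-, h4⟩ := hcov.indep (-C d * X 0 ^ 2) 1 (by simp [h3, smul_def])
    exact one_ne_zero h4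
  have hd0 : d = 0 := by
    have h3 := congrArg (coeff (Finsupp.single 0 2)) h2
    rw [coeff_C_mul_X_pow, if_pos rfl, coeff_zero] at h3
    simpa [hc0] using h3
  rw [hd0, zero_smul, add_zero] at hc
  have hw0 : w ≠ 0 := fun h3 => by
    have h4 := hcov.indep 0 1 (by simp [h3])
    exact one_ne_zero h4.2
  have hc2 := hθ.sq_eq_one hw0 hc
  have hb1 : b = 1 := by
    have h3 : C (4 * (b - 1)) * X 1 ^ 3 = (0 : Poly) := by
      rw [← h1, hc2, hd0]
      simp only [C_mul, map_sub, C_1]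
      simp
      ring
    have h4 := congrArg (coeff (Finsupp.single 1 3)) h3
    rw [coeff_C_mul_X_pow, if_pos rfl, coeff_zero] at h4
    have : b - 1 = 0 := by simpa using h4
    linear_combination this
  rw [hb1, one_smul] at hb'
  have hz2 : (2 : ℂ) • z = w - x ^ 2 := by
    rw [hw, smul_def, map_ofNat]
    ring
  have hz : ∀ f, (2 : ℂ) • θ z = (2 : ℂ) • f → θ z = f := fun f hf =>
    smul_right_injective _ (two_ne_zero : (2 : ℂ) ≠ 0) hf
  rcases sq_eq_one_cases ha2 with rfl | rfl <;>
    rcases sq_eq_one_cases hc2 with rfl | rfl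
  · rw [one_smul] at ha hc
    exact absurd hc (h.generate_branch.not_identity hθ hb ha hb')
  · right
    rw [one_smul] at ha
    refine ⟨ha, hb', hz _ ?_⟩
    rw [← map_smul, hz2, map_sub, map_pow, ha, hc, neg_one_smul, smul_sub, smul_neg, hz2, two_smul]
    ring
  · left
    rw [one_smul] at hc
    rw [neg_one_smul] at ha
    refine ⟨ha, hb', hz _ ?_⟩
    rw [← map_smul, hz2, map_sub, map_pow, ha, hc]
    ring
  · exfalso
    rw [neg_one_smul] at ha hc
    have hbr : ((bracket x y : invariants Γ) : Poly).IsHomogeneous 12 :=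
      polyBracket_isHomogeneous h.hx h.hy
    obtain ⟨r, s, hrs⟩ := hwh _ hbr
    have h3 := hθ.antiPoisson x y
    have h4 : bracket (-x) y = -bracket x y := Subtype.ext (by
      simp only [coe_bracket, polyBracket, NegMemClass.coe_neg, map_neg]
      ring)
    have hn : (-x) ^ 2 = x ^ 2 := by ring
    rw [ha, hb', h4, neg_neg, hrs, map_add, map_smul, map_smul, map_pow, ha, hc, hn,
      add_left_inj, smul_neg, neg_eq_iff_add_eq_zero, ← two_smul ℂ, smul_smul] at h3
    have h5 : r = 0 := by
      have := (smul_eq_zero.mp h3).resolve_right hw0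
      simpa using this
    rw [h5, zero_smul, zero_add] at hrs
    exact h.bracket_not_mem_span s hrs

theorem fixed_one (h : IsE6 x y z) (hθ : IsGraded θ) (hx : θ x = -x) (hy : θ y = y) (hz : θ z = z) :
    fixedIdeal θ = Ideal.span {x} ∧ IsPlaneCurve θ y z (fun s t => t ^ 2 + s ^ 3) ∧
    IsReducedUnion θ 0 1 ∧ HasGoodComponents (FixedRing θ) := by
  have hw : θ (2 * z + x ^ 2) = 2 * z + x ^ 2 := by
    rw [map_add, map_mul, map_pow, map_ofNat, hz, hx]
    ring
  obtain ⟨h1, h2⟩ := h.isDoubleCover.swap.isPlaneCurve_flip (F := fun s t => t ^ 2 + 4 * s ^ 3)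
    hy hx hw (d := -Polynomial.C 4 * Polynomial.X ^ 3) (c := 1) (by simp [algebraMap_eq]) one_ne_zero
    (by simp [algebraMap_eq, C_ofNat_four])
  have h3 : IsPlaneCurve θ y z (fun s t => t ^ 2 + s ^ 3) := by
    refine h2.change (α := 1 / 2) (by norm_num) 0 ?_ (c := 1 / 4) (by norm_num) ?_
    · rw [h1, Ideal.mem_span_singleton]
      refine ⟨(-1 / 2 : ℂ) • x, ?_⟩
      rw [two_mul_add_sq, smul_add, smul_smul, smul_smul, map_zero, mul_smul_comm, ← sq]
      norm_num
    · simp only [map_add, map_pow, aeval_X, cons_val_zero, cons_val_one, map_zero, add_zero]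
      linear_combination X 1 ^ 2 * C_half_sq - X 0 ^ 3 * four_mul_C
  refine ⟨h1, h3, ?_⟩
  exact h3.cusp hθ (mem_originIdeal_of h.hy)
    (mem_originIdeal_of h.hz) (p := 3) (q := 2) (α := 1) (β := 1)
    (by simp [add_comm]) (by norm_num) (by norm_num) (by norm_num) one_ne_zero one_ne_zero

theorem fixed_two (h : IsE6 x y z) (hθ : IsGraded θ) (hx : θ x = x) (hy : θ y = y)
    (hz : θ z = -z - x ^ 2) : fixedIdeal θ = Ideal.span {2 * z + x ^ 2} ∧
    IsPlaneCurve θ x y (fun s t => s ^ 4 - 4 * t ^ 3) ∧ IsReducedUnion θ 0 1 ∧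
    HasGoodComponents (FixedRing θ) := by
  have hw : θ (2 * z + x ^ 2) = -(2 * z + x ^ 2) := by
    rw [map_add, map_mul, map_pow, map_ofNat, hz, hx]
    ring
  obtain ⟨h1, h2⟩ := h.isDoubleCover.isPlaneCurve_branch (F := fun s t => s ^ 4 - 4 * t ^ 3)
    hx hy hw (c := 1) one_ne_zero (by simp [C_ofNat_four])
  refine ⟨h1, h2, ?_⟩
  exact h2.cusp hθ (mem_originIdeal_of h.hx)
    (mem_originIdeal_of h.hy) (p := 4) (q := 3) (α := 1) (β := -4)
    (by simp [sub_eq_add_neg, C_ofNat_four]) (by norm_num) (by norm_num) (by norm_num) one_ne_zero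
    (by norm_num)

theorem fixed (h : IsE6 x y z) (hθ : IsAntiPoissonInvolution θ) :
    HasGoodComponents (FixedRing θ) := by
  rcases h.apply_eq hθ with ⟨h1, h2, h3⟩ | ⟨h1, h2, h3⟩
  · exact (h.fixed_one hθ.graded h1 h2 h3).2.2.2
  · exact (h.fixed_two hθ.graded h1 h2 h3).2.2.2

end IsE6

/-- The linear form vanishing along the vector `w`. -/
noncomputable def linForm (w : Fin 2 → ℂ) : Poly := C (w 0) * X 1 - C (w 1) * X 0

theorem linForm_isHomogeneous (w : Fin 2 → ℂ) : (linForm w).IsHomogeneous 1 :=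
  (isHomogeneous_C_mul_X _ _).sub (isHomogeneous_C_mul_X _ _)

theorem eval_linForm (w y : Fin 2 → ℂ) : eval y (linForm w) = w 0 * y 1 - w 1 * y 0 := by
  simp [linForm]

theorem linForm_ne_zero {w : Fin 2 → ℂ} (hw : w ≠ 0) : linForm w ≠ 0 := fun h => by
  apply hw
  have h1 := congrArg (eval ![0, 1]) h
  have h2 := congrArg (eval ![1, 0]) h
  simp only [eval_linForm, map_zero, cons_val_zero, cons_val_one] at h1 h2
  ext i
  fin_cases i
  · simpa using h1
  · simpa using h2

/-- Restriction of polynomials to the line spanned by `w`. -/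
noncomputable def restrictLine (w : Fin 2 → ℂ) : Poly →ₐ[ℂ] Polynomial ℂ :=
  aeval fun j => Polynomial.C (w j) * Polynomial.X

theorem restrictLine_eq {f : Poly} {d : ℕ} (hf : f.IsHomogeneous d) (w : Fin 2 → ℂ) :
    restrictLine w f = Polynomial.C (eval w f) * Polynomial.X ^ d := by
  rw [restrictLine, aeval_def, eval₂_eq', eval_eq', map_sum, Finset.sum_mul]
  refine Finset.sum_congr rfl fun m hm => ?_
  have h1 := hf (mem_support_iff.mp hm)
  rw [Finsupp.weight_apply, Finsupp.sum_fintype _ _ (by simp)] at h1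
  simp only [Fin.sum_univ_two, Fin.prod_univ_two, smul_eq_mul, Pi.one_apply, mul_one] at h1 ⊢
  rw [← h1, Polynomial.algebraMap_eq]
  simp only [map_mul, map_pow, mul_pow, pow_add]
  ring

theorem linForm_prime_and_ker {w : Fin 2 → ℂ} (hw : w ≠ 0) : Prime (linForm w) ∧
    RingHom.ker (restrictLine w) = Ideal.span {linForm w} := by
  obtain ⟨m, hm⟩ : ∃ m : Fin 2 → ℂ, m 0 * w 0 + m 1 * w 1 = 1 := by
    by_cases h0 : w 0 = 0
    · have h1 : w 1 ≠ 0 := fun h1 => hw (by ext i; fin_cases i <;> assumption)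
      exact ⟨![0, (w 1)⁻¹], by simp [h1]⟩
    · exact ⟨![(w 0)⁻¹, 0], by simp [h0]⟩
  let ι : Polynomial ℂ →ₐ[ℂ] Poly := Polynomial.aeval (C (m 0) * X 0 + C (m 1) * X 1)
  have h1 : restrictLine w (ι Polynomial.X) = Polynomial.X := by
    simp only [ι, restrictLine, Polynomial.aeval_X, map_add, map_mul, aeval_X, algHom_C,
      Polynomial.algebraMap_eq]
    rw [← mul_assoc, ← mul_assoc, ← add_mul, ← map_mul, ← map_mul, ← map_add, hm, map_one, one_mul]
  have h2 : restrictLine w (linForm w) = 0 := by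
    rw [restrictLine_eq (linForm_isHomogeneous w), eval_linForm, mul_comm (w 1), sub_self]
    simp
  have h3 : ∀ i, X i - ι (restrictLine w (X i)) ∈ Ideal.span {linForm w} := by
    have hm' : (C (m 0) * C (w 0) + C (m 1) * C (w 1) : Poly) = 1 := by
      rw [← map_mul, ← map_mul, ← map_add, hm, map_one]
    intro i
    rw [Ideal.mem_span_singleton]
    fin_cases i
    · refine ⟨-C (m 1), ?_⟩
      simp only [ι, restrictLine, aeval_X, map_mul, Polynomial.aeval_C, Polynomial.aeval_X,
        algebraMap_eq, linForm, Fin.mk_zero]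
      linear_combination (-X 0) * hm'
    · refine ⟨C (m 0), ?_⟩
      simp only [ι, restrictLine, aeval_X, map_mul, Polynomial.aeval_C, Polynomial.aeval_X,
        algebraMap_eq, linForm, Fin.mk_one]
      linear_combination (-X 1) * hm'
  exact ⟨(prime_and_isAffineLine _ (linForm_ne_zero hw) _ ι h1 h2 h3).1,
    ker_eq_span_of_section _ _ ι h2 h3⟩

theorem linForm_dvd_iff {f : Poly} {d : ℕ} (hf : f.IsHomogeneous d) {w : Fin 2 → ℂ} (hw : w ≠ 0) :
    linForm w ∣ f ↔ eval w f = 0 := by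
  rw [← Ideal.mem_span_singleton, ← (linForm_prime_and_ker hw).2, RingHom.mem_ker,
    restrictLine_eq hf]
  simp

theorem linSubst_linForm (g : Mat) (w : Fin 2 → ℂ) :
    linSubst g (linForm (g.mulVec w)) = C g.det * linForm w := by
  simp only [linForm, linSubst, map_sub, map_mul, algHom_C, aeval_X, Fin.sum_univ_two,
    mulVec, dotProduct, det_fin_two, map_add, algebraMap_eq]
  ring

theorem exists_homogeneous_quotient {F f : Poly} {d : ℕ} (hF : F.IsHomogeneous m)
    (hf : f.IsHomogeneous (m + d)) (h : F ∣ f) : ∃ q : Poly, q.IsHomogeneous d ∧ f = F * q := by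
  obtain ⟨q, rfl⟩ := h
  refine ⟨homogeneousComponent d q, homogeneousComponent_isHomogeneous _ _, ?_⟩
  letI := gradedAlgebra (σ := Fin 2) (R := ℂ)
  have h1 := DirectSum.coe_decompose_mul_add_of_left_mem (homogeneousSubmodule (Fin 2) ℂ)
    (j := d) (b := q) ((mem_homogeneousSubmodule _ _).mpr hF)
  have h2 : ∀ (k : ℕ) (p : Poly),
      ((DirectSum.decompose (homogeneousSubmodule (Fin 2) ℂ) p k : _) : Poly) =
        homogeneousComponent k p := fun k p => decomposition.decompose'_apply p k
  rwa [h2, h2, homogeneousComponent_of_mem ((mem_homogeneousSubmodule _ _).mpr hf), if_pos rfl] at h1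

theorem eval_polynomial_aeval (x : Fin 2 → Polynomial ℂ) (f : Poly) (t : ℂ) :
    (aeval x f).eval t = eval (fun i => (x i).eval t) f := by
  rw [← Polynomial.coe_aeval_eq_eval, ← AlgHom.comp_apply, comp_aeval, ← coe_aeval_eq_eval]
  rfl

theorem eval_smul_of_isHomogeneous {f : Poly} {d : ℕ} (hf : f.IsHomogeneous d) (s : ℂ)
    (w : Fin 2 → ℂ) : eval (s • w) f = s ^ d * eval w f := by
  rw [eval_eq', eval_eq', Finset.mul_sum]
  refine Finset.sum_congr rfl fun m hm => ?_
  have h1 := hf (mem_support_iff.mp hm)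
  rw [Finsupp.weight_apply, Finsupp.sum_fintype _ _ (by simp)] at h1
  simp only [Fin.sum_univ_two, Fin.prod_univ_two, smul_eq_mul, Pi.one_apply, mul_one,
    Pi.smul_apply, mul_pow] at h1 ⊢
  rw [← h1, pow_add]
  ring

theorem exists_zero_of_isHomogeneous {f : Poly} {d : ℕ} (hf : f.IsHomogeneous d) (hd : d ≠ 0) :
    ∃ w : Fin 2 → ℂ, w ≠ 0 ∧ eval w f = 0 := by
  by_cases h0 : eval ![1, 0] f = 0
  · exact ⟨![1, 0], fun h => by simpa using congrFun h 0, h0⟩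
  let p : Polynomial ℂ := aeval ![Polynomial.X, 1] f
  have hp : ∀ t, p.eval t = eval ![t, 1] f := fun t => by
    rw [eval_polynomial_aeval]
    congr 2
    ext i
    fin_cases i <;> simp
  by_cases hdeg : p.degree = 0
  · exfalso
    obtain ⟨c, hc⟩ : ∃ c, p = Polynomial.C c := ⟨_, Polynomial.eq_C_of_degree_eq_zero hdeg⟩
    have hq : ∀ t, (aeval ![1, Polynomial.X] f : Polynomial ℂ).eval t = eval ![1, t] f := by
      intro t
      rw [eval_polynomial_aeval]
      congr 2
      ext i
      fin_cases i <;> simp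
    have hpoly : (aeval ![1, Polynomial.X] f : Polynomial ℂ) =
        Polynomial.C c * Polynomial.X ^ d := by
      refine Polynomial.eq_of_infinite_eval_eq _ _ (Set.Infinite.mono (s := {0}ᶜ) ?_
        (Set.finite_singleton _).infinite_compl)
      intro s hs
      have hs : s ≠ 0 := hs
      have h3 : ![1, s] = s • ![s⁻¹, 1] := by
        ext i
        fin_cases i <;> simp [hs]
      change Polynomial.eval s _ = Polynomial.eval s _
      rw [hq, h3, eval_smul_of_isHomogeneous hf, ← hp, hc, Polynomial.eval_C, Polynomial.eval_mul,
        Polynomial.eval_C, Polynomial.eval_pow, Polynomial.eval_X, mul_comm]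
    apply h0
    rw [← hq, hpoly, Polynomial.eval_mul, Polynomial.eval_pow, Polynomial.eval_X, zero_pow hd,
      mul_zero]
  · obtain ⟨t, ht⟩ := IsAlgClosed.exists_root p hdeg
    exact ⟨![t, 1], fun h => by simpa using congrFun h 1, by rw [← hp]; exact ht⟩

/-- The points of the projective line over `ℂ`. -/
abbrev Point : Type := Projectivization ℂ (Fin 2 → ℂ)

/-- The linear form vanishing at a point of the projective line. -/
noncomputable def pointForm (p : Point) : Poly := linForm p.rep

/-- The product of the linear forms vanishing at the points of a finite set. -/
noncomputable def orbitForm (S : Finset Point) : Poly := ∏ p ∈ S, pointForm p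

theorem pointForm_isHomogeneous (p : Point) : (pointForm p).IsHomogeneous 1 :=
  linForm_isHomogeneous _

theorem orbitForm_isHomogeneous (S : Finset Point) : (orbitForm S).IsHomogeneous S.card := by
  have := IsHomogeneous.prod S pointForm (fun _ => 1) fun p _ => pointForm_isHomogeneous p
  simpa [orbitForm] using this

theorem pointForm_prime (p : Point) : Prime (pointForm p) :=
  (linForm_prime_and_ker p.rep_nonzero).1

theorem orbitForm_ne_zero (S : Finset Point) : orbitForm S ≠ 0 :=
  Finset.prod_ne_zero_iff.mpr fun p _ => (pointForm_prime p).ne_zero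

theorem pointForm_dvd_iff {f : Poly} {d : ℕ} (hf : f.IsHomogeneous d) (p : Point) :
    pointForm p ∣ f ↔ eval p.rep f = 0 :=
  linForm_dvd_iff hf p.rep_nonzero

theorem linForm_smul (c : ℂ) (w : Fin 2 → ℂ) : linForm (c • w) = C c * linForm w := by
  simp only [linForm, Pi.smul_apply, smul_eq_mul, map_mul]
  ring

theorem eval_pointForm_eq_zero_iff {p q : Point} : eval q.rep (pointForm p) = 0 ↔ p = q := by
  rw [pointForm, eval_linForm]
  constructor
  · intro h
    rw [← p.mk_rep, ← q.mk_rep, Projectivization.mk_eq_mk_iff']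
    by_cases h0 : q.rep 0 = 0
    · have h1 : q.rep 1 ≠ 0 := fun h1 => q.rep_nonzero (by ext i; fin_cases i <;> assumption)
      have h2 : p.rep 0 = 0 := by
        rw [h0, mul_zero, sub_zero] at h
        exact (mul_eq_zero.mp h).resolve_right h1
      refine ⟨p.rep 1 / q.rep 1, ?_⟩
      ext i
      fin_cases i
      · simp [h0, h2]
      · simp [h1]
    · refine ⟨p.rep 0 / q.rep 0, ?_⟩
      ext i
      fin_cases i
      · simp [h0]
      · simp only [Fin.mk_one, Pi.smul_apply, smul_eq_mul]
        field_simp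
        linear_combination h
  · rintro rfl
    ring

theorem pointForm_dvd_orbitForm {S : Finset Point} {p : Point} : pointForm p ∣ orbitForm S ↔
    p ∈ S := by
  constructor
  · intro h
    obtain ⟨q, hq, h⟩ := (pointForm_prime p).exists_mem_finset_dvd h
    rw [pointForm_dvd_iff (pointForm_isHomogeneous q), eval_pointForm_eq_zero_iff] at h
    exact h ▸ hq
  · exact fun h => Finset.dvd_prod_of_mem _ h

theorem isRelPrime_pointForm {p q : Point} (h : p ≠ q) :
    IsRelPrime (pointForm p) (pointForm q) := by
  rw [(pointForm_prime p).irreducible.isRelPrime_iff_not_dvd,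
    pointForm_dvd_iff (pointForm_isHomogeneous q), eval_pointForm_eq_zero_iff]
  exact fun h' => h h'.symm

theorem orbitForm_dvd {S : Finset Point} {f : Poly} {d : ℕ} (hf : f.IsHomogeneous d)
    (h : ∀ p ∈ S, eval p.rep f = 0) : orbitForm S ∣ f :=
  Finset.prod_dvd_of_isRelPrime (fun _ _ _ _ hpq => isRelPrime_pointForm hpq)
    fun p hp => (pointForm_dvd_iff hf p).mpr (h p hp)

theorem isRelPrime_orbitForm {S T : Finset Point} (h : Disjoint S T) :
    IsRelPrime (orbitForm S) (orbitForm T) :=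
  IsRelPrime.prod_left fun _ hp => IsRelPrime.prod_right fun _ hq =>
    isRelPrime_pointForm (Finset.disjoint_iff_ne.mp h _ hp _ hq)

theorem eval_orbitForm_eq_zero_iff {S : Finset Point} {p : Point} : eval p.rep (orbitForm S) = 0 ↔
    p ∈ S := by
  rw [← pointForm_dvd_iff (orbitForm_isHomogeneous S), pointForm_dvd_orbitForm]

theorem smul_eq_mk (g : SL2) (p : Point) (hw : g.1.mulVec p.rep ≠ 0) :
    g • p = Projectivization.mk ℂ (g.1.mulVec p.rep) hw := by
  conv_lhs => rw [← p.mk_rep]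
  rfl

theorem mulVec_rep_ne_zero (g : SL2) (p : Point) : g.1.mulVec p.rep ≠ 0 := fun h => by
  apply p.rep_nonzero
  have := congrArg (g⁻¹).1.mulVec h
  rwa [Matrix.mulVec_mulVec, ← sl_mul, inv_mul_cancel,
    sl_one, one_mulVec, Matrix.mulVec_zero] at this

theorem exists_rep_smul (g : SL2) (p : Point) : ∃ c : ℂ, c ≠ 0 ∧
    (g • p).rep = c • g.1.mulVec p.rep := by
  have h := smul_eq_mk g p (mulVec_rep_ne_zero g p)
  rw [← (g • p).mk_rep, Projectivization.mk_eq_mk_iff'] at h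
  obtain ⟨c, hc⟩ := h
  refine ⟨c, ?_, hc.symm⟩
  rintro rfl
  exact (g • p).rep_nonzero (by rw [← hc, zero_smul])

theorem smul_eq_iff_exists (g : SL2) (p : Point) : g • p = p ↔ ∃ c : ℂ,
    g.1.mulVec p.rep = c • p.rep := by
  constructor
  · intro h
    obtain ⟨c, hc, h1⟩ := exists_rep_smul g p
    rw [h] at h1
    exact ⟨c⁻¹, by rw [h1, smul_smul, inv_mul_cancel₀ hc, one_smul, ← h1]⟩
  · rintro ⟨c, hc⟩
    rw [smul_eq_mk g p (mulVec_rep_ne_zero g p)]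
    conv_rhs => rw [← p.mk_rep]
    rw [Projectivization.mk_eq_mk_iff']
    exact ⟨c, hc.symm⟩

theorem linSubst_pointForm (g : SL2) (p : Point) : ∃ c : ℂ, c ≠ 0 ∧
    linSubst g.1 (pointForm (g • p)) = C c * pointForm p := by
  obtain ⟨c, hc, h⟩ := exists_rep_smul g p
  refine ⟨c, hc, ?_⟩
  rw [pointForm, h, linForm_smul, map_mul, linSubst_linForm, g.2, map_one, one_mul, pointForm,
    algHom_C, algebraMap_eq]

theorem linSubst_orbitForm {S : Finset Point} (g : SL2) (hS : ∀ p ∈ S, g • p ∈ S) : ∃ c : ℂ, c ≠ 0 ∧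
    linSubst g.1 (orbitForm S) = C c * orbitForm S := by
  choose c hc h using linSubst_pointForm g
  refine ⟨∏ p ∈ S, c p, Finset.prod_ne_zero_iff.mpr fun p _ => hc p, ?_⟩
  have h1 : orbitForm S = ∏ p ∈ S, pointForm (g • p) := by
    refine (Finset.prod_bij (fun p _ => g • p) hS (fun p _ q _ h => smul_left_cancel g h) ?_
      fun _ _ => rfl).symm
    intro b hb
    obtain ⟨a, ha, h⟩ := Finset.surj_on_of_inj_on_of_card_le (fun p _ => g • p) hS
      (fun p q _ _ h => smul_left_cancel g h) le_rfl b hb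
    exact ⟨a, ha, h.symm⟩
  conv_lhs => rw [h1]
  rw [map_prod, Finset.prod_congr rfl fun p _ => h p, Finset.prod_mul_distrib, ← map_prod]
  rfl

theorem eval_smul_rep_eq_zero {f : Poly} {d : ℕ} (hf : f.IsHomogeneous d) (g : SL2) {c : ℂ}
    (hc : linSubst g.1 f = C c * f) {p : Point} (hp : eval p.rep f = 0) :
    eval (g • p).rep f = 0 := by
  obtain ⟨a, -, ha⟩ := exists_rep_smul g p
  rw [ha, eval_smul_of_isHomogeneous hf, ← eval_linSubst, hc, map_mul, hp, mul_zero, mul_zero]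

theorem exists_point_eval_eq_zero {f : Poly} {d : ℕ} (hf : f.IsHomogeneous d) (hd : d ≠ 0) : ∃ p :
    Point, eval p.rep f = 0 := by
  obtain ⟨w, hw, h⟩ := exists_zero_of_isHomogeneous hf hd
  obtain ⟨a, ha⟩ := Projectivization.exists_smul_eq_mk_rep ℂ w hw
  refine ⟨Projectivization.mk ℂ w hw, ?_⟩
  rw [← ha, Units.smul_def, eval_smul_of_isHomogeneous hf, h, mul_zero]

/-- The factor of semi-invariance of an orbit form at a group element fixing a point. -/
theorem orbitForm_factor_of_mem {S : Finset Point} {g : SL2} {c μ : ℂ} {p : Point} (hp : p ∈ S)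
    (hc : linSubst g.1 (orbitForm S) = C c * orbitForm S) (hμ : g.1.mulVec p.rep = μ • p.rep) :
    c * μ ^ 2 = μ ^ S.card := by
  classical
  have hS : orbitForm S = pointForm p * orbitForm (S.erase p) :=
    (Finset.mul_prod_erase S pointForm hp).symm
  have h1 : C μ * linSubst g.1 (pointForm p) = pointForm p := by
    have := linSubst_linForm g.1 p.rep
    rwa [hμ, linForm_smul, map_mul, g.2, map_one, one_mul, algHom_C, algebraMap_eq] at this
  have h2 : C (c * μ) * orbitForm (S.erase p) = linSubst g.1 (orbitForm (S.erase p)) := by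
    apply mul_left_cancel₀ (pointForm_prime p).ne_zero
    calc _ = C μ * (C c * (pointForm p * orbitForm (S.erase p))) := by rw [map_mul]; ring
      _ = C μ * linSubst g.1 (pointForm p) * linSubst g.1 (orbitForm (S.erase p)) := by
        rw [← hS, ← hc, hS, map_mul]; ring
      _ = _ := by rw [h1]
  have h3 := congrArg (eval p.rep) h2
  have h4 : eval p.rep (orbitForm (S.erase p)) ≠ 0 := by
    rw [Ne, eval_orbitForm_eq_zero_iff]
    exact Finset.notMem_erase p S
  rw [eval_linSubst, hμ, eval_smul_of_isHomogeneous (orbitForm_isHomogeneous _), map_mul,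
    eval_C] at h3
  have h5 := mul_right_cancel₀ h4 h3
  rw [pow_two, ← mul_assoc, h5, ← pow_succ, Finset.card_erase_add_one hp]

theorem orbitForm_factor_of_notMem {S : Finset Point} {g : SL2} {c μ : ℂ} {p : Point} (hp : p ∉ S)
    (hc : linSubst g.1 (orbitForm S) = C c * orbitForm S) (hμ : g.1.mulVec p.rep = μ • p.rep) :
    c = μ ^ S.card := by
  have h3 := congrArg (eval p.rep) hc
  have h4 : eval p.rep (orbitForm S) ≠ 0 := by rwa [Ne, eval_orbitForm_eq_zero_iff]
  rw [eval_linSubst, hμ, eval_smul_of_isHomogeneous (orbitForm_isHomogeneous _), map_mul,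
    eval_C] at h3
  exact (mul_right_cancel₀ h4 h3).symm

/-- The action of a polyhedral group on the projective line: three exceptional orbits `orb i`,
whose points have stabilizers of order `2 * e i`, all other orbits having `N` points. -/
structure PolyhedralData (Γ : Subgroup SL2) (e : Fin 3 → ℕ) (N : ℕ) where
  orb : Fin 3 → Finset Point
  stable : ∀ i, ∀ g ∈ Γ, ∀ p ∈ orb i, g • p ∈ orb i
  disj : ∀ i j, i ≠ j → Disjoint (orb i) (orb j)
  card_mul : ∀ i, (orb i).card * e i = N
  pos : 0 < N
  trans : ∀ i, ∀ p ∈ orb i, ∀ q ∈ orb i, ∃ g ∈ Γ, g • p = q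
  generic : ∀ p, (∀ i, p ∉ orb i) → ∃ S : Finset Point, S.card = N ∧ ∀ q ∈ S, ∃ g ∈ Γ, g • p = q
  fixes : ∀ g ∈ Γ, g = 1 ∨ g = -1 ∨ ∃ i, ∃ p ∈ orb i, g • p = p
  order : ∀ i, ∀ p ∈ orb i, ∀ g ∈ Γ, ∀ c : ℂ, g.1.mulVec p.rep = c • p.rep → c ^ (2 * e i) = 1
  prim : ∀ i, ∃ p ∈ orb i, ∃ g ∈ Γ, ∃ c : ℂ, g.1.mulVec p.rep = c • p.rep ∧
    IsPrimitiveRoot c (2 * e i)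

namespace PolyhedralData

variable {e : Fin 3 → ℕ} {N : ℕ} (D : PolyhedralData Γ e N)

theorem e_pos (D : PolyhedralData Γ e N) (i : Fin 3) : 0 < e i :=
  Nat.pos_of_ne_zero fun h => D.pos.ne' (by rw [← D.card_mul i, h, mul_zero])

theorem card_pos (D : PolyhedralData Γ e N) (i : Fin 3) : 0 < (D.orb i).card :=
  Nat.pos_of_ne_zero fun h => D.pos.ne' (by rw [← D.card_mul i, h, zero_mul])

/-- The form vanishing along an exceptional orbit. -/
noncomputable def form (i : Fin 3) : Poly := orbitForm (D.orb i)

theorem form_isHomogeneous (i : Fin 3) :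
    (D.form i).IsHomogeneous (D.orb i).card :=
  orbitForm_isHomogeneous _

theorem form_ne_zero (i : Fin 3) : D.form i ≠ 0 :=
  orbitForm_ne_zero _

theorem exists_char : ∃ χ : Fin 3 → SL2 → ℂ, ∀ i, ∀ g ∈ Γ, χ i g ≠ 0 ∧
    linSubst g.1 (D.form i) = C (χ i g) * D.form i := by
  have h : ∀ i (g : SL2), ∃ c : ℂ, g ∈ Γ →
      c ≠ 0 ∧ linSubst g.1 (D.form i) = C c * D.form i := fun i g => by
    by_cases hg : g ∈ Γ
    · obtain ⟨c, hc⟩ := linSubst_orbitForm g (D.stable i g hg)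
      exact ⟨c, fun _ => hc⟩
    · exact ⟨0, fun h => absurd h hg⟩
  choose χ hχ using h
  exact ⟨χ, hχ⟩

/-- The factors of semi-invariance of the exceptional forms. -/
noncomputable def char : Fin 3 → SL2 → ℂ := D.exists_char.choose

theorem char_ne_zero (i : Fin 3) {g : SL2} (hg : g ∈ Γ) :
    D.char i g ≠ 0 :=
  (D.exists_char.choose_spec i g hg).1

theorem linSubst_form (i : Fin 3) {g : SL2} (hg : g ∈ Γ) :
    linSubst g.1 (D.form i) = C (D.char i g) * D.form i :=
  (D.exists_char.choose_spec i g hg).2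

theorem eval_form_eq_zero_iff (i : Fin 3) (p : Point) :
    eval p.rep (D.form i) = 0 ↔ p ∈ D.orb i :=
  eval_orbitForm_eq_zero_iff

theorem notMem_of_mem {i j : Fin 3} (hij : i ≠ j) {p : Point}
    (hp : p ∈ D.orb i) : p ∉ D.orb j :=
  Finset.disjoint_left.mp (D.disj i j hij) hp

theorem char_mul_of_mem (i j : Fin 3) {g : SL2} (hg : g ∈ Γ) {p : Point}
    (hp : p ∈ D.orb j) {μ : ℂ} (hμ : g.1.mulVec p.rep = μ • p.rep) :
    D.char i g * μ ^ (if i = j then 2 else 0) = μ ^ (D.orb i).card := by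
  split_ifs with hij
  · subst hij
    exact orbitForm_factor_of_mem hp (D.linSubst_form i hg) hμ
  · rw [pow_zero, mul_one]
    exact orbitForm_factor_of_notMem (D.notMem_of_mem (Ne.symm hij) hp) (D.linSubst_form i hg) hμ

theorem exists_eigenvalue {g : SL2} (hg : g ∈ Γ) : ∃ (j : Fin 3) (μ : ℂ),
    μ ≠ 0 ∧ μ ^ (2 * e j) = 1 ∧ ∀ i,
    D.char i g * μ ^ (if i = j then 2 else 0) = μ ^ (D.orb i).card := by
  have central : ∀ μ : ℂ, μ ^ 2 = 1 → (∀ w, g.1.mulVec w = μ • w) →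
      ∃ (j : Fin 3) (μ : ℂ), μ ≠ 0 ∧ μ ^ (2 * e j) = 1 ∧
      ∀ i, D.char i g * μ ^ (if i = j then 2 else 0) = μ ^ (D.orb i).card := fun μ hμ hw => by
    refine ⟨0, μ, ?_, by rw [pow_mul, hμ, one_pow], fun i => ?_⟩
    · rintro rfl
      norm_num at hμ
    · obtain ⟨p, hp⟩ := Finset.card_pos.mp (D.card_pos i)
      have h1 := D.char_mul_of_mem i i hg hp (hw p.rep)
      rw [if_pos rfl, hμ, mul_one] at h1
      split_ifs <;> simp [hμ, h1]
  rcases D.fixes g hg with rfl | rfl | ⟨j, p, hp, hfix⟩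
  · exact central 1 (by norm_num) (by simp)
  · exact central (-1) (by norm_num) (by simp [Matrix.neg_mulVec])
  · obtain ⟨μ, hμ⟩ := (smul_eq_iff_exists g p).mp hfix
    refine ⟨j, μ, ?_, D.order j p hp g hg μ hμ, fun i => D.char_mul_of_mem i j hg hp hμ⟩
    rintro rfl
    have := D.order j p hp g hg 0 hμ
    rw [zero_pow (by have := D.e_pos j; omega)] at this
    exact zero_ne_one this

/-- Monomials in the exceptional forms. -/
noncomputable def mono (a : Fin 3 → ℕ) : Poly := ∏ i, D.form i ^ a i

theorem linSubst_mono (a : Fin 3 → ℕ) {g : SL2} (hg : g ∈ Γ) :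
    linSubst g.1 (D.mono a) = C (∏ i, D.char i g ^ a i) * D.mono a := by
  rw [mono, map_prod, map_prod, ← Finset.prod_mul_distrib]
  refine Finset.prod_congr rfl fun i _ => ?_
  rw [map_pow, D.linSubst_form i hg, mul_pow, map_pow]

theorem prod_char_mul (a : Fin 3 → ℕ) {g : SL2} {j : Fin 3} {μ : ℂ}
    (h : ∀ i, D.char i g * μ ^ (if i = j then 2 else 0) = μ ^ (D.orb i).card) :
    (∏ i, D.char i g ^ a i) * μ ^ (2 * a j) = μ ^ (∑ i, a i * (D.orb i).card) := by
  have h1 : μ ^ (2 * a j) = ∏ i, (μ ^ (if i = j then 2 else 0)) ^ a i := by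
    rw [Finset.prod_eq_single j]
    · rw [if_pos rfl, pow_mul]
    · intro i _ hij
      rw [if_neg hij, pow_zero, one_pow]
    · simp
  rw [h1, ← Finset.prod_mul_distrib, ← Finset.prod_pow_eq_pow_sum]
  refine Finset.prod_congr rfl fun i _ => ?_
  rw [← mul_pow, h, ← pow_mul, mul_comm]

/-- The condition for a monomial in the exceptional forms to be invariant. -/
def IsInvariantExponent (a : Fin 3 → ℕ) : Prop :=
  ∀ j, (2 * e j : ℤ) ∣ (∑ i, a i * (D.orb i).card : ℕ) - 2 * a j

theorem isInvariantExponent_of {a : Fin 3 → ℕ}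
    (h : ∀ g ∈ Γ, ∏ i, D.char i g ^ a i = 1) : D.IsInvariantExponent a := fun j => by
  obtain ⟨p, hp, g, hg, μ, hμ, hprim⟩ := D.prim j
  have h1 := D.prod_char_mul a fun i => D.char_mul_of_mem i j hg hp hμ
  rw [h g hg, one_mul] at h1
  have hμ0 : μ ≠ 0 := hprim.ne_zero (by have := D.e_pos j; omega)
  have := (hprim.zpow_eq_one_iff_dvd ((∑ i, a i * (D.orb i).card : ℕ) - (2 * a j : ℕ))).mp (by
    rw [zpow_sub₀ hμ0, zpow_natCast, zpow_natCast, h1, div_self (pow_ne_zero _ hμ0)])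
  exact_mod_cast this

theorem mono_mem_invariants {a : Fin 3 → ℕ} (h : D.IsInvariantExponent a)
    : D.mono a ∈ invariants Γ := fun g hg => by
  obtain ⟨j, μ, hμ0, hμ1, hj⟩ := D.exists_eigenvalue hg
  have h1 := D.prod_char_mul a hj
  have h2 : μ ^ (∑ i, a i * (D.orb i).card) = μ ^ (2 * a j) := by
    obtain ⟨k, hk⟩ := h j
    have h3 : ((∑ i, a i * (D.orb i).card : ℕ) : ℤ) = ((2 * e j : ℕ) : ℤ) * k + (2 * a j : ℕ) := by
      push_cast at hk ⊢
      linarith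
    rw [← zpow_natCast, h3, zpow_add₀ hμ0, zpow_mul, zpow_natCast, hμ1, one_zpow, one_mul,
      zpow_natCast]
  rw [h2] at h1
  rw [D.linSubst_mono a hg, mul_right_cancel₀ (pow_ne_zero _ hμ0) (h1.trans (one_mul _).symm),
    map_one, one_mul]

theorem char_pow_eq (i j : Fin 3) {g : SL2} (hg : g ∈ Γ) :
    D.char i g ^ e i = D.char j g ^ e j := by
  obtain ⟨k, μ, hμ0, hμ1, h⟩ := D.exists_eigenvalue hg
  have key : ∀ i, D.char i g ^ e i = μ ^ N := fun i => by
    have h1 := congrArg (· ^ e i) (h i)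
    simp only [mul_pow] at h1
    rw [← pow_mul μ (D.orb i).card, D.card_mul i, ← pow_mul] at h1
    split_ifs at h1 with hik
    · rw [hik, hμ1, mul_one] at h1
      rw [hik, h1]
    · simpa using h1
  rw [key, key]

/-- The span of the monomials in the exceptional forms with a given factor of semi-invariance. -/
noncomputable def monoSpan (ψ : SL2 → ℂ) : Submodule ℂ Poly :=
  Submodule.span ℂ {m | ∃ a, m = D.mono a ∧ ∀ g ∈ Γ, ∏ i, D.char i g ^ a i = ψ g}

theorem mono_mul_mem_monoSpan (b : Fin 3 → ℕ) {ψ ψ' : SL2 → ℂ}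
    (h : ∀ g ∈ Γ, ψ' g = (∏ i, D.char i g ^ b i) * ψ g) {f : Poly} (hf : f ∈ D.monoSpan ψ) :
    D.mono b * f ∈ D.monoSpan ψ' := by
  unfold monoSpan at hf
  induction hf using Submodule.span_induction with
  | mem f hf =>
    obtain ⟨a, rfl, ha⟩ := hf
    refine Submodule.subset_span ⟨b + a, ?_, fun g hg => ?_⟩
    · simp only [mono, ← Finset.prod_mul_distrib, Pi.add_apply, pow_add]
    · rw [h g hg, ← ha g hg, ← Finset.prod_mul_distrib]
      simp only [Pi.add_apply, pow_add]
  | zero =>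
    rw [mul_zero]
    exact Submodule.zero_mem _
  | add f g _ _ hf hg =>
    rw [mul_add]
    exact Submodule.add_mem _ hf hg
  | smul c f _ hf =>
    rw [mul_smul_comm]
    exact Submodule.smul_mem _ c hf

theorem mono_single (i : Fin 3) (k : ℕ) :
    D.mono (Pi.single i k) = D.form i ^ k := by
  rw [mono, Finset.prod_eq_single i]
  · rw [Pi.single_eq_same]
  · intro j _ hj
    rw [Pi.single_eq_of_ne hj, pow_zero]
  · simp

theorem prod_char_single (i : Fin 3) (k : ℕ) (g : SL2) : ∏ j,
    D.char j g ^ (Pi.single i k : Fin 3 → ℕ) j = D.char i g ^ k := by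
  rw [Finset.prod_eq_single i]
  · rw [Pi.single_eq_same]
  · intro j _ hj
    rw [Pi.single_eq_of_ne hj, pow_zero]
  · simp

theorem pow_form_isHomogeneous (i : Fin 3) :
    (D.form i ^ e i).IsHomogeneous N := by
  have := (D.form_isHomogeneous i).pow (e i)
  rwa [D.card_mul] at this

theorem pencil_isHomogeneous (α β : ℂ) :
    (C α * D.form 0 ^ e 0 + C β * D.form 1 ^ e 1).IsHomogeneous N :=
  ((D.pow_form_isHomogeneous 0).C_mul α).add ((D.pow_form_isHomogeneous 1).C_mul β)

theorem linSubst_pencil (α β : ℂ) {g : SL2} (hg : g ∈ Γ) : linSubst g.1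
    (C α * D.form 0 ^ e 0 + C β * D.form 1 ^ e 1) = C (D.char 0 g ^ e 0) *
    (C α * D.form 0 ^ e 0 + C β * D.form 1 ^ e 1) := by
  have h1 : linSubst g.1 (D.form 1 ^ e 1) = C (D.char 0 g ^ e 0) * D.form 1 ^ e 1 := by
    rw [map_pow, D.linSubst_form 1 hg, mul_pow, ← map_pow, D.char_pow_eq 0 1 hg]
  have h0 : linSubst g.1 (D.form 0 ^ e 0) = C (D.char 0 g ^ e 0) * D.form 0 ^ e 0 := by
    rw [map_pow, D.linSubst_form 0 hg, mul_pow, ← map_pow]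
  rw [map_add, map_mul, map_mul, h1, h0, algHom_C, algHom_C, algebraMap_eq]
  ring

theorem quotient_semiInvariant {G q : Poly} (hG : G ≠ 0) {g : SL2} {a b : ℂ} (ha : a ≠ 0)
    (h : linSubst g.1 G = C a * G) (h' : linSubst g.1 (G * q) = C b * (G * q)) :
    linSubst g.1 q = C (b / a) * q := by
  rw [map_mul, h] at h'
  apply mul_left_cancel₀ (mul_ne_zero (C_ne_zero.mpr ha) hG)
  rw [h']
  have : C b = (C a * C (b / a) : Poly) := by rw [← map_mul, mul_div_cancel₀ _ ha]
  rw [this]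
  ring

theorem form_dvd {f : Poly} {d : ℕ} (hf : f.IsHomogeneous d)
    {ψ : SL2 → ℂ} (hψ : ∀ g ∈ Γ, linSubst g.1 f = C (ψ g) * f) {i : Fin 3} {p : Point}
    (hp : p ∈ D.orb i) (h : eval p.rep f = 0) : D.form i ∣ f := by
  refine orbitForm_dvd hf fun q hq => ?_
  obtain ⟨g, hg, rfl⟩ := D.trans i p hp q hq
  exact eval_smul_rep_eq_zero hf g (hψ g hg) h

theorem le_of_dvd {F f : Poly} {d : ℕ} (hF : F.IsHomogeneous m) (hf : f.IsHomogeneous d)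
    (hf0 : f ≠ 0) (h : F ∣ f) : m ≤ d := by
  have h0 : F ≠ 0 := by
    rintro rfl
    exact hf0 (zero_dvd_iff.mp h)
  rw [← hF.totalDegree h0, ← hf.totalDegree hf0]
  obtain ⟨q, rfl⟩ := h
  rw [totalDegree_mul_of_isDomain h0 (right_ne_zero_of_mul hf0)]
  exact Nat.le_add_right _ _

theorem mem_monoSpan {d : ℕ} : ∀ {f : Poly}, f.IsHomogeneous d →
    ∀ {ψ : SL2 → ℂ}, (∀ g ∈ Γ, linSubst g.1 f = C (ψ g) * f) → f ∈ D.monoSpan ψ := by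
  induction d using Nat.strong_induction_on with
  | _ d ih =>
    intro f hf ψ hψ
    rcases eq_or_ne f 0 with rfl | hf0
    · exact Submodule.zero_mem _
    rcases Nat.eq_zero_or_pos d with rfl | hd
    · obtain ⟨c, rfl⟩ : ∃ c, f = C c :=
        ⟨_, totalDegree_eq_zero_iff_eq_C.mp (Nat.le_zero.mp hf.totalDegree_le)⟩
      have hc : c ≠ 0 := fun h => hf0 (by rw [h, map_zero])
      have : (C c : Poly) = c • D.mono 0 := by simp [mono, smul_eq_C_mul]
      rw [this]
      refine Submodule.smul_mem _ _ (Submodule.subset_span ⟨0, rfl, fun g hg => ?_⟩)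
      have h1 := hψ g hg
      rw [algHom_C, algebraMap_eq, ← map_mul] at h1
      simpa using mul_right_cancel₀ hc ((one_mul c).trans (C_injective _ _ h1))
    obtain ⟨p, hp⟩ := exists_point_eval_eq_zero hf hd.ne'
    by_cases hi : ∃ i, p ∈ D.orb i
    · obtain ⟨i, hi⟩ := hi
      have h1 := D.form_dvd hf hψ hi hp
      have h2 := le_of_dvd (D.form_isHomogeneous i) hf hf0 h1
      obtain ⟨k, rfl⟩ := Nat.exists_eq_add_of_le h2
      obtain ⟨q, hq, rfl⟩ := exists_homogeneous_quotient (D.form_isHomogeneous i) hf h1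
      have h3 := ih k (by have := D.card_pos i; omega) hq (ψ := fun g => ψ g / D.char i g)
        fun g hg => quotient_semiInvariant (D.form_ne_zero i) (D.char_ne_zero i hg)
          (D.linSubst_form i hg) (hψ g hg)
      have h4 := D.mono_mul_mem_monoSpan (Pi.single i 1) (ψ' := ψ) (fun g hg => by
        rw [D.prod_char_single, pow_one, mul_div_cancel₀ _ (D.char_ne_zero i hg)]) h3
      rwa [D.mono_single, pow_one] at h4
    · push Not at hi
      obtain ⟨S, hS, hSp⟩ := D.generic p hi
      set α := eval p.rep (D.form 1 ^ e 1) with hα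
      set β := -eval p.rep (D.form 0 ^ e 0) with hβ
      have hβ0 : β ≠ 0 := by
        rw [hβ, neg_ne_zero, map_pow]
        exact pow_ne_zero _ ((D.eval_form_eq_zero_iff 0 p).not.mpr (hi 0))
      set G := C α * D.form 0 ^ e 0 + C β * D.form 1 ^ e 1 with hG
      have hGp : eval p.rep G = 0 := by
        simp only [hG, map_add, map_mul, eval_C, hα, hβ]
        ring
      have hG0 : G ≠ 0 := fun h0 => by
        obtain ⟨q, hq⟩ := Finset.card_pos.mp (D.card_pos 0)
        have h1 := congrArg (eval q.rep) h0
        simp only [hG, map_add, map_mul, eval_C, map_pow, map_zero,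
          (D.eval_form_eq_zero_iff 0 q).mpr hq, zero_pow (D.e_pos 0).ne', mul_zero, zero_add] at h1
        exact mul_ne_zero hβ0 (pow_ne_zero _ ((D.eval_form_eq_zero_iff 1 q).not.mpr
          (D.notMem_of_mem (by decide) hq))) h1
      have hSG : ∀ {h : Poly} {k : ℕ} {φ : SL2 → ℂ}, h.IsHomogeneous k →
          (∀ g ∈ Γ, linSubst g.1 h = C (φ g) * h) → eval p.rep h = 0 → orbitForm S ∣ h := by
        intro h k φ hh hφ h0
        refine orbitForm_dvd hh fun q hq => ?_
        obtain ⟨g, hg, rfl⟩ := hSp q hq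
        exact eval_smul_rep_eq_zero hh g (hφ g hg) h0
      have hSN := orbitForm_isHomogeneous S
      rw [hS] at hSN
      have h1 : G ∣ f := by
        refine dvd_trans ?_ (hSG hf hψ hp)
        obtain ⟨c, hc, hc'⟩ := exists_homogeneous_quotient hSN (d := 0)
          (D.pencil_isHomogeneous α β)
          (hSG (D.pencil_isHomogeneous α β) (fun g hg => D.linSubst_pencil α β hg) hGp)
        obtain ⟨c, rfl⟩ : ∃ c', c = C c' :=
          ⟨_, totalDegree_eq_zero_iff_eq_C.mp (Nat.le_zero.mp hc.totalDegree_le)⟩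
        have hc0 : c ≠ 0 := by
          rintro rfl
          rw [map_zero, mul_zero] at hc'
          exact hG0 hc'
        refine ⟨C c⁻¹, ?_⟩
        rw [← hG] at hc'
        rw [hc', mul_assoc, ← map_mul, mul_inv_cancel₀ hc0, map_one, mul_one]
      have hGN : G.IsHomogeneous N := D.pencil_isHomogeneous α β
      obtain ⟨k, rfl⟩ := Nat.exists_eq_add_of_le (le_of_dvd hGN hf hf0 h1)
      obtain ⟨q, hq, rfl⟩ := exists_homogeneous_quotient hGN hf h1
      have h3 := ih k (by have := D.pos; omega) hq (ψ := fun g => ψ g / D.char 0 g ^ e 0)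
        fun g hg => quotient_semiInvariant hG0 (pow_ne_zero _ (D.char_ne_zero 0 hg))
          (D.linSubst_pencil α β hg) (hψ g hg)
      have h4 := D.mono_mul_mem_monoSpan (Pi.single 0 (e 0)) (ψ' := ψ) (fun g hg => by
        rw [D.prod_char_single, mul_div_cancel₀ _ (pow_ne_zero _ (D.char_ne_zero 0 hg))]) h3
      have h5 := D.mono_mul_mem_monoSpan (Pi.single 1 (e 1)) (ψ' := ψ) (fun g hg => by
        rw [D.prod_char_single, D.char_pow_eq 1 0 hg,
          mul_div_cancel₀ _ (pow_ne_zero _ (D.char_ne_zero 0 hg))]) h3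
      rw [D.mono_single] at h4 h5
      have : G * q = α • (D.form 0 ^ e 0 * q) + β • (D.form 1 ^ e 1 * q) := by
        rw [hG, smul_eq_C_mul, smul_eq_C_mul]
        ring
      rw [this]
      exact Submodule.add_mem _ (Submodule.smul_mem _ _ h4) (Submodule.smul_mem _ _ h5)

/-- Invariants are polynomials in the invariant monomials in the exceptional forms. -/
theorem invariants_le (A : Subalgebra ℂ Poly)
    (hA : ∀ a, D.IsInvariantExponent a → D.mono a ∈ A) : invariants Γ ≤ A := fun f hf => by
  rw [← sum_homogeneousComponent f]
  refine Subalgebra.sum_mem _ fun d _ => ?_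
  have h1 := D.mem_monoSpan (homogeneousComponent_isHomogeneous d f) (ψ := fun _ => 1)
    fun g hg => by
      rw [map_one, one_mul]
      exact homogeneousComponent_mem_invariants hf d g hg
  have h2 : D.monoSpan (fun _ => 1) ≤ Subalgebra.toSubmodule A := by
    refine Submodule.span_le.mpr ?_
    rintro _ ⟨a, rfl, ha⟩
    exact hA a (D.isInvariantExponent_of ha)
  exact h2 h1

theorem eq_pow_form {d : ℕ} (hd : d < N) : ∀ {f : Poly},
    f.IsHomogeneous d → f ≠ 0 → ∀ {ψ : SL2 → ℂ}, (∀ g ∈ Γ, linSubst g.1 f = C (ψ g) * f) →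
    (∀ p ∈ D.orb 0, eval p.rep f ≠ 0) → (∀ p ∈ D.orb 1, eval p.rep f ≠ 0) → ∃ (m : ℕ) (c : ℂ),
    f = C c * D.form 2 ^ m := by
  induction d using Nat.strong_induction_on with
  | _ d ih =>
    intro f hf hf0 ψ hψ h0 h1
    rcases Nat.eq_zero_or_pos d with rfl | hd'
    · exact ⟨0, _, by
        rw [pow_zero, mul_one]
        exact totalDegree_eq_zero_iff_eq_C.mp (Nat.le_zero.mp hf.totalDegree_le)⟩
    obtain ⟨p, hp⟩ := exists_point_eval_eq_zero hf hd'.ne'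
    by_cases h2 : p ∈ D.orb 2
    · have h3 := D.form_dvd hf hψ h2 hp
      obtain ⟨k, rfl⟩ := Nat.exists_eq_add_of_le (le_of_dvd (D.form_isHomogeneous 2) hf hf0 h3)
      obtain ⟨q, hq, rfl⟩ := exists_homogeneous_quotient (D.form_isHomogeneous 2) hf h3
      obtain ⟨m, c, rfl⟩ := ih k (by have := D.card_pos 2; omega) (by omega) hq
        (right_ne_zero_of_mul hf0) (ψ := fun g => ψ g / D.char 2 g)
        (fun g hg => quotient_semiInvariant (D.form_ne_zero 2) (D.char_ne_zero 2 hg)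
          (D.linSubst_form 2 hg) (hψ g hg))
        (fun p hp h => h0 p hp (by rw [map_mul, h, mul_zero]))
        (fun p hp h => h1 p hp (by rw [map_mul, h, mul_zero]))
      exact ⟨m + 1, c, by ring⟩
    · exfalso
      obtain ⟨S, hS, hSp⟩ := D.generic p (fun i => by
        fin_cases i
        · exact fun h => h0 p h hp
        · exact fun h => h1 p h hp
        · exact h2)
      have h3 : orbitForm S ∣ f := orbitForm_dvd hf fun q hq => by
        obtain ⟨g, hg, rfl⟩ := hSp q hq
        exact eval_smul_rep_eq_zero hf g (hψ g hg) hp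
      have := le_of_dvd (orbitForm_isHomogeneous S) hf hf0 h3
      omega

/-- The relation between the three exceptional forms. -/
theorem exists_relation : ∃ α β γ : ℂ, α ≠ 0 ∧ β ≠ 0 ∧ γ ≠ 0 ∧
    C α * D.form 0 ^ e 0 + C β * D.form 1 ^ e 1 = C γ * D.form 2 ^ e 2 := by
  have nz : ∀ i j, i ≠ j → ∀ p ∈ D.orb i, eval p.rep (D.form j ^ e j) ≠ 0 := fun i j hij p hp => by
    rw [map_pow]
    exact pow_ne_zero _ ((D.eval_form_eq_zero_iff j p).not.mpr (D.notMem_of_mem hij hp))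
  have z : ∀ i, ∀ p ∈ D.orb i, eval p.rep (D.form i ^ e i) = 0 := fun i p hp => by
    rw [map_pow, (D.eval_form_eq_zero_iff i p).mpr hp, zero_pow (D.e_pos i).ne']
  obtain ⟨p, hp⟩ := Finset.card_pos.mp (D.card_pos 2)
  set α := eval p.rep (D.form 1 ^ e 1) with hα
  set β := -eval p.rep (D.form 0 ^ e 0) with hβ
  have hα0 : α ≠ 0 := nz 2 1 (by decide) p hp
  have hβ0 : β ≠ 0 := neg_ne_zero.mpr (nz 2 0 (by decide) p hp)
  set G := C α * D.form 0 ^ e 0 + C β * D.form 1 ^ e 1 with hG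
  have hGN : G.IsHomogeneous N := D.pencil_isHomogeneous α β
  have hGN' := hGN
  have hG0 : ∀ q ∈ D.orb 0, eval q.rep G ≠ 0 := fun q hq => by
    rw [hG, map_add, map_mul, map_mul, z 0 q hq, mul_zero, zero_add, eval_C]
    exact mul_ne_zero hβ0 (nz 0 1 (by decide) q hq)
  have hG1 : ∀ q ∈ D.orb 1, eval q.rep G ≠ 0 := fun q hq => by
    rw [hG, map_add, map_mul, map_mul, z 1 q hq, mul_zero, add_zero, eval_C]
    exact mul_ne_zero hα0 (nz 1 0 (by decide) q hq)
  have hGp : eval p.rep G = 0 := by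
    simp only [hG, map_add, map_mul, eval_C, hα, hβ]
    ring
  have hne : G ≠ 0 := fun h => by
    obtain ⟨q, hq⟩ := Finset.card_pos.mp (D.card_pos 0)
    exact hG0 q hq (by rw [h, map_zero])
  have h3 := D.form_dvd hGN (fun g hg => D.linSubst_pencil α β hg) hp hGp
  obtain ⟨k, hk⟩ := Nat.exists_eq_add_of_le (le_of_dvd (D.form_isHomogeneous 2) hGN hne h3)
  rw [hk] at hGN
  obtain ⟨q, hq, hGq⟩ := exists_homogeneous_quotient (D.form_isHomogeneous 2) hGN h3
  obtain ⟨m, c, rfl⟩ := D.eq_pow_form (by have := D.card_pos 2; omega) hq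
    (by rintro rfl; exact hne (by rw [hGq, mul_zero]))
    (ψ := fun g => D.char 0 g ^ e 0 / D.char 2 g)
    (fun g hg => quotient_semiInvariant (D.form_ne_zero 2) (D.char_ne_zero 2 hg)
      (D.linSubst_form 2 hg) (by rw [← hGq]; exact D.linSubst_pencil α β hg))
    (fun p hp h => hG0 p hp (by rw [hGq, map_mul, h, mul_zero]))
    (fun p hp h => hG1 p hp (by rw [hGq, map_mul, h, mul_zero]))
  have hc : c ≠ 0 := by
    rintro rfl
    exact hne (by rw [hGq, map_zero, zero_mul, mul_zero])
  have hGq' : G = C c * D.form 2 ^ (m + 1) := by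
    rw [hGq]
    ring
  have hm : m + 1 = e 2 := by
    have h1 := ((D.form_isHomogeneous 2).pow (m + 1)).C_mul c
    rw [← hGq'] at h1
    have h2 := h1.inj_right hGN' hne
    have h3 := D.card_mul 2
    exact Nat.eq_of_mul_eq_mul_left (D.card_pos 2) (h2.trans h3.symm)
  exact ⟨α, β, c, hα0, hβ0, hc, by rw [← hm, ← hGq']⟩

end PolyhedralData

theorem generate_of_le (h : invariants Γ ≤ adjoin ℂ {(x : Poly), (y : Poly), (z : Poly)}) :
    Generate x y z := by
  have h1 : (adjoin ℂ {x, y, z}).map (invariants Γ).val =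
      adjoin ℂ {(x : Poly), (y : Poly), (z : Poly)} := by
    rw [AlgHom.map_adjoin]
    congr 1
    simp [Set.image_insert_eq]
  rw [Generate, eq_top_iff]
  intro f _
  have h2 := h f.2
  rw [← h1] at h2
  obtain ⟨g, hg, hgf⟩ := h2
  rwa [← Subtype.ext hgf]

theorem C_mul_mem {A : Subalgebra ℂ Poly} (c : ℂ) (f : Poly) (hf : f ∈ A) : C c * f ∈ A :=
  mul_mem (A.algebraMap_mem c) hf

theorem mem_of_C_mul_mem {A : Subalgebra ℂ Poly} {c : ℂ} (hc : c ≠ 0) {f : Poly} (h : C c * f ∈ A) :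
    f ∈ A := by
  have h1 := A.smul_mem h c⁻¹
  rwa [smul_eq_C_mul, ← mul_assoc, ← map_mul, inv_mul_cancel₀ hc, map_one, one_mul] at h1

theorem isUnit_C {c : ℂ} (hc : c ≠ 0) : IsUnit (C c : Poly) :=
  (isUnit_iff_ne_zero.mpr hc).map C

theorem isRelPrime_C_mul {a b : ℂ} (ha : a ≠ 0) (hb : b ≠ 0) {f g : Poly} (h : IsRelPrime f g) :
    IsRelPrime (C a * f) (C b * g) :=
  (isRelPrime_mul_unit_left_left (isUnit_C ha)).mpr
    ((isRelPrime_mul_unit_left_right (isUnit_C hb)).mpr h)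

namespace PolyhedralData

variable {e : Fin 3 → ℕ} {N : ℕ}

theorem card_eq (D : PolyhedralData Γ e N) {i : Fin 3} {c : ℕ} (h : c * e i = N) :
    (D.orb i).card = c :=
  Nat.eq_of_mul_eq_mul_right (D.e_pos i) ((D.card_mul i).trans h.symm)

theorem isRelPrime_form (D : PolyhedralData Γ e N) {i j : Fin 3}
    (hij : i ≠ j) : IsRelPrime (D.form i) (D.form j) :=
  isRelPrime_orbitForm (D.disj i j hij)

theorem mono_eq (D : PolyhedralData Γ e N) (a : Fin 3 → ℕ) :
    D.mono a = D.form 0 ^ a 0 * D.form 1 ^ a 1 * D.form 2 ^ a 2 :=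
  Fin.prod_univ_three _

theorem isInvariantExponent_iff (D : PolyhedralData Γ e N) (a : Fin 3 → ℕ) :
    D.IsInvariantExponent a ↔ ∀ j, (2 * e j : ℤ) ∣
    (a 0 * (D.orb 0).card + a 1 * (D.orb 1).card + a 2 * (D.orb 2).card) - 2 * a j := by
  simp [IsInvariantExponent, Fin.sum_univ_three]

theorem exists_isE8 (D : PolyhedralData Γ ![2, 3, 5] 60) : ∃ x y z : invariants Γ, IsE8 x y z := by
  have c0 : (D.orb 0).card = 30 := D.card_eq rfl
  have c1 : (D.orb 1).card = 20 := D.card_eq rfl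
  have c2 : (D.orb 2).card = 12 := D.card_eq rfl
  have h0 := c0 ▸ D.form_isHomogeneous 0
  have h1 := c1 ▸ D.form_isHomogeneous 1
  have h2 := c2 ▸ D.form_isHomogeneous 2
  have inv : ∀ i, D.form i ∈ invariants Γ := fun i => by
    have h : D.IsInvariantExponent (Pi.single i 1) := by
      rw [isInvariantExponent_iff, c0, c1, c2]
      intro j
      fin_cases i <;> fin_cases j <;> simp
    have := D.mono_mem_invariants h
    rwa [D.mono_single, pow_one] at this
  obtain ⟨α, β, γ, hα, hβ, hγ, hrel⟩ := D.exists_relation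
  simp only [cons_val_zero, cons_val_one, Matrix.cons_val] at hrel
  obtain ⟨r, hr0, hr⟩ := exists_root 2 hα
  obtain ⟨s, hs0, hs⟩ := exists_root 3 hβ
  obtain ⟨t, ht0, ht⟩ := exists_root 5 (neg_ne_zero.mpr hγ)
  have m : ∀ c i, C c * D.form i ∈ invariants Γ := fun c i => C_mul_mem c _ (inv i)
  refine ⟨⟨_, m t 2⟩, ⟨_, m s 1⟩, ⟨_, m r 0⟩, ⟨h2.C_mul t, h1.C_mul s, h0.C_mul r, ?_, ?_⟩, ?_⟩
  · apply generate_of_le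
    set A := adjoin ℂ {C t * D.form 2, C s * D.form 1, C r * D.form 0} with hA
    refine D.invariants_le A fun a _ => ?_
    rw [mono_eq]
    exact mul_mem (mul_mem (pow_mem (mem_of_C_mul_mem hr0 (subset_adjoin (by simp))) _)
      (pow_mem (mem_of_C_mul_mem hs0 (subset_adjoin (by simp))) _))
      (pow_mem (mem_of_C_mul_mem ht0 (subset_adjoin (by simp))) _)
  · exact isRelPrime_C_mul ht0 hs0
      (D.isRelPrime_form (by decide))
  · apply Subtype.ext
    change (C r * D.form 0) ^ 2 + (C s * D.form 1) ^ 3 + (C t * D.form 2) ^ 5 = (0 : Poly)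
    rw [mul_pow, mul_pow, mul_pow, ← map_pow, ← map_pow, ← map_pow, hr, hs, ht, map_neg]
    linear_combination hrel

theorem exists_isE7 (D : PolyhedralData Γ ![2, 3, 4] 24) : ∃ x y z : invariants Γ, IsE7 x y z := by
  have c0 : (D.orb 0).card = 12 := D.card_eq rfl
  have c1 : (D.orb 1).card = 8 := D.card_eq rfl
  have c2 : (D.orb 2).card = 6 := D.card_eq rfl
  have h0 := c0 ▸ D.form_isHomogeneous 0
  have h1 := c1 ▸ D.form_isHomogeneous 1
  have h2 := c2 ▸ D.form_isHomogeneous 2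
  have inv : ∀ i j k : ℕ, i % 2 = k % 2 →
      D.form 0 ^ i * D.form 1 ^ j * D.form 2 ^ k ∈ invariants Γ := fun i j k hik => by
    refine D.mono_eq ![i, j, k] ▸ D.mono_mem_invariants ?_
    rw [isInvariantExponent_iff, c0, c1, c2]
    intro l
    fin_cases l <;> simp <;> omega
  obtain ⟨α, β, γ, hα, hβ, hγ, hrel⟩ := D.exists_relation
  simp only [cons_val_zero, cons_val_one, Matrix.cons_val] at hrel
  obtain ⟨r, hr0, hr⟩ := exists_root 2 hα
  obtain ⟨s, hs0, hs⟩ := exists_root 3 (neg_ne_zero.mpr hγ)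
  obtain ⟨t, ht0, ht⟩ := exists_root 3 (div_ne_zero hβ hs0)
  have hst : s * t ^ 3 = β := by rw [ht, mul_div_cancel₀ _ hs0]
  have mx := C_mul_mem t (D.form 1) (by simpa using inv 0 1 0 rfl)
  have my := C_mul_mem s (D.form 2 ^ 2) (by simpa using inv 0 0 2 rfl)
  have mz := C_mul_mem r (D.form 0 * D.form 2) (by simpa using inv 1 0 1 rfl)
  refine ⟨⟨_, mx⟩, ⟨_, my⟩, ⟨_, mz⟩, ⟨h1.C_mul t, (h2.pow 2).C_mul s, (h0.mul h2).C_mul r,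
    ?_, ?_⟩, ?_⟩
  · apply generate_of_le
    set A := adjoin ℂ {C t * D.form 1, C s * D.form 2 ^ 2, C r * (D.form 0 * D.form 2)}
      with hA
    have a1 : D.form 1 ∈ A := mem_of_C_mul_mem ht0 (subset_adjoin (by simp))
    have a2 : D.form 2 ^ 2 ∈ A := mem_of_C_mul_mem hs0 (subset_adjoin (by simp))
    have a02 : D.form 0 * D.form 2 ∈ A := mem_of_C_mul_mem hr0 (subset_adjoin (by simp))
    have a0 : D.form 0 ^ 2 ∈ A := by
      refine mem_of_C_mul_mem hα ?_
      have : C α * D.form 0 ^ 2 = C γ * (D.form 2 ^ 2) ^ 2 - C β * D.form 1 ^ 3 := by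
        linear_combination hrel
      rw [this]
      exact sub_mem (mul_mem (A.algebraMap_mem γ) (pow_mem a2 2))
        (mul_mem (A.algebraMap_mem β) (pow_mem a1 3))
    refine D.invariants_le A fun a ha => ?_
    rw [isInvariantExponent_iff, c0, c1, c2] at ha
    have h3 : a 0 % 2 = a 2 % 2 := by have := ha 0; simp at this; omega
    rw [mono_eq]
    rcases Nat.mod_two_eq_zero_or_one (a 0) with h | h
    · obtain ⟨i, hi⟩ : ∃ i, a 0 = 2 * i := ⟨a 0 / 2, by omega⟩
      obtain ⟨k, hk⟩ : ∃ k, a 2 = 2 * k := ⟨a 2 / 2, by omega⟩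
      rw [hi, hk, pow_mul, pow_mul]
      exact mul_mem (mul_mem (pow_mem a0 _) (pow_mem a1 _)) (pow_mem a2 _)
    · obtain ⟨i, hi⟩ : ∃ i, a 0 = 2 * i + 1 := ⟨a 0 / 2, by omega⟩
      obtain ⟨k, hk⟩ : ∃ k, a 2 = 2 * k + 1 := ⟨a 2 / 2, by omega⟩
      have : D.form 0 ^ a 0 * D.form 1 ^ a 1 * D.form 2 ^ a 2 =
          (D.form 0 ^ 2) ^ i * D.form 1 ^ a 1 * (D.form 2 ^ 2) ^ k * (D.form 0 * D.form 2) := by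
        rw [hi, hk]
        ring
      rw [this]
      exact mul_mem (mul_mem (mul_mem (pow_mem a0 _) (pow_mem a1 _)) (pow_mem a2 _)) a02
  · exact isRelPrime_C_mul ht0 hs0
      (D.isRelPrime_form (by decide)).pow_right
  · apply Subtype.ext
    change (C r * (D.form 0 * D.form 2)) ^ 2 + C s * D.form 2 ^ 2 *
      ((C t * D.form 1) ^ 3 + (C s * D.form 2 ^ 2) ^ 2) = (0 : Poly)
    have e1 : C r ^ 2 = (C α : Poly) := by rw [← map_pow, hr]
    have e2 : C s ^ 3 = (-C γ : Poly) := by rw [← map_pow, hs, map_neg]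
    have e3 : C s * C t ^ 3 = (C β : Poly) := by rw [← map_pow, ← map_mul, hst]
    linear_combination D.form 2 ^ 2 * hrel + (D.form 0 * D.form 2) ^ 2 * e1 +
      D.form 2 ^ 6 * e2 + D.form 2 ^ 2 * D.form 1 ^ 3 * e3

theorem exists_isE6 (D : PolyhedralData Γ ![2, 3, 3] 12) : ∃ x y z : invariants Γ, IsE6 x y z := by
  have c0 : (D.orb 0).card = 6 := D.card_eq rfl
  have c1 : (D.orb 1).card = 4 := D.card_eq rfl
  have c2 : (D.orb 2).card = 4 := D.card_eq rfl
  have h0 := c0 ▸ D.form_isHomogeneous 0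
  have h1 := c1 ▸ D.form_isHomogeneous 1
  have h2 := c2 ▸ D.form_isHomogeneous 2
  have inv : ∀ i j k : ℕ, j % 3 = k % 3 →
      D.form 0 ^ i * D.form 1 ^ j * D.form 2 ^ k ∈ invariants Γ := fun i j k hik => by
    refine D.mono_eq ![i, j, k] ▸ D.mono_mem_invariants ?_
    rw [isInvariantExponent_iff, c0, c1, c2]
    intro l
    fin_cases l <;> simp <;> omega
  obtain ⟨α, β, γ, hα, hβ, hγ, hrel⟩ := D.exists_relation
  simp only [cons_val_zero, cons_val_one, Matrix.cons_val] at hrel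
  obtain ⟨t, ht0, ht⟩ := exists_root 2 hβ
  obtain ⟨s, hs0, hs⟩ := exists_root 3 (neg_ne_zero.mpr hγ)
  obtain ⟨r, hr0, hr⟩ := exists_root 2 (div_ne_zero hα ht0)
  have hrt : t * r ^ 2 = α := by rw [hr, mul_div_cancel₀ _ ht0]
  have mx := C_mul_mem r (D.form 0) (by simpa using inv 1 0 0 rfl)
  have my := C_mul_mem s (D.form 1 * D.form 2) (by simpa using inv 0 1 1 rfl)
  have mz := C_mul_mem t (D.form 1 ^ 3) (by simpa using inv 0 3 0 rfl)
  refine ⟨⟨_, mx⟩, ⟨_, my⟩, ⟨_, mz⟩, ⟨h0.C_mul r, (h1.mul h2).C_mul s, (h1.pow 3).C_mul t,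
    ?_, ?_⟩, ?_⟩
  · apply generate_of_le
    set A := adjoin ℂ {C r * D.form 0, C s * (D.form 1 * D.form 2), C t * D.form 1 ^ 3}
      with hA
    have a0 : D.form 0 ∈ A := mem_of_C_mul_mem hr0 (subset_adjoin (by simp))
    have a12 : D.form 1 * D.form 2 ∈ A := mem_of_C_mul_mem hs0 (subset_adjoin (by simp))
    have a1 : D.form 1 ^ 3 ∈ A := mem_of_C_mul_mem ht0 (subset_adjoin (by simp))
    have a2 : D.form 2 ^ 3 ∈ A := by
      refine mem_of_C_mul_mem hγ ?_
      rw [← hrel]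
      exact add_mem (mul_mem (A.algebraMap_mem α) (pow_mem a0 2))
        (mul_mem (A.algebraMap_mem β) a1)
    refine D.invariants_le A fun a ha => ?_
    rw [isInvariantExponent_iff, c0, c1, c2] at ha
    have h3 : a 1 % 3 = a 2 % 3 := by have := ha 1; simp at this; omega
    rw [mono_eq]
    obtain ⟨i, j, k, hi, hj⟩ : ∃ i j k, a 1 = 3 * i + k ∧ a 2 = 3 * j + k :=
      ⟨a 1 / 3, a 2 / 3, a 1 % 3, by omega, by omega⟩
    have : D.form 0 ^ a 0 * D.form 1 ^ a 1 * D.form 2 ^ a 2 =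
        D.form 0 ^ a 0 * (D.form 1 ^ 3) ^ i * (D.form 2 ^ 3) ^ j * (D.form 1 * D.form 2) ^ k := by
      rw [hi, hj]
      ring
    rw [this]
    exact mul_mem (mul_mem (mul_mem (pow_mem a0 _) (pow_mem a1 _)) (pow_mem a2 _)) (pow_mem a12 _)
  · exact isRelPrime_C_mul hr0 hs0
      ((D.isRelPrime_form (by decide)).mul_right (D.isRelPrime_form (by decide)))
  · apply Subtype.ext
    change (C t * D.form 1 ^ 3) ^ 2 + C t * D.form 1 ^ 3 * (C r * D.form 0) ^ 2 +
      (C s * (D.form 1 * D.form 2)) ^ 3 = (0 : Poly)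
    have e1 : C t ^ 2 = (C β : Poly) := by rw [← map_pow, ht]
    have e2 : C s ^ 3 = (-C γ : Poly) := by rw [← map_pow, hs, map_neg]
    have e3 : C t * C r ^ 2 = (C α : Poly) := by rw [← map_pow, ← map_mul, hrt]
    linear_combination D.form 1 ^ 3 * hrel + D.form 1 ^ 6 * e1 +
      (D.form 1 * D.form 2) ^ 3 * e2 + D.form 1 ^ 3 * D.form 0 ^ 2 * e3

end PolyhedralData

/-- The diagonal matrix `diag(c, c⁻¹)` in `SL₂(ℂ)`. -/
noncomputable def diagSL (c : ℂ) (hc : c ≠ 0) : SL2 :=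
  ⟨!![c, 0; 0, c⁻¹], by simp [det_fin_two, hc]⟩

theorem sl_ext {g h : SL2} (h00 : g.1 0 0 = h.1 0 0) (h01 : g.1 0 1 = h.1 0 1)
    (h10 : g.1 1 0 = h.1 1 0) (h11 : g.1 1 1 = h.1 1 1) : g = h := by
  apply Subtype.ext
  ext i j
  fin_cases i <;> fin_cases j <;> assumption

theorem exists_sl_first_column {w : Fin 2 → ℂ} (hw : w ≠ 0) : ∃ h : SL2, h.1 0 0 = w 0 ∧
    h.1 1 0 = w 1 := by
  by_cases h0 : w 0 = 0
  · have h1 : w 1 ≠ 0 := fun h1 => hw (by ext i; fin_cases i <;> assumption)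
    exact ⟨⟨!![w 0, -(w 1)⁻¹; w 1, 0], by simp [det_fin_two, h1]⟩, rfl, rfl⟩
  · exact ⟨⟨!![w 0, 0; w 1, (w 0)⁻¹], by simp [det_fin_two, h0]⟩, rfl, rfl⟩

theorem eq_upper_triangular {g : SL2} {w : Fin 2 → ℂ} {c : ℂ} (hc : g.1.mulVec w = c • w)
    {h : SL2} (h0 : h.1 0 0 = w 0) (h1 : h.1 1 0 = w 1) (hw : w ≠ 0) :
    c ≠ 0 ∧ ∃ b : ℂ, h⁻¹ * g * h = ⟨!![c, b; 0, c⁻¹], by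
      have hc0 : c ≠ 0 := by
        rintro rfl
        apply hw
        have := congrArg (g⁻¹).1.mulVec hc
        rwa [Matrix.mulVec_mulVec, ← sl_mul, inv_mul_cancel, sl_one, one_mulVec, zero_smul,
          Matrix.mulVec_zero] at this
      simp [det_fin_two, hc0]⟩ := by
  have hT0 : (h⁻¹ * g * h).1 0 0 = c ∧ (h⁻¹ * g * h).1 1 0 = 0 := by
    have e0 := congrFun hc 0
    have e1 := congrFun hc 1
    have hd := h.2
    rw [det_fin_two] at hd
    simp only [mulVec, dotProduct, Fin.sum_univ_two, Pi.smul_apply, smul_eq_mul,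
      ← h0, ← h1] at e0 e1
    constructor
    · simp only [sl_mul, Matrix.mul_apply, Fin.sum_univ_two,
        Matrix.SpecialLinearGroup.coe_inv, Matrix.adjugate_fin_two, of_apply,
        cons_val', cons_val_zero, cons_val_one, cons_val_fin_one]
      linear_combination h.1 1 1 * e0 - h.1 0 1 * e1 + c * hd
    · simp only [sl_mul, Matrix.mul_apply, Fin.sum_univ_two,
        Matrix.SpecialLinearGroup.coe_inv, Matrix.adjugate_fin_two, of_apply,
        cons_val', cons_val_zero, cons_val_one, cons_val_fin_one]
      linear_combination -h.1 1 0 * e0 + h.1 0 0 * e1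
  have hd := (h⁻¹ * g * h).2
  rw [det_fin_two, hT0.1, hT0.2, mul_zero, sub_zero] at hd
  have hc0 : c ≠ 0 := left_ne_zero_of_mul_eq_one hd
  exact ⟨hc0, (h⁻¹ * g * h).1 0 1, sl_ext hT0.1 rfl hT0.2
    (eq_inv_of_mul_eq_one_right hd)⟩

theorem upper_triangular_pow {T : SL2} {c b : ℂ} (hc : c ^ 2 = 1) (h00 : T.1 0 0 = c)
    (h01 : T.1 0 1 = b) (h10 : T.1 1 0 = 0) (h11 : T.1 1 1 = c) (n : ℕ) : (T ^ n).1 0 0 = c ^ n ∧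
    (T ^ n).1 0 1 = n * c ^ (n + 1) * b := by
  induction n with
  | zero => simp
  | succ n ih =>
    rw [pow_succ, sl_mul, Matrix.mul_apply, Matrix.mul_apply,
      Fin.sum_univ_two, Fin.sum_univ_two, h00, h01, h10, h11, ih.1, ih.2]
    refine ⟨by ring, ?_⟩
    push_cast
    linear_combination (-(c ^ n * b)) * hc

theorem eq_of_upper_triangular {g h : SL2} {c b : ℂ} (hc : c ^ 2 = 1) (hg : IsOfFinOrder g)
    (hd : (!![c, b; 0, c⁻¹] : Mat).det = 1) (hT : h⁻¹ * g * h = ⟨!![c, b; 0, c⁻¹], hd⟩) :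
    g.1 = c • (1 : Mat) := by
  have hc0 : c ≠ 0 := by rintro rfl; norm_num at hc
  have hinv : c⁻¹ = c := inv_eq_of_mul_eq_one_right (by rw [← pow_two, hc])
  obtain ⟨n, hn, hgn⟩ := isOfFinOrder_iff_pow_eq_one.mp hg
  have h1 : (h⁻¹ * g * h) ^ n = 1 := by
    have : h⁻¹ * g * h = MulAut.conj h⁻¹ g := by simp
    rw [this, ← map_pow, hgn, map_one]
  have h2 := (upper_triangular_pow (T := h⁻¹ * g * h) (c := c) (b := b) hc (by rw [hT]; rfl)
    (by rw [hT]; rfl) (by rw [hT]; rfl) (by rw [hT]; exact hinv) n).2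
  rw [h1] at h2
  have hb : b = 0 := by
    have h3 : (n : ℂ) * c ^ (n + 1) * b = 0 := h2.symm.trans (by simp)
    exact (mul_eq_zero.mp h3).resolve_left
      (mul_ne_zero (Nat.cast_ne_zero.mpr hn.ne') (pow_ne_zero _ hc0))
  have h3 : g = h * (h⁻¹ * g * h) * h⁻¹ := by group
  have h4 : (h⁻¹ * g * h).1 = c • (1 : Mat) := by
    subst hb
    rw [hT]
    ext i j
    fin_cases i <;> fin_cases j <;> simp [hinv]
  rw [h3, sl_mul, sl_mul, h4, Matrix.mul_smul, mul_one, Matrix.smul_mul, ← sl_mul,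
    mul_inv_cancel, sl_one]

theorem eq_one_of_eigenvalue_one {g : SL2} (hg : IsOfFinOrder g) {w : Fin 2 → ℂ} (hw : w ≠ 0)
    (h1 : g.1.mulVec w = w) : g = 1 := by
  obtain ⟨h, h0, h1'⟩ := exists_sl_first_column hw
  obtain ⟨-, b, hb⟩ := eq_upper_triangular (c := 1) (by rw [h1, one_smul]) h0 h1' hw
  apply Subtype.ext
  rw [eq_of_upper_triangular (one_pow 2) hg _ hb, one_smul, sl_one]

theorem sl_eq_one_or_neg_one {g : SL2} {c : ℂ} (h : g.1 = c • (1 : Mat)) : g = 1 ∨ g = -1 := by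
  have hd := g.2
  rw [h, Matrix.det_smul, Fintype.card_fin, Matrix.det_one, mul_one] at hd
  rcases sq_eq_one_cases hd with rfl | rfl
  · exact Or.inl (Subtype.ext (by rw [h]; simp))
  · exact Or.inr (Subtype.ext (by rw [h]; simp))

theorem exists_diagonalization {g : SL2} (hg : IsOfFinOrder g) (h1 : g ≠ 1) (h2 : g ≠ -1) :
    ∃ (h : SL2) (c : ℂ) (hc : c ≠ 0), c ^ 2 ≠ 1 ∧ h⁻¹ * g * h = diagSL c hc := by
  obtain ⟨s, hs⟩ := exists_pow_nat_eq ((g.1 0 0 + g.1 1 1) ^ 2 - 4) (n := 2)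
    (by norm_num)
  set c := (g.1 0 0 + g.1 1 1 + s) / 2 with hc
  have hd := g.2
  rw [det_fin_two] at hd
  have hdet : (g.1 - c • (1 : Mat)).det = 0 := by
    rw [det_fin_two]
    simp only [Matrix.sub_apply, Matrix.smul_apply, Matrix.one_apply_eq, smul_eq_mul, mul_one,
      Matrix.one_apply_ne (show (0 : Fin 2) ≠ 1 by decide),
      Matrix.one_apply_ne (show (1 : Fin 2) ≠ 0 by decide), mul_zero, sub_zero]
    rw [hc]
    linear_combination hd + hs / 4
  obtain ⟨w, hw, hw0⟩ := Matrix.exists_mulVec_eq_zero_iff.mpr hdet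
  rw [Matrix.sub_mulVec, Matrix.smul_mulVec, one_mulVec, sub_eq_zero] at hw0
  obtain ⟨h, h0, h1'⟩ := exists_sl_first_column hw
  obtain ⟨hc0, b, hb⟩ := eq_upper_triangular hw0 h0 h1' hw
  have hc1 : c ^ 2 ≠ 1 := fun hc1 => by
    rcases sl_eq_one_or_neg_one (eq_of_upper_triangular hc1 hg _ hb) with h | h
    · exact h1 h
    · exact h2 h
  have hc2 : c⁻¹ - c ≠ 0 := fun h => by
    apply hc1
    field_simp at h
    linear_combination -h
  let k : SL2 := ⟨!![1, b / (c⁻¹ - c); 0, 1], by simp [det_fin_two]⟩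
  refine ⟨h * k, c, hc0, hc1, ?_⟩
  have h3 : (h * k)⁻¹ * g * (h * k) = k⁻¹ * ((h⁻¹ * g * h) * k) := by group
  rw [h3, inv_mul_eq_iff_eq_mul, hb]
  apply Subtype.ext
  change !![c, b; 0, c⁻¹] * !![1, b / (c⁻¹ - c); 0, 1] =
    !![1, b / (c⁻¹ - c); 0, 1] * !![c, 0; 0, c⁻¹]
  rw [mul_fin_two, mul_fin_two]
  have h4 : c * (b / (c⁻¹ - c)) + b = b / (c⁻¹ - c) * c⁻¹ := by
    linear_combination (-1 : ℂ) * div_mul_cancel₀ b hc2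
  simp [h4]

theorem exists_fixed_points {g : SL2} (hg : IsOfFinOrder g) (h1 : g ≠ 1) (h2 : g ≠ -1) : ∃ p q :
    Point, p ≠ q ∧ ∀ r, g • r = r ↔ r = p ∨ r = q := by
  obtain ⟨h, c, hc, hc1, hD⟩ := exists_diagonalization hg h1 h2
  have fixD : ∀ w : Fin 2 → ℂ, ∀ hw : w ≠ 0,
      diagSL c hc • Projectivization.mk ℂ w hw = Projectivization.mk ℂ w hw ↔
        w 0 = 0 ∨ w 1 = 0 := fun w hw => by
    have e : diagSL c hc • Projectivization.mk ℂ w hw = Projectivization.mk ℂ w hw ↔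
        ∃ a : ℂ, a • w = (diagSL c hc).1.mulVec w := Projectivization.mk_eq_mk_iff' ℂ _ _ _ _
    rw [e]
    have h0 : (diagSL c hc).1.mulVec w 0 = c * w 0 := by simp [diagSL, mulVec, dotProduct]
    have h1 : (diagSL c hc).1.mulVec w 1 = c⁻¹ * w 1 := by simp [diagSL, mulVec, dotProduct]
    constructor
    · rintro ⟨a, ha⟩
      have e0 := congrFun ha 0
      have e1 := congrFun ha 1
      rw [h0, Pi.smul_apply, smul_eq_mul] at e0
      rw [h1, Pi.smul_apply, smul_eq_mul] at e1
      by_contra! hne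
      have f0 := mul_right_cancel₀ hne.1 e0
      have f1 := mul_right_cancel₀ hne.2 e1
      apply hc1
      rw [f0] at f1
      field_simp at f1
      exact f1
    · rintro (hw0 | hw0)
      · refine ⟨c⁻¹, ?_⟩
        ext i
        fin_cases i
        · simp only [Fin.zero_eta, Pi.smul_apply, smul_eq_mul, h0, hw0, mul_zero]
        · simp only [Fin.mk_one, Pi.smul_apply, smul_eq_mul, h1]
      · refine ⟨c, ?_⟩
        ext i
        fin_cases i
        · simp only [Fin.zero_eta, Pi.smul_apply, smul_eq_mul, h0]
        · simp only [Fin.mk_one, Pi.smul_apply, smul_eq_mul, h1, hw0, mul_zero]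
  let p₀ : Point := Projectivization.mk ℂ ![1, 0] (fun h => by simpa using congrFun h 0)
  let q₀ : Point := Projectivization.mk ℂ ![0, 1] (fun h => by simpa using congrFun h 1)
  have hpq : p₀ ≠ q₀ := fun h => by
    obtain ⟨a, ha⟩ := (Projectivization.mk_eq_mk_iff' ℂ _ _ _ _).mp h
    simpa using congrFun ha 0
  have fixD' : ∀ r : Point, diagSL c hc • r = r ↔ r = p₀ ∨ r = q₀ := fun r => by
    constructor
    · intro hr
      rw [← r.mk_rep, fixD] at hr
      rw [← r.mk_rep]
      rcases hr with hr | hr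
      · right
        rw [Projectivization.mk_eq_mk_iff']
        refine ⟨r.rep 1, ?_⟩
        ext i
        fin_cases i <;> simp [hr]
      · left
        rw [Projectivization.mk_eq_mk_iff']
        refine ⟨r.rep 0, ?_⟩
        ext i
        fin_cases i <;> simp [hr]
    · rintro (rfl | rfl)
      · exact (fixD _ _).mpr (Or.inr rfl)
      · exact (fixD _ _).mpr (Or.inl rfl)
  refine ⟨h • p₀, h • q₀, fun e => hpq (smul_left_cancel h e), fun r => ?_⟩
  rw [← inv_smul_eq_iff (g := h), ← inv_smul_eq_iff (g := h), ← fixD', ← hD, mul_smul, mul_smul,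
    smul_inv_smul, smul_left_cancel_iff]

theorem exists_eigenvalue_hom {G : Type*} [Group G] [Finite G] (ι : G →* SL2)
    (hι : Function.Injective ι) (p : Point) (hp : ∀ g, ι g • p = p) : ∃ φ : G →* ℂ,
    Function.Injective φ ∧ ∀ g, (ι g).1.mulVec p.rep = φ g • p.rep := by
  choose φ hφ using fun g => (smul_eq_iff_exists (ι g) p).mp (hp g)
  have inj : ∀ a b : ℂ, a • p.rep = b • p.rep → a = b := fun a b h =>
    smul_left_injective ℂ p.rep_nonzero h
  let Φ : G →* ℂ :=
    { toFun := φ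
      map_one' := inj _ _ (by rw [← hφ, map_one, sl_one, one_mulVec, one_smul])
      map_mul' := fun a b => inj _ _ (by
        rw [← hφ, map_mul, sl_mul, ← Matrix.mulVec_mulVec, hφ,
          Matrix.mulVec_smul, hφ, smul_smul, mul_comm]) }
  refine ⟨Φ, (injective_iff_map_eq_one Φ).mpr fun g hg => ?_, hφ⟩
  apply hι
  rw [map_one]
  refine eq_one_of_eigenvalue_one (MonoidHom.isOfFinOrder ι (isOfFinOrder_of_finite g)) p.rep_nonzero ?_
  have : φ g = 1 := hg
  rw [hφ, this, one_smul]

theorem sl_eq_neg_one_of_sq {g : SL2} (h : g ^ 2 = 1) (h1 : g ≠ 1) : g = -1 := by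
  have hd := g.2
  rw [det_fin_two] at hd
  have hg : ∀ i j, g.1 i 0 * g.1 0 j + g.1 i 1 * g.1 1 j = (1 : Mat) i j := fun i j => by
    rw [← Fin.sum_univ_two fun k => g.1 i k * g.1 k j, ← Matrix.mul_apply, ← sl_mul, ← pow_two, h]
    rfl
  have e00 := hg 0 0
  have e01 := hg 0 1
  have e10 := hg 1 0
  have e11 := hg 1 1
  simp only [Matrix.one_apply_eq, Matrix.one_apply_ne (show (0 : Fin 2) ≠ 1 by decide),
    Matrix.one_apply_ne (show (1 : Fin 2) ≠ 0 by decide)] at e00 e01 e10 e11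
  have ht : g.1 0 0 + g.1 1 1 ≠ 0 := fun ht => by
    have : (2 : ℂ) = 0 := by linear_combination (-1 : ℂ) * e00 - hd + g.1 0 0 * ht
    norm_num at this
  have f01 : g.1 0 1 = 0 := (mul_eq_zero.mp (by linear_combination e01 :
    (g.1 0 0 + g.1 1 1) * g.1 0 1 = 0)).resolve_left ht
  have f10 : g.1 1 0 = 0 := (mul_eq_zero.mp (by linear_combination e10 :
    (g.1 0 0 + g.1 1 1) * g.1 1 0 = 0)).resolve_left ht
  have f : g.1 0 0 = g.1 1 1 := by
    have : (g.1 0 0 + g.1 1 1) * (g.1 0 0 - g.1 1 1) = 0 := by linear_combination e00 - e11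
    exact sub_eq_zero.mp ((mul_eq_zero.mp this).resolve_left ht)
  refine (sl_eq_one_or_neg_one (c := g.1 0 0) ?_).resolve_left h1
  ext i j
  fin_cases i <;> fin_cases j <;> simp [f01, f10, f]

section

variable (Γ : Subgroup SL2)

/-- The elements `±1` of a group. -/
def centralPart : Subgroup Γ where
  carrier := {g | g.1 = 1 ∨ g.1 = -1}
  one_mem' := Or.inl rfl
  mul_mem' := by
    rintro a b (ha | ha) (hb | hb) <;> simp only [Set.mem_ofPred_eq, Subgroup.coe_mul, ha, hb] <;>
      simp
  inv_mem' := by rintro a (ha | ha) <;> simp only [Set.mem_ofPred_eq, Subgroup.coe_inv, ha] <;> simp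

theorem mem_centralPart {g : Γ} : g ∈ centralPart Γ ↔ g.1 = 1 ∨ g.1 = -1 := Iff.rfl

theorem neg_one_smul_point (p : Point) : (-1 : SL2) • p = p :=
  (smul_eq_iff_exists _ p).mpr ⟨-1, by simp [Matrix.neg_mulVec]⟩

theorem smul_eq_of_mem_centralPart {g : Γ} (hg : g ∈ centralPart Γ) (p : Point) : g • p = p := by
  rcases hg with hg | hg
  · change g.1 • p = p
    rw [hg, one_smul]
  · change g.1 • p = p
    rw [hg, neg_one_smul_point]

theorem centralPart_le (p : Point) : centralPart Γ ≤ stabilizer Γ p :=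
  fun _ hg => smul_eq_of_mem_centralPart Γ hg p

variable [Finite Γ]

/-- The orbit of a point under a finite group. -/
noncomputable def orbitFinset (p : Point) : Finset Point :=
  (show (MulAction.orbit Γ p).Finite from Set.finite_range fun g : Γ => g • p).toFinset

theorem mem_orbitFinset {p q : Point} : q ∈ orbitFinset Γ p ↔ ∃ g ∈ Γ, g • p = q := by
  rw [orbitFinset, Set.Finite.mem_toFinset, MulAction.mem_orbit_iff]
  exact ⟨fun ⟨g, hg⟩ => ⟨g.1, g.2, hg⟩, fun ⟨g, hg, h⟩ => ⟨⟨g, hg⟩, h⟩⟩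

theorem mem_orbitFinset_self (p : Point) : p ∈ orbitFinset Γ p :=
  (mem_orbitFinset Γ).mpr ⟨1, Γ.one_mem, one_smul _ p⟩

theorem orbitFinset_eq_iff {p q : Point} :
    orbitFinset Γ q = orbitFinset Γ p ↔ q ∈ orbitFinset Γ p := by
  constructor
  · intro h
    rw [← h]
    exact mem_orbitFinset_self Γ q
  · intro h
    have h1 : MulAction.orbit Γ q = MulAction.orbit Γ p :=
      MulAction.orbit_eq_iff.mpr ((Set.Finite.mem_toFinset _).mp h)
    ext r
    rw [orbitFinset, orbitFinset, Set.Finite.mem_toFinset, Set.Finite.mem_toFinset, h1]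

theorem card_orbitFinset_mul (p : Point) :
    (orbitFinset Γ p).card * Nat.card (stabilizer Γ p) = Nat.card Γ := by
  rw [← Nat.card_congr (MulAction.orbitProdStabilizerEquivGroup Γ p), Nat.card_prod,
    orbitFinset, ← Set.ncard_eq_toFinset_card (MulAction.orbit Γ p)
      (Set.finite_range fun g : Γ => g • p)]
  rfl

theorem isOfFinOrder_coe (g : Γ) : IsOfFinOrder g.1 :=
  MonoidHom.isOfFinOrder Γ.subtype (isOfFinOrder_of_finite g)

theorem ncard_fixed {g : Γ} (hg : g ∉ centralPart Γ) :
    {p : Point | g • p = p}.ncard = 2 := by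
  rw [mem_centralPart, not_or] at hg
  obtain ⟨p, q, hpq, h⟩ := exists_fixed_points (isOfFinOrder_coe Γ g) hg.1 hg.2
  have : {p : Point | g • p = p} = {p, q} := by
    ext r
    exact h r
  rw [this, Set.ncard_pair hpq]

theorem finite_exceptional : {p : Point | ∃ g : Γ, g ∉ centralPart Γ ∧ g • p = p}.Finite := by
  have : {p : Point | ∃ g : Γ, g ∉ centralPart Γ ∧ g • p = p} =
      ⋃ g : {g : Γ // g ∉ centralPart Γ}, {p : Point | g.1 • p = p} := by
    ext p
    simp
  rw [this]
  refine Set.finite_iUnion fun g => Set.finite_of_ncard_ne_zero ?_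
  rw [ncard_fixed Γ g.2]
  decide

/-- The points fixed by some noncentral element. -/
noncomputable def exceptional : Finset Point := (finite_exceptional Γ).toFinset

theorem mem_exceptional {p : Point} :
    p ∈ exceptional Γ ↔ ∃ g : Γ, g ∉ centralPart Γ ∧ g • p = p := by
  rw [exceptional, Set.Finite.mem_toFinset]
  rfl

theorem mem_exceptional_of_mem_orbit {p q : Point} (hp : p ∈ exceptional Γ)
    (hq : q ∈ orbitFinset Γ p) : q ∈ exceptional Γ := by
  obtain ⟨g, hg, rfl⟩ := (mem_orbitFinset Γ).mp hq
  obtain ⟨h, hh, hp⟩ := (mem_exceptional Γ).mp hp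
  let g' : Γ := ⟨g, hg⟩
  refine (mem_exceptional Γ).mpr ⟨g' * h * g'⁻¹, ?_, ?_⟩
  · intro hc
    apply hh
    have h1 : (g' * h * g'⁻¹).1 = g * h.1 * g⁻¹ := rfl
    rw [mem_centralPart, h1] at hc
    refine hc.imp (fun hc => ?_) fun hc => ?_
    · rwa [mul_inv_eq_one, mul_eq_left] at hc
    · rw [mul_inv_eq_iff_eq_mul, neg_one_mul, ← mul_neg_one] at hc
      exact mul_left_cancel hc
  · change (g' * h * g'⁻¹) • (g' • p) = g' • p
    rw [mul_smul, mul_smul, inv_smul_smul, hp]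

open Classical in
theorem sum_card_stabilizer :
    ∑ p ∈ exceptional Γ, Nat.card (stabilizer Γ p) =
      Nat.card (centralPart Γ) * (exceptional Γ).card +
        2 * (Nat.card Γ - Nat.card (centralPart Γ)) := by
  have := Fintype.ofFinite Γ
  have h1 : ∀ p : Point, Nat.card (stabilizer Γ p) =
      (Finset.univ.filter fun g : Γ => g • p = p).card := fun p => by
    rw [← Fintype.card_subtype, ← Nat.card_eq_fintype_card]
    rfl
  simp only [h1]
  have h2 := Finset.sum_card_bipartiteAbove_eq_sum_card_bipartiteBelow (s := exceptional Γ)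
    (t := (Finset.univ : Finset Γ)) (fun (p : Point) (g : Γ) => g • p = p)
  simp only [Finset.bipartiteAbove, Finset.bipartiteBelow] at h2
  rw [h2]
  have h3 : ∀ g : Γ, ((exceptional Γ).filter fun p : Point => g • p = p).card =
      if g ∈ centralPart Γ then (exceptional Γ).card else 2 := fun g => by
    split_ifs with hg
    · rw [Finset.filter_true_of_mem fun p _ => smul_eq_of_mem_centralPart Γ hg p]
    · refine Eq.trans ?_ (ncard_fixed Γ hg)
      rw [← Set.ncard_coe_finset]
      congr 1
      ext p
      simp only [Finset.coe_filter, Set.mem_ofPred_eq, and_iff_right_iff_imp]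
      exact fun hp => (mem_exceptional Γ).mpr ⟨g, hg, hp⟩
  rw [Finset.sum_congr rfl fun g _ => h3 g, Finset.sum_ite, Finset.sum_const, Finset.sum_const,
    smul_eq_mul, smul_eq_mul, mul_comm 2]
  have h4 : (Finset.univ.filter fun g : Γ => g ∈ centralPart Γ).card =
      Nat.card (centralPart Γ) := by
    rw [← Fintype.card_subtype, ← Nat.card_eq_fintype_card]
  have h5 := Finset.card_filter_add_card_filter_not (s := (Finset.univ : Finset Γ))
    fun g => g ∈ centralPart Γ
  rw [Finset.card_univ, ← Nat.card_eq_fintype_card, h4] at h5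
  rw [h4]
  congr 2
  omega

open Classical in
/-- The orbits of points fixed by some noncentral element. -/
noncomputable def excOrbits : Finset (Finset Point) :=
  (exceptional Γ).image (orbitFinset Γ)

theorem mem_excOrbits {O : Finset Point} :
    O ∈ excOrbits Γ ↔ ∃ p ∈ exceptional Γ, orbitFinset Γ p = O := by
  classical
  exact Finset.mem_image

open Classical in
theorem fiber_eq {O : Finset Point} (hO : O ∈ excOrbits Γ) :
    (exceptional Γ).filter (fun p => orbitFinset Γ p = O) = O := by
  obtain ⟨p, hp, rfl⟩ := (mem_excOrbits Γ).mp hO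
  ext q
  rw [Finset.mem_filter, orbitFinset_eq_iff]
  exact ⟨fun h => h.2, fun h => ⟨mem_exceptional_of_mem_orbit Γ hp h, h⟩⟩

open Classical in
theorem burnside : Nat.card (centralPart Γ) * ∑ O ∈ excOrbits Γ, O.card +
    2 * (Nat.card Γ - Nat.card (centralPart Γ)) = (excOrbits Γ).card * Nat.card Γ := by
  have maps : ∀ p ∈ exceptional Γ, orbitFinset Γ p ∈ excOrbits Γ := fun p hp =>
    (mem_excOrbits Γ).mpr ⟨p, hp, rfl⟩
  have h1 : ∑ O ∈ excOrbits Γ, O.card = (exceptional Γ).card := by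
    rw [Finset.card_eq_sum_card_fiberwise maps]
    exact Finset.sum_congr rfl fun O hO => by rw [fiber_eq Γ hO]
  rw [h1, ← sum_card_stabilizer, ← Finset.sum_fiberwise_of_maps_to maps, ← smul_eq_mul,
    ← Finset.sum_const]
  refine Finset.sum_congr rfl fun O hO => ?_
  rw [fiber_eq Γ hO]
  obtain ⟨p, hp, rfl⟩ := (mem_excOrbits Γ).mp hO
  rw [← card_orbitFinset_mul Γ p, ← smul_eq_mul, ← Finset.sum_const]
  refine Finset.sum_congr rfl fun q hq => ?_
  have h2 := card_orbitFinset_mul Γ q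
  rw [(orbitFinset_eq_iff Γ).mpr hq, ← card_orbitFinset_mul Γ p] at h2
  exact Nat.eq_of_mul_eq_mul_left (Finset.card_pos.mpr ⟨p, mem_orbitFinset_self Γ p⟩) h2

theorem exists_ramification {p : Point} (hp : p ∈ exceptional Γ) :
    ∃ e, 2 ≤ e ∧ Nat.card (stabilizer Γ p) = Nat.card (centralPart Γ) * e := by
  obtain ⟨e, he⟩ := Subgroup.card_dvd_of_le (centralPart_le Γ p)
  refine ⟨e, ?_, he⟩
  by_contra! hlt
  obtain ⟨g, hg, hgp⟩ := (mem_exceptional Γ).mp hp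
  apply hg
  have h1 : stabilizer Γ p ≤ centralPart Γ := by
    refine (Subgroup.eq_of_le_of_card_ge (centralPart_le Γ p) ?_).ge
    rw [he]
    calc _ ≤ Nat.card (centralPart Γ) * 1 := Nat.mul_le_mul_left _ (by omega)
      _ = _ := mul_one _
  exact h1 hgp

theorem fixed_of_card_one {p : Point} (h : (orbitFinset Γ p).card = 1) : ∀ g ∈ Γ, g • p = p := by
  intro g hg
  obtain ⟨q, hq⟩ := Finset.card_eq_one.mp h
  have h1 : g • p ∈ orbitFinset Γ p := (mem_orbitFinset Γ).mpr ⟨g, hg, rfl⟩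
  have h2 := mem_orbitFinset_self Γ p
  rw [hq, Finset.mem_singleton] at h1 h2
  rw [h1, h2]

theorem pair_of_card_two {p : Point} (h : (orbitFinset Γ p).card = 2) :
    ∃ p q : Point, p ≠ q ∧ ∀ g ∈ Γ, (g • p = p ∧ g • q = q) ∨ (g • p = q ∧ g • q = p) := by
  classical
  obtain ⟨a, b, hab, hO⟩ := Finset.card_eq_two.mp h
  refine ⟨a, b, hab, fun g hg => ?_⟩
  have st : ∀ q ∈ orbitFinset Γ p, g • q ∈ orbitFinset Γ p := fun q hq => by
    obtain ⟨k, hk, rfl⟩ := (mem_orbitFinset Γ).mp hq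
    exact (mem_orbitFinset Γ).mpr ⟨g * k, Γ.mul_mem hg hk, mul_smul _ _ _⟩
  rw [hO] at st
  have ha := st a (by simp)
  have hb := st b (by simp)
  rw [Finset.mem_insert, Finset.mem_singleton] at ha hb
  have hne : g • a ≠ g • b := fun h => hab (smul_left_cancel g h)
  rcases ha with ha | ha <;> rcases hb with hb | hb
  · exact absurd (ha.trans hb.symm) hne
  · exact Or.inl ⟨ha, hb⟩
  · exact Or.inr ⟨ha, hb⟩
  · exact absurd (ha.trans hb.symm) hne

theorem card_centralPart_of_even (h : 2 ∣ Nat.card Γ) : Nat.card (centralPart Γ) = 2 := by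
  have : Fact (Nat.Prime 2) := ⟨Nat.prime_two⟩
  obtain ⟨g, hg⟩ := exists_prime_orderOf_dvd_card' 2 h
  have h1 : g ^ 2 = 1 := by
    have := pow_orderOf_eq_one g
    rwa [hg] at this
  have h2 : g ≠ 1 := by
    rintro rfl
    rw [orderOf_one] at hg
    norm_num at hg
  have h3 : g.1 = -1 := sl_eq_neg_one_of_sq (by exact_mod_cast congrArg Subtype.val h1)
    fun h => h2 (Subtype.ext h)
  have h4 : (centralPart Γ : Set Γ) = {1, g} := by
    ext k
    rw [SetLike.mem_coe, mem_centralPart, Set.mem_insert_iff, Set.mem_singleton_iff,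
      Subtype.ext_iff, Subtype.ext_iff, h3]
    rfl
  have h5 : Nat.card (centralPart Γ) = (centralPart Γ : Set Γ).ncard := rfl
  rw [h5, h4, Set.ncard_pair h2.symm]

theorem exists_stabilizer_char (p : Point) : ∃ φ : stabilizer Γ p →* ℂ, Function.Injective φ ∧
    ∀ g : stabilizer Γ p, g.1.1.1.mulVec p.rep = φ g • p.rep :=
  exists_eigenvalue_hom (Γ.subtype.comp (Subgroup.subtype _))
    (Γ.subtype_injective.comp (Subgroup.subtype_injective _)) p fun g => g.2

/-- Three exceptional orbits make a polyhedral group. -/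
noncomputable def polyhedralData_of (h2 : 2 ∣ Nat.card Γ) {N : ℕ} (hN : 2 * N = Nat.card Γ)
    {e : Fin 3 → ℕ} (O : Fin 3 → Finset Point) (hinj : Function.Injective O)
    (hO : ∀ i, O i ∈ excOrbits Γ) (hcard : ∀ i, (O i).card * e i = N)
    (hall : ∀ T ∈ excOrbits Γ, ∃ i, O i = T) : PolyhedralData Γ e N :=
  have hrep : ∀ i, ∀ p ∈ O i, orbitFinset Γ p = O i ∧ p ∈ exceptional Γ := fun i p hp => by
    obtain ⟨q, hq, h⟩ := (mem_excOrbits Γ).mp (hO i)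
    rw [← h] at hp ⊢
    exact ⟨(orbitFinset_eq_iff Γ).mpr hp, mem_exceptional_of_mem_orbit Γ hq hp⟩
  have hmem : ∀ p ∈ exceptional Γ, ∃ i, p ∈ O i := fun p hp => by
    obtain ⟨i, hi⟩ := hall _ ((mem_excOrbits Γ).mpr ⟨p, hp, rfl⟩)
    exact ⟨i, hi ▸ mem_orbitFinset_self Γ p⟩
  have hst : ∀ i, ∀ p ∈ O i, Nat.card (stabilizer Γ p) = 2 * e i := fun i p hp => by
    have h1 := card_orbitFinset_mul Γ p
    rw [(hrep i p hp).1, ← hN, ← hcard i, Nat.mul_left_comm] at h1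
    exact Nat.eq_of_mul_eq_mul_left (Finset.card_pos.mpr ⟨p, hp⟩) h1
  { orb := O
    stable := fun i g hg p hp => by
      rw [← (hrep i p hp).1]
      exact (mem_orbitFinset Γ).mpr ⟨g, hg, rfl⟩
    disj := fun i j hij => by
      rw [Finset.disjoint_left]
      intro p hpi hpj
      exact hij (hinj ((hrep i p hpi).1.symm.trans (hrep j p hpj).1))
    card_mul := hcard
    pos := by have := Nat.card_pos (α := Γ); omega
    trans := fun i p hp q hq => by
      rw [← (hrep i p hp).1] at hq
      exact (mem_orbitFinset Γ).mp hq
    generic := fun p hp => by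
      refine ⟨orbitFinset Γ p, ?_, fun q hq => (mem_orbitFinset Γ).mp hq⟩
      have h1 := card_orbitFinset_mul Γ p
      have h3 : stabilizer Γ p = centralPart Γ := by
        refine le_antisymm (fun g hg => ?_) (centralPart_le Γ p)
        by_contra hc
        obtain ⟨i, hi⟩ := hmem p ((mem_exceptional Γ).mpr ⟨g, hc, hg⟩)
        exact hp i hi
      rw [h3, card_centralPart_of_even Γ h2] at h1
      omega
    fixes := fun g hg => by
      by_cases hc : (⟨g, hg⟩ : Γ) ∈ centralPart Γ
      · rcases hc with hc | hc
        · exact Or.inl hc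
        · exact Or.inr (Or.inl hc)
      · right
        right
        have hc' := hc
        rw [mem_centralPart, not_or] at hc'
        obtain ⟨p, q, -, h⟩ := exists_fixed_points (isOfFinOrder_coe Γ ⟨g, hg⟩) hc'.1 hc'.2
        have hp : g • p = p := (h p).mpr (Or.inl rfl)
        obtain ⟨i, hi⟩ := hmem p ((mem_exceptional Γ).mpr ⟨⟨g, hg⟩, hc, hp⟩)
        exact ⟨i, p, hi, hp⟩
    order := fun i p hp g hg c hc => by
      obtain ⟨φ, hφ, h⟩ := exists_stabilizer_char Γ p
      let g' : stabilizer Γ p := ⟨⟨g, hg⟩, (smul_eq_iff_exists g p).mpr ⟨c, hc⟩⟩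
      have h1 : φ g' = c := smul_left_injective ℂ p.rep_nonzero ((h g').symm.trans hc)
      rw [← h1, ← map_pow, ← hst i p hp, pow_card_eq_one', map_one]
    prim := fun i => by
      obtain ⟨q, hq, h⟩ := (mem_excOrbits Γ).mp (hO i)
      have hp : q ∈ O i := h ▸ mem_orbitFinset_self Γ q
      obtain ⟨φ, hφ, h⟩ := exists_stabilizer_char Γ q
      have : IsCyclic (stabilizer Γ q) := isCyclic_of_injective_ringHom φ hφ
      obtain ⟨g, hg⟩ := IsCyclic.exists_ofOrder_eq_natCard (α := stabilizer Γ q)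
      refine ⟨q, hp, g.1.1, g.1.2, φ g, h g, ?_⟩
      rw [← hst i q hp, ← hg, ← orderOf_injective φ hφ]
      exact IsPrimitiveRoot.orderOf (φ g) }

theorem ramification_cases {e n : Fin 3 → ℕ} {N : ℕ} (h : ∀ i, n i * e i = N)
    (hmono : Monotone e) (hn : ∀ i, 3 ≤ n i) (he : ∀ i, 2 ≤ e i) (hsum : ∑ i, n i = N + 2) :
    (e = ![2, 3, 3] ∧ N = 12) ∨ (e = ![2, 3, 4] ∧ N = 24) ∨ (e = ![2, 3, 5] ∧ N = 60) := by
  rw [Fin.sum_univ_three] at hsum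
  have h01 : e 0 ≤ e 1 := hmono (by decide)
  have h12 : e 1 ≤ e 2 := hmono (by decide)
  have h0 := h 0
  have h1 := h 1
  have h2 := h 2
  have n1 := hn 1
  have n2 := hn 2
  have bound : ∀ i k, k ≤ e i → n i * k ≤ N := fun i k hk =>
    (Nat.mul_le_mul_left _ hk).trans (h i).le
  have e0 : e 0 = 2 := by
    by_contra hne
    have h3 : 3 ≤ e 0 := by have := he 0; omega
    have := bound 0 3 h3
    have := bound 1 3 (by omega)
    have := bound 2 3 (by omega)
    omega
  rw [e0] at h0
  have e1 : e 1 = 3 := by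
    by_contra hne
    rcases Nat.lt_or_ge (e 1) 3 with h3 | h3
    · have h4 : e 1 = 2 := by omega
      rw [h4] at h1
      omega
    · have := bound 1 4 (by omega)
      have := bound 2 4 (by omega)
      omega
  rw [e1] at h1
  have e2 : e 2 < 6 := by
    by_contra! h6
    have := bound 2 6 h6
    omega
  have ext : ∀ c, e 2 = c → e = ![2, 3, c] := fun c hc => by
    ext i
    fin_cases i
    · exact e0
    · exact e1
    · exact hc
  obtain h3 | h3 | h3 : e 2 = 3 ∨ e 2 = 4 ∨ e 2 = 5 := by omega
  · exact Or.inl ⟨ext 3 h3, by rw [h3] at h2; omega⟩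
  · exact Or.inr (Or.inl ⟨ext 4 h3, by rw [h3] at h2; omega⟩)
  · exact Or.inr (Or.inr ⟨ext 5 h3, by rw [h3] at h2; omega⟩)

/-- A finite subgroup of `SL₂(ℂ)` fixes a point, stabilizes a pair of points, or is a binary
polyhedral group. -/
theorem finite_subgroup_cases : (∃ p : Point, ∀ g ∈ Γ, g • p = p) ∨
    (∃ p q : Point, p ≠ q ∧ ∀ g ∈ Γ, (g • p = p ∧ g • q = q) ∨ (g • p = q ∧ g • q = p)) ∨
    Nonempty (PolyhedralData Γ ![2, 3, 3] 12) ∨ Nonempty (PolyhedralData Γ ![2, 3, 4] 24) ∨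
    Nonempty (PolyhedralData Γ ![2, 3, 5] 60) := by
  obtain ⟨N, hN⟩ := (centralPart Γ).card_subgroup_dvd_card
  have hz : 0 < Nat.card (centralPart Γ) := Nat.card_pos
  have hΓ : 0 < Nat.card Γ := Nat.card_pos
  have hN0 : 0 < N := Nat.pos_of_ne_zero fun h => by rw [h, mul_zero] at hN; omega
  have key : ∑ O ∈ excOrbits Γ, O.card + 2 * (N - 1) = (excOrbits Γ).card * N := by
    have h1 := burnside Γ
    rw [hN] at h1
    apply Nat.eq_of_mul_eq_mul_left hz
    have h2 : Nat.card (centralPart Γ) * N - Nat.card (centralPart Γ) =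
        Nat.card (centralPart Γ) * (N - 1) := by rw [Nat.mul_sub, mul_one]
    rw [h2] at h1
    linarith
  have hO : ∀ O ∈ excOrbits Γ, ∃ p e, O = orbitFinset Γ p ∧ 2 ≤ e ∧ O.card * e = N := by
    intro O hO
    obtain ⟨p, hp, rfl⟩ := (mem_excOrbits Γ).mp hO
    obtain ⟨e, he, hst⟩ := exists_ramification Γ hp
    refine ⟨p, e, rfl, he, ?_⟩
    have h1 := card_orbitFinset_mul Γ p
    rw [hst, hN, Nat.mul_left_comm] at h1
    exact Nat.eq_of_mul_eq_mul_left hz h1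
  by_cases h1 : ∃ O ∈ excOrbits Γ, O.card = 1
  · obtain ⟨O, hO1, h1⟩ := h1
    obtain ⟨p, e, rfl, -⟩ := hO O hO1
    exact Or.inl ⟨p, fixed_of_card_one Γ h1⟩
  by_cases h2 : ∃ O ∈ excOrbits Γ, O.card = 2
  · obtain ⟨O, hO1, h2⟩ := h2
    obtain ⟨p, e, rfl, -⟩ := hO O hO1
    exact Or.inr (Or.inl (pair_of_card_two Γ h2))
  push Not at h1 h2
  have hge : ∀ O ∈ excOrbits Γ, 3 ≤ O.card := fun O hO1 => by
    have := h1 O hO1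
    have := h2 O hO1
    have : O.card ≠ 0 := by
      obtain ⟨p, e, rfl, -⟩ := hO O hO1
      exact (Finset.card_pos.mpr ⟨p, mem_orbitFinset_self Γ p⟩).ne'
    omega
  have hlo : (excOrbits Γ).card * 3 ≤ ∑ O ∈ excOrbits Γ, O.card := by
    rw [← smul_eq_mul, ← Finset.sum_const]
    exact Finset.sum_le_sum hge
  have hhi : 2 * ∑ O ∈ excOrbits Γ, O.card ≤ (excOrbits Γ).card * N := by
    rw [Finset.mul_sum, ← smul_eq_mul, ← Finset.sum_const]
    refine Finset.sum_le_sum fun O hO1 => ?_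
    obtain ⟨p, e, -, he, h⟩ := hO O hO1
    rw [← h, mul_comm]
    exact Nat.mul_le_mul_left _ he
  have hk : (excOrbits Γ).card = 0 ∨ (excOrbits Γ).card = 3 := by
    have h4 : (excOrbits Γ).card < 4 := by
      by_contra! h4
      have := Nat.mul_le_mul_right N h4
      omega
    obtain h | h | h | h : (excOrbits Γ).card = 0 ∨ (excOrbits Γ).card = 1 ∨
      (excOrbits Γ).card = 2 ∨ (excOrbits Γ).card = 3 := by omega
    · exact Or.inl h
    · rw [h] at key hlo hhi
      omega
    · rw [h] at key hlo hhi
      omega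
    · exact Or.inr h
  rcases hk with hk | hk
  · left
    rw [Finset.card_eq_zero.mp hk, Finset.sum_empty, Finset.card_empty] at key
    have hN1 : N = 1 := by omega
    rw [hN1, mul_one] at hN
    have htop : centralPart Γ = ⊤ := Subgroup.eq_top_of_card_eq _ hN.symm
    refine ⟨Projectivization.mk ℂ ![1, 0] (fun h => by simpa using congrFun h 0), fun g hg => ?_⟩
    exact smul_eq_of_mem_centralPart Γ (g := ⟨g, hg⟩) (htop ▸ Subgroup.mem_top _) _
  · right
    right
    choose! p e he using hO
    let f : Fin 3 ≃ excOrbits Γ := (Finset.equivFinOfCardEq hk).symm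
    let σ := Tuple.sort fun i => e (f i)
    let O : Fin 3 → Finset Point := fun i => f (σ i)
    have hOm : ∀ i, O i ∈ excOrbits Γ := fun i => (f (σ i)).2
    have hsum : ∑ i, (O i).card = N + 2 := by
      have h3 : ∑ i, (O i).card = ∑ T ∈ excOrbits Γ, T.card := by
        exact (Equiv.sum_comp (σ.trans f) fun T : excOrbits Γ => T.1.card).trans
          (Finset.sum_coe_sort (excOrbits Γ) Finset.card)
      rw [hk] at key
      omega
    have hcard : ∀ i, (O i).card * e (O i) = N := fun i => (he _ (hOm i)).2.2
    have cases := ramification_cases hcard (Tuple.monotone_sort fun i => e (f i))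
      (fun i => hge _ (hOm i)) (fun i => (he _ (hOm i)).2.1) hsum
    have hev : 2 ∣ Nat.card Γ := by
      rw [hN]
      refine Dvd.dvd.mul_left ?_ _
      rcases cases with ⟨-, h⟩ | ⟨-, h⟩ | ⟨-, h⟩ <;> rw [h] <;> norm_num
    have hN2 : 2 * N = Nat.card Γ := by rw [hN, card_centralPart_of_even Γ hev]
    have D := polyhedralData_of Γ hev hN2 O
      (Subtype.val_injective.comp ((σ.trans f).injective)) hOm hcard (fun T hT =>
        ⟨(σ.trans f).symm ⟨T, hT⟩, by
          change ((σ.trans f) ((σ.trans f).symm ⟨T, hT⟩)).1 = T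
          rw [Equiv.apply_symm_apply]⟩)
    rcases cases with ⟨h, h'⟩ | ⟨h, h'⟩ | ⟨h, h'⟩ <;> rw [h, h'] at D
    · exact Or.inl ⟨D⟩
    · exact Or.inr (Or.inl ⟨D⟩)
    · exact Or.inr (Or.inr ⟨D⟩)

end

theorem PolyhedralData.exists_dvd_of_mem {e : Fin 3 → ℕ} {N : ℕ} (D : PolyhedralData Γ e N) {c : ℂ}
    (hc : c ≠ 0) {k : ℕ} (hk : 2 < k) (hprim : IsPrimitiveRoot c k) (hg : diagSL c hc ∈ Γ) : ∃ i,
    k ∣ 2 * e i := by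
  have hne : ∀ d : ℂ, d ^ 2 = 1 → c ≠ d := by
    rintro d hd rfl
    exact absurd (Nat.le_of_dvd (by norm_num) (hprim.dvd_of_pow_eq_one 2 hd)) (by omega)
  rcases D.fixes _ hg with h | h | ⟨i, p, hp, h⟩
  · exact absurd (congrFun (congrFun (congrArg Subtype.val h) 0) 0) (hne 1 (by norm_num))
  · refine absurd (congrFun (congrFun (congrArg Subtype.val h) 0) 0) ?_
    rw [Matrix.SpecialLinearGroup.coe_neg, sl_one, Matrix.neg_apply, Matrix.one_apply_eq]
    exact hne (-1) (by norm_num)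
  · obtain ⟨d, hd⟩ := (smul_eq_iff_exists _ p).mp h
    refine ⟨i, ?_⟩
    have h1 := D.order i p hp _ hg d hd
    have e0 := congrFun hd 0
    have e1 := congrFun hd 1
    have h0' : (diagSL c hc).1.mulVec p.rep 0 = c * p.rep 0 := by simp [diagSL, mulVec, dotProduct]
    have h1' : (diagSL c hc).1.mulVec p.rep 1 = c⁻¹ * p.rep 1 := by
      simp [diagSL, mulVec, dotProduct]
    rw [h0', Pi.smul_apply, smul_eq_mul] at e0
    rw [h1', Pi.smul_apply, smul_eq_mul] at e1
    apply hprim.dvd_of_pow_eq_one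
    by_cases hr : p.rep 0 = 0
    · have hr1 : p.rep 1 ≠ 0 := fun hr1 => p.rep_nonzero (by ext i; fin_cases i <;> assumption)
      rwa [← mul_right_cancel₀ hr1 e1, inv_pow, inv_eq_one] at h1
    · rwa [← mul_right_cancel₀ hr e0] at h1

theorem isHomogeneous_two_eq {f : Poly} (hf : f.IsHomogeneous 2) : ∃ a b c : ℂ,
    f = C a * u ^ 2 + C b * (u * v) + C c * v ^ 2 := by
  have lin : ∀ g : Poly, g.IsHomogeneous 1 → ∃ a b : ℂ, g = C a * u + C b * v := fun g hg => by
    have h1 := euler_identity hg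
    have h2 : ∀ i, ∃ c, pderiv i g = C c := fun i =>
      ⟨_, totalDegree_eq_zero_iff_eq_C.mp (Nat.le_zero.mp (hg.pderiv (i := i)).totalDegree_le)⟩
    obtain ⟨a, ha⟩ := h2 0
    obtain ⟨b, hb⟩ := h2 1
    refine ⟨a, b, ?_⟩
    rw [ha, hb] at h1
    simp only [Nat.cast_one, map_one, one_mul] at h1
    rw [← h1, u, v]
    ring
  obtain ⟨a, b, h0⟩ := lin _ (hf.pderiv (i := 0))
  obtain ⟨c, d, h1⟩ := lin _ (hf.pderiv (i := 1))
  have h2 := euler_identity hf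
  rw [h0, h1] at h2
  refine ⟨a / 2, (b + c) / 2, d / 2, ?_⟩
  have half : ∀ t : ℂ, (C t : Poly) = C 2 * C (t / 2) := fun t => by
    rw [← map_mul]
    congr 1
    ring
  have h3 : (C (2 : ℂ) : Poly) ≠ 0 := C_ne_zero.mpr two_ne_zero
  apply mul_left_cancel₀ h3
  rw [half a, half d] at h2
  have h4 := half (b + c)
  rw [map_add] at h4
  rw [Nat.cast_ofNat] at h2
  rw [← h2, u, v]
  linear_combination (X 0 * X 1) * h4

theorem finite_zeros {f : Poly} {d : ℕ} (hf : f.IsHomogeneous d) (hf0 : f ≠ 0) :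
    {p : Point | eval p.rep f = 0}.Finite := by
  by_contra hinf
  obtain ⟨S, hS, hcard⟩ := Set.Infinite.exists_subset_card_eq hinf (d + 1)
  have := PolyhedralData.le_of_dvd (orbitForm_isHomogeneous S) hf hf0 (orbitForm_dvd hf fun p hp => hS hp)
  omega

theorem eq_one_or_neg_one_of_fixes {g : SL2} {S : Finset Point} (hS : S.card = 3)
    (h : ∀ p ∈ S, g • p = p) : g = 1 ∨ g = -1 := by
  let Q : Poly := X 0 * (C (g.1 1 0) * X 0 + C (g.1 1 1) * X 1) -
    X 1 * (C (g.1 0 0) * X 0 + C (g.1 0 1) * X 1)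
  have hQ : Q.IsHomogeneous 2 :=
    ((isHomogeneous_X _ _).mul ((isHomogeneous_C_mul_X _ _).add (isHomogeneous_C_mul_X _ _))).sub
      ((isHomogeneous_X _ _).mul ((isHomogeneous_C_mul_X _ _).add (isHomogeneous_C_mul_X _ _)))
  have hQ0 : Q = 0 := by
    by_contra hne
    have := PolyhedralData.le_of_dvd (orbitForm_isHomogeneous S) hQ hne (orbitForm_dvd hQ fun p hp => by
      obtain ⟨c, hc⟩ := (smul_eq_iff_exists g p).mp (h p hp)
      have e0 := congrFun hc 0
      have e1 := congrFun hc 1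
      simp only [mulVec, dotProduct, Fin.sum_univ_two, Pi.smul_apply, smul_eq_mul] at e0 e1
      simp only [Q, map_sub, map_mul, map_add, eval_X, eval_C]
      linear_combination p.rep 0 * e1 - p.rep 1 * e0)
    omega
  have ev : ∀ a b : ℂ, a * (g.1 1 0 * a + g.1 1 1 * b) - b * (g.1 0 0 * a + g.1 0 1 * b) = 0 := by
    intro a b
    have := congrArg (eval ![a, b]) hQ0
    simpa [Q] using this
  have h1 := ev 1 0
  have h2 := ev 0 1
  have h3 := ev 1 1
  apply sl_eq_one_or_neg_one (c := g.1 0 0)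
  have e10 : g.1 1 0 = 0 := by linear_combination h1
  have e01 : g.1 0 1 = 0 := by linear_combination -h2
  have e11 : g.1 1 1 = g.1 0 0 := by linear_combination h3 - e10 + e01
  ext i j
  fin_cases i <;> fin_cases j <;> simp [e10, e01, e11]

/-- A group with an invariant form that has at least three zeros is finite. -/
theorem finite_of_invariant {f : Poly} {d : ℕ} (hf : f.IsHomogeneous d) (hf0 : f ≠ 0)
    (hinv : f ∈ invariants Γ) {S : Finset Point} (hS : S.card = 3) (hz : ∀ p ∈ S, eval p.rep f = 0)
    : Finite Γ := by
  let Z : Set Point := {p : Point | eval p.rep f = 0}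
  have hZ : Finite Z := finite_zeros hf hf0
  have stab : ∀ (g : Γ) (p : Z), g.1 • p.1 ∈ Z := fun g p =>
    eval_smul_rep_eq_zero hf g.1 (c := 1) (by rw [hinv g.1 g.2, map_one, one_mul]) p.2
  let φ : Γ → Z → Z := fun g p => ⟨g.1 • p.1, stab g p⟩
  have h1 : ∀ b ∈ (Set.univ : Set (Z → Z)), (φ ⁻¹' {b}).Finite := fun b _ => by
    by_cases hb : ∃ g₀, φ g₀ = b
    · obtain ⟨g₀, rfl⟩ := hb
      refine Set.Finite.subset (s := (fun g : Γ => g.1) ⁻¹' {g₀.1, g₀.1 * -1})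
        (Set.Finite.preimage Subtype.val_injective.injOn (by simp)) ?_
      intro g hg
      have h2 : g₀.1⁻¹ * g.1 = 1 ∨ g₀.1⁻¹ * g.1 = -1 := by
        refine eq_one_or_neg_one_of_fixes hS fun p hp => ?_
        rw [mul_smul, inv_smul_eq_iff]
        exact congrArg Subtype.val (congrFun hg ⟨p, hz p hp⟩)
      rw [Set.mem_preimage, Set.mem_insert_iff, Set.mem_singleton_iff]
      rwa [inv_mul_eq_iff_eq_mul, inv_mul_eq_iff_eq_mul, mul_one] at h2
    · convert Set.finite_empty
      ext g
      simp only [Set.mem_preimage, Set.mem_singleton_iff, Set.mem_empty_iff_false, iff_false]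
      exact fun h => hb ⟨g, h⟩
  have h2 := Set.Finite.preimage' (f := φ) Set.finite_univ h1
  rw [Set.preimage_univ] at h2
  exact Set.finite_univ_iff.mp h2

theorem polyhedral_of_primitive [Finite Γ]
    (h : ∀ f : Poly, f.IsHomogeneous 2 → (∀ g ∈ Γ, ∃ c : ℂ, linSubst g.1 f = C c * f) → f = 0) :
    Nonempty (PolyhedralData Γ ![2, 3, 3] 12) ∨ Nonempty (PolyhedralData Γ ![2, 3, 4] 24) ∨
    Nonempty (PolyhedralData Γ ![2, 3, 5] 60) := by
  have swap : ∀ {g : SL2} {p q : Point}, g • p = q →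
      ∃ c : ℂ, linSubst g.1 (pointForm q) = C c * pointForm p := by
    rintro g p _ rfl
    obtain ⟨c, -, hc⟩ := linSubst_pointForm g p
    exact ⟨c, hc⟩
  have prod : ∀ p q : Point, ¬ ∀ g ∈ Γ,
      (g • p = p ∧ g • q = q) ∨ (g • p = q ∧ g • q = p) := fun p q hpq => by
    refine mul_ne_zero (pointForm_prime p).ne_zero (pointForm_prime q).ne_zero
      (h _ ((pointForm_isHomogeneous p).mul (pointForm_isHomogeneous q)) fun g hg => ?_)
    rcases hpq g hg with ⟨h1, h2⟩ | ⟨h1, h2⟩ <;> obtain ⟨a, ha⟩ := swap h1 <;>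
      obtain ⟨b, hb⟩ := swap h2 <;> refine ⟨a * b, ?_⟩ <;> rw [map_mul, ha, hb, map_mul] <;> ring
  rcases finite_subgroup_cases Γ with ⟨p, hp⟩ | ⟨p, q, -, h⟩ | h
  · exact absurd (fun g hg => Or.inl ⟨hp g hg, hp g hg⟩) (prod p p)
  · exact absurd h (prod p q)
  · exact h

theorem isPrimitiveRoot_rootOfUnity (hn : n ≠ 0) : IsPrimitiveRoot (rootOfUnity n) n :=
  Complex.isPrimitiveRoot_exp n hn

theorem rootOfUnity_ne_zero (n : ℕ) : rootOfUnity n ≠ 0 := Complex.exp_ne_zero _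

theorem linSubst_scalar {f : Poly} {d : ℕ} (hf : f.IsHomogeneous d) (c : ℂ) :
    linSubst !![c, 0; 0, c] f = C (c ^ d) * f := by
  apply MvPolynomial.funext
  intro w
  have : (!![c, 0; 0, c]).mulVec w = c • w := by
    ext i
    fin_cases i <;> simp [mulVec, dotProduct]
  rw [eval_linSubst, this, eval_smul_of_isHomogeneous hf, map_mul, eval_C]

theorem linSubst_diag_u (a b : ℂ) : linSubst !![a, 0; 0, b] u = C a * u := by
  rw [linSubst_u]
  simp

theorem linSubst_diag_v (a b : ℂ) : linSubst !![a, 0; 0, b] v = C b * v := by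
  rw [linSubst_v]
  simp

theorem linSubst_antidiag_u (a b : ℂ) : linSubst !![0, a; b, 0] u = C a * v := by
  rw [linSubst_u]
  simp

theorem linSubst_antidiag_v (a b : ℂ) : linSubst !![0, a; b, 0] v = C b * u := by
  rw [linSubst_v]
  simp

/-- The Hessian determinant. -/
noncomputable def hessian (f : Poly) : Poly :=
  pderiv 0 (pderiv 0 f) * pderiv 1 (pderiv 1 f) - pderiv 0 (pderiv 1 f) * pderiv 1 (pderiv 0 f)

theorem hessian_mem {f : Poly} (hf : f ∈ invariants Γ) : hessian f ∈ invariants Γ := fun g hg => by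
  have hdet : (C (g.1 0 0) * C (g.1 1 1) - C (g.1 0 1) * C (g.1 1 0) : Poly) = 1 := by
    have := g.2
    rw [det_fin_two] at this
    rw [← map_mul, ← map_mul, ← map_sub, this, map_one]
  have e : ∀ k l, pderiv l (pderiv k f) =
      ∑ i, C (g.1 i k) * ∑ j, C (g.1 j l) * linSubst g.1 (pderiv j (pderiv i f)) := fun k l => by
    conv_lhs => rw [← hf g hg]
    rw [pderiv_linSubst, map_sum]
    refine Finset.sum_congr rfl fun i _ => ?_
    rw [pderiv_C_mul, pderiv_linSubst]
  conv_rhs => rw [hessian, e 0 0, e 1 1, e 0 1, e 1 0]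
  rw [hessian, map_sub, map_mul, map_mul]
  simp only [Fin.sum_univ_two]
  linear_combination (-(linSubst g.1 (pderiv 0 (pderiv 0 f)) * linSubst g.1 (pderiv 1 (pderiv 1 f))
    - linSubst g.1 (pderiv 0 (pderiv 1 f)) * linSubst g.1 (pderiv 1 (pderiv 0 f)))) *
    (C (g.1 0 0) * C (g.1 1 1) - C (g.1 0 1) * C (g.1 1 0) + 1) * hdet

theorem finite_of_invariant_vectors {f : Poly} {d : ℕ} (hf : f.IsHomogeneous d) (hf0 : f ≠ 0)
    (hinv : f ∈ invariants Γ) (w : Fin 3 → Fin 2 → ℂ)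
    (hw : ∀ i j, i ≠ j → w i 0 * w j 1 - w i 1 * w j 0 ≠ 0) (hz : ∀ i, eval (w i) f = 0) :
    Finite Γ := by
  classical
  have hw0 : ∀ i, w i ≠ 0 := fun i h => by
    have := hw i (i + 1) (by fin_cases i <;> decide)
    simp [h] at this
  let p : Fin 3 → Point := fun i => Projectivization.mk ℂ (w i) (hw0 i)
  have hp : Function.Injective p := fun i j hij => by
    by_contra hne
    obtain ⟨a, ha⟩ := (Projectivization.mk_eq_mk_iff' ℂ _ _ _ _).mp hij
    apply hw i j hne
    rw [← ha]
    simp only [Pi.smul_apply, smul_eq_mul]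
    ring
  refine finite_of_invariant hf hf0 hinv (S := Finset.univ.image p)
    (by rw [Finset.card_image_of_injective _ hp, Finset.card_univ, Fintype.card_fin]) ?_
  intro q hq
  obtain ⟨i, -, rfl⟩ := Finset.mem_image.mp hq
  obtain ⟨a, ha⟩ := Projectivization.exists_smul_eq_mk_rep ℂ (w i) (hw0 i)
  rw [← ha, Units.smul_def, eval_smul_of_isHomogeneous hf, hz, mul_zero]

theorem Generate.of_mem {x' y' z' : invariants Γ} (h : Generate x y z)
    (hx : x ∈ adjoin ℂ {x', y', z'}) (hy : y ∈ adjoin ℂ {x', y', z'})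
    (hz : z ∈ adjoin ℂ {x', y', z'}) : Generate x' y' z' :=
  eq_top_iff.mpr fun f _ => h.induction _ hx hy hz f

theorem mem_of_eq_smul {A : Subalgebra ℂ (invariants Γ)} {x' : invariants Γ} {r : ℂ}
    (h : x' = r • x) (h0 : x' ≠ 0) (hx' : x' ∈ A) : x ∈ A := by
  have hr : r ≠ 0 := by
    rintro rfl
    exact h0 (by rw [h, zero_smul])
  have : x = r⁻¹ • x' := by rw [h, smul_smul, inv_mul_cancel₀ hr, one_smul]
  rw [this]
  exact A.smul_mem hx' _

theorem Generate.of_smul {x' y' z' : invariants Γ} (h : Generate x y z) {r s t : ℂ}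
    (hx : x' = r • x) (hy : y' = s • y) (hz : z' = t • z) (hx0 : x' ≠ 0) (hy0 : y' ≠ 0)
    (hz0 : z' ≠ 0) : Generate x' y' z' :=
  h.of_mem (mem_of_eq_smul hx hx0 (subset_adjoin (by simp)))
    (mem_of_eq_smul hy hy0 (subset_adjoin (by simp)))
    (mem_of_eq_smul hz hz0 (subset_adjoin (by simp)))

theorem isRelPrime_of_smul {x' y' : invariants Γ} (h : IsRelPrime (x : Poly) (y : Poly)) {r s : ℂ}
    (hx : x' = r • x) (hy : y' = s • y) (hx0 : x' ≠ 0) (hy0 : y' ≠ 0) :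
    IsRelPrime (x' : Poly) (y' : Poly) := by
  have hr : r ≠ 0 := by
    rintro rfl
    exact hx0 (by rw [hx, zero_smul])
  have hs : s ≠ 0 := by
    rintro rfl
    exact hy0 (by rw [hy, zero_smul])
  have e : ∀ (c : ℂ) (f : invariants Γ), ((c • f : invariants Γ) : Poly) = C c * (f : Poly) := by
    intro c f
    exact smul_eq_C_mul _ _
  rw [hx, hy, e, e]
  exact isRelPrime_C_mul hr hs h

/-- The form of degree `6` of the octahedron. -/
noncomputable def formT : Poly := u * v * (u ^ 4 - v ^ 4)

/-- The form of degree `8` of the cube. -/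
noncomputable def formW : Poly := u ^ 8 + 14 * u ^ 4 * v ^ 4 + v ^ 8

/-- The form of degree `12` of the edges of the octahedron. -/
noncomputable def formK : Poly := u ^ 12 - 33 * u ^ 8 * v ^ 4 - 33 * u ^ 4 * v ^ 8 + v ^ 12

theorem u_isHomogeneous : u.IsHomogeneous 1 := isHomogeneous_X _ _

theorem v_isHomogeneous : v.IsHomogeneous 1 := isHomogeneous_X _ _

theorem natCast_isHomogeneous (n : ℕ) : (n : Poly).IsHomogeneous 0 := by
  rw [← map_natCast (C : ℂ →+* Poly)]
  exact isHomogeneous_C _ _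

theorem formT_isHomogeneous : formT.IsHomogeneous 6 :=
  (u_isHomogeneous.mul v_isHomogeneous).mul
    ((u_isHomogeneous.pow 4).sub (v_isHomogeneous.pow 4))

theorem formW_isHomogeneous : formW.IsHomogeneous 8 :=
  ((u_isHomogeneous.pow 8).add (((natCast_isHomogeneous 14).mul (u_isHomogeneous.pow 4)).mul
    (v_isHomogeneous.pow 4))).add (v_isHomogeneous.pow 8)

theorem formK_isHomogeneous : formK.IsHomogeneous 12 :=
  (((u_isHomogeneous.pow 12).sub (((natCast_isHomogeneous 33).mul (u_isHomogeneous.pow 8)).mul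
    (v_isHomogeneous.pow 4))).sub (((natCast_isHomogeneous 33).mul (u_isHomogeneous.pow 4)).mul
    (v_isHomogeneous.pow 8))).add (v_isHomogeneous.pow 12)

theorem pderiv_zero_u : pderiv (0 : Fin 2) u = 1 := pderiv_X_self 0
theorem pderiv_one_v : pderiv (1 : Fin 2) v = 1 := pderiv_X_self 1
theorem pderiv_zero_v : pderiv (0 : Fin 2) v = 0 := pderiv_X_of_ne (by decide)
theorem pderiv_one_u : pderiv (1 : Fin 2) u = 0 := pderiv_X_of_ne (by decide)

theorem pderiv_natCast (i : Fin 2) (n : ℕ) : pderiv i (n : Poly) = 0 :=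
  Derivation.map_natCast _ n

theorem hessian_formT : hessian formT = C (-25) * formW := by
  simp only [hessian, formT, formW, Derivation.leibniz, Derivation.leibniz_pow, map_sub, map_add,
    pderiv_zero_u, pderiv_one_u, pderiv_zero_v, pderiv_one_v, smul_eq_mul, mul_zero, mul_one,
    zero_add, add_zero, nsmul_eq_mul, map_neg, map_ofNat, Derivation.map_natCast, sub_zero, zero_sub]
  push_cast
  ring

theorem bracket_formT_formW : polyBracket formT formW = C (-8) * formK := by
  have h14 : ∀ i : Fin 2, pderiv i (14 : Poly) = 0 := fun i => pderiv_natCast i 14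
  simp only [polyBracket, formT, formW, formK, Derivation.leibniz, Derivation.leibniz_pow, map_sub,
    map_add, pderiv_zero_u, pderiv_one_u, pderiv_zero_v, pderiv_one_v, smul_eq_mul, mul_zero,
    mul_one, zero_add, add_zero, nsmul_eq_mul, h14, map_neg, map_ofNat, sub_zero,
    zero_sub]
  push_cast
  ring

theorem formW_pow_three : formW ^ 3 = formK ^ 2 + 108 * formT ^ 4 := by
  rw [formW, formK, formT]
  ring

theorem linSubst_tetrahedral_formT : linSubst tetrahedralMatrix formT = formT := by
  have hc : (1 / (1 - I)) ^ 2 = I / 2 := by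
    have h1 : (1 - I) ≠ 0 := fun h => by
      have := congrArg Complex.im h
      simp at this
    field_simp
    linear_combination (2 - I) * I_sq
  set c := 1 / (1 - I) with hc'
  have hU : linSubst tetrahedralMatrix u = C c * u + C c * C I * v := by
    rw [linSubst_u, ← map_mul]
    simp [tetrahedralMatrix, ← hc']
  have hV : linSubst tetrahedralMatrix v = C c * u - C c * C I * v := by
    rw [linSubst_v, ← map_mul]
    simp [tetrahedralMatrix, ← hc']
    ring
  have h1 : 2 * (C c : Poly) ^ 2 = C I := by
    rw [← map_pow, hc, ← map_ofNat C 2, ← map_mul]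
    congr 1
    ring
  have h2 : (C I : Poly) ^ 2 = -1 := by rw [← map_pow, I_sq, map_neg, map_one]
  set U := linSubst tetrahedralMatrix u
  set V := linSubst tetrahedralMatrix v
  have e1 : 2 * (U * V) = C I * (u ^ 2 + v ^ 2) := by
    rw [hU, hV]
    linear_combination (u ^ 2 + v ^ 2) * h1 - 2 * C c ^ 2 * v ^ 2 * h2
  have e2 : U ^ 2 - V ^ 2 = -2 * (u * v) := by
    rw [hU, hV]
    linear_combination 2 * C I * u * v * h1 + 2 * u * v * h2
  have e3 : U ^ 2 + V ^ 2 = C I * (u ^ 2 - v ^ 2) := by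
    rw [hU, hV]
    linear_combination (u ^ 2 - v ^ 2) * h1 + 2 * C c ^ 2 * v ^ 2 * h2
  have h3 : (2 : Poly) ≠ 0 := two_ne_zero
  apply mul_left_cancel₀ h3
  have e4 : linSubst tetrahedralMatrix formT = U * V * (U ^ 4 - V ^ 4) := by
    simp only [formT, map_mul, map_sub, map_pow]
    rfl
  rw [e4, formT]
  linear_combination (U ^ 4 - V ^ 4) * e1 +
    C I * (u ^ 2 + v ^ 2) * (U ^ 2 + V ^ 2) * e2 -
    2 * C I * (u ^ 2 + v ^ 2) * (u * v) * e3 -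
    2 * (u ^ 2 + v ^ 2) * (u * v) * (u ^ 2 - v ^ 2) * h2

theorem formT_mem_E6 : formT ∈ invariants groupE6 := by
  have h2 : (C I : Poly) ^ 2 = -1 := by rw [← map_pow, I_sq, map_neg, map_one]
  apply mem_invariants_generatedBy
  rintro M (rfl | rfl | rfl)
  · simp only [formT, map_mul, map_sub, map_pow, linSubst_diag_u, linSubst_diag_v, map_neg]
    linear_combination (-(C I ^ 4 - C I ^ 2 + 1) * u * v * (u ^ 4 - v ^ 4)) * h2
  · simp only [formT, map_mul, map_sub, map_pow, linSubst_antidiag_u, linSubst_antidiag_v]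
    linear_combination (-(C I ^ 4 - C I ^ 2 + 1) * u * v * (u ^ 4 - v ^ 4)) * h2
  · exact linSubst_tetrahedral_formT

theorem formW_mem_E6 : formW ∈ invariants groupE6 := by
  have := hessian_mem formT_mem_E6
  rw [hessian_formT] at this
  exact mem_of_C_mul_mem (by norm_num) this

theorem formK_mem_E6 : formK ∈ invariants groupE6 := by
  have := polyBracket_mem formT_mem_E6 formW_mem_E6
  rw [bracket_formT_formW] at this
  exact mem_of_C_mul_mem (by norm_num) this

theorem eval_u (w : Fin 2 → ℂ) : eval w u = w 0 := eval_X _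

theorem eval_v (w : Fin 2 → ℂ) : eval w v = w 1 := eval_X _

theorem one_sub_I_ne_zero : 1 - I ≠ 0 := fun h => by
  have := congrArg Complex.im h
  simp at this

theorem det_tetrahedralMatrix : tetrahedralMatrix.det = 1 := by
  have := one_sub_I_ne_zero
  simp only [tetrahedralMatrix, Matrix.smul_of, Matrix.smul_cons, smul_eq_mul, mul_one,
    Matrix.smul_empty, det_fin_two_of]
  field_simp
  linear_combination (-1 : ℂ) * I_sq

theorem eq_zero_of_tetrahedral_semiInvariant {f : Poly} (hf : f.IsHomogeneous 2) {c c' : ℂ}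
    (h1 : linSubst !![I, 0; 0, -I] f = C c * f) (h2 : linSubst tetrahedralMatrix f = C c' * f) :
    f = 0 := by
  obtain ⟨a, b, d, rfl⟩ := isHomogeneous_two_eq hf
  have hI := I_sq
  have e1 := fun w => congrArg (eval w) h1
  have e2 := fun w => congrArg (eval w) h2
  simp only [eval_linSubst] at e1 e2
  set k := 1 / (1 - I) with hk
  have hk0 : k ≠ 0 := one_div_ne_zero one_sub_I_ne_zero
  have p1 := e1 ![1, 0]
  have p2 := e1 ![0, 1]
  have p3 := e1 ![1, 1]
  have q1 := e2 ![1, 0]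
  have q2 := e2 ![0, 1]
  have q3 := e2 ![1, 1]
  simp only [tetrahedralMatrix, ← hk, map_add, map_mul, map_pow, eval_C, eval_u, eval_v,
    mulVec, dotProduct, Fin.sum_univ_two, of_apply, cons_val', Matrix.smul_apply,
    cons_val_zero, cons_val_one, cons_val_fin_one, smul_eq_mul, mul_one,
    mul_zero, zero_mul, add_zero, zero_add, zero_pow two_ne_zero, one_pow] at p1 p2 p3 q1 q2 q3
  have hb : (c - 1) * b = 0 := by linear_combination -p3 + p1 + p2 - (2 * b) * hI + b * hI
  have ha : (c + 1) * a = 0 := by linear_combination -p1 + a * hI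
  have hd : (c + 1) * d = 0 := by linear_combination -p2 + d * hI
  suffices a = 0 ∧ b = 0 ∧ d = 0 by
    obtain ⟨rfl, rfl, rfl⟩ := this
    simp
  rcases mul_eq_zero.mp hb with hc | rfl
  · have hc : c = 1 := sub_eq_zero.mp hc
    rw [hc] at ha hd
    have ha : a = 0 := (mul_eq_zero.mp ha).resolve_left (by norm_num)
    have hd : d = 0 := (mul_eq_zero.mp hd).resolve_left (by norm_num)
    refine ⟨ha, ?_, hd⟩
    rw [ha, hd] at q1
    have : k ^ 2 * b = 0 := by linear_combination q1
    exact (mul_eq_zero.mp this).resolve_left (pow_ne_zero 2 hk0)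
  · have hsum : c' * (a + d) = 0 := by linear_combination -q1 - q2 + k ^ 2 * (a + d) * hI
    have hdiff : k ^ 2 * I * (2 * (a - d)) = 0 := by
      linear_combination q3 + hsum - k ^ 2 * (a + d) * hI
    have had : a = d := by
      have h3 := (mul_eq_zero.mp hdiff).resolve_left (mul_ne_zero (pow_ne_zero 2 hk0) Complex.I_ne_zero)
      exact sub_eq_zero.mp ((mul_eq_zero.mp h3).resolve_left two_ne_zero)
    subst had
    have h4 : k ^ 2 * (2 * (2 * a)) = 0 := by linear_combination 2 * q1 + hsum
    have h5 := (mul_eq_zero.mp h4).resolve_left (pow_ne_zero 2 hk0)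
    have h6 : a = 0 := by linear_combination h5 / 4
    exact ⟨h6, rfl, h6⟩

theorem formT_ne_zero : formT ≠ 0 := fun h => by
  have := congrArg (eval ![2, 1]) h
  simp [formT, eval_u, eval_v] at this
  norm_num at this

theorem formW_ne_zero : formW ≠ 0 := fun h => by
  have := congrArg (eval ![1, 0]) h
  simp [formW, eval_u, eval_v] at this

theorem formK_ne_zero : formK ≠ 0 := fun h => by
  have := congrArg (eval ![1, 0]) h
  simp [formK, eval_u, eval_v] at this

/-- A group with the octahedral form as an invariant is finite. -/
theorem finite_of_octahedral_zeros {f : Poly} {d : ℕ} (hf : f.IsHomogeneous d) (hf0 : f ≠ 0)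
    (hinv : f ∈ invariants Γ) (hT : formT ∣ f) : Finite Γ := by
  refine finite_of_invariant_vectors hf hf0 hinv ![![1, 0], ![0, 1], ![1, 1]] ?_ fun i => ?_
  · intro i j hij
    fin_cases i <;> fin_cases j <;> simp at hij ⊢
  · obtain ⟨q, rfl⟩ := hT
    rw [map_mul]
    fin_cases i <;> simp [formT, eval_u, eval_v]

theorem coe_ne_zero_iff : f ≠ 0 ↔ (f : Poly) ≠ 0 := by
  rw [Ne, Ne, ← Subtype.coe_inj]
  rfl

theorem finite_groupE6 : Finite groupE6 :=
  finite_of_octahedral_zeros formT_isHomogeneous formT_ne_zero formT_mem_E6 dvd_rfl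

theorem exists_isE6_groupE6 : ∃ x y z : invariants groupE6, IsE6 x y z := by
  have := finite_groupE6
  have hprim : ∀ f : Poly, f.IsHomogeneous 2 →
      (∀ g ∈ groupE6, ∃ c : ℂ, linSubst g.1 f = C c * f) → f = 0 := fun f hf h => by
    obtain ⟨c, hc⟩ := h ⟨!![I, 0; 0, -I], by simp [det_fin_two]⟩
      (Subgroup.subset_closure (Or.inl rfl))
    obtain ⟨c', hc'⟩ := h ⟨tetrahedralMatrix, det_tetrahedralMatrix⟩
      (Subgroup.subset_closure (Or.inr (Or.inr rfl)))
    exact eq_zero_of_tetrahedral_semiInvariant hf hc hc'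
  let t : invariants groupE6 := ⟨formT, formT_mem_E6⟩
  have ht : t ≠ 0 := coe_ne_zero_iff.mpr formT_ne_zero
  rcases polyhedral_of_primitive hprim with ⟨⟨D⟩⟩ | ⟨⟨D⟩⟩ | ⟨⟨D⟩⟩
  · exact D.exists_isE6
  · obtain ⟨x, y, z, h⟩ := D.exists_isE7
    exact absurd (h.eq_zero_of_isHomogeneous (f := t) formT_isHomogeneous (by omega)) ht
  · obtain ⟨x, y, z, h⟩ := D.exists_isE8
    exact absurd (h.eq_zero_of_isHomogeneous (f := t) formT_isHomogeneous (by omega)) ht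

theorem IsE6.explicit {X Y Z : invariants Γ} (h : IsE6 X Y Z) (hx : (x : Poly).IsHomogeneous 6)
    (hy : (y : Poly).IsHomogeneous 8) (hz : (z : Poly).IsHomogeneous 12) (hx0 : x ≠ 0) (hy0 : y ≠ 0)
    (hz0 : ∀ c : ℂ, z ≠ c • x ^ 2) (rel : z ^ 2 + z * x ^ 2 + y ^ 3 = 0) : IsE6 x y z := by
  obtain ⟨r, hr⟩ := h.exists_smul_x hx
  obtain ⟨s, hs⟩ := h.exists_smul_y hy
  obtain ⟨a, b, hab⟩ := h.exists_smul_z hz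
  have hr0 : r ≠ 0 := by
    rintro rfl
    exact hx0 (by rw [hr, zero_smul])
  have hX : X = r⁻¹ • x := by rw [hr, smul_smul, inv_mul_cancel₀ hr0, one_smul]
  have ha : a ≠ 0 := by
    rintro rfl
    apply hz0 (b * r⁻¹ ^ 2)
    rw [hab, zero_smul, zero_add, hX, smul_pow, smul_smul]
  have hX' : X ∈ adjoin ℂ {x, y, z} :=
    mem_of_eq_smul hr hx0 (subset_adjoin (by simp))
  refine ⟨⟨hx, hy, hz, h.gen.of_mem hX' (mem_of_eq_smul hs hy0 (subset_adjoin (by simp)))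
    ?_, isRelPrime_of_smul h.coprime hr hs hx0 hy0⟩, rel⟩
  have hZ : Z = a⁻¹ • (z - b • X ^ 2) := by
    rw [hab, add_sub_cancel_right, smul_smul, inv_mul_cancel₀ ha, one_smul]
  rw [hZ]
  exact Subalgebra.smul_mem _ (Subalgebra.sub_mem _ (subset_adjoin (by simp))
    (Subalgebra.smul_mem _ (Subalgebra.pow_mem _ hX' 2) b)) _

theorem two_mul_mem {f : Poly} (hf : f ∈ invariants Γ) : 2 * f ∈ invariants Γ := by
  rw [two_mul]
  exact add_mem hf hf

theorem diagSL_mem_generatedBy {S : Set (Mat)} {c : ℂ} (hc : c ≠ 0) (h : !![c, 0; 0, c⁻¹] ∈ S) :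
    diagSL c hc ∈ generatedBy S :=
  Subgroup.subset_closure h

theorem IsGradedTriple.of_isHomogeneous {a b c : ℕ} {X Y Z : invariants Γ}
    (h : IsGradedTriple a b c X Y Z) (hx : (x : Poly).IsHomogeneous a)
    (hy : (y : Poly).IsHomogeneous b) (hz : (z : Poly).IsHomogeneous c) (hx0 : x ≠ 0)
    (hy0 : y ≠ 0) (hz0 : z ≠ 0)
    (ha : ∀ i j k, a * i + b * j + c * k = a → i = 1 ∧ j = 0 ∧ k = 0 := by omega)
    (hb : ∀ i j k, a * i + b * j + c * k = b → i = 0 ∧ j = 1 ∧ k = 0 := by omega)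
    (hc : ∀ i j k, a * i + b * j + c * k = c → i = 0 ∧ j = 0 ∧ k = 1 := by omega) :
    IsGradedTriple a b c x y z := by
  obtain ⟨r, hr⟩ := h.exists_smul_x hx ha
  obtain ⟨s, hs⟩ := h.exists_smul_y hy hb
  obtain ⟨t, ht⟩ := h.exists_smul_z hz hc
  exact ⟨hx, hy, hz, h.gen.of_smul hr hs ht hx0 hy0 hz0, isRelPrime_of_smul h.coprime hr hs hx0 hy0⟩

/-- The involution induced by the scalar matrix `i`. -/
theorem Generate.exists_antiPoisson_scalar (h : Generate x y z) {a b c : ℕ}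
    (hx : (x : Poly).IsHomogeneous (4 * a)) (hy : (y : Poly).IsHomogeneous (4 * b))
    (hz : (z : Poly).IsHomogeneous (4 * c + 2)) : ∃ θ : Aut Γ, IsAntiPoissonInvolution θ ∧ θ x = x ∧
    θ y = y ∧ θ z = -z := by
  have e4 : ∀ k, I ^ (4 * k) = 1 := fun k => by rw [pow_mul, Complex.I_pow_four, one_pow]
  have e2 : I ^ (4 * c + 2) = -1 := by rw [pow_add, e4, I_sq, one_mul]
  refine h.exists_antiPoisson !![I, 0; 0, I] ?_ x y (-z) ?_ ?_ ?_ ?_ ?_ ?_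
  · rw [det_fin_two_of, mul_zero, sub_zero, ← pow_two, I_sq]
  · rw [linSubst_scalar hx, e4, map_one, one_mul]
  · rw [linSubst_scalar hy, e4, map_one, one_mul]
  · rw [linSubst_scalar hz, e2, map_neg, map_one, neg_one_mul]
    rfl
  · rw [linSubst_scalar hx, e4, map_one, one_mul]
  · rw [linSubst_scalar hy, e4, map_one, one_mul]
  · change linSubst _ (-(z : Poly)) = (z : Poly)
    rw [map_neg, linSubst_scalar hz, e2, map_neg, map_one, neg_one_mul, neg_neg]

theorem linSubst_neg_diag {f : Poly} (hf : f.IsHomogeneous 2) (a b : ℂ) :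
    linSubst !![-a, 0; 0, -b] f = linSubst !![a, 0; 0, b] f := by
  have h1 : !![-a, 0; 0, -b] = !![a, 0; 0, b] * !![(-1 : ℂ), 0; 0, -1] := by
    rw [mul_fin_two]
    simp
  rw [h1, ← linSubst_linSubst, linSubst_scalar (linSubst_isHomogeneous _ hf), neg_one_sq, map_one,
    one_mul]

theorem rootOfUnity_eight_pow_four : rootOfUnity 8 ^ 4 = -1 := by
  have h := isPrimitiveRoot_rootOfUnity (n := 8) (by norm_num)
  have h1 : (rootOfUnity 8 ^ 4) ^ 2 = 1 := by rw [← pow_mul, h.pow_eq_one]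
  rcases sq_eq_one_cases h1 with h2 | h2
  · exact absurd h2 (h.pow_ne_one_of_pos_of_lt (by norm_num) (by norm_num))
  · exact h2

theorem mem_groupE7 {f : Poly} (hf : f ∈ invariants groupE6)
    (h : linSubst !![rootOfUnity 8, 0; 0, (rootOfUnity 8)⁻¹] f = f) : f ∈ invariants groupE7 := by
  apply mem_invariants_generatedBy
  rintro M (rfl | rfl | rfl)
  · exact h
  · exact linSubst_eq_of_mem_generatedBy hf (Or.inr (Or.inl rfl)) (by simp [det_fin_two])
  · exact linSubst_eq_of_mem_generatedBy hf (Or.inr (Or.inr rfl)) det_tetrahedralMatrix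

theorem linSubst_eight : linSubst !![rootOfUnity 8, 0; 0, (rootOfUnity 8)⁻¹] formT = -formT ∧
    linSubst !![rootOfUnity 8, 0; 0, (rootOfUnity 8)⁻¹] formW = formW ∧
    linSubst !![rootOfUnity 8, 0; 0, (rootOfUnity 8)⁻¹] formK = -formK := by
  set ε := rootOfUnity 8 with hε
  have h1 : (C ε : Poly) ^ 4 = -1 := by rw [← map_pow, rootOfUnity_eight_pow_four, map_neg, map_one]
  have h2 : (C ε⁻¹ : Poly) ^ 4 = -1 := by
    rw [← map_pow, inv_pow, rootOfUnity_eight_pow_four, inv_neg, inv_one, map_neg, map_one]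
  have h3 : (C ε * C ε⁻¹ : Poly) = 1 := by
    rw [← map_mul, mul_inv_cancel₀ (rootOfUnity_ne_zero 8), map_one]
  have p : ∀ a b : ℕ, (C ε * u) ^ (4 * a) * (C ε⁻¹ * v) ^ (4 * b) =
      (-1) ^ (a + b) * u ^ (4 * a) * v ^ (4 * b) := fun a b => by
    rw [mul_pow, mul_pow, pow_mul (C ε), pow_mul (C ε⁻¹), h1, h2, pow_add]
    ring
  have p0 := fun a => p a 0
  have p1 := fun a => p 0 a
  simp only [mul_zero, pow_zero, mul_one, add_zero, zero_add, one_mul] at p0 p1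
  have q10 := p0 1
  have q20 := p0 2
  have q30 := p0 3
  have q01 := p1 1
  have q02 := p1 2
  have q03 := p1 3
  norm_num at q10 q20 q30 q01 q02 q03
  refine ⟨?_, ?_, ?_⟩
  · simp only [formT, map_mul, map_sub, map_pow, linSubst_diag_u, linSubst_diag_v]
    rw [q10, q01]
    linear_combination (-u * v * (u ^ 4 - v ^ 4)) * h3
  · simp only [formW, map_mul, map_add, map_pow, linSubst_diag_u, linSubst_diag_v, map_ofNat]
    rw [q10, q01, q20, q02]
    ring
  · simp only [formK, map_mul, map_add, map_sub, map_pow, linSubst_diag_u, linSubst_diag_v,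
      map_ofNat]
    rw [q10, q01, q20, q02, q30, q03]
    ring

theorem formW_mem_E7 : formW ∈ invariants groupE7 :=
  mem_groupE7 formW_mem_E6 linSubst_eight.2.1

theorem formT_sq_mem_E7 : formT ^ 2 ∈ invariants groupE7 :=
  mem_groupE7 (pow_mem formT_mem_E6 2) (by rw [map_pow, linSubst_eight.1, neg_sq])

theorem formT_mul_formK_mem_E7 : formT * formK ∈ invariants groupE7 :=
  mem_groupE7 (mul_mem formT_mem_E6 formK_mem_E6)
    (by rw [map_mul, linSubst_eight.1, linSubst_eight.2.2, neg_mul_neg])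

theorem exists_isE7_groupE7 : ∃ x y z : invariants groupE7, IsE7 x y z := by
  have : Finite groupE7 := finite_of_octahedral_zeros (formT_isHomogeneous.pow 2)
    (pow_ne_zero 2 formT_ne_zero) formT_sq_mem_E7 (dvd_pow_self _ two_ne_zero)
  have h8 := isPrimitiveRoot_rootOfUnity (n := 8) (by norm_num)
  have hmem : diagSL (rootOfUnity 8) (rootOfUnity_ne_zero 8) ∈ groupE7 :=
    diagSL_mem_generatedBy _ (Or.inl rfl)
  have hprim : ∀ f : Poly, f.IsHomogeneous 2 →
      (∀ g ∈ groupE7, ∃ c : ℂ, linSubst g.1 f = C c * f) → f = 0 := fun f hf h => by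
    obtain ⟨c, hc⟩ := h _ (groupE7.mul_mem hmem hmem)
    obtain ⟨c', hc'⟩ := h ⟨tetrahedralMatrix, det_tetrahedralMatrix⟩
      (Subgroup.subset_closure (Or.inr (Or.inr rfl)))
    have h4 := rootOfUnity_eight_pow_four
    have hI : (rootOfUnity 8 ^ 2 = I) ∨ (rootOfUnity 8 ^ 2 = -I) := by
      apply sq_eq_sq_iff_eq_or_eq_neg.mp
      rw [← pow_mul, I_sq, h4]
    have hinv : (rootOfUnity 8)⁻¹ ^ 2 = -rootOfUnity 8 ^ 2 := by
      rw [inv_pow]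
      refine inv_eq_of_mul_eq_one_right ?_
      linear_combination -h4
    have hdiag : (diagSL (rootOfUnity 8) (rootOfUnity_ne_zero 8) *
        diagSL (rootOfUnity 8) (rootOfUnity_ne_zero 8)).1 =
        !![rootOfUnity 8 ^ 2, 0; 0, -rootOfUnity 8 ^ 2] := by
      rw [sl_mul, ← hinv, diagSL]
      ext i j
      fin_cases i <;> fin_cases j <;> simp [Matrix.mul_apply, Fin.sum_univ_two, pow_two]
    rw [hdiag] at hc
    rcases hI with hI | hI
    · rw [hI] at hc
      exact eq_zero_of_tetrahedral_semiInvariant hf hc hc'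
    · rw [hI, linSubst_neg_diag hf I (-I)] at hc
      exact eq_zero_of_tetrahedral_semiInvariant hf hc hc'
  rcases polyhedral_of_primitive hprim with ⟨⟨D⟩⟩ | ⟨⟨D⟩⟩ | ⟨⟨D⟩⟩
  · obtain ⟨i, hi⟩ := D.exists_dvd_of_mem _ (by norm_num) h8 hmem
    fin_cases i <;> simp at hi
  · exact D.exists_isE7
  · obtain ⟨i, hi⟩ := D.exists_dvd_of_mem _ (by norm_num) h8 hmem
    fin_cases i <;> simp at hi

theorem formT_sq : formT ^ 2 = (u ^ 5 * v - u * v ^ 5) ^ 2 := by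
  rw [formT]
  ring

theorem formT_mul_formK :
    formT * formK = u * v * (u ^ 8 - v ^ 8) * (u ^ 8 - 34 * u ^ 4 * v ^ 4 + v ^ 8) := by
  rw [formT, formK]
  ring

/-- The form of degree `12` of the icosahedron. -/
noncomputable def formF : Poly := u * v * (u ^ 10 + 11 * u ^ 5 * v ^ 5 - v ^ 10)

/-- The form of degree `20` of the dodecahedron. -/
noncomputable def formH : Poly :=
  u ^ 20 + v ^ 20 - 228 * (u ^ 15 * v ^ 5 - u ^ 5 * v ^ 15) + 494 * u ^ 10 * v ^ 10

/-- The form of degree `30` of the edges of the icosahedron. -/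
noncomputable def formJ : Poly :=
  u ^ 30 + v ^ 30 + 522 * (u ^ 25 * v ^ 5 - u ^ 5 * v ^ 25) - 10005 * (u ^ 20 * v ^ 10 + u ^ 10 * v ^ 20)

theorem formF_isHomogeneous : formF.IsHomogeneous 12 :=
  (u_isHomogeneous.mul v_isHomogeneous).mul (((u_isHomogeneous.pow 10).add
    (((natCast_isHomogeneous 11).mul (u_isHomogeneous.pow 5)).mul (v_isHomogeneous.pow 5))).sub
    (v_isHomogeneous.pow 10))

theorem uv_isHomogeneous (a b : ℕ) : (u ^ a * v ^ b).IsHomogeneous (a + b) := by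
  simpa using (u_isHomogeneous.pow a).mul (v_isHomogeneous.pow b)

theorem formH_isHomogeneous : formH.IsHomogeneous 20 := by
  have := (((u_isHomogeneous.pow 20).add (v_isHomogeneous.pow 20)).sub
    ((natCast_isHomogeneous 228).mul ((uv_isHomogeneous 15 5).sub (uv_isHomogeneous 5 15)))).add
    ((natCast_isHomogeneous 494).mul (uv_isHomogeneous 10 10))
  simpa [formH, mul_assoc] using this

theorem formJ_isHomogeneous : formJ.IsHomogeneous 30 := by
  have := (((u_isHomogeneous.pow 30).add (v_isHomogeneous.pow 30)).add
    ((natCast_isHomogeneous 522).mul ((uv_isHomogeneous 25 5).sub (uv_isHomogeneous 5 25)))).sub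
    ((natCast_isHomogeneous 10005).mul ((uv_isHomogeneous 20 10).add (uv_isHomogeneous 10 20)))
  simpa [formJ] using this

theorem hessian_formF : hessian formF = C (-121) * formH := by
  have h11 : ∀ i : Fin 2, pderiv i (11 : Poly) = 0 := fun i => pderiv_natCast i 11
  simp only [hessian, formF, formH, Derivation.leibniz, Derivation.leibniz_pow, map_sub, map_add,
    pderiv_zero_u, pderiv_one_u, pderiv_zero_v, pderiv_one_v, smul_eq_mul, mul_zero, mul_one,
    zero_add, add_zero, nsmul_eq_mul, map_neg, map_ofNat, Derivation.map_natCast, sub_zero,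
    zero_sub, h11, map_zero]
  push_cast
  ring

theorem bracket_formF_formH : polyBracket formF formH = C (-20) * formJ := by
  have h11 : ∀ i : Fin 2, pderiv i (11 : Poly) = 0 := fun i => pderiv_natCast i 11
  have h228 : ∀ i : Fin 2, pderiv i (228 : Poly) = 0 := fun i => pderiv_natCast i 228
  have h494 : ∀ i : Fin 2, pderiv i (494 : Poly) = 0 := fun i => pderiv_natCast i 494
  simp only [polyBracket, formF, formH, formJ, Derivation.leibniz, Derivation.leibniz_pow, map_sub,
    map_add, pderiv_zero_u, pderiv_one_u, pderiv_zero_v, pderiv_one_v, smul_eq_mul, mul_zero,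
    mul_one, zero_add, add_zero, nsmul_eq_mul, h11, h228, h494, map_neg, map_ofNat, sub_zero,
    zero_sub, map_zero]
  push_cast
  ring

theorem formJ_sq : formJ ^ 2 = formH ^ 3 + 1728 * formF ^ 5 := by
  rw [formJ, formH, formF]
  ring

/-- The golden ratio, as a cyclotomic number. -/
noncomputable def goldenSum : ℂ := -(rootOfUnity 5 + rootOfUnity 5 ^ 4)

theorem rootOfUnity_five_sum :
    1 + rootOfUnity 5 + rootOfUnity 5 ^ 2 + rootOfUnity 5 ^ 3 + rootOfUnity 5 ^ 4 = 0 := by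
  have h := (isPrimitiveRoot_rootOfUnity (n := 5) (by norm_num)).geom_sum_eq_zero (by norm_num)
  simpa [Finset.sum_range_succ] using h

theorem goldenSum_sq : goldenSum ^ 2 = goldenSum + 1 := by
  have h := rootOfUnity_five_sum
  have h5 := (isPrimitiveRoot_rootOfUnity (n := 5) (by norm_num)).pow_eq_one
  rw [goldenSum]
  linear_combination h + (2 + rootOfUnity 5 ^ 3) * h5

theorem exists_icosahedralMatrix_eq : ∃ p : ℂ, p ^ 2 * (goldenSum + 2) = -1 ∧
    icosahedralMatrix = !![p, p * goldenSum; p * goldenSum, -p] := by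
  have hs : ((Real.sqrt 5 : ℝ) : ℂ) ^ 2 = 5 := by
    rw [← Complex.ofReal_pow, Real.sq_sqrt (by norm_num)]
    norm_num
  have hs0 : ((Real.sqrt 5 : ℝ) : ℂ) ≠ 0 := fun h => by
    rw [h] at hs
    norm_num at hs
  have h5 := (isPrimitiveRoot_rootOfUnity (n := 5) (by norm_num)).pow_eq_one
  have hsum := rootOfUnity_five_sum
  set s := ((Real.sqrt 5 : ℝ) : ℂ)
  set e := rootOfUnity 5
  have hinv : s⁻¹ ^ 2 * 5 = 1 := by rw [← hs, inv_pow, inv_mul_cancel₀ (pow_ne_zero 2 hs0)]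
  have hq : s⁻¹ * (e ^ 2 - e ^ 3) = s⁻¹ * (-e + e ^ 4) * goldenSum := by
    rw [goldenSum]
    linear_combination (s⁻¹ * e ^ 3) * h5
  refine ⟨s⁻¹ * (-e + e ^ 4), ?_, ?_⟩
  · rw [goldenSum]
    linear_combination (-1 : ℂ) * hinv + s⁻¹ ^ 2 * hsum +
      s⁻¹ ^ 2 * (-e ^ 7 - e ^ 2 + e ^ 4 + 2 * e ^ 3 + e - 4) * h5
  · rw [← hq, icosahedralMatrix]
    ext i j
    fin_cases i <;> fin_cases j <;> simp <;> ring

theorem formF_eq : formF = u * v * ((u ^ 2 - v ^ 2) ^ 5 + 5 * (u * v) ^ 2 * (u ^ 2 - v ^ 2) ^ 3 + 5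
    * (u * v) ^ 4 * (u ^ 2 - v ^ 2) + 11 * (u * v) ^ 5) := by
  rw [formF]
  ring

theorem det_icosahedralMatrix : icosahedralMatrix.det = 1 := by
  obtain ⟨p, hp, hM⟩ := exists_icosahedralMatrix_eq
  rw [hM, det_fin_two_of]
  linear_combination (-1 : ℂ) * hp - p ^ 2 * goldenSum_sq

theorem linSubst_icosahedralMatrix_formF : linSubst icosahedralMatrix formF = formF := by
  obtain ⟨p, hp, hM⟩ := exists_icosahedralMatrix_eq
  have ht := goldenSum_sq
  set t := goldenSum
  have hC : (C t : Poly) ^ 2 = C t + 1 := by rw [← map_pow, ht, map_add, map_one]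
  have h1 : linSubst icosahedralMatrix (u * v) =
      C (p ^ 2 * t) * (u * v + (u ^ 2 - v ^ 2)) := by
    rw [map_mul, linSubst_u, linSubst_v, hM]
    simp only [of_apply, cons_val', cons_val_zero, cons_val_one,
      cons_val_fin_one, map_mul, map_neg, map_pow]
    linear_combination (C p ^ 2 * u * v) * hC
  have h2 : linSubst icosahedralMatrix (u ^ 2 - v ^ 2) =
      C (p ^ 2 * t) * (4 * (u * v) - (u ^ 2 - v ^ 2)) := by
    rw [map_sub, map_pow, map_pow, linSubst_u, linSubst_v, hM]
    simp only [of_apply, cons_val', cons_val_zero, cons_val_one,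
      cons_val_fin_one, map_mul, map_neg, map_pow]
    linear_combination (C p ^ 2 * (v ^ 2 - u ^ 2)) * hC
  have h3 : (p ^ 2 * t) ^ 6 * 125 = 1 := by
    have h4 : (p ^ 2 * t) ^ 2 * 5 = 1 := by
      linear_combination (p ^ 2 * (t + 2) - 1) * hp + (4 * p ^ 4) * ht
    calc (p ^ 2 * t) ^ 6 * 125 = ((p ^ 2 * t) ^ 2 * 5) ^ 3 := by ring
      _ = 1 := by rw [h4, one_pow]
  have h4 : (C (p ^ 2 * t) : Poly) ^ 6 * 125 = 1 := by
    rw [← map_ofNat C 125, ← map_pow, ← map_mul, h3, map_one]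
  have h5 : ∀ a d : Poly, linSubst icosahedralMatrix
      (a * (d ^ 5 + 5 * a ^ 2 * d ^ 3 + 5 * a ^ 4 * d + 11 * a ^ 5)) =
      linSubst icosahedralMatrix a * (linSubst icosahedralMatrix d ^ 5 +
        5 * linSubst icosahedralMatrix a ^ 2 * linSubst icosahedralMatrix d ^ 3 +
        5 * linSubst icosahedralMatrix a ^ 4 * linSubst icosahedralMatrix d +
        11 * linSubst icosahedralMatrix a ^ 5) := fun a d => by
    simp only [map_mul, map_add, map_pow, map_ofNat]
  rw [formF_eq, h5, h1, h2]
  generalize u * v = a at *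
  generalize u ^ 2 - v ^ 2 = d at *
  generalize (C (p ^ 2 * t) : Poly) = k at *
  linear_combination (a * (d ^ 5 + 5 * a ^ 2 * d ^ 3 + 5 * a ^ 4 * d + 11 * a ^ 5)) * h4

theorem formF_mem : formF ∈ invariants groupE8 := by
  apply mem_invariants_generatedBy
  rintro M (rfl | rfl | rfl)
  · have h := (isPrimitiveRoot_rootOfUnity (n := 10) (by norm_num)).pow_eq_one
    set ε := rootOfUnity 10
    have hε : ε ≠ 0 := rootOfUnity_ne_zero 10
    have h1 : (C ε : Poly) ^ 10 = 1 := by rw [← map_pow, h, map_one]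
    have h2 : (C ε⁻¹ : Poly) ^ 10 = 1 := by rw [← map_pow, inv_pow, h, inv_one, map_one]
    have h3 : (C ε * C ε⁻¹ : Poly) = 1 := by rw [← map_mul, mul_inv_cancel₀ hε, map_one]
    simp only [formF, map_mul, map_add, map_sub, map_pow, linSubst_diag_u, linSubst_diag_v,
      map_ofNat]
    have e : ∀ a b : Poly, a * u * (b * v) * ((a * u) ^ 10 + 11 * (a * u) ^ 5 * (b * v) ^ 5 -
        (b * v) ^ 10) = (a * b) * (u * v * (a ^ 10 * u ^ 10 +
        11 * (a * b) ^ 5 * u ^ 5 * v ^ 5 - b ^ 10 * v ^ 10)) := fun a b => by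
      ring
    rw [e, h1, h2, h3, one_pow, one_mul, one_mul, one_mul, mul_one]
  · simp only [formF, map_mul, map_add, map_sub, map_pow, linSubst_antidiag_u, linSubst_antidiag_v,
      map_ofNat, map_one, map_neg]
    ring
  · exact linSubst_icosahedralMatrix_formF

theorem formH_mem : formH ∈ invariants groupE8 :=
  mem_of_C_mul_mem (by norm_num) (hessian_formF ▸ hessian_mem formF_mem)

theorem formJ_mem : formJ ∈ invariants groupE8 :=
  mem_of_C_mul_mem (by norm_num) (bracket_formF_formH ▸ polyBracket_mem formF_mem formH_mem)

theorem formF_ne_zero : formF ≠ 0 := fun h => by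
  have := congrArg (eval ![1, 1]) h
  simp [formF, eval_u, eval_v] at this

theorem formH_ne_zero : formH ≠ 0 := fun h => by
  have := congrArg (eval ![1, 0]) h
  simp [formH, eval_u, eval_v] at this

theorem formJ_ne_zero : formJ ≠ 0 := fun h => by
  have := congrArg (eval ![1, 0]) h
  simp [formJ, eval_u, eval_v] at this

theorem finite_groupE8 : Finite groupE8 := by
  have ht := goldenSum_sq
  have h1 : goldenSum - 1 ≠ 0 := fun h => by
    have : goldenSum = 1 := sub_eq_zero.mp h
    rw [this] at ht
    norm_num at ht
  refine finite_of_invariant_vectors formF_isHomogeneous formF_ne_zero formF_mem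
    ![![1, 0], ![0, 1], ![goldenSum - 1, 1]] ?_ fun i => ?_
  · intro i j hij
    fin_cases i <;> fin_cases j <;> simp at hij ⊢
    · rwa [← neg_sub, neg_eq_zero]
    · exact h1
  · rw [formF_eq]
    fin_cases i
    · simp [eval_u, eval_v]
    · simp [eval_u, eval_v]
    · have h2 : (goldenSum - 1) ^ 2 - 1 = -(goldenSum - 1) := by linear_combination ht
      simp only [Fin.reduceFinMk, Matrix.cons_val, map_mul, map_add, map_sub, map_pow, eval_u,
        eval_v, map_ofNat, cons_val_zero, cons_val_one, cons_val_fin_one,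
        one_pow, mul_one, h2]
      ring

theorem eq_zero_of_icosahedral_semiInvariant {f : Poly} (hf : f.IsHomogeneous 2) {c₀ c₁ c₂ : ℂ}
    (h1 : linSubst !![rootOfUnity 10, 0; 0, (rootOfUnity 10)⁻¹] f = C c₀ * f)
    (h2 : linSubst !![0, 1; -1, 0] f = C c₁ * f) (h3 : linSubst icosahedralMatrix f = C c₂ * f) :
    f = 0 := by
  obtain ⟨a, b, d, rfl⟩ := isHomogeneous_two_eq hf
  obtain ⟨p, hp, hM⟩ := exists_icosahedralMatrix_eq
  have ht := goldenSum_sq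
  rw [hM] at h3
  have hprim := isPrimitiveRoot_rootOfUnity (n := 10) (by norm_num)
  have hε2 := hprim.pow_ne_one_of_pos_of_lt (l := 2) (by norm_num) (by norm_num)
  have hε4 := hprim.pow_ne_one_of_pos_of_lt (l := 4) (by norm_num) (by norm_num)
  have hε0 := rootOfUnity_ne_zero 10
  generalize goldenSum = t at *
  generalize rootOfUnity 10 = ε at *
  have e1 := fun w => congrArg (eval w) h1
  have e2 := fun w => congrArg (eval w) h2
  have e3 := congrArg (eval ![1, 0]) h3
  simp only [eval_linSubst] at e1 e2 e3
  have p1 := e1 ![1, 0]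
  have p2 := e1 ![0, 1]
  have p3 := e1 ![1, 1]
  have q2 := e2 ![0, 1]
  simp only [map_add, map_mul, map_pow, eval_C, eval_u, eval_v,
    mulVec, dotProduct, Fin.sum_univ_two, of_apply, cons_val',
    cons_val_zero, cons_val_one, cons_val_fin_one, mul_one,
    mul_zero, zero_mul, add_zero, zero_add, zero_pow two_ne_zero, one_pow] at p1 p2 p3 q2 e3
  have hε : ε * ε⁻¹ = 1 := mul_inv_cancel₀ hε0
  have ha : (c₀ - ε ^ 2) * a = 0 := by linear_combination -p1
  have hb : (c₀ - 1) * b = 0 := by linear_combination -p3 + p1 + p2 + b * hε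
  have hd : (c₀ * ε ^ 2 - 1) * d = 0 := by linear_combination -ε ^ 2 * p2 + d * (ε * ε⁻¹ + 1) * hε
  suffices a = 0 ∧ b = 0 ∧ d = 0 by
    obtain ⟨rfl, rfl, rfl⟩ := this
    simp
  rcases mul_eq_zero.mp hb with hc | rfl
  · have hc : c₀ = 1 := sub_eq_zero.mp hc
    rw [hc] at ha hd
    have ha : a = 0 := (mul_eq_zero.mp ha).resolve_left (sub_ne_zero.mpr hε2.symm)
    have hd : d = 0 := (mul_eq_zero.mp hd).resolve_left (by rwa [one_mul, sub_eq_zero])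
    refine ⟨ha, ?_, hd⟩
    rw [ha, hd] at e3
    have h4 : p ^ 2 * t * b = 0 := by linear_combination e3
    refine (mul_eq_zero.mp h4).resolve_left ?_
    intro h5
    rcases mul_eq_zero.mp h5 with h6 | h6
    · rw [h6, zero_mul] at hp
      norm_num at hp
    · rw [h6] at ht
      norm_num at ht
  · have hd0 : d = 0 := by
      by_contra hd0
      have ha0 : a ≠ 0 := by
        rintro rfl
        have h5 := (mul_eq_zero.mp hd).resolve_right hd0
        have h6 : c₁ * d = 0 := by linear_combination -q2
        have q1 := e2 ![1, 0]
        simp only [map_add, map_mul, map_pow, eval_C, eval_u, eval_v,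
          mulVec, dotProduct, Fin.sum_univ_two, of_apply, cons_val',
          cons_val_zero, cons_val_one, cons_val_fin_one, mul_one,
          mul_zero, zero_mul, add_zero, zero_add, zero_pow two_ne_zero, one_pow] at q1
        exact hd0 (by linear_combination q1)
      have h5 := (mul_eq_zero.mp hd).resolve_right hd0
      have h6 := (mul_eq_zero.mp ha).resolve_right ha0
      exact hε4 (by linear_combination h5 - ε ^ 2 * h6)
    refine ⟨?_, rfl, hd0⟩
    rw [hd0] at q2
    linear_combination q2

theorem exists_isE8_groupE8 : ∃ x y z : invariants groupE8, IsE8 x y z := by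
  have := finite_groupE8
  have h10 := isPrimitiveRoot_rootOfUnity (n := 10) (by norm_num)
  have hmem : diagSL (rootOfUnity 10) (rootOfUnity_ne_zero 10) ∈ groupE8 :=
    diagSL_mem_generatedBy _ (Or.inl rfl)
  have hprim : ∀ f : Poly, f.IsHomogeneous 2 →
      (∀ g ∈ groupE8, ∃ c : ℂ, linSubst g.1 f = C c * f) → f = 0 := fun f hf h => by
    obtain ⟨c, hc⟩ := h _ hmem
    obtain ⟨c', hc'⟩ := h ⟨!![0, 1; -1, 0], by simp [det_fin_two]⟩
      (Subgroup.subset_closure (Or.inr (Or.inl rfl)))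
    obtain ⟨c'', hc''⟩ := h ⟨icosahedralMatrix, det_icosahedralMatrix⟩
      (Subgroup.subset_closure (Or.inr (Or.inr rfl)))
    exact eq_zero_of_icosahedral_semiInvariant hf hc hc' hc''
  rcases polyhedral_of_primitive hprim with ⟨⟨D⟩⟩ | ⟨⟨D⟩⟩ | ⟨⟨D⟩⟩
  · obtain ⟨i, hi⟩ := D.exists_dvd_of_mem _ (by norm_num) h10 hmem
    fin_cases i <;> simp at hi
  · obtain ⟨i, hi⟩ := D.exists_dvd_of_mem _ (by norm_num) h10 hmem
    fin_cases i <;> simp at hi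
  · exact D.exists_isE8

theorem monomial_eq_mul (m : Fin 2 →₀ ℕ) (c : ℂ) : monomial m c = C c * (u ^ m 0 * v ^ m 1) := by
  rw [monomial_eq, Finsupp.prod_fintype _ _ (by simp), Fin.prod_univ_two]
  rfl

theorem coeff_linSubst_diag (a b : ℂ) (m : Fin 2 →₀ ℕ) (f : Poly) :
    coeff m (linSubst !![a, 0; 0, b] f) = a ^ m 0 * b ^ m 1 * coeff m f := by
  induction f using MvPolynomial.induction_on' with
  | monomial k c =>
    have : linSubst !![a, 0; 0, b] (monomial k c) = monomial k (a ^ k 0 * b ^ k 1 * c) := by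
      rw [monomial_eq_mul, monomial_eq_mul, map_mul, map_mul, map_pow, map_pow, linSubst_diag_u,
        linSubst_diag_v, algHom_C, algebraMap_eq, map_mul, map_mul, map_pow, map_pow]
      ring
    rw [this, coeff_monomial, coeff_monomial]
    split_ifs with h
    · rw [h]
    · rw [mul_zero]
  | add p q hp hq => rw [map_add, coeff_add, hp, hq, coeff_add, mul_add]

theorem mem_of_diag_invariant {N : ℕ} {ζ : ℂ} (hζ : IsPrimitiveRoot ζ N) (h0 : ζ ≠ 0) {f : Poly}
    (h : linSubst !![ζ, 0; 0, ζ⁻¹] f = f) {P : Poly → Prop} (zero : P 0)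
    (add : ∀ f g, P f → P g → P (f + g)) (smul : ∀ c f, P f → P (C c * f))
    (hu : ∀ i t, P ((u * v) ^ i * (u ^ N) ^ t)) (hv : ∀ i t, P ((u * v) ^ i * (v ^ N) ^ t)) :
    P f := by
  rw [f.as_sum]
  refine Finset.sum_induction _ P add zero fun m hm => ?_
  have h1 := coeff_linSubst_diag ζ ζ⁻¹ m f
  rw [h] at h1
  have h2 : ζ ^ m 0 * ζ⁻¹ ^ m 1 = 1 := by
    have h3 : (ζ ^ m 0 * ζ⁻¹ ^ m 1 - 1) * coeff m f = 0 := by linear_combination -h1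
    exact sub_eq_zero.mp ((mul_eq_zero.mp h3).resolve_right (mem_support_iff.mp hm))
  rw [inv_pow, mul_inv_eq_one₀ (pow_ne_zero _ h0)] at h2
  have hd : ∀ i j : ℕ, ζ ^ i = ζ ^ j → i ≤ j → ∃ t, j = i + N * t := fun i j hij hle => by
    obtain ⟨d, rfl⟩ := Nat.exists_eq_add_of_le hle
    rw [pow_add, left_eq_mul₀ (pow_ne_zero _ h0)] at hij
    obtain ⟨t, rfl⟩ := hζ.dvd_of_pow_eq_one d hij
    exact ⟨t, rfl⟩
  rw [monomial_eq_mul]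
  refine smul _ _ ?_
  rcases le_total (m 0) (m 1) with hle | hle
  · obtain ⟨t, ht⟩ := hd _ _ h2 hle
    convert hv (m 0) t using 1
    rw [ht]
    ring
  · obtain ⟨t, ht⟩ := hd _ _ h2.symm hle
    convert hu (m 1) t using 1
    rw [ht]
    ring

theorem linSubst_eq_of_mem {f : Poly} (hf : f ∈ invariants Γ) {g : SL2} (hg : g ∈ Γ) :
    linSubst g.1 f = f := hf g hg

/-- Generators of type `A n`. -/
structure IsA (n : ℕ) (x y z : invariants Γ) : Prop where
  hx : (x : Poly) = u ^ (n + 1)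
  hy : (y : Poly) = v ^ (n + 1)
  hz : (z : Poly) = u * v
  gen : Generate x y z

theorem mem_groupA_iff {f : Poly} (h : ∀ ε : ℂ, ε ^ (n + 1) = 1 → linSubst !![ε, 0; 0, ε⁻¹] f = f) :
    f ∈ invariants (groupA n) := by
  apply mem_invariants_generatedBy
  rintro M ⟨ε, hε, rfl⟩
  exact h ε hε

theorem linSubst_diag_pow {N : ℕ} {a b : ℂ} (ha : a ^ N = 1) (hb : b ^ N = 1) :
    linSubst !![a, 0; 0, b] (u ^ N) = u ^ N ∧ linSubst !![a, 0; 0, b] (v ^ N) = v ^ N := by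
  rw [map_pow, map_pow, linSubst_diag_u, linSubst_diag_v, mul_pow, mul_pow, ← map_pow, ← map_pow,
    ha, hb, map_one, one_mul, one_mul]
  exact ⟨rfl, rfl⟩

theorem linSubst_diag_uv (a b : ℂ) : linSubst !![a, 0; 0, b] (u * v) = C (a * b) * (u * v) := by
  rw [map_mul, linSubst_diag_u, linSubst_diag_v, map_mul]
  ring

theorem generators_mem_groupA (n : ℕ) : u ^ (n + 1) ∈ invariants (groupA n) ∧
    v ^ (n + 1) ∈ invariants (groupA n) ∧ u * v ∈ invariants (groupA n) := by
  have hinv : ∀ ε : ℂ, ε ^ (n + 1) = 1 → ε⁻¹ ^ (n + 1) = 1 := fun ε hε => by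
    rw [inv_pow, hε, inv_one]
  refine ⟨mem_groupA_iff fun ε hε => (linSubst_diag_pow hε (hinv ε hε)).1,
    mem_groupA_iff fun ε hε => (linSubst_diag_pow hε (hinv ε hε)).2, mem_groupA_iff fun ε hε => ?_⟩
  have h0 : ε ≠ 0 := by
    rintro rfl
    simp at hε
  rw [linSubst_diag_uv, mul_inv_cancel₀ h0, map_one, one_mul]

theorem exists_diag_mem_groupA (n : ℕ) : ∃ (ζ : ℂ) (h0 : ζ ≠ 0), IsPrimitiveRoot ζ (n + 1) ∧
    diagSL ζ h0 ∈ groupA n := by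
  have h := isPrimitiveRoot_rootOfUnity (n := n + 1) (by omega)
  exact ⟨_, rootOfUnity_ne_zero _, h, diagSL_mem_generatedBy _ ⟨_, h.pow_eq_one, rfl⟩⟩

theorem mem_subalgebra_of_diag_invariant {N : ℕ} {ζ : ℂ} (hζ : IsPrimitiveRoot ζ N) (h0 : ζ ≠ 0)
    {f : Poly} (h : linSubst !![ζ, 0; 0, ζ⁻¹] f = f) (A : Subalgebra ℂ Poly) (hx : u ^ N ∈ A)
    (hy : v ^ N ∈ A) (hz : u * v ∈ A) : f ∈ A :=
  mem_of_diag_invariant hζ h0 h (P := fun f => f ∈ A) A.zero_mem (fun _ _ => A.add_mem)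
    (fun c _ hf => mul_mem (A.algebraMap_mem c) hf)
    (fun i t => mul_mem (pow_mem hz i) (pow_mem hx t))
    fun i t => mul_mem (pow_mem hz i) (pow_mem hy t)

theorem mem_adjoin_of_mem_groupA {f : Poly} (hf : f ∈ invariants (groupA n)) :
    f ∈ adjoin ℂ {u ^ (n + 1), v ^ (n + 1), u * v} := by
  obtain ⟨ζ, h0, hζ, hmem⟩ := exists_diag_mem_groupA n
  have key := linSubst_eq_of_mem hf hmem
  exact mem_subalgebra_of_diag_invariant hζ h0 key _ (subset_adjoin (by simp))
    (subset_adjoin (by simp)) (subset_adjoin (by simp))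

theorem exists_isA (n : ℕ) : ∃ x y z : invariants (groupA n), IsA n x y z := by
  obtain ⟨hx, hy, hz⟩ := generators_mem_groupA n
  exact ⟨⟨_, hx⟩, ⟨_, hy⟩, ⟨_, hz⟩, rfl, rfl, rfl,
    generate_of_le fun f hf => mem_adjoin_of_mem_groupA hf⟩

theorem bracket_mul_pow (i : ℕ) : polyBracket (u * v) (u ^ i) = C (-(i : ℂ)) * u ^ i ∧
    polyBracket (u * v) (v ^ i) = C (i : ℂ) * v ^ i := by
  cases i with
  | zero => simp [polyBracket]
  | succ i =>
    constructor <;>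
    · simp only [polyBracket, Derivation.leibniz, Derivation.leibniz_pow, pderiv_zero_u,
        pderiv_one_u, pderiv_zero_v, pderiv_one_v, smul_eq_mul, nsmul_eq_mul, map_neg, map_natCast]
      push_cast
      ring

theorem coe_smul_eq (c : ℂ) (f : invariants Γ) :
    ((c • f : invariants Γ) : Poly) = C c * (f : Poly) := smul_eq_C_mul _ _

theorem linSubst_coe_smul {M : Mat} {c : ℂ} (hM : linSubst M (f : Poly) = C c * (h : Poly))
    (hc : c ^ 2 = 1) : linSubst M ((c • f : invariants Γ) : Poly) = h := by
  rw [coe_smul_eq, map_mul, hM, algHom_C, algebraMap_eq, ← mul_assoc, ← map_mul, ← pow_two, hc,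
    map_one, one_mul]

theorem bracket_add (f g h : invariants Γ) : bracket f (g + h) = bracket f g + bracket f h := by
  apply Subtype.ext
  change polyBracket _ ((g : Poly) + h) = polyBracket _ _ + polyBracket _ _
  simp only [polyBracket, map_add]
  ring

theorem bracket_smul (c : ℂ) (f g : invariants Γ) : bracket f (c • g) = c • bracket f g := by
  apply Subtype.ext
  rw [coe_bracket, coe_smul_eq, coe_smul_eq, coe_bracket]
  simp only [polyBracket, pderiv_C_mul]
  ring

/-- The Poisson bracket with `f` as a linear map. -/
noncomputable def bracketHom (f : invariants Γ) : invariants Γ →ₗ[ℂ] invariants Γ where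
  toFun := bracket f
  map_add' := bracket_add f
  map_smul' c := bracket_smul c f

namespace IsA

theorem rel (h : IsA n x y z) : x * y = z ^ (n + 1) := by
  apply Subtype.ext
  change (x : Poly) * (y : Poly) = (z : Poly) ^ (n + 1)
  rw [h.hx, h.hy, h.hz, mul_pow]

theorem homogeneous_x (h : IsA n x y z) : (x : Poly).IsHomogeneous (n + 1) := by
  rw [h.hx]
  simpa using u_isHomogeneous.pow (n + 1)

theorem homogeneous_y (h : IsA n x y z) : (y : Poly).IsHomogeneous (n + 1) := by
  rw [h.hy]
  simpa using v_isHomogeneous.pow (n + 1)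

theorem homogeneous_z (h : IsA n x y z) : (z : Poly).IsHomogeneous 2 := by
  rw [h.hz]
  exact u_isHomogeneous.mul v_isHomogeneous

theorem bracket_z_x (h : IsA n x y z) : bracket z x = (-((n + 1 : ℕ) : ℂ)) • x := by
  apply Subtype.ext
  rw [coe_bracket, coe_smul_eq, h.hx, h.hz, (bracket_mul_pow _).1]

theorem bracket_z_y (h : IsA n x y z) : bracket z y = ((n + 1 : ℕ) : ℂ) • y := by
  apply Subtype.ext
  rw [coe_bracket, coe_smul_eq, h.hy, h.hz, (bracket_mul_pow _).2]

theorem isRelPrime (h : IsA n x y z) : IsRelPrime (x : Poly) (y : Poly) := by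
  have huv : IsRelPrime u v := by
    refine (X_isLine 0).1.irreducible.isRelPrime_iff_not_dvd.mpr fun ⟨q, hq⟩ => ?_
    have := congrArg (eval ![0, 1]) hq
    rw [eval_v, map_mul, show (X 0 : Poly) = u from rfl, eval_u] at this
    simp at this
  rw [h.hx, h.hy]
  exact huv.pow

theorem bracket_ne_zero (h : IsA n x y z) : bracket x y ≠ 0 :=
  bracket_ne_zero_of_isRelPrime h.homogeneous_x h.homogeneous_y (by omega) (by omega) h.isRelPrime

theorem x_ne_zero (h : IsA n x y z) : x ≠ 0 := (ne_zero_of_bracket_ne_zero h.bracket_ne_zero).1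

theorem y_ne_zero (h : IsA n x y z) : y ≠ 0 := (ne_zero_of_bracket_ne_zero h.bracket_ne_zero).2

theorem z_ne_zero (h : IsA n x y z) : z ≠ 0 := fun h0 => by
  have := h.rel
  rw [h0, zero_pow (by omega)] at this
  exact mul_ne_zero h.x_ne_zero h.y_ne_zero this

theorem independent (h : IsA n x y z) {a b : ℂ} (h0 : a • x + b • y = 0) : a = 0 ∧ b = 0 :=
  coeffs_eq_zero h.bracket_ne_zero one_ne_zero one_ne_zero (by simpa using h0)

theorem exists_bracket_eq (h : IsA n x y z) (hf : (f : Poly).IsHomogeneous (n + 1)) : ∃ a b : ℂ,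
    bracket z f = a • x + b • y := by
  have := h.gen.mem_of_isHomogeneous h.homogeneous_x h.homogeneous_y h.homogeneous_z hf
    ((Submodule.span ℂ {x, y}).comap (bracketHom z)) ?_
  · obtain ⟨a, b, hab⟩ := Submodule.mem_span_pair.mp this
    exact ⟨a, b, hab.symm⟩
  · intro i j k hijk
    change bracket z (x ^ i * y ^ j * z ^ k) ∈ Submodule.span ℂ {x, y}
    rcases Nat.eq_zero_or_pos i with rfl | hi
    · rcases Nat.eq_zero_or_pos j with rfl | hj
      · have : bracket z (x ^ 0 * y ^ 0 * z ^ k) = 0 := by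
          apply Subtype.ext
          rw [pow_zero, pow_zero, one_mul, one_mul]
          change polyBracket (z : Poly) ((z : Poly) ^ k) = 0
          simp only [polyBracket, Derivation.leibniz_pow, smul_eq_mul, nsmul_eq_mul]
          ring
        rw [this]
        exact zero_mem _
      · have : j = 1 ∧ k = 0 := by constructor <;> nlinarith [Nat.zero_le k]
        obtain ⟨rfl, rfl⟩ := this
        rw [pow_zero, pow_one, pow_zero, one_mul, mul_one, h.bracket_z_y]
        exact Submodule.smul_mem _ _ (Submodule.subset_span (by simp))
    · have : i = 1 ∧ j = 0 ∧ k = 0 := by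
        have hi1 : i = 1 := by nlinarith [Nat.zero_le k, Nat.zero_le ((n + 1) * j)]
        subst hi1
        have hj : (n + 1) * j = 0 := by omega
        exact ⟨rfl, (Nat.mul_eq_zero.mp hj).resolve_left (by omega), by omega⟩
      obtain ⟨rfl, rfl, rfl⟩ := this
      rw [pow_zero, pow_one, pow_zero, mul_one, mul_one, h.bracket_z_x]
      exact Submodule.smul_mem _ _ (Submodule.subset_span (by simp))

end IsA

theorem smul_bracket (c : ℂ) (f g : invariants Γ) : bracket (c • f) g = c • bracket f g := by
  apply Subtype.ext
  rw [coe_bracket, coe_smul_eq, coe_smul_eq, coe_bracket]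
  simp only [polyBracket, pderiv_C_mul]
  ring

theorem IsPlaneCurve.swap {a b : invariants Γ} {F G : Poly → Poly → Poly} (h : IsPlaneCurve θ a b F)
    (hG : aeval ![X 1, X 0] (F (X 0) (X 1)) = G (X 0) (X 1)) : IsPlaneCurve θ b a G := by
  obtain ⟨e, ha, hb⟩ := h
  have hρ : (aeval ![X 1, X 0] : Poly →ₐ[ℂ] Poly).comp (aeval ![X 1, X 0]) = AlgHom.id ℂ Poly := by
    apply algHom_ext
    intro i
    fin_cases i <;> simp
  let ρ : Poly ≃ₐ[ℂ] Poly := AlgEquiv.ofAlgHom (aeval ![X 1, X 0]) (aeval ![X 1, X 0]) hρ hρ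
  have hmap : Ideal.span {F (X 0) (X 1)} = Ideal.map (ρ : Poly →+* Poly)
      (Ideal.span {G (X 0) (X 1)}) := by
    rw [Ideal.map_span, Set.image_singleton, ← hG]
    congr 2
    exact (DFunLike.congr_fun hρ _).symm
  refine ⟨(Ideal.quotientEquivAlg _ _ ρ hmap).trans e, ?_, ?_⟩
  · rw [AlgEquiv.trans_apply, ← hb]
    congr 1
    change Ideal.Quotient.mk _ (aeval ![X 1, X 0] (X 0)) = _
    simp
  · rw [AlgEquiv.trans_apply, ← ha]
    congr 1
    change Ideal.Quotient.mk _ (aeval ![X 1, X 0] (X 1)) = _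
    simp

/-- If the generators are modulo an ideal in the image of `φ`, so are all functions. -/
theorem Generate.exists_sub_mem (h : Generate x y z) {B : Type*} [CommRing B] [Algebra ℂ B]
    (φ : B →ₐ[ℂ] invariants Γ) {J : Ideal (invariants Γ)} (hx : ∃ b, x - φ b ∈ J)
    (hy : ∃ b, y - φ b ∈ J) (hz : ∃ b, z - φ b ∈ J) (f : invariants Γ) : ∃ b, f - φ b ∈ J := by
  have e : ∀ g : invariants Γ, (∃ b, g - φ b ∈ J) ↔
      g ∈ ((Ideal.Quotient.mkₐ ℂ J).comp φ).range.comap (Ideal.Quotient.mkₐ ℂ J) := fun g => by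
    rw [Subalgebra.mem_comap, AlgHom.mem_range]
    refine exists_congr fun b => ?_
    rw [← Ideal.Quotient.mk_eq_mk_iff_sub_mem]
    exact eq_comm
  rw [e] at hx hy hz ⊢
  exact h.induction _ hx hy hz f

theorem X_dvd_of_aeval_eq_zero (i : Fin 2) {N : ℕ} (hN : 0 < N) {p : Poly}
    (h : aeval (fun k => if k = i then 0 else (Polynomial.X ^ N : Polynomial ℂ)) p = 0) :
    X i ∣ p := by
  let φ : Poly →ₐ[ℂ] Polynomial ℂ := aeval fun k => if k = i then 0 else Polynomial.X
  have hcomp : (Polynomial.expand ℂ N).comp φ =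
      aeval fun k => if k = i then 0 else (Polynomial.X ^ N : Polynomial ℂ) := by
    apply algHom_ext
    intro k
    simp only [φ, AlgHom.comp_apply, aeval_X]
    split_ifs <;> simp
  have h1 : φ p = 0 := by
    rw [← hcomp, AlgHom.comp_apply] at h
    exact (Polynomial.expand_eq_zero hN).mp h
  obtain ⟨j, hj⟩ : ∃ j, j ≠ i := exists_ne i
  have hker := ker_eq_span_of_section (X i) φ (Polynomial.aeval (X j)) (by simp [φ]) fun k => by
    by_cases hk : k = i
    · subst hk
      simp [φ]
    · have : k = j := by omega
      subst this
      simp [φ, hk]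
  rw [← Ideal.mem_span_singleton, ← hker]
  exact h1

namespace IsA

theorem exists_diag (h : IsA n x y z) {a b s t : ℂ} (hab : a * b = -1) (ha : a ^ (n + 1) = s)
    (hb : b ^ (n + 1) = t) (hs : s ^ 2 = 1) (ht : t ^ 2 = 1) : ∃ θ : Aut Γ,
    IsAntiPoissonInvolution θ ∧ θ x = s • x ∧ θ y = t • y ∧ θ z = -z := by
  have hx : linSubst !![a, 0; 0, b] (x : Poly) = C s * (x : Poly) := by
    rw [h.hx, map_pow, linSubst_diag_u, mul_pow, ← map_pow, ha]
  have hy : linSubst !![a, 0; 0, b] (y : Poly) = C t * (y : Poly) := by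
    rw [h.hy, map_pow, linSubst_diag_v, mul_pow, ← map_pow, hb]
  have hz : linSubst !![a, 0; 0, b] (z : Poly) = -(z : Poly) := by
    rw [h.hz, linSubst_diag_uv, hab, map_neg, map_one, neg_one_mul]
  refine h.gen.exists_antiPoisson !![a, 0; 0, b] (by rw [det_fin_two_of, hab]; ring)
    _ _ _ ?_ ?_ ?_ ?_ ?_ ?_
  · rw [hx, coe_smul_eq]
  · rw [hy, coe_smul_eq]
  · exact hz
  · exact linSubst_coe_smul hx hs
  · exact linSubst_coe_smul hy ht
  · change linSubst _ (-(z : Poly)) = _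
    rw [map_neg, hz, neg_neg]

theorem exists_antidiag (h : IsA n x y z) {s : ℂ} (hs : s ^ 2 = 1) : ∃ θ : Aut Γ,
    IsAntiPoissonInvolution θ ∧ θ x = s • y ∧ θ y = s • x ∧ θ z = z := by
  obtain ⟨a, ha0, ha⟩ := exists_root (n + 1) (a := s) (by rintro rfl; norm_num at hs)
  have hb : a⁻¹ ^ (n + 1) = s := by
    rw [inv_pow, ha]
    exact inv_eq_of_mul_eq_one_right (by rw [← pow_two, hs])
  have hx : linSubst !![0, a; a⁻¹, 0] (x : Poly) = C s * (y : Poly) := by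
    rw [h.hx, h.hy, map_pow, linSubst_antidiag_u, mul_pow, ← map_pow, ha]
  have hy : linSubst !![0, a; a⁻¹, 0] (y : Poly) = C s * (x : Poly) := by
    rw [h.hx, h.hy, map_pow, linSubst_antidiag_v, mul_pow, ← map_pow, hb]
  have hz : linSubst !![0, a; a⁻¹, 0] (z : Poly) = (z : Poly) := by
    have : (C a * C a⁻¹ : Poly) = 1 := by rw [← map_mul, mul_inv_cancel₀ ha0, map_one]
    rw [h.hz, map_mul, linSubst_antidiag_u, linSubst_antidiag_v]
    linear_combination u * v * this
  refine h.gen.exists_antiPoisson !![0, a; a⁻¹, 0]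
    (by rw [det_fin_two_of, mul_inv_cancel₀ ha0]; ring) _ _ _ ?_ ?_ hz ?_ ?_ hz
  · rw [hx, coe_smul_eq]
  · rw [hy, coe_smul_eq]
  · exact linSubst_coe_smul hy hs
  · exact linSubst_coe_smul hx hs

theorem apply_eq (h : IsA n x y z) (hθ : IsAntiPoissonInvolution θ) {c : ℂ} (hz : θ z = c • z) :
    (c = 1 ∧ ∃ b : ℂ, b ≠ 0 ∧ θ x = b • y ∧ θ y = b⁻¹ • x) ∨
    (c = -1 ∧ ∃ a b : ℂ, a ^ 2 = 1 ∧ b ^ 2 = 1 ∧ a * b = (-1) ^ (n + 1) ∧ θ x = a • x ∧ θ y = b • y)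
    := by
  have hN : ((n + 1 : ℕ) : ℂ) ≠ 0 := Nat.cast_ne_zero.mpr (by omega)
  set N := ((n + 1 : ℕ) : ℂ) with hNdef
  have hb : ∀ a b : ℂ, bracket z (a • x + b • y) = (-N * a) • x + (N * b) • y := fun a b => by
    rw [bracket_add, bracket_smul, bracket_smul, h.bracket_z_x, h.bracket_z_y, smul_smul, smul_smul]
    congr 2 <;> ring
  have key : ∀ (f : invariants Γ) (m : ℂ), (f : Poly).IsHomogeneous (n + 1) → m ≠ 0 →
      bracket z f = m • f → ∃ a b : ℂ, θ f = a • x + b • y ∧ c * (-N * a) = -m * a ∧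
        c * (N * b) = -m * b := fun f m hf hm hbr => by
    obtain ⟨a, b, hab⟩ := h.exists_bracket_eq (hθ.graded _ _ hf)
    have h1 := hθ.antiPoisson z f
    rw [hz, smul_bracket, hbr, map_smul, hab] at h1
    have h2 : θ f = (-m⁻¹ * c * a) • x + (-m⁻¹ * c * b) • y := by
      have h3 : θ f = m⁻¹ • (m • θ f) := by rw [smul_smul, inv_mul_cancel₀ hm, one_smul]
      rw [h3, h1]
      module
    refine ⟨_, _, h2, ?_⟩
    have h4 := hθ.antiPoisson z f
    rw [hz, smul_bracket, hbr, map_smul, h2, hb] at h4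
    generalize -m⁻¹ * c * a = p at h4
    generalize -m⁻¹ * c * b = q at h4
    have h5 : (c * (-N * p) + m * p) • x + (c * (N * q) + m * q) • y = 0 := by
      have h6 := add_eq_zero_iff_eq_neg.mpr h4
      rw [← h6]
      module
    obtain ⟨h7, h8⟩ := h.independent h5
    exact ⟨by linear_combination h7, by linear_combination h8⟩
  obtain ⟨a, b, hx, ha, hb1⟩ := key x (-N) h.homogeneous_x (neg_ne_zero.mpr hN) h.bracket_z_x
  obtain ⟨a', b', hy, ha', hb'⟩ := key y N h.homogeneous_y hN h.bracket_z_y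
  have hx0 := h.x_ne_zero
  have hy0 := h.y_ne_zero
  have ha2 : (c + 1) * a = 0 := mul_left_cancel₀ hN (by linear_combination -ha)
  have hb2 : (c - 1) * b = 0 := mul_left_cancel₀ hN (by linear_combination hb1)
  have ha2' : (c - 1) * a' = 0 := mul_left_cancel₀ hN (by linear_combination -ha')
  have hb2' : (c + 1) * b' = 0 := mul_left_cancel₀ hN (by linear_combination hb')
  rcases sq_eq_one_cases (hθ.sq_eq_one h.z_ne_zero hz) with rfl | rfl
  · left
    have ha0 : a = 0 := (mul_eq_zero.mp ha2).resolve_left (by norm_num)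
    have hb0 : b' = 0 := (mul_eq_zero.mp hb2').resolve_left (by norm_num)
    rw [ha0, zero_smul, zero_add] at hx
    rw [hb0, zero_smul, add_zero] at hy
    have h1 := hθ.involutive x
    rw [hx, map_smul, hy, smul_smul] at h1
    have h2 : (b * a' - 1) • x = 0 := by rw [sub_smul, h1, one_smul, sub_self]
    have h3 := sub_eq_zero.mp ((smul_eq_zero.mp h2).resolve_right hx0)
    exact ⟨rfl, b, left_ne_zero_of_mul_eq_one h3, hx, by rw [hy, eq_inv_of_mul_eq_one_right h3]⟩
  · right
    have hb0 : b = 0 := (mul_eq_zero.mp hb2).resolve_left (by norm_num)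
    have ha0 : a' = 0 := (mul_eq_zero.mp ha2').resolve_left (by norm_num)
    rw [hb0, zero_smul, add_zero] at hx
    rw [ha0, zero_smul, zero_add] at hy
    refine ⟨rfl, a, b', hθ.sq_eq_one hx0 hx, hθ.sq_eq_one hy0 hy, ?_, hx, hy⟩
    have h1 := congrArg θ h.rel
    rw [map_mul, map_pow, hz, hx, hy, smul_mul_smul_comm, smul_pow, ← h.rel] at h1
    have h2 : (a * b' - (-1) ^ (n + 1)) • (x * y) = 0 := by rw [sub_smul, h1, sub_self]
    exact sub_eq_zero.mp ((smul_eq_zero.mp h2).resolve_right (mul_ne_zero hx0 hy0))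

theorem exists_diag_poisson (h : IsA n x y z) {c : ℂ} (hc : c ≠ 0) : ∃ σ : Aut Γ,
    IsGradedPoisson σ ∧ σ x = c ^ (n + 1) • x ∧ σ y = (c ^ (n + 1))⁻¹ • y ∧ σ z = z := by
  have e : ∀ c : ℂ, c ≠ 0 → linSubst !![c, 0; 0, c⁻¹] (x : Poly) = C (c ^ (n + 1)) * (x : Poly) ∧
      linSubst !![c, 0; 0, c⁻¹] (y : Poly) = C ((c ^ (n + 1))⁻¹) * (y : Poly) ∧
      linSubst !![c, 0; 0, c⁻¹] (z : Poly) = (z : Poly) := fun c hc => by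
    refine ⟨?_, ?_, ?_⟩
    · rw [h.hx, map_pow, linSubst_diag_u, mul_pow, ← map_pow]
    · rw [h.hy, map_pow, linSubst_diag_v, mul_pow, ← map_pow, inv_pow]
    · rw [h.hz, linSubst_diag_uv, mul_inv_cancel₀ hc, map_one, one_mul]
  obtain ⟨s1, s2, s3⟩ := e c hc
  obtain ⟨t1, t2, t3⟩ := e c⁻¹ (inv_ne_zero hc)
  obtain ⟨σ, hσ, hσf⟩ := h.gen.exists_gradedPoisson !![c, 0; 0, c⁻¹] !![c⁻¹, 0; 0, c⁻¹⁻¹]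
    (by
      rw [mul_fin_two, one_fin_two]
      simp [hc])
    (by rw [det_fin_two_of, mul_inv_cancel₀ hc]; ring) (s1 ▸ C_mul_mem _ _ x.2)
    (s2 ▸ C_mul_mem _ _ y.2) (by rw [s3]; exact z.2) (t1 ▸ C_mul_mem _ _ x.2)
    (t2 ▸ C_mul_mem _ _ y.2) (by rw [t3]; exact z.2)
  exact ⟨σ, hσ, Subtype.ext (by rw [hσf, s1, coe_smul_eq]),
    Subtype.ext (by rw [hσf, s2, coe_smul_eq]), Subtype.ext (by rw [hσf, s3])⟩

theorem areConjugate_of_apply_z (h : IsA n x y z) (hθ : IsAntiPoissonInvolution θ)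
    (hη : IsAntiPoissonInvolution η) (hz : θ z = z) (hz' : η z = z) : AreConjugate θ η := by
  have h1 : (1 : ℂ) ≠ -1 := by norm_num
  obtain ⟨-, b, hb, hx, hy⟩ := (h.apply_eq hθ (c := 1) (by rw [hz, one_smul])).resolve_right
    fun hc => h1 hc.1
  obtain ⟨-, b', hb', hx', hy'⟩ := (h.apply_eq hη (c := 1) (by rw [hz', one_smul])).resolve_right
    fun hc => h1 hc.1
  obtain ⟨k, hk0, hk⟩ := exists_root 2 (div_ne_zero hb hb')
  obtain ⟨α, hα0, hα⟩ := exists_root (n + 1) hk0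
  have hkb : k ^ 2 * b' = b := by rw [hk, div_mul_cancel₀ _ hb']
  obtain ⟨σ, hσ, σx, σy, σz⟩ := h.exists_diag_poisson hα0
  rw [hα] at σx σy
  refine h.gen.areConjugate hσ ?_ ?_ (by rw [hz, σz, hz'])
  · rw [hx, σx, map_smul, map_smul, σy, hx', smul_smul, smul_smul, ← hkb]
    congr 1
    field_simp
  · rw [hy, σy, map_smul, map_smul, σx, hy', smul_smul, smul_smul, ← hkb]
    congr 1
    field_simp

theorem areConjugate_of_even (h : IsA n x y z) (hn : Even n) (hx : θ x = x) (hy : θ y = -y)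
    (hz : θ z = -z) (hx' : η x = -x) (hy' : η y = y) (hz' : η z = -z) : AreConjugate θ η := by
  have hs : (-1 : Poly) ^ (n + 1) = -1 := hn.add_one.neg_one_pow
  have e : ∀ c d : ℂ, c * d = -1 → c ^ (n + 1) = c → d ^ (n + 1) = d →
      linSubst !![0, c; d, 0] (x : Poly) = C c * (y : Poly) ∧
      linSubst !![0, c; d, 0] (y : Poly) = C d * (x : Poly) ∧
      linSubst !![0, c; d, 0] (z : Poly) = -(z : Poly) := fun c d hcd hc hd => by
    refine ⟨?_, ?_, ?_⟩
    · rw [h.hx, h.hy, map_pow, linSubst_antidiag_u, mul_pow, ← map_pow, hc]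
    · rw [h.hx, h.hy, map_pow, linSubst_antidiag_v, mul_pow, ← map_pow, hd]
    · have : (C c * C d : Poly) = -1 := by rw [← map_mul, hcd, map_neg, map_one]
      rw [h.hz, map_mul, linSubst_antidiag_u, linSubst_antidiag_v]
      linear_combination u * v * this
  obtain ⟨s1, s2, s3⟩ := e 1 (-1) (by ring) (one_pow _) hn.add_one.neg_one_pow
  obtain ⟨t1, t2, t3⟩ := e (-1) 1 (by ring) hn.add_one.neg_one_pow (one_pow _)
  obtain ⟨σ, hσ, hσf⟩ := h.gen.exists_gradedPoisson !![0, 1; -1, 0] !![0, -1; 1, 0]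
    (by rw [mul_fin_two, one_fin_two]; simp)
    (by rw [det_fin_two_of]; ring) (s1 ▸ C_mul_mem _ _ y.2) (s2 ▸ C_mul_mem _ _ x.2)
    (s3 ▸ neg_mem z.2) (t1 ▸ C_mul_mem _ _ y.2) (t2 ▸ C_mul_mem _ _ x.2) (t3 ▸ neg_mem z.2)
  have σx : σ x = y := Subtype.ext (by rw [hσf, s1, map_one, one_mul])
  have σy : σ y = -x := Subtype.ext (by
    rw [hσf, s2, map_neg, map_one, neg_one_mul]
    rfl)
  have σz : σ z = -z := Subtype.ext (by
    rw [hσf, s3]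
    rfl)
  refine h.gen.areConjugate hσ ?_ ?_ ?_
  · rw [hx, σx, hy']
  · rw [hy, map_neg, σy, map_neg, hx']
  · rw [hz, map_neg, σz, map_neg, hz']

end IsA

theorem AreConjugate.trans {ζ : Aut Γ} (h : AreConjugate θ η) (h' : AreConjugate η ζ) :
    AreConjugate θ ζ := by
  obtain ⟨σ, hσ, h1⟩ := h
  obtain ⟨τ, hτ, h2⟩ := h'
  refine ⟨σ.trans τ, ⟨fun d f hf => hτ.graded _ _ (hσ.graded _ _ hf), fun f g => ?_⟩, fun f => ?_⟩
  · simp only [AlgEquiv.trans_apply, hσ.poisson, hτ.poisson]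
  · simp only [AlgEquiv.trans_apply, h1, h2]

theorem Generate.aeval_mem (h : Generate x y z) {M : Mat} (hx : (θ x : Poly) = linSubst M x)
    (hy : (θ y : Poly) = linSubst M y) (hz : (θ z : Poly) = linSubst M z) (f : invariants Γ) :
    (θ f : Poly) = linSubst M f := by
  have := h.algHom_ext (φ := (invariants Γ).val.comp (θ : invariants Γ →ₐ[ℂ] invariants Γ))
    (ψ := (linSubst M).comp (invariants Γ).val) hx hy hz
  exact DFunLike.congr_fun this f

theorem IsPlaneCurve.two_lines (hθ : IsGraded θ) {a b : invariants Γ} (ha : a ∈ originIdeal Γ)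
    (hb : b ∈ originIdeal Γ) {F : Poly → Poly → Poly} (h : IsPlaneCurve θ a b F) (G H : Poly)
    (hF : F (X 0) (X 1) = G * H) (hG0 : constantCoeff G = 0) (hH0 : constantCoeff H = 0)
    (hG : Prime G ∧ IsAffineLine (Poly ⧸ Ideal.span {G}))
    (hH : Prime H ∧ IsAffineLine (Poly ⧸ Ideal.span {H}))
    (hmeet : ∀ Q : Ideal Poly, Q.IsPrime → G ∈ Q → H ∈ Q → X 0 ∈ Q ∧ X 1 ∈ Q) :
    IsReducedUnion θ 2 0 ∧ HasGoodComponents (FixedRing θ) := by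
  refine h.lines hθ ha hb ![G, H] (by rw [hF, Fin.prod_univ_two]; rfl)
    (Fin.forall_fin_two.mpr ⟨hG0, hH0⟩) (Fin.forall_fin_two.mpr ⟨hG, hH⟩) ?_
  · intro i j hij
    obtain ⟨rfl, rfl⟩ : i = 0 ∧ j = 1 := by omega
    exact hmeet

theorem span_image_neg_sub (S : Set (invariants Γ)) :
    Ideal.span ((fun f => -f - f) '' S) = Ideal.span S := by
  refine le_antisymm (Ideal.span_le.mpr ?_) (Ideal.span_le.mpr fun f hf => ?_)
  · rintro _ ⟨f, hf, rfl⟩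
    exact sub_mem (neg_mem (Ideal.subset_span hf)) (Ideal.subset_span hf)
  · have := Submodule.smul_mem _ (algebraMap ℂ (invariants Γ) (-1 / 2))
      (Ideal.subset_span (Set.mem_image_of_mem (fun f => -f - f) hf))
    have e : (-1 / 2 : ℂ) • (-f - f) = f := by module
    rwa [smul_eq_mul, ← smul_def, e] at this

namespace IsA

theorem x_mem (h : IsA n x y z) : x ∈ originIdeal Γ := mem_originIdeal_of h.homogeneous_x

theorem y_mem (h : IsA n x y z) : y ∈ originIdeal Γ := mem_originIdeal_of h.homogeneous_y

theorem z_mem (h : IsA n x y z) : z ∈ originIdeal Γ := mem_originIdeal_of h.homogeneous_z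

theorem isDoubleCover (h : IsA n x y z) :
    IsDoubleCover z (x - y) (x + y) (X 1 ^ 2 + 4 * X 0 ^ (n + 1)) := by
  obtain ⟨η, -, hx, hy, hz⟩ := h.exists_antidiag (s := -1) (by norm_num)
  rw [neg_one_smul] at hx hy
  refine isDoubleCover_of_flip ?_ ?_ ?_ ?_ η hz (by rw [map_sub, hx, hy]; ring)
    (by rw [map_add, hx, hy]; ring)
  · have h1 : x - y ∈ adjoin ℂ {z, x - y, x + y} := subset_adjoin (by simp)
    have h2 : x + y ∈ adjoin ℂ {z, x - y, x + y} := subset_adjoin (by simp)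
    refine h.gen.of_mem ?_ ?_ (subset_adjoin (by simp))
    · convert Subalgebra.smul_mem _ (add_mem h1 h2) (1 / 2) using 1
      module
    · convert Subalgebra.smul_mem _ (sub_mem h2 h1) (1 / 2) using 1
      module
  · simp only [map_add, map_mul, map_pow, map_ofNat, aeval_X, cons_val_zero,
      cons_val_one, cons_val_fin_one]
    linear_combination 4 * h.rel
  · have e : x - y = (1 : ℂ) • x + (-1 : ℂ) • y := by module
    rw [e, bracket_add, bracket_smul, bracket_smul, h.bracket_z_x, h.bracket_z_y, smul_smul,
      smul_smul]
    intro h0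
    have := (h.independent h0).1
    rw [one_mul, neg_eq_zero, Nat.cast_eq_zero] at this
    omega
  · intro h0
    exact one_ne_zero (h.independent (a := 1) (b := 1) (by rw [one_smul, one_smul, h0])).1

theorem fixed_swap (h : IsA n x y z) (hx : θ x = y) (hy : θ y = x) (hz : θ z = z) :
    fixedIdeal θ = Ideal.span {x - y} ∧ IsPlaneCurve θ x z (fun s t => s ^ 2 - t ^ (n + 1)) := by
  obtain ⟨h1, h2⟩ := h.isDoubleCover.isPlaneCurve_flip (θ := θ) hz (by rw [map_sub, hx, hy]; ring)
    (by rw [map_add, hx, hy]; ring) (d := 4 * Polynomial.X ^ (n + 1))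
    (by simp [map_ofNat]) (F := fun s t => t ^ 2 - 4 * s ^ (n + 1)) one_ne_zero
    (by simp [map_ofNat])
  have h3 : IsPlaneCurve θ z x (fun s t => t ^ 2 - s ^ (n + 1)) := by
    refine h2.change (α := 1 / 2) (by norm_num) 0 ?_ (c := 1 / 4) (by norm_num) ?_
    · have : x - ((1 / 2 : ℂ) • (x + y) + Polynomial.aeval z (0 : Polynomial ℂ)) =
          algebraMap ℂ _ (1 / 2) * (x - y) := by
        rw [map_zero, add_zero, ← smul_def]
        module
      rw [this, h1]
      exact Ideal.mul_mem_left _ _ (Ideal.mem_span_singleton_self _)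
    · simp only [map_sub, map_pow, aeval_X, cons_val_zero, cons_val_one,
        cons_val_fin_one, map_zero, add_zero]
      linear_combination X 1 ^ 2 * C_half_sq + X 0 ^ (n + 1) * four_mul_C
  exact ⟨h1, h3.swap (by simp)⟩

theorem swap_cusp (h : IsA n x y z) (hn : Even n) (hn2 : 2 ≤ n) (hθ : IsGraded θ)
    (hp : IsPlaneCurve θ x z (fun s t => s ^ 2 - t ^ (n + 1))) : IsReducedUnion θ 0 1 ∧
    HasGoodComponents (FixedRing θ) :=
  hp.cusp hθ h.x_mem h.z_mem (p := 2) (q := n + 1) (α := 1) (β := -1)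
    (by simp [sub_eq_add_neg]) le_rfl (by omega)
    (Nat.coprime_two_left.mpr hn.add_one) one_ne_zero (by norm_num)

theorem swap_lines (h : IsA n x y z) (hn : Odd n) (hθ : IsGraded θ)
    (hp : IsPlaneCurve θ x z (fun s t => s ^ 2 - t ^ (n + 1))) : IsReducedUnion θ 2 0 ∧
    HasGoodComponents (FixedRing θ) := by
  obtain ⟨m, rfl⟩ := hn
  have g := fun c : ℂ => graph_isLine (i := 0) (j := 1) (by decide) c (m + 1)
  refine hp.two_lines hθ h.x_mem h.z_mem (X 0 - C 1 * X 1 ^ (m + 1)) (X 0 - C (-1) * X 1 ^ (m + 1))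
    ?_ (by simp) (by simp) (g 1) (g (-1)) ?_
  · rw [map_neg, map_one]
    ring
  · intro Q hQ h1 h2
    have hu : ∀ f : Poly, 2 * f ∈ Q → f ∈ Q := fun f hf => by
      rw [← map_ofNat C 2] at hf
      exact (Ideal.unit_mul_mem_iff_mem Q ((IsUnit.mk0 (2 : ℂ) two_ne_zero).map C)).mp hf
    refine ⟨hu _ ?_, hQ.mem_of_pow_mem (m + 1) (hu _ ?_)⟩
    · have := Q.add_mem h1 h2
      rw [map_neg, map_one] at this
      convert this using 1
      ring
    · have := Q.sub_mem h2 h1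
      rw [map_neg, map_one] at this
      convert this using 1
      ring

theorem fixed_neg (h : IsA n x y z) (hx : θ x = x) (hy : θ y = y) (hz : θ z = -z) :
    fixedIdeal θ = Ideal.span {z} ∧ IsPlaneCurve θ x y (fun s t => s * t) := by
  have hJ : fixedIdeal θ = Ideal.span {z} := by
    rw [h.gen.fixedIdeal_eq, hx, hy, hz, sub_self, sub_self, Ideal.span_insert_zero,
      Ideal.span_insert_zero, span_neg_sub_self]
  refine ⟨hJ, isPlaneCurve_of (h.gen.exists_sub_mem (aeval ![x, y]) ⟨X 0, by simp⟩ ⟨X 1, by simp⟩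
    ⟨0, ?_⟩) fun p => ?_⟩
  · rw [hJ, map_zero, sub_zero]
    exact Ideal.mem_span_singleton_self z
  · rw [hJ, Ideal.mem_span_singleton]
    constructor
    · rintro ⟨q, hq⟩
      have hq' : aeval ![(x : Poly), (y : Poly)] p = u * v * (q : Poly) := by
        rw [← coe_aeval, hq, ← h.hz]
        rfl
      have key : ∀ i : Fin 2, X i ∣ p := fun i => by
        apply X_dvd_of_aeval_eq_zero i (N := n + 1) (by omega)
        have hc : (aeval fun k => if k = i then (0 : Polynomial ℂ) else Polynomial.X).comp
            (aeval ![(x : Poly), (y : Poly)]) =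
            aeval fun k => if k = i then 0 else (Polynomial.X ^ (n + 1) : Polynomial ℂ) := by
          apply algHom_ext
          intro k
          rw [AlgHom.comp_apply, aeval_X, aeval_X]
          fin_cases k
          · simp only [Fin.zero_eta, cons_val_zero, h.hx, map_pow, u, aeval_X]
            split_ifs <;> simp
          · simp only [Fin.mk_one, cons_val_one, cons_val_fin_one, h.hy, map_pow, v, aeval_X]
            split_ifs <;> simp
        rw [← hc, AlgHom.comp_apply, hq', map_mul, map_mul, u, v, aeval_X, aeval_X]
        fin_cases i <;> simp
      obtain ⟨r, rfl⟩ := key 0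
      have h1 : X 1 ∣ r := ((X_isLine 1).1.dvd_or_dvd (key 1)).resolve_left fun hd => by
        exact one_ne_zero (X_dvd_X.mp hd)
      exact mul_dvd_mul_left _ h1
    · rintro ⟨q, rfl⟩
      rw [map_mul, map_mul, aeval_X, aeval_X]
      change z ∣ x * y * _
      rw [h.rel]
      exact (dvd_pow_self z (by omega)).mul_right _

theorem neg_lines (h : IsA n x y z) (hθ : IsGraded θ) (hp : IsPlaneCurve θ x y (fun s t => s * t)) :
    IsReducedUnion θ 2 0 ∧ HasGoodComponents (FixedRing θ) :=
  hp.two_lines hθ h.x_mem h.y_mem (X 0) (X 1) rfl (by simp) (by simp) (X_isLine 0) (X_isLine 1)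
    fun _ _ h0 h1 => ⟨h0, h1⟩

theorem fixed_point (h : IsA n x y z) (hx : θ x = -x) (hy : θ y = -y) (hz : θ z = -z) :
    fixedIdeal θ = Ideal.span {x, y, z} ∧ IsReducedPoint θ := by
  have hJ : fixedIdeal θ = Ideal.span {x, y, z} := by
    rw [h.gen.fixedIdeal_eq, hx, hy, hz]
    simpa only [Set.image_insert_eq, Set.image_singleton] using span_image_neg_sub {x, y, z}
  refine ⟨hJ, ?_⟩
  let φ : invariants Γ →ₐ[ℂ] ℂ := (aeval fun _ => (0 : ℂ)).comp (invariants Γ).val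
  have hker : fixedIdeal θ = RingHom.ker φ := by
    have hle : Ideal.span {x, y, z} ≤ RingHom.ker φ := by
      rw [Ideal.span_le]
      rintro _ (rfl | rfl | rfl)
      exacts [h.x_mem, h.y_mem, h.z_mem]
    rw [hJ]
    refine le_antisymm hle fun f hf => ?_
    obtain ⟨c, hc⟩ := h.gen.exists_sub_mem (Algebra.ofId ℂ (invariants Γ))
      (J := Ideal.span {x, y, z}) ⟨0, by simpa using Ideal.subset_span (by simp)⟩
      ⟨0, by simpa using Ideal.subset_span (by simp)⟩
      ⟨0, by simpa using Ideal.subset_span (by simp)⟩ f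
    have h1 := hle hc
    rw [RingHom.mem_ker, map_sub, RingHom.mem_ker.mp hf, zero_sub, neg_eq_zero] at h1
    have h2 : c = 0 := by simpa [Algebra.ofId_apply] using h1
    rwa [h2, map_zero, sub_zero] at hc
  exact ⟨(Ideal.quotientEquivAlgOfEq ℂ hker).trans
    (Ideal.quotientKerAlgEquivOfSurjective fun c => ⟨algebraMap ℂ _ c, φ.commutes c⟩)⟩

theorem fixed_line (h : IsA n x y z) (hx : θ x = -x) (hy : θ y = y) (hz : θ z = -z) :
    fixedIdeal θ = Ideal.span {x, z} ∧ IsLineWithCoordinate θ y := by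
  have hJ : fixedIdeal θ = Ideal.span {x, z} := by
    rw [h.gen.fixedIdeal_eq, hx, hy, hz, sub_self, Set.insert_comm, Ideal.span_insert_zero]
    simpa only [Set.image_insert_eq, Set.image_singleton] using span_image_neg_sub {x, z}
  let φ : invariants Γ →ₐ[ℂ] Polynomial ℂ := (aeval ![0, Polynomial.X]).comp (invariants Γ).val
  have φx : φ x = 0 := by
    change aeval _ (x : Poly) = 0
    rw [h.hx, u, map_pow, aeval_X]
    simp
  have φy : φ y = Polynomial.X ^ (n + 1) := by
    change aeval _ (y : Poly) = _
    rw [h.hy, v, map_pow, aeval_X]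
    simp
  have φz : φ z = 0 := by
    change aeval _ (z : Poly) = 0
    rw [h.hz, u, map_mul, aeval_X]
    simp
  have hle : Ideal.span {x, z} ≤ RingHom.ker φ :=
    Ideal.span_le.mpr (Set.insert_subset_iff.mpr ⟨φx, Set.singleton_subset_iff.mpr φz⟩)
  have hinj : Function.Injective ((restrict θ).comp (Polynomial.aeval y)) := by
    rw [injective_iff_map_eq_zero]
    intro p hp
    have h1 : Polynomial.aeval y p ∈ Ideal.span {x, z} := by
      rw [← hJ]
      exact Ideal.Quotient.eq_zero_iff_mem.mp hp
    have h3 := RingHom.mem_ker.mp (hle h1)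
    rw [← Polynomial.aeval_algHom_apply, φy, ← Polynomial.expand_aeval,
      Polynomial.aeval_X_left_apply, Polynomial.expand_eq_zero (by omega)] at h3
    exact h3
  have hsurj : Function.Surjective ((restrict θ).comp (Polynomial.aeval y)) := fun f => by
    obtain ⟨f, rfl⟩ := Ideal.Quotient.mk_surjective f
    obtain ⟨p, hp⟩ := h.gen.exists_sub_mem (Polynomial.aeval y) (J := fixedIdeal θ)
      ⟨0, by rw [hJ, map_zero, sub_zero]; exact Ideal.subset_span (by simp)⟩
      ⟨Polynomial.X, by simp⟩
      ⟨0, by rw [hJ, map_zero, sub_zero]; exact Ideal.subset_span (by simp)⟩ f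
    exact ⟨p, ((Ideal.Quotient.mk_eq_mk_iff_sub_mem _ _).mpr hp).symm⟩
  exact ⟨hJ, AlgEquiv.ofBijective _ ⟨hinj, hsurj⟩, congrArg (restrict θ) (Polynomial.aeval_X y)⟩

end IsA

/-- A binary quadratic form that is a square is the square of a linear form. -/
theorem exists_linear_sq {f p : Poly} (hf : f.IsHomogeneous 2) (h : f = p ^ 2) : ∃ α β : ℂ,
    f = (C α * u + C β * v) ^ 2 := by
  obtain ⟨a, b, c, habc⟩ := isHomogeneous_two_eq hf
  obtain ⟨w, hw, hw0⟩ := exists_zero_of_isHomogeneous hf (by omega)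
  have hp : eval w p = 0 := by
    rw [h, map_pow] at hw0
    exact pow_eq_zero_iff two_ne_zero |>.mp hw0
  have hd : ∀ i, eval w (pderiv i f) = 0 := fun i => by
    rw [h, Derivation.leibniz_pow]
    simp [hp]
  have h0 := hd 0
  have h1 := hd 1
  simp only [habc, map_add, Derivation.leibniz, Derivation.leibniz_pow, pderiv_zero_u,
    pderiv_one_u, pderiv_zero_v, pderiv_one_v, pderiv_C, smul_eq_mul, nsmul_eq_mul, map_mul, eval_C,
    eval_u, eval_v, map_pow, map_natCast, map_one, map_zero] at h0 h1
  have hdisc : b ^ 2 - 4 * a * c = 0 := by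
    have e0 : (b ^ 2 - 4 * a * c) * w 0 = 0 := by
      push_cast at h0 h1
      linear_combination b * h1 - 2 * c * h0
    have e1 : (b ^ 2 - 4 * a * c) * w 1 = 0 := by
      push_cast at h0 h1
      linear_combination b * h0 - 2 * a * h1
    by_contra hne
    apply hw
    ext i
    fin_cases i
    · exact (mul_eq_zero.mp e0).resolve_left hne
    · exact (mul_eq_zero.mp e1).resolve_left hne
  obtain ⟨α, hα⟩ := exists_pow_nat_eq a (n := 2) (by omega)
  obtain ⟨β, hβ⟩ := exists_pow_nat_eq c (n := 2) (by omega)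
  have hb : b ^ 2 = (2 * α * β) ^ 2 := by
    rw [← hα, ← hβ] at hdisc
    linear_combination hdisc
  rcases sq_eq_sq_iff_eq_or_eq_neg.mp hb with hb | hb
  · refine ⟨α, β, ?_⟩
    rw [habc, hb, ← hα, ← hβ]
    simp only [map_mul, map_pow, map_ofNat]
    ring
  · refine ⟨α, -β, ?_⟩
    rw [habc, hb, ← hα, ← hβ]
    simp only [map_mul, map_pow, map_neg, map_ofNat]
    ring

theorem exists_sq_of_mul_eq_sq {f g k : Poly} (hfg : IsRelPrime f g) (h : f * g = k ^ 2) : ∃ p,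
    f = p ^ 2 := by
  classical
  let : GCDMonoid Poly := UniqueFactorizationMonoid.toGCDMonoid Poly
  obtain ⟨d, e, he⟩ := exists_associated_pow_of_mul_eq_pow (gcd_isUnit_iff_isRelPrime.mpr hfg) h
  obtain ⟨r, -, hr⟩ := isUnit_iff_eq_C_of_isReduced.mp e.isUnit
  obtain ⟨s, hs⟩ := exists_pow_nat_eq r (n := 2) (by omega)
  exact ⟨d * C s, by rw [mul_pow, ← map_pow, hs, ← hr, he]⟩

/-- A reflection is diagonalizable by a matrix of determinant `1`. -/
theorem exists_reflection_diagonalization {g : Mat} (hdet : g.det = -1) (hg : g * g = 1) :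
    ∃ (h : SL2) (a b : ℂ), a * b = -1 ∧ a ^ 2 = 1 ∧ b ^ 2 = 1 ∧ g * h.1 = h.1 * !![a, 0; 0, b] := by
  have main : ∀ g : Mat, g.det = -1 → g * g = 1 → g 0 0 ≠ -1 →
      ∃ h : SL2, g * h.1 = h.1 * !![1, 0; 0, -1] := fun g hdet hg hne => by
    rw [Matrix.eta_fin_two g] at hdet hg ⊢
    generalize g 0 0 = α at *
    generalize g 0 1 = β at *
    generalize g 1 0 = γ at *
    generalize g 1 1 = δ at *
    rw [det_fin_two_of] at hdet
    rw [mul_fin_two, one_fin_two] at hg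
    have e00 := congrFun (congrFun hg 0) 0
    have e01 := congrFun (congrFun hg 0) 1
    have e11 := congrFun (congrFun hg 1) 1
    simp at e00 e01 e11
    have htr : δ = -α := by
      have e1 : (α + δ) * α = 0 := by linear_combination e00 + hdet
      have e2 : (α + δ) * δ = 0 := by linear_combination e11 + hdet
      have e3 : (α + δ) ^ 2 = 0 := by linear_combination e1 + e2
      linear_combination pow_eq_zero_iff two_ne_zero |>.mp e3
    subst htr
    have h1 : 1 + α ≠ 0 := fun h0 => hne (by linear_combination h0)
    have hk : (-(2 * (1 + α))⁻¹) * (1 + α) = -(1 / 2) := by field_simp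
    set k := -(2 * (1 + α))⁻¹
    refine ⟨⟨!![1 + α, β * k; γ, -(1 + α) * k], ?_⟩, ?_⟩
    · rw [det_fin_two_of]
      linear_combination (-k) * e00 - 2 * hk
    · change !![α, β; γ, -α] * !![1 + α, β * k; γ, -(1 + α) * k] =
        !![1 + α, β * k; γ, -(1 + α) * k] * !![1, 0; 0, -1]
      rw [mul_fin_two, mul_fin_two]
      ext i j
      fin_cases i <;> fin_cases j <;> simp
      · linear_combination e00
      · ring
      · ring
      · linear_combination k * e00
  by_cases h : g 0 0 = -1
  · obtain ⟨k, hk⟩ := main (-g) (by rw [Matrix.det_neg, hdet]; norm_num) (by rw [neg_mul_neg, hg])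
      (by
        rw [Matrix.neg_apply, h]
        norm_num)
    refine ⟨k, -1, 1, by ring, by ring, by ring, ?_⟩
    rw [← neg_inj, ← neg_mul, hk, ← mul_neg]
    congr 1
    ext i j
    fin_cases i <;> fin_cases j <;> simp
  · obtain ⟨k, hk⟩ := main g hdet hg h
    exact ⟨k, 1, -1, by ring, by ring, by ring, hk⟩

namespace IsA

theorem exists_lift_of_one (h : IsA 1 x y z) (hθ : IsAntiPoissonInvolution θ) : ∃ g : Mat,
    (θ x : Poly) = linSubst g x ∧ (θ y : Poly) = linSubst g y ∧ (θ z : Poly) = linSubst g z := by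
  have hspan : ∀ f : invariants Γ, (f : Poly).IsHomogeneous 2 → ∀ d : Poly,
      d ∣ (θ x : Poly) → d ∣ (θ y : Poly) → d ∣ (θ z : Poly) → d ∣ (θ f : Poly) := by
    intro f hf d hdx hdy hdz
    let T : Submodule ℂ (invariants Γ) :=
      { carrier := {f | d ∣ (θ f : Poly)}
        add_mem' := fun ha hb => by
          rw [Set.mem_ofPred_eq, map_add]
          exact dvd_add ha hb
        zero_mem' := by simp
        smul_mem' := fun c f hf => by
          rw [Set.mem_ofPred_eq, map_smul, coe_smul_eq]
          exact Dvd.dvd.mul_left hf _ }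
    have e : ∀ i j k, ((θ (x ^ i * y ^ j * z ^ k) : invariants Γ) : Poly) =
        (θ x : Poly) ^ i * (θ y : Poly) ^ j * (θ z : Poly) ^ k := fun i j k => by
      rw [map_mul, map_mul, map_pow, map_pow, map_pow]
      rfl
    refine h.gen.mem_of_isHomogeneous h.homogeneous_x h.homogeneous_y h.homogeneous_z hf T
      fun i j k hijk => ?_
    change d ∣ ((θ (x ^ i * y ^ j * z ^ k) : invariants Γ) : Poly)
    rw [e]
    have : i ≠ 0 ∨ j ≠ 0 ∨ k ≠ 0 := by omega
    rcases this with h0 | h0 | h0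
    · exact ((hdx.trans (dvd_pow_self _ h0)).mul_right _).mul_right _
    · exact ((hdy.trans (dvd_pow_self _ h0)).mul_left _).mul_right _
    · exact (hdz.trans (dvd_pow_self _ h0)).mul_left _
  have hX := hθ.graded _ _ h.homogeneous_x
  have hY := hθ.graded _ _ h.homogeneous_y
  have hrel : (θ x : Poly) * (θ y : Poly) = (θ z : Poly) ^ 2 := by
    have := congrArg (fun f => (θ f : Poly)) h.rel
    simpa using this
  have hrp : IsRelPrime (θ x : Poly) (θ y : Poly) := by
    refine WfDvdMonoid.isRelPrime_of_no_irreducible_factors ?_ fun d hd hdx hdy => ?_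
    · rintro ⟨h1, -⟩
      exact h.x_ne_zero (θ.injective (Subtype.ext (by rw [h1, map_zero]; rfl)))
    · have hdz : d ∣ (θ z : Poly) := hd.prime.dvd_of_dvd_pow (hrel ▸ hdx.mul_right _)
      have h1 := hspan _ hX d hdx hdy hdz
      have h2 := hspan _ hY d hdx hdy hdz
      rw [hθ.involutive] at h1 h2
      exact hd.not_isUnit (h.isRelPrime h1 h2)
  obtain ⟨p, hp⟩ := exists_sq_of_mul_eq_sq hrp hrel
  obtain ⟨q, hq⟩ := exists_sq_of_mul_eq_sq hrp.symm ((mul_comm _ _).trans hrel)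
  obtain ⟨α, β, h1⟩ := exists_linear_sq hX hp
  obtain ⟨γ, δ, h2⟩ := exists_linear_sq hY hq
  have h3 : (θ z : Poly) ^ 2 = ((C α * u + C β * v) * (C γ * u + C δ * v)) ^ 2 := by
    rw [← hrel, h1, h2, mul_pow]
  rcases sq_eq_sq_iff_eq_or_eq_neg.mp h3 with h3 | h3
  · refine ⟨!![α, β; γ, δ], ?_, ?_, ?_⟩
    · rw [h1, h.hx, map_pow, linSubst_u]
      rfl
    · rw [h2, h.hy, map_pow, linSubst_v]
      rfl
    · rw [h3, h.hz, map_mul, linSubst_u, linSubst_v]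
      rfl
  · refine ⟨!![α, β; -γ, -δ], ?_, ?_, ?_⟩
    · rw [h1, h.hx, map_pow, linSubst_u]
      rfl
    · rw [h2, h.hy, map_pow, linSubst_v]
      simp
      ring
    · rw [h3, h.hz, map_mul, linSubst_u, linSubst_v]
      simp
      ring

theorem exists_lift_of_zero (h : IsA 0 x y z) (hθ : IsAntiPoissonInvolution θ) : ∃ g : Mat,
    (θ x : Poly) = linSubst g x ∧ (θ y : Poly) = linSubst g y ∧ (θ z : Poly) = linSubst g z := by
  have hlin : ∀ f : invariants Γ, (f : Poly).IsHomogeneous 1 →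
      ∃ a b : ℂ, (f : Poly) = C a * u + C b * v := fun f hf => by
    have := h.gen.mem_of_isHomogeneous h.homogeneous_x h.homogeneous_y h.homogeneous_z hf
      (Submodule.span ℂ {x, y}) fun i j k hijk => by
        obtain ⟨rfl, rfl, rfl⟩ | ⟨rfl, rfl, rfl⟩ : (i = 1 ∧ j = 0 ∧ k = 0) ∨
          (i = 0 ∧ j = 1 ∧ k = 0) := by omega
        · exact Submodule.subset_span (by simp)
        · exact Submodule.subset_span (by simp)
    obtain ⟨a, b, hab⟩ := Submodule.mem_span_pair.mp this
    refine ⟨a, b, ?_⟩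
    rw [← hab]
    change ((a • x : invariants Γ) : Poly) + ((b • y : invariants Γ) : Poly) = _
    rw [coe_smul_eq, coe_smul_eq, h.hx, h.hy, zero_add, pow_one, pow_one]
  obtain ⟨α, β, h1⟩ := hlin _ (hθ.graded _ _ h.homogeneous_x)
  obtain ⟨γ, δ, h2⟩ := hlin _ (hθ.graded _ _ h.homogeneous_y)
  have hz : z = x * y := by rw [h.rel, zero_add, pow_one]
  have hx : (θ x : Poly) = linSubst !![α, β; γ, δ] x := by
    rw [h1, h.hx, zero_add, pow_one, linSubst_u]
    rfl
  have hy : (θ y : Poly) = linSubst !![α, β; γ, δ] y := by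
    rw [h2, h.hy, zero_add, pow_one, linSubst_v]
    rfl
  refine ⟨!![α, β; γ, δ], hx, hy, ?_⟩
  rw [hz, map_mul]
  change (θ x : Poly) * (θ y : Poly) = linSubst _ ((x : Poly) * (y : Poly))
  rw [hx, hy, map_mul]

theorem linSubst_mem (h : IsA n x y z) (hn : n < 2) (M : Mat) :
    linSubst M (x : Poly) ∈ invariants Γ ∧ linSubst M (y : Poly) ∈ invariants Γ ∧
    linSubst M (z : Poly) ∈ invariants Γ := by
  have hx := x.2
  have hy := y.2
  have hz := z.2
  rw [h.hx] at hx
  rw [h.hy] at hy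
  rw [h.hz] at hz
  rw [h.hx, h.hy, h.hz, map_pow, map_pow, map_mul, linSubst_u, linSubst_v]
  interval_cases n
  · rw [zero_add, pow_one] at hx hy ⊢
    have hl : ∀ a b : ℂ, C a * u + C b * v ∈ invariants Γ := fun a b =>
      add_mem (C_mul_mem a _ hx) (C_mul_mem b _ hy)
    rw [pow_one]
    exact ⟨hl _ _, hl _ _, mul_mem (hl _ _) (hl _ _)⟩
  · have hl : ∀ a b c d : ℂ, (C a * u + C b * v) * (C c * u + C d * v) ∈ invariants Γ := by
      intro a b c d
      have : (C a * u + C b * v) * (C c * u + C d * v) = C (a * c) * u ^ (1 + 1) +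
          C (a * d + b * c) * (u * v) + C (b * d) * v ^ (1 + 1) := by
        simp only [map_add, map_mul]
        ring
      rw [this]
      exact add_mem (add_mem (C_mul_mem _ _ hx) (C_mul_mem _ _ hz)) (C_mul_mem _ _ hy)
    rw [pow_succ, pow_one, pow_succ, pow_one]
    exact ⟨hl _ _ _ _, hl _ _ _ _, hl _ _ _ _⟩

theorem eq_one_or_neg_one (h : IsA n x y z) (hn : n < 2) {M : Mat} (hx : linSubst M (x : Poly) = x)
    (hy : linSubst M (y : Poly) = y) (hz : linSubst M (z : Poly) = z) : M = 1 ∨ M = -1 := by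
  rw [h.hx, map_pow, linSubst_u] at hx
  rw [h.hy, map_pow, linSubst_v] at hy
  rw [h.hz, map_mul, linSubst_u, linSubst_v] at hz
  have x0 := congrArg (eval ![0, 1]) hx
  have x1 := congrArg (eval ![1, 0]) hx
  have y0 := congrArg (eval ![1, 0]) hy
  have z0 := congrArg (eval ![1, 1]) hz
  simp [eval_u, eval_v] at x0 x1 y0 z0
  rw [x0, y0, add_zero, zero_add] at z0
  rw [Matrix.eta_fin_two M, x0, y0, one_fin_two]
  have h2 : M 0 0 ^ 2 = 1 := by
    interval_cases n
    · rw [zero_add, pow_one] at x1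
      rw [x1, one_pow]
    · exact x1
  rcases sq_eq_one_cases h2 with h0 | h0
  · rw [h0, one_mul] at z0
    rw [h0, z0]
    exact Or.inl rfl
  · rw [h0] at z0
    rw [h0, show M 1 1 = -1 by linear_combination -z0]
    right
    ext i j
    fin_cases i <;> fin_cases j <;> simp

theorem det_eq_neg_one (h : IsA n x y z) (hθ : IsAntiPoissonInvolution θ) {g : Mat}
    (hg : ∀ f, (θ f : Poly) = linSubst g f) : g.det = -1 := by
  have h1 := congrArg (fun f : invariants Γ => (f : Poly)) (hθ.antiPoisson z x)
  change (θ (bracket z x) : Poly) = -polyBracket (θ z : Poly) (θ x : Poly) at h1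
  rw [hg z, hg x, polyBracket_linSubst, ← coe_bracket, ← hg] at h1
  have h2 : (θ (bracket z x) : Poly) ≠ 0 := by
    rw [← coe_ne_zero_iff, h.bracket_z_x]
    intro h0
    rw [EmbeddingLike.map_eq_zero_iff, smul_eq_zero, neg_eq_zero, Nat.cast_eq_zero] at h0
    exact h0.elim (by omega) h.x_ne_zero
  have h3 : (C (g.det + 1) : Poly) * (θ (bracket z x) : Poly) = 0 := by
    rw [map_add, map_one]
    linear_combination h1
  have h4 := (mul_eq_zero.mp h3).resolve_right h2
  rw [C_eq_zero] at h4
  linear_combination h4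

theorem exists_conjugate_of_lt (h : IsA n x y z) (hn : n < 2) (hθ : IsAntiPoissonInvolution θ) :
    ∃ η : Aut Γ, IsAntiPoissonInvolution η ∧ AreConjugate θ η ∧ η z = -z := by
  obtain ⟨g, gx, gy, gz⟩ : ∃ g : Mat, (θ x : Poly) = linSubst g x ∧
      (θ y : Poly) = linSubst g y ∧ (θ z : Poly) = linSubst g z := by
    interval_cases n
    · exact h.exists_lift_of_zero hθ
    · exact h.exists_lift_of_one hθ
  have hg := h.gen.aeval_mem gx gy gz
  have hdet := h.det_eq_neg_one hθ hg
  have hgg : ∀ f : invariants Γ, linSubst (g * g) (f : Poly) = f := fun f => by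
    rw [← linSubst_linSubst, ← hg, ← hg, hθ.involutive]
  rcases h.eq_one_or_neg_one hn (hgg x) (hgg y) (hgg z) with hone | hneg
  · obtain ⟨k, a, b, hab, ha, hb, hk⟩ := exists_reflection_diagonalization hdet hone
    obtain ⟨η, hη, ηx, ηy, ηz⟩ := h.exists_diag hab rfl rfl
      (by rw [← pow_mul, mul_comm, pow_mul, ha, one_pow])
      (by rw [← pow_mul, mul_comm, pow_mul, hb, one_pow])
    have hD := h.gen.aeval_mem (θ := η) (M := !![a, 0; 0, b])
      (by rw [ηx, coe_smul_eq, h.hx, map_pow, map_pow, linSubst_diag_u, mul_pow])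
      (by rw [ηy, coe_smul_eq, h.hy, map_pow, map_pow, linSubst_diag_v, mul_pow])
      (by
        rw [ηz, h.hz, linSubst_diag_uv, hab, map_neg, map_one, neg_one_mul, ← h.hz]
        rfl)
    have hm := h.linSubst_mem hn
    obtain ⟨σ, hσ, hσf⟩ := h.gen.exists_gradedPoisson k.1 (k⁻¹).1
      (by rw [← sl_mul, mul_inv_cancel,
        sl_one]) k.2 (hm _).1 (hm _).2.1 (hm _).2.2 (hm _).1 (hm _).2.1
      (hm _).2.2
    refine ⟨η, hη, ⟨σ, hσ, fun f => Subtype.ext ?_⟩, ηz⟩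
    rw [hσf, hg, hD, hσf, linSubst_linSubst, linSubst_linSubst, hk]
  · refine ⟨θ, hθ, areConjugate_refl θ, Subtype.ext ?_⟩
    change (θ z : Poly) = -(z : Poly)
    rw [hg, h.hz, map_mul, linSubst_u, linSubst_v]
    rw [Matrix.eta_fin_two g] at hneg hdet
    rw [mul_fin_two] at hneg
    have e00 := congrFun (congrFun hneg 0) 0
    have e01 := congrFun (congrFun hneg 0) 1
    have e10 := congrFun (congrFun hneg 1) 0
    have e11 := congrFun (congrFun hneg 1) 1
    simp at e00 e01 e10 e11
    rw [det_fin_two_of] at hdet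
    generalize g 0 0 = α at *
    generalize g 0 1 = β at *
    generalize g 1 0 = γ at *
    generalize g 1 1 = δ at *
    have htr : α + δ ≠ 0 := fun h0 => by
      have : (1 : ℂ) = -1 := by linear_combination e00 + hdet - α * h0
      norm_num at this
    have hβ : β = 0 := by
      refine (mul_eq_zero.mp ?_).resolve_left htr
      linear_combination e01
    have hγ : γ = 0 := by
      refine (mul_eq_zero.mp ?_).resolve_left htr
      linear_combination e10
    rw [hβ, zero_mul, sub_zero] at hdet
    have hC : (C α * C δ : Poly) = -1 := by rw [← map_mul, hdet, map_neg, map_one]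
    rw [hβ, hγ, map_zero]
    linear_combination u * v * hC

theorem exists_conjugate (h : IsA n x y z) (hθ : IsAntiPoissonInvolution θ) : ∃ η : Aut Γ,
    IsAntiPoissonInvolution η ∧ AreConjugate θ η ∧ ((2 ≤ n ∧ η z = z) ∨ η z = -z) := by
  rcases lt_or_ge n 2 with hn | hn
  · obtain ⟨η, h1, h2, h3⟩ := h.exists_conjugate_of_lt hn hθ
    exact ⟨η, h1, h2, Or.inr h3⟩
  · refine ⟨θ, hθ, areConjugate_refl θ, ?_⟩
    obtain ⟨c, hc⟩ := h.gen.eq_smul_of_isHomogeneous h.homogeneous_x h.homogeneous_y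
      h.homogeneous_z (hθ.graded _ _ h.homogeneous_z) (m := z) fun i j k hijk => by
        obtain rfl : i = 0 := by
          by_contra hi
          nlinarith [Nat.pos_of_ne_zero hi, Nat.zero_le ((n + 1) * j)]
        obtain rfl : j = 0 := by
          by_contra hj
          nlinarith [Nat.pos_of_ne_zero hj]
        obtain rfl : k = 1 := by omega
        simp
    rcases sq_eq_one_cases (hθ.sq_eq_one h.z_ne_zero hc) with rfl | rfl
    · exact Or.inl ⟨hn, by rw [hc, one_smul]⟩
    · exact Or.inr (by rw [hc, neg_one_smul])

theorem apply_eq_of_odd (h : IsA n x y z) (hn : Odd n) (hθ : IsAntiPoissonInvolution θ)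
    (hz : θ z = -z) : (θ x = x ∧ θ y = y) ∨ (θ x = -x ∧ θ y = -y) := by
  obtain ⟨-, a, b, ha, hb, hab, hx, hy⟩ := (h.apply_eq hθ (c := -1)
    (by rw [hz, neg_one_smul])).resolve_left fun hc => by norm_num at hc
  rw [hn.add_one.neg_one_pow] at hab
  rcases sq_eq_one_cases ha with rfl | rfl
  · obtain rfl : b = 1 := by linear_combination hab
    rw [one_smul] at hx hy
    exact Or.inl ⟨hx, hy⟩
  · obtain rfl : b = -1 := by linear_combination -hab
    rw [neg_one_smul] at hx hy
    exact Or.inr ⟨hx, hy⟩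

theorem apply_eq_of_even (h : IsA n x y z) (hn : Even n) (hθ : IsAntiPoissonInvolution θ)
    (hz : θ z = -z) : (θ x = x ∧ θ y = -y) ∨ (θ x = -x ∧ θ y = y) := by
  obtain ⟨-, a, b, ha, hb, hab, hx, hy⟩ := (h.apply_eq hθ (c := -1)
    (by rw [hz, neg_one_smul])).resolve_left fun hc => by norm_num at hc
  rw [hn.add_one.neg_one_pow] at hab
  rcases sq_eq_one_cases ha with rfl | rfl
  · obtain rfl : b = -1 := by linear_combination hab
    rw [one_smul] at hx
    rw [neg_one_smul] at hy
    exact Or.inl ⟨hx, hy⟩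
  · obtain rfl : b = 1 := by linear_combination -hab
    rw [neg_one_smul] at hx
    rw [one_smul] at hy
    exact Or.inr ⟨hx, hy⟩

theorem exists_swap (h : IsA n x y z) : ∃ θ : Aut Γ, IsAntiPoissonInvolution θ ∧ θ x = y ∧ θ y = x ∧
    θ z = z := by
  simpa only [one_smul] using h.exists_antidiag (s := 1) (one_pow 2)

theorem exists_neg_of_odd (h : IsA n x y z) (hn : Odd n) : ∃ θ : Aut Γ, IsAntiPoissonInvolution θ ∧
    θ x = x ∧ θ y = y ∧ θ z = -z := by
  simpa only [one_smul] using h.exists_diag (a := 1) (b := -1) (s := 1) (t := 1) (by ring)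
    (one_pow _) hn.add_one.neg_one_pow (one_pow 2) (one_pow 2)

theorem exists_point_of_odd (h : IsA n x y z) (hn : Odd n) : ∃ θ : Aut Γ,
    IsAntiPoissonInvolution θ ∧ θ x = -x ∧ θ y = -y ∧ θ z = -z := by
  obtain ⟨a, ha0, ha⟩ := exists_root (n + 1) (neg_ne_zero.mpr (one_ne_zero (α := ℂ)))
  simpa only [neg_one_smul] using h.exists_diag (a := a) (b := -a⁻¹) (s := -1) (t := -1)
    (by rw [mul_neg, mul_inv_cancel₀ ha0]) ha
    (by rw [hn.add_one.neg_pow, inv_pow, ha, inv_neg, inv_one]) (by norm_num) (by norm_num)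

theorem exists_line_of_even (h : IsA n x y z) (hn : Even n) : ∃ θ : Aut Γ,
    IsAntiPoissonInvolution θ ∧ θ x = -x ∧ θ y = y ∧ θ z = -z := by
  simpa only [one_smul, neg_one_smul] using h.exists_diag (a := -1) (b := 1) (s := -1) (t := 1)
    (by ring) hn.add_one.neg_one_pow (one_pow _) (by norm_num) (one_pow 2)

theorem hasGoodComponents (h : IsA n x y z) (hθ : IsAntiPoissonInvolution θ) :
    HasGoodComponents (FixedRing θ) := by
  obtain ⟨η, hη, hconj, ⟨hn, hz⟩ | hz⟩ := h.exists_conjugate hθ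
  · obtain ⟨θ₁, h1, x1, y1, z1⟩ := h.exists_swap
    refine (hconj.trans (h.areConjugate_of_apply_z hη h1 hz z1)).hasGoodComponents ?_
    have hp := (h.fixed_swap x1 y1 z1).2
    rcases Nat.even_or_odd n with he | ho
    · exact (h.swap_cusp he hn h1.graded hp).2
    · exact (h.swap_lines ho h1.graded hp).2
  · refine hconj.hasGoodComponents ?_
    rcases Nat.even_or_odd n with he | ho
    · obtain ⟨θ₂, h2, x2, y2, z2⟩ := h.exists_line_of_even he
      have hline := (isReducedUnion_of_isLineWithCoordinate (h.fixed_line x2 y2 z2).2).2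
      rcases h.apply_eq_of_even he hη hz with ⟨hx, hy⟩ | ⟨hx, hy⟩
      · exact (h.areConjugate_of_even he hx hy hz x2 y2 z2).hasGoodComponents hline
      · exact (isReducedUnion_of_isLineWithCoordinate (h.fixed_line hx hy hz).2).2
    · rcases h.apply_eq_of_odd ho hη hz with ⟨hx, hy⟩ | ⟨hx, hy⟩
      · exact (h.neg_lines hη.graded (h.fixed_neg hx hy hz).2).2
      · obtain ⟨e⟩ := (h.fixed_point hx hy hz).2
        exact HasGoodComponents.of_equiv_complex e

end IsA

/-- Generators of type `D (k + 2)`. -/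
structure IsD (k : ℕ) (x s t : invariants Γ) : Prop where
  hx : (x : Poly) = (u * v) ^ 2
  hs : (s : Poly) = u ^ (2 * k) + (-1) ^ k * v ^ (2 * k)
  ht : (t : Poly) = u * v * (u ^ (2 * k) - (-1) ^ k * v ^ (2 * k))
  gen : Generate x s t

theorem Subalgebra.symmetric_mem (A : Subalgebra ℂ Poly) {w a b : Poly} (hx : w ^ 2 ∈ A)
    (hs : a + b ∈ A) (ht : w * (a - b) ∈ A) (hab : a * b ∈ A) (i m : ℕ) :
    w ^ i * (a ^ m + (-1) ^ i * b ^ m) ∈ A := by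
  have h : a ^ m + b ^ m ∈ A ∧ w * (a ^ m - b ^ m) ∈ A := by
    induction m using Nat.twoStepInduction with
    | zero =>
      rw [pow_zero, pow_zero, sub_self, mul_zero]
      exact ⟨add_mem A.one_mem A.one_mem, A.zero_mem⟩
    | one =>
      rw [pow_one, pow_one]
      exact ⟨hs, ht⟩
    | more m h0 h1 =>
      constructor
      · have : a ^ (m + 2) + b ^ (m + 2) =
            (a + b) * (a ^ (m + 1) + b ^ (m + 1)) - a * b * (a ^ m + b ^ m) := by ring
        rw [this]
        exact sub_mem (mul_mem hs h1.1) (mul_mem hab h0.1)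
      · have : w * (a ^ (m + 2) - b ^ (m + 2)) =
            (a + b) * (w * (a ^ (m + 1) - b ^ (m + 1))) - a * b * (w * (a ^ m - b ^ m)) := by ring
        rw [this]
        exact sub_mem (mul_mem hs h1.2) (mul_mem hab h0.2)
  rcases Nat.even_or_odd' i with ⟨j, rfl | rfl⟩
  · rw [(even_two_mul j).neg_one_pow, one_mul, pow_mul]
    exact mul_mem (pow_mem hx j) h.1
  · rw [(odd_two_mul_add_one j).neg_one_pow, pow_succ, pow_mul, mul_assoc]
    refine mul_mem (pow_mem hx j) ?_
    convert h.2 using 1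
    ring

theorem linSubst_antidiag_pow (k : ℕ) {a b : ℂ} (ha : a ^ (2 * k) = (-1) ^ k)
    (hb : b ^ (2 * k) = (-1) ^ k) (hab : a * b = -1) :
    linSubst !![0, a; b, 0] (u ^ (2 * k)) = (-1) ^ k * v ^ (2 * k) ∧
    linSubst !![0, a; b, 0] (v ^ (2 * k)) = (-1) ^ k * u ^ (2 * k) ∧
    linSubst !![0, a; b, 0] (u * v) = -(u * v) := by
  refine ⟨?_, ?_, ?_⟩
  · rw [map_pow, linSubst_antidiag_u, mul_pow, ← map_pow, ha, map_pow, map_neg, map_one]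
  · rw [map_pow, linSubst_antidiag_v, mul_pow, ← map_pow, hb, map_pow, map_neg, map_one]
  · have : (C a * C b : Poly) = -1 := by rw [← map_mul, hab, map_neg, map_one]
    rw [map_mul, linSubst_antidiag_u, linSubst_antidiag_v]
    linear_combination u * v * this

theorem generators_mem_groupD {k : ℕ} (hk : k ≠ 0) : (u * v) ^ 2 ∈ invariants (groupD (k + 2)) ∧
    u ^ (2 * k) + (-1) ^ k * v ^ (2 * k) ∈ invariants (groupD (k + 2)) ∧
    u * v * (u ^ (2 * k) - (-1) ^ k * v ^ (2 * k)) ∈ invariants (groupD (k + 2)) := by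
  have hsq : ((-1) ^ k * (-1) ^ k : Poly) = 1 := by rw [← mul_pow]; norm_num
  have key : ∀ M, (∃ ε : ℂ, ε ^ (2 * (k + 2 - 2)) = 1 ∧ (M = !![ε, 0; 0, ε⁻¹] ∨
      M = !![0, I * ε; I * ε⁻¹, 0])) →
      linSubst M ((u * v) ^ 2) = (u * v) ^ 2 ∧
      linSubst M (u ^ (2 * k) + (-1) ^ k * v ^ (2 * k)) = u ^ (2 * k) + (-1) ^ k * v ^ (2 * k) ∧
      linSubst M (u * v * (u ^ (2 * k) - (-1) ^ k * v ^ (2 * k))) =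
        u * v * (u ^ (2 * k) - (-1) ^ k * v ^ (2 * k)) := by
    rintro M ⟨ε, hε, hM⟩
    rw [Nat.add_sub_cancel] at hε
    have h0 : ε ≠ 0 := by
      rintro rfl
      rw [zero_pow (by omega)] at hε
      exact zero_ne_one hε
    rw [map_mul _ (u * v), map_sub, map_add, map_mul _ ((-1) ^ k), map_pow _ (u * v), map_pow _ (-1),
      map_neg, map_one]
    have hε' : ε⁻¹ ^ (2 * k) = 1 := by rw [inv_pow, hε, inv_one]
    rcases hM with rfl | rfl
    · obtain ⟨h1, h2⟩ := linSubst_diag_pow (N := 2 * k) hε hε'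
      rw [h1, h2, linSubst_diag_uv, mul_inv_cancel₀ h0, map_one, one_mul]
      exact ⟨rfl, rfl, rfl⟩
    · obtain ⟨h1, h2, h3⟩ := linSubst_antidiag_pow k (a := I * ε) (b := I * ε⁻¹)
        (by rw [mul_pow, hε, pow_mul, I_sq, mul_one])
        (by rw [mul_pow, hε', pow_mul, I_sq, mul_one])
        (by rw [mul_mul_mul_comm, Complex.I_mul_I, mul_inv_cancel₀ h0, mul_one])
      rw [h1, h2, h3]
      refine ⟨by ring, by linear_combination u ^ (2 * k) * hsq, ?_⟩
      linear_combination u * v * u ^ (2 * k) * hsq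
  exact ⟨mem_invariants_generatedBy fun M hM => (key M hM).1,
    mem_invariants_generatedBy fun M hM => (key M hM).2.1,
    mem_invariants_generatedBy fun M hM => (key M hM).2.2⟩

theorem exists_mem_groupD {k : ℕ} (hk : k ≠ 0) :
    (∃ (ζ : ℂ) (h0 : ζ ≠ 0), IsPrimitiveRoot ζ (2 * k) ∧ diagSL ζ h0 ∈ groupD (k + 2)) ∧
    ∀ f ∈ invariants (groupD (k + 2)), linSubst !![0, I; I, 0] f = f := by
  constructor
  · have h := isPrimitiveRoot_rootOfUnity (n := 2 * k) (by omega)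
    exact ⟨_, rootOfUnity_ne_zero _, h, diagSL_mem_generatedBy _ ⟨_, h.pow_eq_one, Or.inl rfl⟩⟩
  · intro f hf
    exact linSubst_eq_of_mem_generatedBy hf ⟨1, one_pow _, Or.inr (by simp)⟩
      (by simp [det_fin_two_of])

theorem mem_of_mem_groupD {k : ℕ} (hk : k ≠ 0) {f : Poly} (hf : f ∈ invariants (groupD (k + 2)))
    {A : Subalgebra ℂ Poly} (hx : (u * v) ^ 2 ∈ A) (hs : u ^ (2 * k) + (-1) ^ k * v ^ (2 * k) ∈ A)
    (ht : u * v * (u ^ (2 * k) - (-1) ^ k * v ^ (2 * k)) ∈ A) : f ∈ A := by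
  obtain ⟨⟨ζ, h0, hζ, hmem⟩, hB⟩ := exists_mem_groupD hk
  have hdiag := linSubst_eq_of_mem hf hmem
  have hneg : ∀ j : ℕ, (-1 : Poly) ^ j ∈ A := fun j => pow_mem (neg_mem A.one_mem) j
  have hsym := Subalgebra.symmetric_mem A hx hs ht (by
    have : u ^ (2 * k) * ((-1) ^ k * v ^ (2 * k)) = (-1) ^ k * ((u * v) ^ 2) ^ k := by ring
    rw [this]
    exact mul_mem (hneg k) (pow_mem hx k))
  obtain ⟨b1, b2, b3⟩ := linSubst_antidiag_pow k (a := I) (b := I)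
    (by rw [pow_mul, I_sq]) (by rw [pow_mul, I_sq]) Complex.I_mul_I
  have key : f + linSubst !![0, I; I, 0] f ∈ A := by
    refine mem_of_diag_invariant hζ h0 hdiag
      (P := fun f => f + linSubst !![0, I; I, 0] f ∈ A) ?_ ?_ ?_ ?_ ?_
    · rw [map_zero, add_zero]
      exact A.zero_mem
    · intro f g hf hg
      rw [map_add, add_add_add_comm]
      exact add_mem hf hg
    · intro c f hf
      rw [map_mul, algHom_C, algebraMap_eq, ← mul_add]
      exact mul_mem (A.algebraMap_mem c) hf
    · intro i m
      convert hsym i m using 1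
      rw [map_mul, map_pow _ (u * v), map_pow _ (u ^ (2 * k)), b1, b3]
      ring
    · intro i m
      convert mul_mem (mul_mem (hneg i) (hneg (k * m))) (hsym i m) using 1
      rw [map_mul, map_pow _ (u * v), map_pow _ (v ^ (2 * k)), b2, b3]
      have e1 : ((-1) ^ (k * m) * (-1) ^ (k * m) : Poly) = 1 := by rw [← mul_pow]; norm_num
      have e2 : ((-1) ^ i * (-1) ^ i : Poly) = 1 := by rw [← mul_pow]; norm_num
      have e3 : (-(u * v)) ^ i = (-1) ^ i * (u * v) ^ i := by rw [neg_pow]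
      rw [e3, mul_pow ((-1) ^ k), mul_pow ((-1) ^ k), ← pow_mul (-1 : Poly) k m]
      generalize ((-1 : Poly) ^ (k * m)) = p at *
      generalize ((-1 : Poly) ^ i) = q at *
      linear_combination (-(u * v) ^ i * (v ^ (2 * k)) ^ m) * e1 -
        (u * v) ^ i * (v ^ (2 * k)) ^ m * p ^ 2 * e2
  rw [hB f hf] at key
  refine mem_of_C_mul_mem (two_ne_zero (α := ℂ)) ?_
  rwa [map_ofNat, two_mul]

theorem exists_isD {k : ℕ} (hk : k ≠ 0) : ∃ x s t : invariants (groupD (k + 2)), IsD k x s t := by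
  obtain ⟨hx, hs, ht⟩ := generators_mem_groupD hk
  exact ⟨⟨_, hx⟩, ⟨_, hs⟩, ⟨_, ht⟩, rfl, rfl, rfl,
    generate_of_le fun f hf => mem_of_mem_groupD hk hf (subset_adjoin (by simp))
      (subset_adjoin (by simp)) (subset_adjoin (by simp))⟩

theorem polyBracket_sq_left (w f : Poly) : polyBracket (w ^ 2) f = 2 * w * polyBracket w f := by
  simp only [polyBracket, Derivation.leibniz_pow, smul_eq_mul, nsmul_eq_mul]
  push_cast
  ring

theorem polyBracket_mul_right (w f : Poly) : polyBracket w (w * f) = w * polyBracket w f := by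
  simp only [polyBracket, Derivation.leibniz, smul_eq_mul]
  ring

namespace IsD

variable {k : ℕ} {s t : invariants Γ}

theorem rel (h : IsD k x s t) : t ^ 2 = x * s ^ 2 - (4 * (-1) ^ k) * x ^ (k + 1) := by
  apply Subtype.ext
  change (t : Poly) ^ 2 = (x : Poly) * (s : Poly) ^ 2 - (4 * (-1) ^ k) * (x : Poly) ^ (k + 1)
  rw [h.hx, h.hs, h.ht]
  ring

theorem homogeneous_x (h : IsD k x s t) : (x : Poly).IsHomogeneous 4 := by
  rw [h.hx]
  exact (u_isHomogeneous.mul v_isHomogeneous).pow 2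

theorem homogeneous_pow (k : ℕ) : (u ^ (2 * k)).IsHomogeneous (2 * k) ∧
    ((-1) ^ k * v ^ (2 * k)).IsHomogeneous (2 * k) := by
  constructor
  · simpa using u_isHomogeneous.pow (2 * k)
  · have : ((-1) ^ k : Poly) = C ((-1) ^ k) := by simp
    rw [this]
    simpa using (v_isHomogeneous.pow (2 * k)).C_mul ((-1) ^ k)

theorem homogeneous_s (h : IsD k x s t) : (s : Poly).IsHomogeneous (2 * k) := by
  rw [h.hs]
  exact (homogeneous_pow k).1.add (homogeneous_pow k).2

theorem homogeneous_t (h : IsD k x s t) : (t : Poly).IsHomogeneous (2 * k + 2) := by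
  rw [h.ht, add_comm]
  exact (u_isHomogeneous.mul v_isHomogeneous).mul ((homogeneous_pow k).1.sub (homogeneous_pow k).2)

theorem polyBracket_pow (k : ℕ) : polyBracket (u * v) (u ^ (2 * k) + (-1) ^ k * v ^ (2 * k)) = C
    (-(2 * k : ℂ)) * (u ^ (2 * k) - (-1) ^ k * v ^ (2 * k)) ∧ polyBracket (u * v)
    (u ^ (2 * k) - (-1) ^ k * v ^ (2 * k)) = C (-(2 * k : ℂ)) *
    (u ^ (2 * k) + (-1) ^ k * v ^ (2 * k)) := by
  have e : ((-1) ^ k : Poly) = C ((-1) ^ k) := by simp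
  obtain ⟨h1, h2⟩ := bracket_mul_pow (2 * k)
  rw [e]
  simp only [polyBracket, map_add, map_sub, pderiv_C_mul, map_neg, Nat.cast_mul, Nat.cast_ofNat]
    at h1 h2 ⊢
  exact ⟨by linear_combination h1 + C ((-1) ^ k) * h2,
    by linear_combination h1 - C ((-1) ^ k) * h2⟩

theorem bracket_x_s (h : IsD k x s t) : bracket x s = (-(4 * k : ℂ)) • t := by
  apply Subtype.ext
  rw [coe_bracket, coe_smul_eq, h.hx, h.hs, h.ht, polyBracket_sq_left, (polyBracket_pow k).1]
  simp only [map_neg, map_mul, map_ofNat]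
  ring

theorem bracket_x_t (h : IsD k x s t) : bracket x t = (-(4 * k : ℂ)) • (x * s) := by
  apply Subtype.ext
  rw [coe_bracket, coe_smul_eq]
  change _ = _ * ((x : Poly) * (s : Poly))
  rw [h.hx, h.hs, h.ht, polyBracket_sq_left, polyBracket_mul_right, (polyBracket_pow k).2]
  simp only [map_neg, map_mul, map_ofNat]
  ring

theorem t_ne_zero (h : IsD k x s t) (hk : k ≠ 0) : t ≠ 0 := by
  rw [coe_ne_zero_iff, h.ht]
  refine mul_ne_zero (mul_ne_zero (X_ne_zero _) (X_ne_zero _)) fun h0 => ?_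
  have := congrArg (eval ![1, 0]) h0
  simp [eval_u, eval_v, hk] at this

theorem bracket_ne_zero (h : IsD k x s t) (hk : k ≠ 0) : bracket x s ≠ 0 := by
  rw [h.bracket_x_s, smul_ne_zero_iff]
  exact ⟨by simpa using hk, h.t_ne_zero hk⟩

theorem x_ne_zero (h : IsD k x s t) (hk : k ≠ 0) : x ≠ 0 :=
  (ne_zero_of_bracket_ne_zero (h.bracket_ne_zero hk)).1

theorem s_ne_zero (h : IsD k x s t) (hk : k ≠ 0) : s ≠ 0 :=
  (ne_zero_of_bracket_ne_zero (h.bracket_ne_zero hk)).2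

theorem x_mem (h : IsD k x s t) : x ∈ originIdeal Γ := mem_originIdeal_of h.homogeneous_x

theorem s_mem (h : IsD k x s t) (hk : k ≠ 0) : s ∈ originIdeal Γ :=
  mem_originIdeal_of h.homogeneous_s

theorem t_mem (h : IsD k x s t) : t ∈ originIdeal Γ := mem_originIdeal_of h.homogeneous_t

theorem exists_involution (h : IsD k x s t) (hk : k ≠ 0) {c : ℂ} (hc : c ^ 2 = 1) : ∃ θ : Aut Γ,
    IsAntiPoissonInvolution θ ∧ θ x = x ∧ θ s = c • s ∧ θ t = (-c) • t := by
  obtain ⟨a, ha0, ha⟩ := exists_root (2 * k) (a := c) (by rintro rfl; norm_num at hc)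
  have hb : (-a⁻¹) ^ (2 * k) = c := by
    rw [(even_two_mul k).neg_pow, inv_pow, ha]
    exact inv_eq_of_mul_eq_one_right (by rw [← pow_two, hc])
  have hab : a * -a⁻¹ = -1 := by rw [mul_neg, mul_inv_cancel₀ ha0]
  have hU : linSubst !![a, 0; 0, -a⁻¹] (u ^ (2 * k)) = C c * u ^ (2 * k) := by
    rw [map_pow, linSubst_diag_u, mul_pow, ← map_pow, ha]
  have hV : linSubst !![a, 0; 0, -a⁻¹] (v ^ (2 * k)) = C c * v ^ (2 * k) := by
    rw [map_pow, linSubst_diag_v, mul_pow, ← map_pow, hb]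
  have hw : linSubst !![a, 0; 0, -a⁻¹] (u * v) = -(u * v) := by
    rw [linSubst_diag_uv, hab, map_neg, map_one, neg_one_mul]
  have hx : linSubst !![a, 0; 0, -a⁻¹] (x : Poly) = x := by rw [h.hx, map_pow, hw, neg_sq]
  have hs : linSubst !![a, 0; 0, -a⁻¹] (s : Poly) = C c * (s : Poly) := by
    rw [h.hs, map_add, map_mul, map_pow _ (-1), map_neg, map_one, hU, hV]
    ring
  have ht : linSubst !![a, 0; 0, -a⁻¹] (t : Poly) = C (-c) * (t : Poly) := by
    rw [h.ht, map_mul, hw, map_sub, map_mul, map_pow _ (-1), map_neg, map_one, hU, hV, map_neg]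
    ring
  refine h.gen.exists_antiPoisson !![a, 0; 0, -a⁻¹] (by rw [det_fin_two_of, hab]; ring)
    _ _ _ hx (by rw [hs, coe_smul_eq]) (by rw [ht, coe_smul_eq]) hx ?_ ?_
  · exact linSubst_coe_smul hs hc
  · exact linSubst_coe_smul ht (by rw [neg_sq, hc])

theorem isDoubleCover (h : IsD k x s t) (hk : k ≠ 0) :
    IsDoubleCover x s t (X 0 * X 1 ^ 2 - (4 * (-1) ^ k) * X 0 ^ (k + 1)) := by
  obtain ⟨η, -, hx, hs, ht⟩ := h.exists_involution hk (one_pow 2)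
  rw [one_smul] at hs
  rw [neg_one_smul] at ht
  refine isDoubleCover_of_flip h.gen ?_ (h.bracket_ne_zero hk) (h.t_ne_zero hk) η hx hs ht
  simpa [map_ofNat] using h.rel

theorem apply_eq_of_apply_x (h : IsD k x s t) (hk : 2 ≤ k) (hθ : IsAntiPoissonInvolution θ) {α : ℂ}
    (hx : θ x = α • x) : θ x = x ∧ ((θ s = s ∧ θ t = -t) ∨ (θ s = -s ∧ θ t = t)) := by
  have hk0 : (-(4 * k : ℂ)) ≠ 0 := by simp; omega
  have hα0 : α ≠ 0 := by
    rintro rfl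
    have := hθ.sq_eq_one (h.x_ne_zero (by omega)) hx
    norm_num at this
  obtain ⟨β, hβ⟩ : ∃ β : ℂ, bracket x (θ s) = β • t := by
    have := h.gen.mem_of_isHomogeneous h.homogeneous_x h.homogeneous_s h.homogeneous_t
      (hθ.graded _ _ h.homogeneous_s) ((Submodule.span ℂ {t}).comap (bracketHom x)) ?_
    · obtain ⟨β, hβ⟩ := Submodule.mem_span_singleton.mp this
      exact ⟨β, hβ.symm⟩
    · intro i j l hijl
      change bracket x (x ^ i * s ^ j * t ^ l) ∈ Submodule.span ℂ {t}
      have hl : l = 0 := by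
        by_contra hl
        nlinarith [Nat.pos_of_ne_zero hl]
      subst hl
      rw [pow_zero, mul_one]
      rcases Nat.eq_zero_or_pos j with rfl | hj
      · have : bracket x (x ^ i * s ^ 0) = 0 := by
          apply Subtype.ext
          rw [pow_zero, mul_one]
          change polyBracket (x : Poly) ((x : Poly) ^ i) = 0
          simp only [polyBracket, Derivation.leibniz_pow, smul_eq_mul, nsmul_eq_mul]
          ring
        rw [this]
        exact zero_mem _
      · obtain rfl : j = 1 := by nlinarith
        obtain rfl : i = 0 := by omega
        rw [pow_zero, one_mul, pow_one, h.bracket_x_s]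
        exact Submodule.smul_mem _ _ (Submodule.mem_span_singleton_self t)
  have h1 := hθ.antiPoisson x s
  rw [h.bracket_x_s, hx, smul_bracket, hβ, map_smul, smul_smul] at h1
  obtain ⟨γ, hγ⟩ : ∃ γ : ℂ, θ t = γ • t := by
    refine ⟨(-(4 * k : ℂ))⁻¹ * -(α * β), ?_⟩
    rw [mul_smul, neg_smul, ← h1, smul_smul, inv_mul_cancel₀ hk0, one_smul]
  have hγ2 := hθ.sq_eq_one (h.t_ne_zero (by omega)) hγ
  have h2 := hθ.antiPoisson x t
  rw [h.bracket_x_t, hx, hγ, smul_bracket, bracket_smul, h.bracket_x_t, map_smul, map_mul, hx,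
    smul_mul_assoc] at h2
  have hs : θ s = (-γ) • s := by
    have h3 : (-(4 * k : ℂ) * α) • (x * (θ s - (-γ) • s)) = 0 := by
      rw [mul_sub, smul_sub, mul_smul, h2, mul_smul_comm, smul_smul, smul_smul, smul_smul]
      module
    have h4 := (smul_eq_zero.mp h3).resolve_left (mul_ne_zero hk0 hα0)
    exact sub_eq_zero.mp ((mul_eq_zero.mp h4).resolve_left (h.x_ne_zero (by omega)))
  have hα : α = 1 := by
    have h1 := hθ.antiPoisson x s
    rw [h.bracket_x_s, hx, hs, smul_bracket, bracket_smul, h.bracket_x_s, map_smul, hγ] at h1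
    have h3 : ((-(4 * k : ℂ)) * (γ * (1 - α))) • t = 0 := by
      rw [smul_smul, smul_smul, smul_smul, ← neg_smul, ← sub_eq_zero, ← sub_smul] at h1
      convert h1 using 2
      ring
    have h4 := (smul_eq_zero.mp h3).resolve_right (h.t_ne_zero (by omega))
    have h5 := (mul_eq_zero.mp h4).resolve_left hk0
    have h6 := (mul_eq_zero.mp h5).resolve_left (by rintro rfl; norm_num at hγ2)
    linear_combination -h6
  subst hα
  rw [one_smul] at hx
  refine ⟨hx, ?_⟩
  rcases sq_eq_one_cases hγ2 with rfl | rfl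
  · exact Or.inr ⟨by rw [hs, neg_one_smul], by rw [hγ, one_smul]⟩
  · exact Or.inl ⟨by rw [hs, neg_neg, one_smul], by rw [hγ, neg_one_smul]⟩

theorem linSubst_of_two (h : IsD 2 x s t) {M : Mat} {r : ℂ} (hM : linSubst M formT = formT)
    (huv : linSubst M ((u * v) ^ 2) = C (-1 / 2) * (u * v) ^ 2 + C (-r / 4) * (u ^ 4 + v ^ 4))
    (hs : linSubst M (u ^ 4 + v ^ 4) = C (3 * r) * (u * v) ^ 2 + C (-1 / 2) * (u ^ 4 + v ^ 4)) :
    linSubst M (x : Poly) = ((-1 / 2 : ℂ) • x + (-r / 4) • s : invariants Γ) ∧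
    linSubst M (s : Poly) = ((3 * r) • x + (-1 / 2 : ℂ) • s : invariants Γ) ∧
    linSubst M (t : Poly) = t := by
  have h1 : (s : Poly) = u ^ 4 + v ^ 4 := by rw [h.hs]; ring
  have h2 : (t : Poly) = formT := by rw [h.ht, formT]; ring
  have hadd : ∀ f g : invariants Γ, ((f + g : invariants Γ) : Poly) = (f : Poly) + (g : Poly) :=
    fun _ _ => rfl
  rw [hadd, hadd, coe_smul_eq, coe_smul_eq, coe_smul_eq, coe_smul_eq, h.hx, h1, h2]
  exact ⟨huv, hs, hM⟩

/-- The rotations of order three permuting the three coordinate axes. -/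
theorem exists_rotation (h : IsD 2 x s t) {r : ℂ} (hr : r = 1 ∨ r = -1) : ∃ σ : Aut Γ,
    IsGradedPoisson σ ∧ σ x = (-1 / 2 : ℂ) • x + (-r / 4) • s ∧
    σ s = (3 * r) • x + (-1 / 2 : ℂ) • s ∧ σ t = t := by
  obtain ⟨c, hc⟩ : ∃ c : ℂ, c = 1 / (1 - I) := ⟨_, rfl⟩
  have hI : (C I : Poly) ^ 2 = -1 := by rw [← map_pow, I_sq, map_neg, map_one]
  have hc2 : c ^ 2 = I / 2 := by
    rw [hc, div_pow, div_eq_div_iff (pow_ne_zero 2 one_sub_I_ne_zero) two_ne_zero]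
    linear_combination (2 - I) * I_sq
  have hc4 : (C c : Poly) ^ 4 = C (-1 / 4) := by
    rw [← map_pow]
    congr 1
    linear_combination (c ^ 2 + I / 2) * hc2 + (1 / 4) * I_sq
  have h4 : (C (-1 / 4) : Poly) * 4 = -1 := by
    rw [← C_ofNat_four, ← map_mul, ← map_one C, ← map_neg]
    norm_num
  have h2 : (C (-1 / 2) : Poly) = 2 * C (-1 / 4) := by
    rw [← map_ofNat C 2, ← map_mul]
    norm_num
  have hM : tetrahedralMatrix = !![c, c * I; c, -(c * I)] := by
    rw [tetrahedralMatrix, ← hc]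
    ext i j
    fin_cases i <;> fin_cases j <;> simp
  obtain ⟨N, hN⟩ : ∃ N : Mat, N = !![-(c * I), -(c * I); -c, c] :=
    ⟨_, rfl⟩
  have hMN : tetrahedralMatrix * N = 1 := by
    rw [hM, hN, mul_fin_two, one_fin_two]
    have : -2 * (c ^ 2 * I) = 1 := by rw [hc2]; linear_combination -I_sq
    ext i j
    fin_cases i <;> fin_cases j <;> simp <;> first | linear_combination this | ring
  have hNM : N * tetrahedralMatrix = 1 := mul_eq_one_comm.mp hMN
  have hMT := linSubst_tetrahedral_formT
  have hNT : linSubst N formT = formT := by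
    conv_lhs => rw [← hMT, linSubst_linSubst, hMN, linSubst_one]
  have key1 := h.linSubst_of_two (r := 1) hMT (by
    simp only [hM, map_mul, map_pow, map_neg, linSubst_u, linSubst_v, of_apply,
      cons_val', cons_val_zero, cons_val_one, cons_val_fin_one]
    rw [h2]
    linear_combination (u ^ 2 + v ^ 2) ^ 2 * hc4 -
      C c ^ 4 * v ^ 2 * (2 * u ^ 2 - C I ^ 2 * v ^ 2 + v ^ 2) * hI) (by
    simp only [hM, map_mul, map_add, map_pow, map_neg, linSubst_u, linSubst_v, of_apply,
      cons_val', cons_val_zero, cons_val_one, cons_val_fin_one]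
    rw [h2, map_ofNat, map_one]
    linear_combination (2 * u ^ 4 - 12 * u ^ 2 * v ^ 2 + 2 * v ^ 4) * hc4 - 3 * (u * v) ^ 2 * h4 +
      C c ^ 4 * (12 * u ^ 2 * v ^ 2 + 2 * v ^ 4 * (C I ^ 2 - 1)) * hI)
  have key2 := h.linSubst_of_two (r := -1) hNT (by
    simp only [hN, map_mul, map_pow, linSubst_u, linSubst_v, of_apply,
      cons_val', cons_val_zero, cons_val_one, cons_val_fin_one]
    rw [h2, show (- -1 / 4 : ℂ) = -(-1 / 4) by ring, map_neg, map_neg, map_neg, map_mul]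
    linear_combination C I ^ 2 * (v ^ 2 - u ^ 2) ^ 2 * hc4 +
      C (-1 / 4) * (v ^ 2 - u ^ 2) ^ 2 * hI) (by
    simp only [hN, map_mul, map_add, map_pow, map_neg, linSubst_u, linSubst_v, of_apply,
      cons_val', cons_val_zero, cons_val_one, cons_val_fin_one]
    rw [h2, map_ofNat, map_one]
    linear_combination (C I ^ 4 * (u + v) ^ 4 + (v - u) ^ 4) * hc4 + 3 * (u * v) ^ 2 * h4 +
      C (-1 / 4) * (u + v) ^ 4 * (C I ^ 2 - 1) * hI)
  have mem1 : ∀ f : invariants Γ, linSubst tetrahedralMatrix (f : Poly) ∈ invariants Γ := by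
    refine h.gen.linSubst_mem (key1.1 ▸ Subtype.prop _) (key1.2.1 ▸ Subtype.prop _) ?_
    rw [key1.2.2]
    exact t.2
  have mem2 : ∀ f : invariants Γ, linSubst N (f : Poly) ∈ invariants Γ := by
    refine h.gen.linSubst_mem (key2.1 ▸ Subtype.prop _) (key2.2.1 ▸ Subtype.prop _) ?_
    rw [key2.2.2]
    exact t.2
  have hNdet : N.det = 1 := by
    have := congrArg Matrix.det hMN
    rwa [Matrix.det_mul, det_tetrahedralMatrix, one_mul, Matrix.det_one] at this
  rcases hr with rfl | rfl
  · obtain ⟨σ, hσ, hσf⟩ := h.gen.exists_gradedPoisson _ N hMN det_tetrahedralMatrix (mem1 _) (mem1 _)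
      (mem1 _) (mem2 _) (mem2 _) (mem2 _)
    exact ⟨σ, hσ, Subtype.ext ((hσf _).trans key1.1), Subtype.ext ((hσf _).trans key1.2.1),
      Subtype.ext ((hσf _).trans key1.2.2)⟩
  · obtain ⟨σ, hσ, hσf⟩ := h.gen.exists_gradedPoisson N _ hNM hNdet (mem2 _) (mem2 _) (mem2 _)
      (mem1 _) (mem1 _) (mem1 _)
    exact ⟨σ, hσ, Subtype.ext ((hσf _).trans key2.1), Subtype.ext ((hσf _).trans key2.2.1),
      Subtype.ext ((hσf _).trans key2.2.2)⟩

theorem bracket_s_t (h : IsD 2 x s t) : bracket s t = (4 : ℂ) • s ^ 2 - (48 : ℂ) • x ^ 2 := by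
  apply Subtype.ext
  rw [coe_bracket]
  change _ = ((4 : ℂ) • s ^ 2 : invariants Γ).1 - ((48 : ℂ) • x ^ 2 : invariants Γ).1
  rw [coe_smul_eq, coe_smul_eq]
  change _ = C 4 * (s : Poly) ^ 2 - C 48 * (x : Poly) ^ 2
  rw [h.hx, h.hs, h.ht, map_ofNat, map_ofNat]
  simp only [polyBracket, map_add, map_sub, Derivation.leibniz, Derivation.leibniz_pow,
    pderiv_zero_u, pderiv_one_u, pderiv_zero_v, pderiv_one_v, smul_eq_mul, nsmul_eq_mul, map_neg,
    Derivation.map_one_eq_zero]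
  push_cast
  ring

theorem quadratic_coeffs (h : IsD 2 x s t) {a b c : ℂ}
    (h0 : a • x ^ 2 + b • (x * s) + c • s ^ 2 = 0) : a = 0 ∧ b = 0 ∧ c = 0 := by
  have h1 := aeval_injective_of_bracket_ne_zero (h.bracket_ne_zero two_ne_zero)
    (C a * X 0 ^ 2 + C b * (X 0 * X 1) + C c * X 1 ^ 2) (by
      simpa [algebraMap_eq, smul_def] using h0)
  have e1 := congrArg (eval ![1, 0]) h1
  have e2 := congrArg (eval ![0, 1]) h1
  have e3 := congrArg (eval ![1, 1]) h1
  simp at e1 e2 e3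
  exact ⟨e1, by linear_combination e3 - e1 - e2, e2⟩

theorem quadratic_relation (h : IsD 2 x s t) {α β γ δ : ℂ} (h0 : (-8 : ℂ) • ((α • x + β • s) * (γ •
    x + δ • s)) = -((-8 * α) • (x * s) + ((4 * β) • s ^ 2 - (48 * β) • x ^ 2))) :
    -8 * (α * γ) - 48 * β = 0 ∧ -8 * (β * δ) + 4 * β = 0 := by
  obtain ⟨q1, -, q3⟩ := h.quadratic_coeffs (a := -8 * (α * γ) - 48 * β)
    (b := -8 * (β * γ + α * δ) - 8 * α) (c := -8 * (β * δ) + 4 * β) (by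
      rw [← sub_eq_zero] at h0
      rw [← h0]
      simp only [mul_add (_ • x + _ • s), add_mul (_ • x)]
      rw [smul_mul_smul_comm, smul_mul_smul_comm,
        smul_mul_smul_comm, smul_mul_smul_comm, mul_comm s x, ← pow_two, ← pow_two]
      module)
  exact ⟨q1, q3⟩

theorem exists_coeffs (h : IsD 2 x s t) (hf : (f : Poly).IsHomogeneous 4) : ∃ a b : ℂ,
    a • x + b • s = f :=
  Submodule.mem_span_pair.mp <| h.gen.mem_of_isHomogeneous h.homogeneous_x h.homogeneous_s
    h.homogeneous_t hf (Submodule.span ℂ {x, s}) fun i j l hijl => by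
      obtain rfl : l = 0 := by omega
      rw [pow_zero, mul_one]
      obtain ⟨rfl, rfl⟩ | ⟨rfl, rfl⟩ : (i = 1 ∧ j = 0) ∨ (i = 0 ∧ j = 1) := by omega
      · exact Submodule.subset_span (by simp)
      · exact Submodule.subset_span (by simp)

theorem bracket_combination (h : IsD 2 x s t) (a b c d : ℂ) :
    bracket (a • x + b • s) (c • x + d • s) = (-8 * (a * d - b * c)) • t ∧
    bracket (a • x + b • s) t = (-8 * a) • (x * s) + ((4 * b) • s ^ 2 - (48 * b) • x ^ 2) := by
  have hadd : ∀ f g : invariants Γ, bracket (f + g) t = bracket f t + bracket g t := fun f g => by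
    apply Subtype.ext
    change polyBracket ((f : Poly) + g) _ = polyBracket _ _ + polyBracket _ _
    simp only [polyBracket, map_add]
    ring
  have h1 : bracket (a • x + b • s) (c • x + d • s) = (a * d - b * c) • bracket x s := by
    apply Subtype.ext
    rw [coe_bracket, coe_smul_eq, coe_bracket]
    change polyBracket ((a • x : invariants Γ).1 + (b • s : invariants Γ).1)
      ((c • x : invariants Γ).1 + (d • s : invariants Γ).1) = _
    rw [coe_smul_eq, coe_smul_eq, coe_smul_eq, coe_smul_eq]
    simp only [polyBracket, map_add, map_sub, map_mul, pderiv_C_mul]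
    ring
  constructor
  · rw [h1, h.bracket_x_s, smul_smul]
    congr 1
    push_cast
    ring
  · rw [hadd, smul_bracket, smul_bracket, h.bracket_s_t, h.bracket_x_t, smul_sub, smul_smul,
      smul_smul, smul_smul]
    congr 2
    · push_cast
      ring
    · rw [mul_comm]
    · rw [mul_comm]

theorem apply_eq_of_two (h : IsD 2 x s t) (hθ : IsAntiPoissonInvolution θ)
    (hne : ∀ α : ℂ, θ x ≠ α • x) : ∃ e : ℂ, (e = 1 ∨ e = -1) ∧
    θ x = (-1 / 2 : ℂ) • x + (e / 4) • s ∧ θ s = (3 * e) • x + (1 / 2 : ℂ) • s ∧ θ t = t := by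
  obtain ⟨α, β, hx⟩ := h.exists_coeffs (hθ.graded _ _ h.homogeneous_x)
  obtain ⟨γ, δ, hs⟩ := h.exists_coeffs (hθ.graded _ _ h.homogeneous_s)
  obtain ⟨ε, ht⟩ := h.gen.eq_smul_of_isHomogeneous h.homogeneous_x h.homogeneous_s h.homogeneous_t
    (hθ.graded _ _ h.homogeneous_t) (m := t) fun i j l hijl => by
      obtain rfl : l = 1 := by omega
      obtain rfl : i = 0 := by omega
      obtain rfl : j = 0 := by omega
      simp
  have hβ : β ≠ 0 := by
    rintro rfl
    exact hne α (by rw [← hx, zero_smul, add_zero])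
  have ind : ∀ {a b : ℂ}, a • x + b • s = 0 → a = 0 ∧ b = 0 := fun {a b} h0 =>
    coeffs_eq_zero (h.bracket_ne_zero two_ne_zero) one_ne_zero one_ne_zero
      (by rwa [pow_one, pow_one])
  have hinv := hθ.involutive x
  rw [← hx, map_add, map_smul, map_smul, ← hx, ← hs] at hinv
  obtain ⟨i1, i2⟩ := ind (a := α ^ 2 + β * γ - 1) (b := β * (α + δ)) (by
    rw [← sub_eq_zero] at hinv
    rw [← hinv]
    module)
  have hδ : δ = -α := by linear_combination (mul_eq_zero.mp i2).resolve_left hβ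
  subst hδ
  obtain ⟨c1, -⟩ := h.bracket_combination 1 0 0 1
  rw [one_smul, zero_smul, zero_smul, one_smul, add_zero, zero_add] at c1
  have hε := hθ.antiPoisson x s
  rw [c1, ← hx, ← hs, (h.bracket_combination _ _ _ _).1, map_smul, ht, smul_smul, ← neg_smul,
    ← sub_eq_zero, ← sub_smul] at hε
  have hε1 := (smul_eq_zero.mp hε).resolve_right (h.t_ne_zero two_ne_zero)
  obtain rfl : ε = 1 := by linear_combination (-1 / 8) * hε1 + i1
  rw [one_smul] at ht
  obtain ⟨-, c2⟩ := h.bracket_combination 1 0 0 1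
  rw [one_smul, zero_smul, add_zero, mul_zero, mul_zero, zero_smul, zero_smul, sub_zero, add_zero,
    mul_one] at c2
  have h2 := hθ.antiPoisson x t
  rw [ht, c2, ← hx, (h.bracket_combination _ _ 0 0).2, map_smul, map_mul, ← hx, ← hs] at h2
  obtain ⟨q1, q3⟩ := h.quadratic_relation h2
  have hα : α = -1 / 2 := by
    have : β * (8 * α + 4) = 0 := by linear_combination q3
    linear_combination (1 / 8) * (mul_eq_zero.mp this).resolve_left hβ
  subst hα
  have hγ : γ = 12 * β := by linear_combination (1 / 4) * q1
  subst hγ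
  refine ⟨4 * β, sq_eq_one_cases (by linear_combination (4 / 3) * i1), ?_, ?_, ht⟩
  · rw [← hx]
    congr 2
    ring
  · rw [← hs]
    congr 2 <;> ring

theorem exists_conjugate (h : IsD k x s t) (hk : 2 ≤ k) (hθ : IsAntiPoissonInvolution θ) : ∃ η :
    Aut Γ, IsAntiPoissonInvolution η ∧ AreConjugate θ η ∧ η x = x ∧
    ((η s = s ∧ η t = -t) ∨ (η s = -s ∧ η t = t)) := by
  by_cases hx : ∃ α : ℂ, θ x = α • x
  · obtain ⟨α, hα⟩ := hx
    exact ⟨θ, hθ, areConjugate_refl θ, h.apply_eq_of_apply_x hk hθ hα⟩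
  · push Not at hx
    obtain rfl : k = 2 := by
      by_contra hk2
      obtain ⟨c, hc⟩ := h.gen.eq_smul_of_isHomogeneous h.homogeneous_x h.homogeneous_s
        h.homogeneous_t (hθ.graded _ _ h.homogeneous_x) (m := x) fun i j l hijl => by
          obtain rfl : l = 0 := by
            by_contra hl
            nlinarith [Nat.pos_of_ne_zero hl, Nat.zero_le (2 * k * j)]
          obtain rfl : j = 0 := by
            by_contra hj
            have : 3 ≤ k := by omega
            nlinarith [Nat.pos_of_ne_zero hj]
          obtain rfl : i = 1 := by omega
          simp
      exact hx c hc
    obtain ⟨e, he, ex, es, et⟩ := h.apply_eq_of_two hθ hx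
    obtain ⟨η, hη, ηx, ηs, ηt⟩ := h.exists_involution two_ne_zero (c := -1) (by norm_num)
    rw [neg_one_smul] at ηs
    rw [neg_neg, one_smul] at ηt
    obtain ⟨σ, hσ, σx, σs, σt⟩ := h.exists_rotation (r := -e) (by
      rcases he with rfl | rfl <;> norm_num)
    have he2 : e ^ 2 = 1 := by rcases he with rfl | rfl <;> norm_num
    refine ⟨η, hη, h.gen.areConjugate hσ ?_ ?_ (by rw [et, σt, ηt]), ηx, Or.inr ⟨ηs, ηt⟩⟩
    · rw [ex]
      simp only [map_add, map_smul, σx, σs, ηx, ηs]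
      match_scalars
      · linear_combination (-3 / 4) * he2
      · ring
    · rw [es]
      simp only [map_add, map_smul, σx, σs, ηx, ηs]
      match_scalars
      · ring
      · linear_combination (3 / 4) * he2

theorem fixed_branch (h : IsD k x s t) (hk : k ≠ 0) (hx : θ x = x) (hs : θ s = s) (ht : θ t = -t) :
    fixedIdeal θ = Ideal.span {t} ∧
    IsPlaneCurve θ x s (fun a b => a * b ^ 2 - (4 * (-1) ^ k) * a ^ (k + 1)) :=
  (h.isDoubleCover hk).isPlaneCurve_branch hx hs ht one_ne_zero (by rw [map_one, one_mul])

theorem fixed_flip (h : IsD k x s t) (hk : k ≠ 0) (hx : θ x = x) (hs : θ s = -s) (ht : θ t = t) :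
    fixedIdeal θ = Ideal.span {s} ∧
    IsPlaneCurve θ x t (fun a b => b ^ 2 + (4 * (-1) ^ k) * a ^ (k + 1)) :=
  (h.isDoubleCover hk).isPlaneCurve_flip hx hs ht (d := -((4 * (-1) ^ k) * Polynomial.X ^ (k + 1)))
    (by simp [map_ofNat]) one_ne_zero (by simp [map_ofNat])

theorem C_half : (C (1 / 2) : Poly) = -2 * C (-1 / 4) := by
  rw [← map_ofNat C 2, ← map_neg, ← map_mul]
  norm_num

theorem C_sixteenth : (C (1 / 16) : Poly) = C (-1 / 4) ^ 2 := by rw [← map_pow]; norm_num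

theorem four_mul_C_neg : (4 * C (-1 / 4) : Poly) = -1 := by
  rw [← map_ofNat C 4, ← map_mul, ← map_one C, ← map_neg]
  norm_num

theorem combination_mem_originIdeal (c d : ℂ) {g : invariants Γ} (hf : f ∈ originIdeal Γ)
    (hg : g ∈ originIdeal Γ) (hm : m ≠ 0) : c • f + d • g ^ m ∈ originIdeal Γ :=
  add_mem (Submodule.smul_of_tower_mem _ c hf)
    (Submodule.smul_of_tower_mem _ d (Ideal.pow_mem_of_mem _ hg m (Nat.pos_of_ne_zero hm)))

/-- The three lines `x y (y - x ^ m) = 0`. -/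
theorem even_branch (h : IsD (2 * m) x s t) (hm : m ≠ 0) (hθ : IsGraded θ) (hx : θ x = x)
    (hs : θ s = s) (ht : θ t = -t) : IsPlaneCurve θ x ((-1 / 4 : ℂ) • s + (1 / 2 : ℂ) • x ^ m)
    (fun a b => a * b * (b - a ^ m)) ∧ IsReducedUnion θ 3 0 ∧ HasGoodComponents (FixedRing θ) := by
  have hp : IsPlaneCurve θ x ((-1 / 4 : ℂ) • s + (1 / 2 : ℂ) • x ^ m)
      (fun a b => a * b * (b - a ^ m)) := by
    refine (h.fixed_branch (by omega) hx hs ht).2.change (α := -1 / 4) (by norm_num)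
      (Polynomial.C (1 / 2) * Polynomial.X ^ m) ?_ (c := 1 / 16) (by norm_num) ?_
    · rw [map_mul, map_pow, Polynomial.aeval_X, Polynomial.aeval_C, ← smul_def, sub_self]
      exact zero_mem _
    · simp only [map_sub, map_mul, map_pow, aeval_X, cons_val_zero, cons_val_one,
        cons_val_fin_one, Polynomial.aeval_X, Polynomial.aeval_C, algebraMap_eq, C_sixteenth, C_half]
      rw [(even_two_mul m).neg_one_pow]
      linear_combination
        (2 * C (-1 / 4) * X 0 ^ (2 * m + 1) - C (-1 / 4) * X 0 ^ (m + 1) * X 1) *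
        four_mul_C_neg
  refine ⟨hp, hp.lines hθ h.x_mem
    (combination_mem_originIdeal _ _ (h.s_mem (by omega)) h.x_mem hm)
    ![X 0, X 1, X 1 - C 1 * X 0 ^ m] ?_ ?_ ?_ ?_⟩
  · rw [Fin.prod_univ_three, map_one, one_mul]
    rfl
  · intro i
    fin_cases i <;> simp [hm]
  · intro i
    fin_cases i
    · exact X_isLine 0
    · exact X_isLine 1
    · exact graph_isLine (by decide) 1 m
  · intro i j hij Q hQ
    rw [map_one, one_mul]
    obtain ⟨rfl, rfl⟩ | ⟨rfl, rfl⟩ | ⟨rfl, rfl⟩ : (i = 0 ∧ j = 1) ∨ (i = 0 ∧ j = 2) ∨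
        (i = 1 ∧ j = 2) := by omega
    · exact And.intro
    · intro h0 h1
      have : X 1 - X 0 ^ m + X 0 ^ m ∈ Q :=
        Q.add_mem h1 (Ideal.pow_mem_of_mem Q h0 m (Nat.pos_of_ne_zero hm))
      exact ⟨h0, by rwa [sub_add_cancel] at this⟩
    · intro h0 h1
      have : X 1 - (X 1 - X 0 ^ m) ∈ Q := Q.sub_mem h0 h1
      exact ⟨hQ.mem_of_pow_mem m (by rwa [sub_sub_cancel] at this), h0⟩

theorem even_flip (h : IsD (2 * m) x s t) (hm : m ≠ 0) (hθ : IsGraded θ) (hx : θ x = x)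
    (hs : θ s = -s) (ht : θ t = t) :
    IsPlaneCurve θ x ((1 / 4 : ℂ) • t) (fun a b => a ^ (2 * m + 1) + 4 * b ^ 2) ∧
    IsReducedUnion θ 0 1 ∧ HasGoodComponents (FixedRing θ) := by
  have hp : IsPlaneCurve θ x ((1 / 4 : ℂ) • t) (fun a b => a ^ (2 * m + 1) + 4 * b ^ 2) := by
    refine (h.fixed_flip (by omega) hx hs ht).2.rescale (by norm_num) (c := 1 / 4) (by norm_num) ?_
    simp only [map_add, map_mul, map_pow, map_ofNat, aeval_X, cons_val_zero, cons_val_one,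
      cons_val_fin_one, (even_two_mul m).neg_one_pow]
    linear_combination (C (1 / 4) * X 1 ^ 2 - X 0 ^ (2 * m + 1)) * four_mul_C
  exact ⟨hp, hp.cusp hθ h.x_mem (Submodule.smul_of_tower_mem _ _ h.t_mem) (p := 2 * m + 1) (q := 2) (α := 1)
    (β := 4) (by rw [map_one, one_mul, map_ofNat]) (by omega) le_rfl
    (Nat.coprime_two_right.mpr (odd_two_mul_add_one m)) one_ne_zero (by norm_num)⟩

/-- The two lines `z (z - x ^ (m + 1)) = 0`. -/
theorem odd_flip (h : IsD (2 * m + 1) x s t) (hθ : IsGraded θ) (hx : θ x = x) (hs : θ s = -s)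
    (ht : θ t = t) : IsPlaneCurve θ x ((-1 / 4 : ℂ) • t + (1 / 2 : ℂ) • x ^ (m + 1))
    (fun a b => b * (b - a ^ (m + 1))) ∧ IsReducedUnion θ 2 0 ∧
    HasGoodComponents (FixedRing θ) := by
  have hp : IsPlaneCurve θ x ((-1 / 4 : ℂ) • t + (1 / 2 : ℂ) • x ^ (m + 1))
      (fun a b => b * (b - a ^ (m + 1))) := by
    refine (h.fixed_flip (by omega) hx hs ht).2.change (α := -1 / 4) (by norm_num)
      (Polynomial.C (1 / 2) * Polynomial.X ^ (m + 1)) ?_ (c := 1 / 16) (by norm_num) ?_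
    · rw [map_mul, map_pow, Polynomial.aeval_X, Polynomial.aeval_C, ← smul_def, sub_self]
      exact zero_mem _
    · simp only [map_sub, map_mul, map_pow, aeval_X, cons_val_zero, cons_val_one,
        cons_val_fin_one, Polynomial.aeval_X, Polynomial.aeval_C, algebraMap_eq, C_sixteenth, C_half]
      rw [(odd_two_mul_add_one m).neg_one_pow]
      linear_combination
        (2 * C (-1 / 4) * X 0 ^ (2 * m + 2) - C (-1 / 4) * X 0 ^ (m + 1) * X 1) *
        four_mul_C_neg
  have g := fun c : ℂ => graph_isLine (i := 1) (j := 0) (by decide) c (m + 1)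
  refine ⟨hp, hp.two_lines hθ h.x_mem
    (combination_mem_originIdeal _ _ h.t_mem h.x_mem (by omega))
    (X 1) (X 1 - C 1 * X 0 ^ (m + 1)) ?_ (by simp) (by simp) (X_isLine 1) (g 1) ?_⟩
  · rw [map_one, one_mul]
  · intro Q hQ h0 h1
    refine ⟨hQ.mem_of_pow_mem (m + 1) ?_, h0⟩
    have := Q.sub_mem h0 h1
    rwa [map_one, one_mul, sub_sub_cancel] at this

theorem odd_branch (h : IsD (2 * m + 1) x s t) (hm : m ≠ 0) (hθ : IsGraded θ) (hx : θ x = x)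
    (hs : θ s = s) (ht : θ t = -t) :
    IsPlaneCurve θ x ((1 / 4 : ℂ) • s) (fun a b => a * (4 * b ^ 2 + a ^ (2 * m + 1))) ∧
    IsReducedUnion θ 1 1 ∧ HasGoodComponents (FixedRing θ) := by
  have hp : IsPlaneCurve θ x ((1 / 4 : ℂ) • s) (fun a b => a * (4 * b ^ 2 + a ^ (2 * m + 1))) := by
    refine (h.fixed_branch (by omega) hx hs ht).2.rescale (by norm_num) (c := 1 / 4) (by norm_num)
      ?_
    simp only [map_add, map_mul, map_pow, map_ofNat, aeval_X, cons_val_zero, cons_val_one,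
      cons_val_fin_one, (odd_two_mul_add_one m).neg_one_pow]
    linear_combination (C (1 / 4) * X 0 * X 1 ^ 2 - X 0 ^ (2 * m + 2)) * four_mul_C
  exact ⟨hp, hp.line_cusp hθ h.x_mem (Submodule.smul_of_tower_mem _ _ (h.s_mem (by omega))) 0
    (p := 2 * m + 1) (q := 2) (α := 1) (β := 4)
    (by rw [map_one, one_mul, map_ofNat, add_comm (_ ^ _)]) (by omega) le_rfl
    (Nat.coprime_two_right.mpr (odd_two_mul_add_one m)) one_ne_zero (by norm_num)⟩

theorem hasGoodComponents (h : IsD k x s t) (hk : 2 ≤ k) (hθ : IsAntiPoissonInvolution θ) :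
    HasGoodComponents (FixedRing θ) := by
  obtain ⟨η, hη, hconj, hx, hst⟩ := h.exists_conjugate hk hθ
  refine hconj.hasGoodComponents ?_
  obtain ⟨m, rfl | rfl⟩ := Nat.even_or_odd' k
  · rcases hst with ⟨hs, ht⟩ | ⟨hs, ht⟩
    · exact (h.even_branch (by omega) hη.graded hx hs ht).2.2
    · exact (h.even_flip (by omega) hη.graded hx hs ht).2.2
  · rcases hst with ⟨hs, ht⟩ | ⟨hs, ht⟩
    · exact (h.odd_branch (by omega) hη.graded hx hs ht).2.2
    · exact (h.odd_flip hη.graded hx hs ht).2.2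

theorem exists_explicit (h : IsD k x s t) (hk : 2 ≤ k) : ∃ θ₁ θ₂ : Aut Γ,
    (∀ θ : Aut Γ, IsAntiPoissonInvolution θ → AreConjugate θ θ₁ ∨ AreConjugate θ θ₂) ∧
    (IsAntiPoissonInvolution θ₁ ∧ θ₁ x = x ∧ θ₁ s = s ∧ θ₁ t = -t) ∧
    (IsAntiPoissonInvolution θ₂ ∧ θ₂ x = x ∧ θ₂ s = -s ∧ θ₂ t = t) := by
  obtain ⟨θ₁, h1, x1, s1, t1⟩ := h.exists_involution (by omega) (c := 1) (by norm_num)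
  obtain ⟨θ₂, h2, x2, s2, t2⟩ := h.exists_involution (by omega) (c := -1) (by norm_num)
  rw [one_smul] at s1
  rw [neg_one_smul] at t1 s2
  rw [neg_neg, one_smul] at t2
  refine ⟨θ₁, θ₂, fun θ hθ => ?_, ⟨h1, x1, s1, t1⟩, ⟨h2, x2, s2, t2⟩⟩
  obtain ⟨η, hη, hconj, hx, ⟨hs, ht⟩ | ⟨hs, ht⟩⟩ := h.exists_conjugate hk hθ
  · exact Or.inl (hconj.trans (h.gen.areConjugate_of_eq (hx.trans x1.symm) (hs.trans s1.symm)
      (ht.trans t1.symm)))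
  · exact Or.inr (hconj.trans (h.gen.areConjugate_of_eq (hx.trans x2.symm) (hs.trans s2.symm)
      (ht.trans t2.symm)))

end IsD

theorem coe_combination (a b : ℂ) (f g : invariants Γ) (m : ℕ) :
    ((a • f + b • g ^ m : invariants Γ) : Poly) = C a * (f : Poly) + C b * (g : Poly) ^ m := by
  change (a • f : invariants Γ).1 + (b • g ^ m : invariants Γ).1 = _
  rw [coe_smul_eq, coe_smul_eq]
  rfl

/-- The conjugate subgroup `h⁻¹ Γ h`. -/
noncomputable def conjugate (h : SL2) (Γ : Subgroup SL2) : Subgroup SL2 :=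
  Γ.comap (MulAut.conj h).toMonoidHom

theorem mem_conjugate {h y : SL2} : y ∈ conjugate h Γ ↔ h * y * h⁻¹ ∈ Γ := Iff.rfl

instance [Finite Γ] (h : SL2) : Finite (conjugate h Γ) :=
  Finite.of_injective (fun y : conjugate h Γ => (⟨h * y.1 * h⁻¹, y.2⟩ : Γ)) fun _ _ hyz =>
    Subtype.ext (mul_left_cancel (mul_right_cancel (congrArg Subtype.val hyz)))

theorem linSubst_mem_conjugate {h : SL2} {f : Poly} (hf : f ∈ invariants Γ) :
    linSubst h.1 f ∈ invariants (conjugate h Γ) := fun y hy => by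
  have key := linSubst_eq_of_mem hf (mem_conjugate.mp hy)
  conv_rhs => rw [← key]
  rw [linSubst_linSubst, linSubst_linSubst, ← sl_mul, ← sl_mul, inv_mul_cancel_right]

theorem linSubst_inv_mem {h : SL2} {f : Poly} (hf : f ∈ invariants (conjugate h Γ)) :
    linSubst (h⁻¹).1 f ∈ invariants Γ := fun g hg => by
  have key := linSubst_eq_of_mem hf (g := h⁻¹ * g * h) (by
    rw [mem_conjugate, mul_assoc, mul_assoc, mul_assoc, mul_inv_cancel, mul_one, mul_inv_cancel_left]
    exact hg)
  conv_rhs => rw [← key]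
  rw [linSubst_linSubst, linSubst_linSubst, ← sl_mul, ← sl_mul, mul_inv_cancel_right]

theorem linSubst_cancel {g h : SL2} (hgh : g * h = 1) (f : Poly) :
    linSubst h.1 (linSubst g.1 f) = f := by
  rw [linSubst_linSubst, ← sl_mul, hgh, sl_one, linSubst_one]

/-- The isomorphism of coordinate rings given by a linear change of coordinates. -/
noncomputable def conjugateEquiv (h : SL2) : invariants Γ ≃ₐ[ℂ] invariants (conjugate h Γ) :=
  AlgEquiv.ofAlgHom
    (((linSubst h.1).comp (invariants Γ).val).codRestrict _ fun f => linSubst_mem_conjugate f.2)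
    (((linSubst (h⁻¹).1).comp (invariants (conjugate h Γ)).val).codRestrict _ fun f =>
      linSubst_inv_mem f.2)
    (AlgHom.ext fun _ => Subtype.ext (linSubst_cancel (inv_mul_cancel h) _))
    (AlgHom.ext fun _ => Subtype.ext (linSubst_cancel (mul_inv_cancel h) _))

theorem conjugateEquiv_bracket (h : SL2) (f g : invariants Γ) :
    conjugateEquiv h (bracket f g) = bracket (conjugateEquiv h f) (conjugateEquiv h g) := by
  apply Subtype.ext
  change linSubst h.1 (polyBracket f g) = polyBracket (linSubst h.1 f) (linSubst h.1 g)
  rw [polyBracket_linSubst, h.2, map_one, one_mul]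

/-- The fixed point loci of all anti-Poisson involutions have the expected components. -/
def HasGoodInvolutions (Γ : Subgroup SL2) : Prop :=
  ∀ θ : Aut Γ, IsAntiPoissonInvolution θ →
    HasGoodComponents (FixedRing θ)

theorem HasGoodInvolutions.of_conjugate (h : SL2) (hΓ : HasGoodInvolutions (conjugate h Γ)) :
    HasGoodInvolutions Γ := fun θ hθ => by
  have hinv : ∀ f, (conjugateEquiv h).symm (conjugateEquiv (Γ := Γ) h f) = f :=
    (conjugateEquiv h).symm_apply_apply
  have hsymm : ∀ f g : invariants (conjugate h Γ), (conjugateEquiv (Γ := Γ) h).symm (bracket f g) =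
      bracket ((conjugateEquiv h).symm f) ((conjugateEquiv h).symm g) := fun f g => by
    rw [AlgEquiv.symm_apply_eq, conjugateEquiv_bracket, AlgEquiv.apply_symm_apply,
      AlgEquiv.apply_symm_apply]
  obtain ⟨e⟩ := nonempty_fixedRing_equiv (θ := θ)
    (θ' := ((conjugateEquiv h).symm.trans θ).trans (conjugateEquiv h)) (conjugateEquiv h)
    fun f => by simp only [AlgEquiv.trans_apply, hinv]
  refine (hΓ _ ⟨fun d f hf => ?_, fun f => ?_, fun f g => ?_⟩).congr e.symm
  · exact linSubst_isHomogeneous h.1 (hθ.graded d _ (linSubst_isHomogeneous (h⁻¹).1 hf))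
  · simp only [AlgEquiv.trans_apply, hinv, hθ.involutive, AlgEquiv.apply_symm_apply]
  · simp only [AlgEquiv.trans_apply, hsymm, hθ.antiPoisson, map_neg, conjugateEquiv_bracket]

theorem diagSL_pow {c : ℂ} (hc : c ≠ 0) (i : ℕ) :
    diagSL c hc ^ i = diagSL (c ^ i) (pow_ne_zero i hc) := by
  induction i with
  | zero =>
    rw [pow_zero]
    apply sl_ext <;> simp [diagSL]
  | succ i ih =>
    rw [pow_succ, ih]
    apply Subtype.ext
    rw [sl_mul]
    simp [diagSL, pow_succ, mul_comm]

theorem eq_groupA {c : ℂ} (hc : c ≠ 0) (hprim : IsPrimitiveRoot c (n + 1)) (hmem : diagSL c hc ∈ Γ)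
    (h : ∀ y ∈ Γ, ∃ i : ℕ, y = diagSL c hc ^ i) : Γ = groupA n := by
  apply le_antisymm
  · intro y hy
    obtain ⟨i, rfl⟩ := h y hy
    have hd : diagSL c hc ∈ groupA n := diagSL_mem_generatedBy hc ⟨c, hprim.pow_eq_one, rfl⟩
    exact pow_mem hd i
  · refine (Subgroup.closure_le _).mpr ?_
    rintro y ⟨ε, hε, hy⟩
    obtain ⟨i, -, rfl⟩ := hprim.eq_pow_of_pow_eq_one hε
    have : y = diagSL c hc ^ i := by rw [diagSL_pow]; exact Subtype.ext hy
    rw [this]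
    exact pow_mem hmem i

theorem exists_diagonal_conjugate {g : SL2} (hg : IsOfFinOrder g) :
    ∃ (h : SL2) (c : ℂ) (hc : c ≠ 0), h⁻¹ * g * h = diagSL c hc := by
  by_cases h1 : g = 1
  · exact ⟨1, 1, one_ne_zero, by rw [h1]; apply sl_ext <;> simp [diagSL]⟩
  by_cases h2 : g = -1
  · exact ⟨1, -1, by norm_num, by rw [h2]; apply sl_ext <;> simp [diagSL]⟩
  obtain ⟨h, c, hc, -, hD⟩ := exists_diagonalization hg h1 h2
  exact ⟨h, c, hc, hD⟩

theorem exists_isPrimitiveRoot_succ {c : ℂ} {N : ℕ} (hN : N ≠ 0) (h : c ^ N = 1) : ∃ n,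
    IsPrimitiveRoot c (n + 1) := by
  have hpos : 0 < orderOf c := orderOf_pos_iff.mpr (isOfFinOrder_iff_pow_eq_one.mpr
    ⟨N, Nat.pos_of_ne_zero hN, h⟩)
  exact ⟨orderOf c - 1, by rw [Nat.sub_add_cancel hpos]; exact IsPrimitiveRoot.orderOf c⟩

theorem mul_pow_conjugate (h g : SL2) (i : ℕ) : (h⁻¹ * g * h) ^ i = h⁻¹ * g ^ i * h := by
  simpa using conj_pow (a := h⁻¹) (b := g) (i := i)

theorem HasGoodInvolutions.of_fixed_point [Finite Γ] {p : Point} (hp : ∀ g ∈ Γ, g • p = p) :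
    HasGoodInvolutions Γ := by
  obtain ⟨φ, hφ, -⟩ := exists_eigenvalue_hom Γ.subtype Γ.subtype_injective p fun g => hp g g.2
  have : IsCyclic Γ := isCyclic_of_injective_ringHom (f := φ) hφ
  obtain ⟨g, hg⟩ := IsCyclic.exists_monoid_generator (α := Γ)
  have hfin : IsOfFinOrder g.1 := Γ.subtype.isOfFinOrder (isOfFinOrder_of_finite g)
  obtain ⟨h, c, hc, hD⟩ := exists_diagonal_conjugate hfin
  have hpow := hD ▸ mul_pow_conjugate h g.1
  obtain ⟨n, hn⟩ := exists_isPrimitiveRoot_succ (c := c) hfin.orderOf_pos.ne' (by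
    have := hpow (orderOf g.1)
    rw [pow_orderOf_eq_one, mul_one, inv_mul_cancel, diagSL_pow] at this
    exact congrArg (fun y : SL2 => y.1 0 0) this)
  have hA : conjugate h Γ = groupA n := by
    refine eq_groupA hc hn ?_ fun y hy => ?_
    · rw [mem_conjugate, ← hD, ← mul_assoc, ← mul_assoc, mul_inv_cancel, one_mul,
        mul_inv_cancel_right]
      exact g.2
    · obtain ⟨i, hi⟩ := hg ⟨_, hy⟩
      have hi' : g.1 ^ i = h * y * h⁻¹ := congrArg Subtype.val hi
      refine ⟨i, ?_⟩
      rw [hpow, hi', ← mul_assoc, ← mul_assoc, inv_mul_cancel, one_mul, inv_mul_cancel_right]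
  refine .of_conjugate h ?_
  rw [hA]
  obtain ⟨x, y, z, hxyz⟩ := exists_isA n
  exact fun θ hθ => hxyz.hasGoodComponents hθ

/-- The matrix `!![0, i; i, 0]` in `SL₂(ℂ)`. -/
noncomputable def antidiagSL : SL2 :=
  ⟨!![0, I; I, 0], by simp [det_fin_two]⟩

theorem eq_groupD {c : ℂ} (hc : c ≠ 0) {k : ℕ} (hk : k ≠ 0) (hprim : IsPrimitiveRoot c (2 * k))
    (hD : diagSL c hc ∈ Γ) (hB : antidiagSL ∈ Γ)
    (h : ∀ y ∈ Γ, ∃ i : ℕ, y = diagSL c hc ^ i ∨ y = diagSL c hc ^ i * antidiagSL) :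
    Γ = groupD (k + 2) := by
  apply le_antisymm
  · have hd : diagSL c hc ∈ groupD (k + 2) :=
      diagSL_mem_generatedBy hc ⟨c, hprim.pow_eq_one, Or.inl rfl⟩
    have hb : antidiagSL ∈ groupD (k + 2) :=
      Subgroup.subset_closure ⟨1, one_pow _, Or.inr (by simp [antidiagSL])⟩
    intro y hy
    obtain ⟨i, rfl | rfl⟩ := h y hy
    · exact pow_mem hd i
    · exact mul_mem (pow_mem hd i) hb
  · refine (Subgroup.closure_le _).mpr ?_
    have : NeZero (2 * k) := ⟨by omega⟩
    rintro y ⟨ε, hε, hy⟩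
    rw [Nat.add_sub_cancel] at hε
    obtain ⟨i, -, rfl⟩ := hprim.eq_pow_of_pow_eq_one hε
    rcases hy with hy | hy
    · have : y = diagSL c hc ^ i := by rw [diagSL_pow]; exact Subtype.ext hy
      rw [this]
      exact pow_mem hD i
    · have : y = diagSL c hc ^ i * antidiagSL := by
        rw [diagSL_pow]
        apply Subtype.ext
        rw [hy, sl_mul]
        simp [diagSL, antidiagSL, mul_comm]
      rw [this]
      exact mul_mem (pow_mem hD i) hB

theorem exists_fixed_point_groupD_three : ∃ p : Point, ∀ g ∈ groupD 3, g • p = p := by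
  have hw : (![1, 1] : Fin 2 → ℂ) ≠ 0 := fun h => one_ne_zero (congrFun h 0)
  refine ⟨Projectivization.mk ℂ ![1, 1] hw, fun g hg => ?_⟩
  have hle : groupD 3 ≤ stabilizer SL2 (Projectivization.mk ℂ ![1, 1] hw) := by
    refine (Subgroup.closure_le _).mpr ?_
    rintro y ⟨ε, hε, hy⟩
    have e : y • Projectivization.mk ℂ ![1, 1] hw = Projectivization.mk ℂ ![1, 1] hw ↔
        ∃ a : ℂ, a • ![1, 1] = y.1.mulVec ![1, 1] := Projectivization.mk_eq_mk_iff' ℂ _ _ _ _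
    refine e.mpr ?_
    obtain rfl | rfl := sq_eq_one_cases (a := ε) (by simpa using hε) <;> rcases hy with hy | hy
    · exact ⟨1, by ext i; fin_cases i <;> simp [hy, mulVec, dotProduct]⟩
    · exact ⟨I, by ext i; fin_cases i <;> simp [hy, mulVec, dotProduct]⟩
    · exact ⟨-1, by ext i; fin_cases i <;> simp [hy, mulVec, dotProduct]⟩
    · exact ⟨-I, by ext i; fin_cases i <;> simp [hy, mulVec, dotProduct]⟩
  exact hle hg

theorem wronskian_mulVec (g : SL2) (P Q : Fin 2 → ℂ) :
    g.1.mulVec P 0 * g.1.mulVec Q 1 - g.1.mulVec P 1 * g.1.mulVec Q 0 = P 0 * Q 1 - P 1 * Q 0 := by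
  have hd := g.2
  rw [det_fin_two] at hd
  simp only [mulVec, dotProduct, Fin.sum_univ_two]
  linear_combination (P 0 * Q 1 - P 1 * Q 0) * hd

theorem conjugate_eq_of_frame {P Q : Fin 2 → ℂ} {h g D : SL2} (hh : h.1 = !![P 0, Q 0; P 1, Q 1])
    (hP : g.1.mulVec P = D.1 0 0 • P + D.1 1 0 • Q) (hQ : g.1.mulVec Q = D.1 0 1 • P + D.1 1 1 • Q)
    : h⁻¹ * g * h = D := by
  rw [mul_assoc, inv_mul_eq_iff_eq_mul]
  apply Subtype.ext
  rw [sl_mul, sl_mul, hh]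
  have p0 := congrFun hP 0
  have p1 := congrFun hP 1
  have q0 := congrFun hQ 0
  have q1 := congrFun hQ 1
  simp only [mulVec, dotProduct, Fin.sum_univ_two, Pi.add_apply, Pi.smul_apply, smul_eq_mul]
    at p0 p1 q0 q1
  ext i j
  fin_cases i <;> fin_cases j <;> simp [Matrix.mul_apply, Fin.sum_univ_two]
  · linear_combination p0
  · linear_combination q0
  · linear_combination p1
  · linear_combination q1

/-- A basis of `ℂ²` over two points that are interchanged by `g`. -/
theorem exists_frame {p q : Point} (hpq : p ≠ q) {g : SL2} (hp : g • p = q) (hq : g • q = p) :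
    ∃ r s : ℂ, ∃ h : SL2, h.1 = !![(r • p.rep) 0, (s • q.rep) 0; (r • p.rep) 1, (s • q.rep) 1] ∧
    h⁻¹ * g * h = antidiagSL := by
  obtain ⟨c, hc, hgp⟩ := exists_rep_smul g p
  obtain ⟨d, hd, hgq⟩ := exists_rep_smul g q
  rw [hp] at hgp
  rw [hq] at hgq
  have hW : p.rep 0 * q.rep 1 - p.rep 1 * q.rep 0 ≠ 0 := fun h0 => by
    refine hpq (eval_pointForm_eq_zero_iff.mp ?_)
    rw [pointForm, eval_linForm]
    linear_combination h0
  obtain ⟨r, hr⟩ := exists_pow_nat_eq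
    (I * c / (p.rep 0 * q.rep 1 - p.rep 1 * q.rep 0)) two_pos
  rw [eq_div_iff hW] at hr
  have hdet : (r • p.rep) 0 * ((-I * r * c⁻¹) • q.rep) 1 -
      (r • p.rep) 1 * ((-I * r * c⁻¹) • q.rep) 0 = 1 := by
    simp only [Pi.smul_apply, smul_eq_mul]
    have hcc := mul_inv_cancel₀ hc
    linear_combination (-I * c⁻¹) * hr - I ^ 2 * hcc - I_sq
  have hP : g.1.mulVec (r • p.rep) = I • ((-I * r * c⁻¹) • q.rep) := by
    rw [hgp, Matrix.mulVec_smul, smul_smul, smul_smul]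
    congr 1
    linear_combination r * c⁻¹ * c * I_sq - r * mul_inv_cancel₀ hc
  obtain ⟨e, hQ⟩ : ∃ e : ℂ, g.1.mulVec ((-I * r * c⁻¹) • q.rep) = e • (r • p.rep) := by
    refine ⟨-I * c⁻¹ * d⁻¹, ?_⟩
    rw [hgq, Matrix.mulVec_smul, smul_smul, smul_smul]
    congr 1
    linear_combination I * r * c⁻¹ * mul_inv_cancel₀ hd
  have he : e = I := by
    have h1 := wronskian_mulVec g (r • p.rep) ((-I * r * c⁻¹) • q.rep)
    rw [hdet, hP, hQ] at h1
    generalize r • p.rep = P at hdet h1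
    generalize (-I * r * c⁻¹) • q.rep = Q at hdet h1
    simp only [Pi.smul_apply, smul_eq_mul] at h1
    linear_combination I * h1 + I ^ 2 * e * hdet + e * I_sq
  refine ⟨r, -I * r * c⁻¹, ⟨_, (det_fin_two_of _ _ _ _).trans ?_⟩, rfl,
    conjugate_eq_of_frame rfl ?_ ?_⟩
  · linear_combination hdet
  · rw [hP]
    simp [antidiagSL]
  · rw [hQ, he]
    simp [antidiagSL]

theorem diag_of_frame {p q : Point} {r s : ℂ} {h t : SL2}
    (hh : h.1 = !![(r • p.rep) 0, (s • q.rep) 0; (r • p.rep) 1, (s • q.rep) 1]) {a : ℂ}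
    (hp : t.1.mulVec p.rep = a • p.rep) (hq : t • q = q) : ∃ ha : a ≠ 0,
    h⁻¹ * t * h = diagSL a ha := by
  obtain ⟨b, hb⟩ := (smul_eq_iff_exists t q).mp hq
  have hP : t.1.mulVec (r • p.rep) = a • (r • p.rep) := by rw [Matrix.mulVec_smul, hp, smul_comm]
  have hQ : t.1.mulVec (s • q.rep) = b • (s • q.rep) := by rw [Matrix.mulVec_smul, hb, smul_comm]
  have hdet := h.2
  rw [hh, det_fin_two_of] at hdet
  have hab : a * b = 1 := by
    have h1 := wronskian_mulVec t (r • p.rep) (s • q.rep)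
    rw [hP, hQ] at h1
    simp only [Pi.smul_apply, smul_eq_mul] at h1 hdet
    linear_combination h1 + (1 - a * b) * hdet
  have ha : a ≠ 0 := left_ne_zero_of_mul_eq_one hab
  refine ⟨ha, conjugate_eq_of_frame hh ?_ ?_⟩
  · rw [hP]
    simp [diagSL]
  · rw [hQ, eq_inv_of_mul_eq_one_right hab]
    simp [diagSL]

theorem HasGoodInvolutions.of_stable_pair [Finite Γ] {p q : Point} (hpq : p ≠ q)
    (hst : ∀ g ∈ Γ, (g • p = p ∧ g • q = q) ∨ (g • p = q ∧ g • q = p)) : HasGoodInvolutions Γ := by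
  by_cases hfix : ∀ g ∈ Γ, g • p = p
  · exact .of_fixed_point hfix
  push Not at hfix
  obtain ⟨g, hg, hgp⟩ := hfix
  obtain ⟨hgp, hgq⟩ := (hst g hg).resolve_left fun h => hgp h.1
  obtain ⟨r, s, h, hh, hB⟩ := exists_frame hpq hgp hgq
  have hT : ∀ t : ↥(Γ ⊓ stabilizer SL2 p), t.1 ∈ Γ ∧ t.1 • p = p := fun t => t.2
  have : Finite ↥(Γ ⊓ stabilizer SL2 p) :=
    Finite.of_injective _ (Subgroup.inclusion_injective (inf_le_left (a := Γ)))
  obtain ⟨φ, hφ, hφp⟩ := exists_eigenvalue_hom (Γ ⊓ stabilizer SL2 p).subtype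
    (Subgroup.subtype_injective _) p fun t => (hT t).2
  have := isCyclic_of_injective_ringHom (f := φ) hφ
  obtain ⟨t, ht⟩ := IsCyclic.exists_monoid_generator (α := ↥(Γ ⊓ stabilizer SL2 p))
  have htq : t.1 • q = q := ((hst _ (hT t).1).resolve_right fun h => hpq ((hT t).2.symm.trans h.1)).2
  obtain ⟨hc, hD⟩ := diag_of_frame hh (hφp t) htq
  have hpow := hD ▸ mul_pow_conjugate h t.1
  obtain ⟨n, hn⟩ := exists_isPrimitiveRoot_succ (c := φ t) (orderOf_pos t).ne' (by
    rw [← map_pow, pow_orderOf_eq_one, map_one])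
  have hgen : ∀ y ∈ Γ, y • p = p → ∃ i : ℕ, h⁻¹ * y * h = diagSL (φ t) hc ^ i := fun y hy hyp => by
    obtain ⟨i, hi⟩ := ht ⟨y, hy, hyp⟩
    have hi' : t.1 ^ i = y := congrArg Subtype.val hi
    exact ⟨i, by rw [hpow, hi']⟩
  obtain ⟨k, hk, hprim⟩ : ∃ k, k ≠ 0 ∧ IsPrimitiveRoot (φ t) (2 * k) := by
    have heven : Even (n + 1) := by
      obtain ⟨i, hi⟩ := hgen (g * g) (mul_mem hg hg) (by rw [mul_smul, hgp, hgq])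
      have e1 : h⁻¹ * (g * g) * h = antidiagSL * antidiagSL := by
        rw [← hB]
        group
      rw [e1, diagSL_pow] at hi
      have e2 : φ t ^ i = -1 := by
        have := congrArg (fun y : SL2 => y.1 0 0) hi
        rw [sl_mul] at this
        simpa [antidiagSL, diagSL] using this.symm
      by_contra hodd
      have : ((-1 : ℂ)) ^ (n + 1) = 1 := by
        rw [← e2, ← pow_mul, mul_comm, pow_mul, hn.pow_eq_one, one_pow]
      rw [(Nat.not_even_iff_odd.mp hodd).neg_one_pow] at this
      norm_num at this
    obtain ⟨k, hk⟩ := heven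
    exact ⟨k, by omega, by rwa [two_mul, ← hk]⟩
  have hmem : ∀ {y z : SL2}, y ∈ Γ → h⁻¹ * y * h = z → z ∈ conjugate h Γ := by
    rintro y z hy rfl
    rw [mem_conjugate]
    convert hy using 1
    group
  have hΓ : conjugate h Γ = groupD (k + 2) := by
    refine eq_groupD hc hk hprim (hmem (hT t).1 hD) (hmem hg hB) fun y hy => ?_
    rw [mem_conjugate] at hy
    rcases hst _ hy with ⟨h1, -⟩ | ⟨h1, -⟩
    · obtain ⟨i, hi⟩ := hgen _ hy h1
      refine ⟨i, Or.inl ?_⟩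
      rw [← hi]
      group
    · obtain ⟨i, hi⟩ := hgen (h * y * h⁻¹ * g⁻¹) (mul_mem hy (inv_mem hg)) (by
        rw [mul_smul, show g⁻¹ • p = q by rw [inv_smul_eq_iff, hgq],
          ((hst _ hy).resolve_left fun h2 => hpq (h2.1.symm.trans h1)).2])
      refine ⟨i, Or.inr ?_⟩
      rw [← hi, ← hB]
      group
  refine .of_conjugate h ?_
  rcases Nat.lt_or_ge k 2 with hk2 | hk2
  · obtain rfl : k = 1 := by omega
    obtain ⟨p', hp'⟩ := exists_fixed_point_groupD_three
    exact .of_fixed_point (hΓ ▸ hp')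
  · rw [hΓ]
    obtain ⟨x, s, t, hxst⟩ := exists_isD hk
    exact fun θ hθ => hxst.hasGoodComponents hk2 hθ

theorem hasGoodInvolutions_of_finite [Finite Γ] : HasGoodInvolutions Γ := by
  rcases finite_subgroup_cases Γ with ⟨p, hp⟩ | ⟨p, q, hpq, h⟩ | ⟨⟨D⟩⟩ | ⟨⟨D⟩⟩ | ⟨⟨D⟩⟩
  · exact .of_fixed_point hp
  · exact .of_stable_pair hpq h
  · obtain ⟨x, y, z, h⟩ := D.exists_isE6
    exact fun θ hθ => h.fixed hθ
  · obtain ⟨x, y, z, h⟩ := D.exists_isE7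
    exact fun θ hθ => (h.fixed hθ).2.2.2
  · obtain ⟨x, y, z, h⟩ := D.exists_isE8
    exact fun θ hθ => (h.fixed hθ).2.2.2

end Kleinian

set_option maxHeartbeats 1000000 in
theorem proposition0p2 :
    -- every quotient of `ℂ²` by a finite subgroup of `SL₂(ℂ)`, every anti-Poisson involution
    (∀ Γ : Subgroup (Matrix.SpecialLinearGroup (Fin 2) ℂ), Finite Γ →
      ∀ θ : invariants Γ ≃ₐ[ℂ] invariants Γ, IsAntiPoissonInvolution θ →
        AlgebraicGeometry.IsReduced (fixedLocus θ) ∧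
        (¬ IsSinglePoint θ → ∀ Z ∈ irreducibleComponents (fixedLocus θ),
          IsAffineLine (ClosedRing θ Z) ∨ IsCuspCurve (ClosedRing θ Z))) ∧
    -- type `A n`, `n` odd
    (∀ n : ℕ, Odd n →
      ∃ x y z : invariants (groupA n),
        (x : Poly) = u ^ (n + 1) ∧
        (y : Poly) = v ^ (n + 1) ∧
        (z : Poly) = u * v ∧
        Generate x y z ∧
      ∃ θ₁ θ₂ θ₃ : invariants (groupA n) ≃ₐ[ℂ] invariants (groupA n),
        (∀ θ : invariants (groupA n) ≃ₐ[ℂ] invariants (groupA n), IsAntiPoissonInvolution θ →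
          AreConjugate θ θ₁ ∨ AreConjugate θ θ₂ ∨ AreConjugate θ θ₃) ∧
        (IsAntiPoissonInvolution θ₁ ∧ θ₁ x = y ∧ θ₁ y = x ∧ θ₁ z = z ∧
          fixedIdeal θ₁ = Ideal.span {x - y} ∧
          IsPlaneCurve θ₁ x z (fun s t => s ^ 2 - t ^ (n + 1)) ∧
          IsReducedUnion θ₁ 2 0) ∧
        (IsAntiPoissonInvolution θ₂ ∧ θ₂ x = x ∧ θ₂ y = y ∧ θ₂ z = -z ∧
          fixedIdeal θ₂ = Ideal.span {z} ∧
          IsPlaneCurve θ₂ x y (fun s t => s * t) ∧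
          IsReducedUnion θ₂ 2 0) ∧
        (IsAntiPoissonInvolution θ₃ ∧ θ₃ x = -x ∧ θ₃ y = -y ∧ θ₃ z = -z ∧
          fixedIdeal θ₃ = Ideal.span {x, y, z} ∧
          IsReducedPoint θ₃)) ∧
    -- type `A n`, `n` even
    (∀ n : ℕ, Even n → 2 ≤ n →
      ∃ x y z : invariants (groupA n),
        (x : Poly) = u ^ (n + 1) ∧
        (y : Poly) = v ^ (n + 1) ∧
        (z : Poly) = u * v ∧
        Generate x y z ∧
      ∃ θ₁ θ₂ : invariants (groupA n) ≃ₐ[ℂ] invariants (groupA n),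
        (∀ θ : invariants (groupA n) ≃ₐ[ℂ] invariants (groupA n), IsAntiPoissonInvolution θ →
          AreConjugate θ θ₁ ∨ AreConjugate θ θ₂) ∧
        (IsAntiPoissonInvolution θ₁ ∧ θ₁ x = y ∧ θ₁ y = x ∧ θ₁ z = z ∧
          fixedIdeal θ₁ = Ideal.span {x - y} ∧
          IsPlaneCurve θ₁ x z (fun s t => s ^ 2 - t ^ (n + 1)) ∧
          IsReducedUnion θ₁ 0 1) ∧
        (IsAntiPoissonInvolution θ₂ ∧ θ₂ x = -x ∧ θ₂ y = y ∧ θ₂ z = -z ∧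
          fixedIdeal θ₂ = Ideal.span {x, z} ∧
          IsLineWithCoordinate θ₂ y ∧
          IsReducedUnion θ₂ 1 0)) ∧
    -- type `D n`, `n` even
    (∀ n : ℕ, Even n → 4 ≤ n →
      ∃ x y z : invariants (groupD n),
        (x : Poly) = u ^ 2 * v ^ 2 ∧
        (y : Poly) = (-1 / 4 : ℂ) • (u ^ (2 * n - 4) - 2 * u ^ (n - 2) * v ^ (n - 2) + v ^ (2 * n - 4)) ∧
        (z : Poly) = (1 / 4 : ℂ) • (u * v * (u ^ (2 * n - 4) - v ^ (2 * n - 4))) ∧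
        Generate x y z ∧
      ∃ θ₁ θ₂ : invariants (groupD n) ≃ₐ[ℂ] invariants (groupD n),
        (∀ θ : invariants (groupD n) ≃ₐ[ℂ] invariants (groupD n), IsAntiPoissonInvolution θ →
          AreConjugate θ θ₁ ∨ AreConjugate θ θ₂) ∧
        (IsAntiPoissonInvolution θ₁ ∧ θ₁ x = x ∧ θ₁ y = y ∧ θ₁ z = -z ∧
          fixedIdeal θ₁ = Ideal.span {z} ∧
          IsPlaneCurve θ₁ x y (fun s t => s * t * (t - s ^ ((n - 2) / 2))) ∧
          IsReducedUnion θ₁ 3 0) ∧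
        (IsAntiPoissonInvolution θ₂ ∧ θ₂ x = x ∧ θ₂ y = x ^ ((n - 2) / 2) - y ∧ θ₂ z = z ∧
          fixedIdeal θ₂ = Ideal.span {2 * y - x ^ ((n - 2) / 2)} ∧
          IsPlaneCurve θ₂ x z (fun s t => s ^ (n - 1) + 4 * t ^ 2) ∧
          IsReducedUnion θ₂ 0 1)) ∧
    -- type `D n`, `n` odd
    (∀ n : ℕ, Odd n → 5 ≤ n →
      ∃ x y z : invariants (groupD n),
        (x : Poly) = u ^ 2 * v ^ 2 ∧
        (y : Poly) = (1 / 4 : ℂ) • (u ^ (2 * n - 4) - v ^ (2 * n - 4)) ∧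
        (z : Poly) = (-1 / 4 : ℂ) • (u * v *
          (u ^ (2 * n - 4) - 2 * u ^ (n - 2) * v ^ (n - 2) + v ^ (2 * n - 4))) ∧
        Generate x y z ∧
      ∃ θ₁ θ₂ : invariants (groupD n) ≃ₐ[ℂ] invariants (groupD n),
        (∀ θ : invariants (groupD n) ≃ₐ[ℂ] invariants (groupD n), IsAntiPoissonInvolution θ →
          AreConjugate θ θ₁ ∨ AreConjugate θ θ₂) ∧
        (IsAntiPoissonInvolution θ₁ ∧ θ₁ x = x ∧ θ₁ y = -y ∧ θ₁ z = z ∧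
          fixedIdeal θ₁ = Ideal.span {y} ∧
          IsPlaneCurve θ₁ x z (fun s t => t * (t - s ^ ((n - 1) / 2))) ∧
          IsReducedUnion θ₁ 2 0) ∧
        (IsAntiPoissonInvolution θ₂ ∧ θ₂ x = x ∧ θ₂ y = y ∧ θ₂ z = x ^ ((n - 1) / 2) - z ∧
          fixedIdeal θ₂ = Ideal.span {2 * z - x ^ ((n - 1) / 2)} ∧
          IsPlaneCurve θ₂ x y (fun s t => s * (4 * t ^ 2 + s ^ (n - 2))) ∧
          IsReducedUnion θ₂ 1 1)) ∧
    -- type `E 6`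
    (∃ x y z : invariants groupE6,
        (x : Poly) = 2 * (u * v * (u ^ 4 - v ^ 4)) ∧
        (y : Poly) = (1 / 3 : ℂ) • (u ^ 8 + 14 * u ^ 4 * v ^ 4 + v ^ 8) ∧
        (z : Poly) = (Complex.I * (Real.sqrt 3 : ℝ) / 9) •
            (u ^ 12 - 33 * u ^ 8 * v ^ 4 - 33 * u ^ 4 * v ^ 8 + v ^ 12) -
          2 * (u * v * (u ^ 4 - v ^ 4)) ^ 2 ∧
        Generate x y z ∧
      ∃ θ₁ θ₂ : invariants groupE6 ≃ₐ[ℂ] invariants groupE6,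
        (∀ θ : invariants groupE6 ≃ₐ[ℂ] invariants groupE6, IsAntiPoissonInvolution θ →
          AreConjugate θ θ₁ ∨ AreConjugate θ θ₂) ∧
        (IsAntiPoissonInvolution θ₁ ∧ θ₁ x = -x ∧ θ₁ y = y ∧ θ₁ z = z ∧
          fixedIdeal θ₁ = Ideal.span {x} ∧
          IsPlaneCurve θ₁ y z (fun s t => t ^ 2 + s ^ 3) ∧
          IsReducedUnion θ₁ 0 1) ∧
        (IsAntiPoissonInvolution θ₂ ∧ θ₂ x = x ∧ θ₂ y = y ∧ θ₂ z = -z - x ^ 2 ∧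
          fixedIdeal θ₂ = Ideal.span {2 * z + x ^ 2} ∧
          IsPlaneCurve θ₂ x y (fun s t => s ^ 4 - 4 * t ^ 3) ∧
          IsReducedUnion θ₂ 0 1)) ∧
    -- type `E 7`
    (∃ x y z : invariants groupE7,
        (x : Poly) = (-1 / 108 : ℂ) • (u ^ 8 + 14 * u ^ 4 * v ^ 4 + v ^ 8) ∧
        (y : Poly) = (1 / 108 : ℂ) • (u ^ 5 * v - u * v ^ 5) ^ 2 ∧
        (z : Poly) = (1 / 108 ^ 2 : ℂ) • (u * v * (u ^ 8 - v ^ 8) * (u ^ 8 - 34 * u ^ 4 * v ^ 4 + v ^ 8)) ∧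
        Generate x y z ∧
      ∃ θ₁ : invariants groupE7 ≃ₐ[ℂ] invariants groupE7,
        (∀ θ : invariants groupE7 ≃ₐ[ℂ] invariants groupE7, IsAntiPoissonInvolution θ →
          AreConjugate θ θ₁) ∧
        (IsAntiPoissonInvolution θ₁ ∧ θ₁ x = x ∧ θ₁ y = y ∧ θ₁ z = -z ∧
          fixedIdeal θ₁ = Ideal.span {z} ∧
          IsPlaneCurve θ₁ x y (fun s t => t * (s ^ 3 + t ^ 2)) ∧
          IsReducedUnion θ₁ 1 1)) ∧
    -- type `E 8`
    (∃ x y z : invariants groupE8,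
        (x : Poly) = (-1 / 1728 : ℂ) • (u * v * (u ^ 10 + 11 * u ^ 5 * v ^ 5 - v ^ 10)) ∧
        (y : Poly) = (-1 / 1728 ^ 2 : ℂ) • (u ^ 20 + v ^ 20 - 228 * (u ^ 15 * v ^ 5 - u ^ 5 * v ^ 15) +
          494 * u ^ 10 * v ^ 10) ∧
        (z : Poly) = (1 / 1728 ^ 3 : ℂ) • (u ^ 30 + v ^ 30 + 522 * (u ^ 25 * v ^ 5 - u ^ 5 * v ^ 25) -
          10005 * (u ^ 20 * v ^ 10 + u ^ 10 * v ^ 20)) ∧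
        Generate x y z ∧
      ∃ θ₁ : invariants groupE8 ≃ₐ[ℂ] invariants groupE8,
        (∀ θ : invariants groupE8 ≃ₐ[ℂ] invariants groupE8, IsAntiPoissonInvolution θ →
          AreConjugate θ θ₁) ∧
        (IsAntiPoissonInvolution θ₁ ∧ θ₁ x = x ∧ θ₁ y = y ∧ θ₁ z = -z ∧
          fixedIdeal θ₁ = Ideal.span {z} ∧
          IsPlaneCurve θ₁ x y (fun s t => s ^ 5 + t ^ 3) ∧
          IsReducedUnion θ₁ 0 1)) := by
  refine ⟨fun Γ hΓ θ hθ => (hasGoodInvolutions_of_finite θ hθ).components, ?_, ?_, ?_, ?_, ?_, ?_, ?_⟩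
  · intro n hn
    obtain ⟨x, y, z, h⟩ := exists_isA n
    obtain ⟨θ₁, h1, x1, y1, z1⟩ := h.exists_swap
    obtain ⟨θ₂, h2, x2, y2, z2⟩ := h.exists_neg_of_odd hn
    obtain ⟨θ₃, h3, x3, y3, z3⟩ := h.exists_point_of_odd hn
    obtain ⟨j1, p1⟩ := h.fixed_swap x1 y1 z1
    obtain ⟨j2, p2⟩ := h.fixed_neg x2 y2 z2
    obtain ⟨j3, p3⟩ := h.fixed_point x3 y3 z3
    refine ⟨x, y, z, h.hx, h.hy, h.hz, h.gen, θ₁, θ₂, θ₃, fun θ hθ => ?_,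
      ⟨h1, x1, y1, z1, j1, p1, (h.swap_lines hn h1.graded p1).1⟩,
      ⟨h2, x2, y2, z2, j2, p2, (h.neg_lines h2.graded p2).1⟩, ⟨h3, x3, y3, z3, j3, p3⟩⟩
    obtain ⟨η, hη, hconj, ⟨-, hz⟩ | hz⟩ := h.exists_conjugate hθ
    · exact Or.inl (hconj.trans (h.areConjugate_of_apply_z hη h1 hz z1))
    · rcases h.apply_eq_of_odd hn hη hz with ⟨hx, hy⟩ | ⟨hx, hy⟩
      · exact Or.inr (Or.inl (hconj.trans (h.gen.areConjugate_of_eq (hx.trans x2.symm)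
          (hy.trans y2.symm) (hz.trans z2.symm))))
      · exact Or.inr (Or.inr (hconj.trans (h.gen.areConjugate_of_eq (hx.trans x3.symm)
          (hy.trans y3.symm) (hz.trans z3.symm))))
  · intro n hn hn2
    obtain ⟨x, y, z, h⟩ := exists_isA n
    obtain ⟨θ₁, h1, x1, y1, z1⟩ := h.exists_swap
    obtain ⟨θ₂, h2, x2, y2, z2⟩ := h.exists_line_of_even hn
    obtain ⟨j1, p1⟩ := h.fixed_swap x1 y1 z1
    obtain ⟨j2, p2⟩ := h.fixed_line x2 y2 z2
    refine ⟨x, y, z, h.hx, h.hy, h.hz, h.gen, θ₁, θ₂, fun θ hθ => ?_,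
      ⟨h1, x1, y1, z1, j1, p1, (h.swap_cusp hn hn2 h1.graded p1).1⟩,
      ⟨h2, x2, y2, z2, j2, p2, (isReducedUnion_of_isLineWithCoordinate p2).1⟩⟩
    obtain ⟨η, hη, hconj, ⟨-, hz⟩ | hz⟩ := h.exists_conjugate hθ
    · exact Or.inl (hconj.trans (h.areConjugate_of_apply_z hη h1 hz z1))
    · rcases h.apply_eq_of_even hn hη hz with ⟨hx, hy⟩ | ⟨hx, hy⟩
      · exact Or.inr (hconj.trans (h.areConjugate_of_even hn hx hy hz x2 y2 z2))
      · exact Or.inr (hconj.trans (h.gen.areConjugate_of_eq (hx.trans x2.symm)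
          (hy.trans y2.symm) (hz.trans z2.symm)))
  · intro n hn hn4
    obtain ⟨m, hm, rfl⟩ : ∃ m, m ≠ 0 ∧ n = 2 * m + 2 := by
      obtain ⟨m, hm⟩ := hn
      exact ⟨m - 1, by omega, by omega⟩
    rw [show 2 * (2 * m + 2) - 4 = 2 * (2 * m) by omega, show (2 * m + 2 - 2) / 2 = m by omega,
      show 2 * m + 2 - 2 = 2 * m by omega, show 2 * m + 2 - 1 = 2 * m + 1 by omega]
    obtain ⟨x, s, t, h⟩ := exists_isD (k := 2 * m) (by omega)
    obtain ⟨θ₁, θ₂, hcl, ⟨h1, x1, s1, t1⟩, ⟨h2, x2, s2, t2⟩⟩ := h.exists_explicit (by omega)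
    obtain ⟨p1, r1, -⟩ := h.even_branch hm h1.graded x1 s1 t1
    obtain ⟨p2, r2, -⟩ := h.even_flip hm h2.graded x2 s2 t2
    refine ⟨x, (-1 / 4 : ℂ) • s + (1 / 2 : ℂ) • x ^ m, (1 / 4 : ℂ) • t, ?_, ?_, ?_, ?_, θ₁, θ₂, hcl,
      ⟨h1, x1, ?_, ?_, ?_, p1, r1⟩, ⟨h2, x2, ?_, ?_, ?_, p2, r2⟩⟩
    · rw [h.hx, mul_pow]
    · rw [coe_combination, h.hs, h.hx, smul_eq_C_mul, IsD.C_half, (even_two_mul m).neg_one_pow]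
      ring
    · rw [coe_smul_eq, h.ht, smul_eq_C_mul, (even_two_mul m).neg_one_pow, one_mul]
    · refine h.gen.of_mem (subset_adjoin (by simp)) ?_ ?_
      · have hx : x ∈ adjoin ℂ {x, (-1 / 4 : ℂ) • s + (1 / 2 : ℂ) • x ^ m, (1 / 4 : ℂ) • t} :=
          subset_adjoin (by simp)
        have hy : (-1 / 4 : ℂ) • s + (1 / 2 : ℂ) • x ^ m ∈
            adjoin ℂ {x, (-1 / 4 : ℂ) • s + (1 / 2 : ℂ) • x ^ m, (1 / 4 : ℂ) • t} :=
          subset_adjoin (by simp)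
        convert add_mem (Subalgebra.smul_mem _ hy (-4)) (Subalgebra.smul_mem _ (pow_mem hx m) 2)
          using 1
        module
      · exact mem_of_eq_smul (r := 1 / 4) rfl
          (smul_ne_zero (by norm_num) (h.t_ne_zero (by omega)))
          (subset_adjoin (by simp))
    · rw [map_add, map_smul, map_smul, map_pow, x1, s1]
    · rw [map_smul, t1, smul_neg]
    · rw [span_smul_eq (by norm_num), (h.fixed_branch (by omega) x1 s1 t1).1]
    · rw [map_add, map_smul, map_smul, map_pow, x2, s2]
      module
    · rw [map_smul, t2]
    · rw [(h.fixed_flip (by omega) x2 s2 t2).1, ← span_smul_eq (c := -1 / 2) (by norm_num) s]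
      congr 2
      rw [two_mul (_ + _)]
      module
  · intro n hn hn5
    obtain ⟨m, hm, rfl⟩ : ∃ m, m ≠ 0 ∧ n = 2 * m + 1 + 2 := by
      obtain ⟨m, hm⟩ := hn
      exact ⟨m - 1, by omega, by omega⟩
    rw [show 2 * (2 * m + 1 + 2) - 4 = 2 * (2 * m + 1) by omega,
      show (2 * m + 1 + 2 - 1) / 2 = m + 1 by omega, show 2 * m + 1 + 2 - 2 = 2 * m + 1 by omega]
    obtain ⟨x, s, t, h⟩ := exists_isD (k := 2 * m + 1) (by omega)
    obtain ⟨θ₁, θ₂, hcl, ⟨h1, x1, s1, t1⟩, ⟨h2, x2, s2, t2⟩⟩ := h.exists_explicit (by omega)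
    obtain ⟨p1, r1, -⟩ := h.odd_branch hm h1.graded x1 s1 t1
    obtain ⟨p2, r2, -⟩ := h.odd_flip h2.graded x2 s2 t2
    refine ⟨x, (1 / 4 : ℂ) • s, (-1 / 4 : ℂ) • t + (1 / 2 : ℂ) • x ^ (m + 1), ?_, ?_, ?_, ?_, θ₂, θ₁,
      fun θ hθ => (hcl θ hθ).symm, ⟨h2, x2, ?_, ?_, ?_, p2, r2⟩, ⟨h1, x1, ?_, ?_, ?_, p1, r1⟩⟩
    · rw [h.hx, mul_pow]
    · rw [coe_smul_eq, h.hs, smul_eq_C_mul, (odd_two_mul_add_one m).neg_one_pow, neg_one_mul,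
        sub_eq_add_neg]
    · rw [coe_combination, h.ht, h.hx, smul_eq_C_mul, IsD.C_half, (odd_two_mul_add_one m).neg_one_pow]
      ring
    · refine h.gen.of_mem (subset_adjoin (by simp)) ?_ ?_
      · exact mem_of_eq_smul (r := 1 / 4) rfl
          (smul_ne_zero (by norm_num) (h.s_ne_zero (by omega)))
          (subset_adjoin (by simp))
      · have hx : x ∈ adjoin ℂ
            {x, (1 / 4 : ℂ) • s, (-1 / 4 : ℂ) • t + (1 / 2 : ℂ) • x ^ (m + 1)} :=
          subset_adjoin (by simp)
        have hz : (-1 / 4 : ℂ) • t + (1 / 2 : ℂ) • x ^ (m + 1) ∈ adjoin ℂ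
            {x, (1 / 4 : ℂ) • s, (-1 / 4 : ℂ) • t + (1 / 2 : ℂ) • x ^ (m + 1)} :=
          subset_adjoin (by simp)
        convert add_mem (Subalgebra.smul_mem _ hz (-4))
          (Subalgebra.smul_mem _ (pow_mem hx (m + 1)) 2) using 1
        module
    · rw [map_smul, s2, smul_neg]
    · rw [map_add, map_smul, map_smul, map_pow, x2, t2]
    · rw [span_smul_eq (by norm_num), (h.fixed_flip (by omega) x2 s2 t2).1]
    · rw [map_smul, s1]
    · rw [map_add, map_smul, map_smul, map_pow, x1, t1]
      module
    · rw [(h.fixed_branch (by omega) x1 s1 t1).1, ← span_smul_eq (c := -1 / 2) (by norm_num) t]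
      congr 2
      rw [two_mul (_ + _)]
      module
  · obtain ⟨X, Y, Z, hE⟩ := exists_isE6_groupE6
    set κ : ℂ := I * (Real.sqrt 3 : ℝ) / 9 with hκ
    have hκ2 : κ ^ 2 = -1 / 27 := by
      have h3 : ((Real.sqrt 3 : ℝ) : ℂ) ^ 2 = 3 := by
        rw [← Complex.ofReal_pow, Real.sq_sqrt (by norm_num)]
        norm_num
      rw [hκ, div_pow, mul_pow, h3, I_sq]
      norm_num
    let x : invariants groupE6 := ⟨2 * formT, two_mul_mem formT_mem_E6⟩
    let y : invariants groupE6 := ⟨(1 / 3 : ℂ) • formW, Subalgebra.smul_mem _ formW_mem_E6 _⟩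
    let z : invariants groupE6 := ⟨κ • formK - 2 * formT ^ 2,
      sub_mem (Subalgebra.smul_mem _ formK_mem_E6 _) (two_mul_mem (pow_mem formT_mem_E6 2))⟩
    have cx : (x : Poly) = 2 * formT := rfl
    have cy : (y : Poly) = C (1 / 3) * formW := smul_eq_C_mul _ _
    have cz : (z : Poly) = C κ * formK - 2 * formT ^ 2 := by rw [← smul_eq_C_mul]
    have h3 : 3 * (C (1 / 3) : Poly) = 1 := by
      rw [← map_ofNat C 3, ← map_mul, ← map_one C]
      norm_num
    have hC : 27 * (C κ : Poly) ^ 2 = -1 := by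
      rw [← map_pow, hκ2, ← map_ofNat C 27, ← map_mul, ← map_one C, ← map_neg]
      norm_num
    have h := hE.explicit (x := x) (y := y) (z := z)
      (by
        rw [cx]
        have := (natCast_isHomogeneous 2).mul formT_isHomogeneous
        simpa using this)
      (cy ▸ formW_isHomogeneous.C_mul _)
      (by
        rw [cz]
        have := (natCast_isHomogeneous 2).mul (formT_isHomogeneous.pow 2)
        exact (formK_isHomogeneous.C_mul _).sub (by simpa using this))
      (coe_ne_zero_iff.mpr (mul_ne_zero two_ne_zero formT_ne_zero))
      (coe_ne_zero_iff.mpr (smul_ne_zero (by norm_num) formW_ne_zero))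
      (by
        intro c hc
        have h1 := congrArg (fun f : invariants groupE6 => eval ![1, 0] (f : Poly)) hc
        have h2 : ((c • x ^ 2 : invariants groupE6) : Poly) = C c * (2 * formT) ^ 2 :=
          smul_eq_C_mul _ _
        simp only [h2, cz] at h1
        simp [formT, formK, eval_u, eval_v] at h1
        rw [h1] at hκ2
        norm_num at hκ2)
      (by
        apply Subtype.ext
        change (z : Poly) ^ 2 + (z : Poly) * (x : Poly) ^ 2 + (y : Poly) ^ 3 = 0
        rw [cx, cy, cz]
        have e3 : (27 : Poly) ≠ 0 := by norm_num
        apply mul_left_cancel₀ e3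
        linear_combination formK ^ 2 * hC + formW_pow_three +
          formW ^ 3 * ((3 * C (1 / 3)) ^ 2 + 3 * C (1 / 3) + 1) * h3)
    have lx : ∀ g, linSubst g (x : Poly) = 2 * linSubst g formT := fun g => by
      rw [cx, map_mul, map_ofNat]
    have ly : ∀ g, linSubst g (y : Poly) = C (1 / 3) * linSubst g formW := fun g => by
      rw [cy, map_mul, algHom_C, algebraMap_eq]
    have lz : ∀ g, linSubst g (z : Poly) = C κ * linSubst g formK - 2 * linSubst g formT ^ 2 :=
      fun g => by rw [cz, map_sub, map_mul, map_mul, map_pow, algHom_C, algebraMap_eq, map_ofNat]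
    have sT : linSubst !![0, 1; 1, 0] formT = -formT := by
      simp only [formT, map_mul, map_sub, map_pow, linSubst_antidiag_u, linSubst_antidiag_v, map_one]
      ring
    have sW : linSubst !![0, 1; 1, 0] formW = formW := by
      simp only [formW, map_mul, map_add, map_pow, linSubst_antidiag_u, linSubst_antidiag_v,
        map_one, map_ofNat]
      ring
    have sK : linSubst !![0, 1; 1, 0] formK = formK := by
      simp only [formK, map_mul, map_add, map_sub, map_pow, linSubst_antidiag_u,
        linSubst_antidiag_v, map_one, map_ofNat]
      ring
    obtain ⟨θ₁, hθ₁, x₁, y₁, z₁⟩ := h.gen.exists_antiPoisson !![0, 1; 1, 0]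
      (by simp [det_fin_two]) (-x) y z
      (by
        change linSubst _ (x : Poly) = -(x : Poly)
        rw [lx, sT, cx, mul_neg])
      (by rw [ly, sW, cy]) (by rw [lz, sK, sT, neg_sq, cz])
      (by
        change linSubst _ (-(x : Poly)) = (x : Poly)
        rw [map_neg, lx, sT, cx, mul_neg, neg_neg])
      (by rw [ly, sW, cy]) (by rw [lz, sK, sT, neg_sq, cz])
    obtain ⟨ε, hε⟩ := exists_pow_nat_eq (-1 : ℂ) (n := 4) (by norm_num)
    have hεC : (C ε : Poly) ^ 4 = -1 := by rw [← map_pow, hε, map_neg, map_one]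
    have gT : linSubst !![ε, 0; 0, ε ^ 3] formT = formT := by
      simp only [formT, map_mul, map_sub, map_pow, linSubst_diag_u, linSubst_diag_v]
      linear_combination u * v * (u ^ 4 * C ε ^ 4 - u ^ 4 -
        v ^ 4 * (C ε ^ 12 - C ε ^ 8 + C ε ^ 4 - 1)) * hεC
    have gW : linSubst !![ε, 0; 0, ε ^ 3] formW = formW := by
      simp only [formW, map_mul, map_add, map_pow, linSubst_diag_u, linSubst_diag_v, map_ofNat]
      linear_combination (u ^ 8 * (C ε ^ 4 - 1) + 14 * u ^ 4 * v ^ 4 *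
        (C ε ^ 12 - C ε ^ 8 + C ε ^ 4 - 1) + v ^ 8 * (C ε ^ 20 - C ε ^ 16 + C ε ^ 12 - C ε ^ 8 +
          C ε ^ 4 - 1)) * hεC
    have gK : linSubst !![ε, 0; 0, ε ^ 3] formK = -formK := by
      simp only [formK, map_mul, map_add, map_sub, map_pow, linSubst_diag_u, linSubst_diag_v,
        map_ofNat]
      linear_combination (u ^ 12 * (C ε ^ 8 - C ε ^ 4 + 1) - 33 * u ^ 8 * v ^ 4 *
        (C ε ^ 16 - C ε ^ 12 + C ε ^ 8 - C ε ^ 4 + 1) - 33 * u ^ 4 * v ^ 8 *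
        (C ε ^ 24 - C ε ^ 20 + C ε ^ 16 - C ε ^ 12 + C ε ^ 8 - C ε ^ 4 + 1) + v ^ 12 *
        (C ε ^ 32 - C ε ^ 28 + C ε ^ 24 - C ε ^ 20 + C ε ^ 16 - C ε ^ 12 + C ε ^ 8 - C ε ^ 4 + 1))
        * hεC
    obtain ⟨θ₂, hθ₂, x₂, y₂, z₂⟩ := h.gen.exists_antiPoisson !![ε, 0; 0, ε ^ 3]
      (by rw [det_fin_two_of, mul_zero, sub_zero, ← hε]; ring) x y (-z - x ^ 2)
      (by rw [lx, gT, cx]) (by rw [ly, gW, cy])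
      (by
        change linSubst _ (z : Poly) = -(z : Poly) - (x : Poly) ^ 2
        rw [lz, gK, gT, cz, cx]
        ring)
      (by rw [lx, gT, cx]) (by rw [ly, gW, cy])
      (by
        change linSubst _ (-(z : Poly) - (x : Poly) ^ 2) = (z : Poly)
        rw [map_sub, map_neg, map_pow, lz, lx, gK, gT, cz]
        ring)
    obtain ⟨a1, a2, a3, -⟩ := h.fixed_one hθ₁.graded x₁ y₁ z₁
    obtain ⟨b1, b2, b3, -⟩ := h.fixed_two hθ₂.graded x₂ y₂ z₂
    refine ⟨x, y, z, rfl, rfl, rfl, h.gen, θ₁, θ₂, fun θ hθ => ?_,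
      ⟨hθ₁, x₁, y₁, z₁, a1, a2, a3⟩, ⟨hθ₂, x₂, y₂, z₂, b1, b2, b3⟩⟩
    rcases h.apply_eq hθ with ⟨hx, hy, hz⟩ | ⟨hx, hy, hz⟩
    · exact Or.inl (h.gen.areConjugate_of_eq (hx.trans x₁.symm) (hy.trans y₁.symm)
        (hz.trans z₁.symm))
    · exact Or.inr (h.gen.areConjugate_of_eq (hx.trans x₂.symm) (hy.trans y₂.symm)
        (hz.trans z₂.symm))
  · obtain ⟨X, Y, Z, hE⟩ := exists_isE7_groupE7
    let x : invariants groupE7 := ⟨(-1 / 108 : ℂ) • formW, Subalgebra.smul_mem _ formW_mem_E7 _⟩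
    let y : invariants groupE7 := ⟨(1 / 108 : ℂ) • formT ^ 2,
      Subalgebra.smul_mem _ formT_sq_mem_E7 _⟩
    let z : invariants groupE7 := ⟨(1 / 108 ^ 2 : ℂ) • (formT * formK),
      Subalgebra.smul_mem _ formT_mul_formK_mem_E7 _⟩
    have cx : (x : Poly) = C (-1 / 108) * formW := smul_eq_C_mul _ _
    have cy : (y : Poly) = C (1 / 108) * formT ^ 2 := smul_eq_C_mul _ _
    have cz : (z : Poly) = C (1 / 108 ^ 2) * (formT * formK) := smul_eq_C_mul _ _
    have hT := hE.of_isHomogeneous (x := x) (y := y) (z := z)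
      (cx ▸ formW_isHomogeneous.C_mul _) (cy ▸ (formT_isHomogeneous.pow 2).C_mul _)
      (cz ▸ (formT_isHomogeneous.mul formK_isHomogeneous).C_mul _)
      (coe_ne_zero_iff.mpr (smul_ne_zero (by norm_num) formW_ne_zero))
      (coe_ne_zero_iff.mpr (smul_ne_zero (by norm_num) (pow_ne_zero 2 formT_ne_zero)))
      (coe_ne_zero_iff.mpr (smul_ne_zero (by norm_num) (mul_ne_zero formT_ne_zero formK_ne_zero)))
    have h : IsE7 x y z := { hT with rel := Subtype.ext (by
        change (z : Poly) ^ 2 + (y : Poly) * ((x : Poly) ^ 3 + (y : Poly) ^ 2) = 0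
        have e1 : (C (-1 / 108) : Poly) = -C (1 / 108) := by rw [neg_div, map_neg]
        have e2 : (C (1 / 108 ^ 2) : Poly) = C (1 / 108) ^ 2 := by rw [← map_pow, one_div_pow]
        have e3 : 108 * (C (1 / 108) : Poly) = 1 := by
          rw [← map_ofNat C 108, ← map_mul, ← map_one C]
          norm_num
        rw [cx, cy, cz, e1, e2]
        linear_combination (-C (1 / 108) ^ 4 * formT ^ 2) * formW_pow_three -
          C (1 / 108) ^ 3 * formT ^ 6 * e3) }
    obtain ⟨θ₁, hθ₁, x₁, y₁, z₁⟩ := h.gen.exists_antiPoisson_scalar (a := 2) (b := 3) (c := 4)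
      h.hx h.hy h.hz
    obtain ⟨a1, a2, a3, -⟩ := h.fixed hθ₁
    have dx : (x : Poly) = (-1 / 108 : ℂ) • (u ^ 8 + 14 * u ^ 4 * v ^ 4 + v ^ 8) := rfl
    have dy : (y : Poly) = (1 / 108 : ℂ) • (u ^ 5 * v - u * v ^ 5) ^ 2 := by
      rw [cy, formT_sq, ← smul_eq_C_mul]
    have dz : (z : Poly) = (1 / 108 ^ 2 : ℂ) • (u * v * (u ^ 8 - v ^ 8) *
        (u ^ 8 - 34 * u ^ 4 * v ^ 4 + v ^ 8)) := by
      rw [cz, formT_mul_formK, ← smul_eq_C_mul]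
    refine ⟨x, y, z, dx, dy, dz, h.gen, θ₁, fun θ hθ => ?_, ⟨hθ₁, x₁, y₁, z₁, a1, a2, a3⟩⟩
    obtain ⟨hx, hy, hz⟩ := h.apply_eq hθ
    exact h.gen.areConjugate_of_eq (hx.trans x₁.symm) (hy.trans y₁.symm) (hz.trans z₁.symm)
  · obtain ⟨X, Y, Z, hE⟩ := exists_isE8_groupE8
    let x : invariants groupE8 := ⟨(-1 / 1728 : ℂ) • formF, Subalgebra.smul_mem _ formF_mem _⟩
    let y : invariants groupE8 := ⟨(-1 / 1728 ^ 2 : ℂ) • formH, Subalgebra.smul_mem _ formH_mem _⟩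
    let z : invariants groupE8 := ⟨(1 / 1728 ^ 3 : ℂ) • formJ, Subalgebra.smul_mem _ formJ_mem _⟩
    have cx : (x : Poly) = C (-1 / 1728) * formF := smul_eq_C_mul _ _
    have cy : (y : Poly) = C (-1 / 1728 ^ 2) * formH := smul_eq_C_mul _ _
    have cz : (z : Poly) = C (1 / 1728 ^ 3) * formJ := smul_eq_C_mul _ _
    have hT := hE.of_isHomogeneous (x := x) (y := y) (z := z)
      (cx ▸ formF_isHomogeneous.C_mul _) (cy ▸ formH_isHomogeneous.C_mul _)
      (cz ▸ formJ_isHomogeneous.C_mul _)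
      (coe_ne_zero_iff.mpr (smul_ne_zero (by norm_num) formF_ne_zero))
      (coe_ne_zero_iff.mpr (smul_ne_zero (by norm_num) formH_ne_zero))
      (coe_ne_zero_iff.mpr (smul_ne_zero (by norm_num) formJ_ne_zero))
    have h : IsE8 x y z := { hT with rel := Subtype.ext (by
        change (z : Poly) ^ 2 + (y : Poly) ^ 3 + (x : Poly) ^ 5 = 0
        have e1 : (C (-1 / 1728) : Poly) = -C (1 / 1728) := by rw [neg_div, map_neg]
        have e2 : (C (-1 / 1728 ^ 2) : Poly) = -C (1 / 1728) ^ 2 := by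
          rw [neg_div, map_neg, ← map_pow, one_div_pow]
        have e4 : (C (1 / 1728 ^ 3) : Poly) = C (1 / 1728) ^ 3 := by rw [← map_pow, one_div_pow]
        have e3 : 1728 * (C (1 / 1728) : Poly) = 1 := by
          rw [← map_ofNat C 1728, ← map_mul, ← map_one C]
          norm_num
        rw [cx, cy, cz, e1, e2, e4]
        linear_combination (C (1 / 1728) ^ 6) * formJ_sq +
          C (1 / 1728) ^ 5 * formF ^ 5 * e3) }
    obtain ⟨θ₁, hθ₁, x₁, y₁, z₁⟩ := h.gen.exists_antiPoisson_scalar (a := 3) (b := 5) (c := 7)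
      h.hx h.hy h.hz
    obtain ⟨a1, a2, a3, -⟩ := h.fixed hθ₁
    refine ⟨x, y, z, rfl, rfl, rfl, h.gen, θ₁, fun θ hθ => ?_, ⟨hθ₁, x₁, y₁, z₁, a1, a2, a3⟩⟩
    obtain ⟨hx, hy, hz⟩ := h.apply_eq hθ
    exact h.gen.areConjugate_of_eq (hx.trans x₁.symm) (hy.trans y₁.symm) (hz.trans z₁.symm)
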